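/- **Setting.** Let $m\in\mathbb R\setminus\{0\}$ and $\mu=m^2/4$. Coordinates on $\mathbb C^3$ are $(u,v,w)$; $O=(0,0,0)$, $U_0=\{u=0\}$, $W_0=\{w=0\}$, $I=\{u=w=0\}$. Spinor indices take the values $0,1$, $\epsilon_{AB}=-\epsilon_{BA}$, $\epsilon_{01}=\epsilon^{01}=1$, $\iota_B=\iota^A\epsilon_{AB}$, $\iota^A=\epsilon^{AB}\iota_B$, $h_{ABCD}=-\epsilon_{A(C}\epsilon_{D)B}$. The unknowns are $\hat e^a{}_{AB}=\hat e^a{}_{(AB)}$, $\hat\Gamma_{ABCD}=\hat\Gamma_{(AB)(CD)}$, $\zeta$, $\zeta_{AB}=\zeta_{(AB)}$, $s$ and a totally symmetric $s_{ABCD}$ with components $s_k$ ($k$ indices equal to $1$), where $\hat e^a{}_{00}=0$, $\hat e^3{}_{AB}=0$, $\hat\Gamma_{00CD}=0$; write $\hat s=s+2$. The frame $e_{AB}=e^a{}_{AB}\partial_{z^a}$, $(z^1,z^2,z^3)=(u,v,w)$, and the connection coefficients are $$e_{00}=\partial_u,\quad e_{01}=e_{10}=\tfrac1{2u}\partial_v+\hat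 e^a{}_{01}\partial_{z^a},\quad e_{11}=\partial_w+\hat e^a{}_{11}\partial_{z^a},\quad \Gamma_{ABCD}=\Gamma^*_{ABCD}+\hat\Gamma_{ABCD},$$ where $\Gamma^*_{0100}=\Gamma^*_{1000}=-\tfrac1{2u}$ and the other $\Gamma^*_{ABCD}$ vanish. With $\Gamma_{AB}{}^C{}_D=\epsilon^{CE}\Gamma_{ABED}$, $D_{AB}\iota_C=e_{AB}(\iota_C)-\Gamma_{AB}{}^K{}_C\iota_K$ (and the Leibniz rule), let the torsion $t_{AB}{}^{EF}{}_{CD}$ and the curvature $r_{ABCDEF}$ be given by $$t_{AB}{}^{EF}{}_{CD}\,e_{EF}=2\Gamma_{AB}{}^{E}{}_{(C}\,e_{D)E}-2\Gamma_{CD}{}^{E}{}_{(A}\,e_{B)E}-[e_{AB},e_{CD}],$$ $$r_{ABCDEF}=e_{CD}(\Gamma_{EFAB})-e_{EF}(\Gamma_{CDAB})+\Gamma_{EF}{}^K{}_B\Gamma_{CDAK}-\Gamma_{CD}{}^K{}_B\Gamma_{EFAK}-\Gamma([e_{CD},e_{EF}])_{AB},$$ where $\Gamma(X)_{AB}=X^{CD}\Gamma_{CDAB}$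 for $X=X^{CD}e_{CD}$. Put $$R_{ABCDEF}=r_{ABCDEF}-\tfrac12(s_{ABCE}\epsilon_{DF}+s_{ABDF}\epsilon_{CE}),\qquad \Sigma_{AB}=D_{AB}\zeta-\zeta_{AB},$$ $$\Sigma_{ABCD}=D_{AB}\zeta_{CD}-s\,h_{ABCD}+\zeta(1-\mu\zeta)s_{ABCD},\qquad S_{AB}=D_{AB}s+(1-\mu\zeta)s_{ABCD}\zeta^{CD},$$ $$H_{ABCD}=D_A{}^Es_{BCDE}-\tfrac{2\mu}{1-\mu\zeta}\,s_{E(BCD}\zeta_{A)}{}^E .$$ The *complete set of conformal static vacuum field equations* is $t_{AB}{}^{EF}{}_{CD}e^a{}_{EF}=0$, $R_{ABCDEF}=0$, $\Sigma_{AB}=0$, $\Sigma_{ABCD}=0$, $S_{AB}=0$, $H_{ABCD}=0$ (all components). Because the frame is singular on $U_0$, these equations on an open set $P$ mean: they hold on $P\setminus U_0$ (so the zero quantities extend by $0$ to $U_0$). The *reduced system* consists of the equations $t_{AB}{}^{EF}{}_{00}e^a{}_{EF}=0$, $R_{AB00EF}=0$, $\Sigma_{00}=0$, $\Sigma_{00CD}=0$,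 $S_{00}=0$, $H_{0BCD}=0$ and $H_{0100}+H_{1000}=0$. **Datum.** Let $\psi_{A_pB_p\cdots A_1B_1CDEF}$, $p=0,1,2,\dots$, be a sequence of totally symmetric complex spinors with $|\psi_{A_pB_p\cdots A_1B_1CDEF}|\le p!\,M/r_1^{\,p}$ for some $M,r_1>0$. Put $\psi_{m,n}=\frac1{m!}\binom{2m+4}{n}\psi_{(\ldots)_n}$, where $\psi_{(\ldots)_n}$ is the component of the $m$-th spinor with $n$ indices equal to $1$, and let $s_0(u,v)=\sum_{m\ge0}\sum_{n=0}^{2m+4}\psi_{m,n}u^mv^n$. A *formal expansion with datum $s_0$* is a family of formal power series in $u,v,w$ for the unknowns which satisfies the reduced system, such that: on $U_0$, $\hat e^a{}_{AB}=0$, $\hat\Gamma_{ABCD}=0$, $\zeta=\zeta_{01}=\zeta_{11}=0$, $\partial_w\zeta_{00}=s$, $\partial_ws=-s_4\zeta_{00}$, and $\partial_vs_k=(4-k)s_{k+1}$ for $k=0,\dots,3$; on $I$, $\zeta_{00}=0$ and $s=-2$; on $W_0$ the component $s_0$ is the datum. A *holomorphic solution* on an open set $P\ni O$ is a family of holomorphic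 functions on $P$ for the unknowns with $1-\mu\zeta\neq0$ on $P$, $e_{00},e_{01},e_{11}$ linearly independent on $P\setminus U_0$, $\hat e^a{}_{AB}=0=\hat\Gamma_{ABCD}$ on $P\cap U_0$, $\zeta=\zeta_{AB}=0$ and $s=-2$ on $P\cap I$, which satisfies the complete set of equations on $P$. It *induces the datum* if its component $s_0$ is the sum of the convergent series $s_0(u,v)$ on $P\cap W_0$. **Claim.** There is exactly one formal expansion with datum $s_0$, and it has the following properties. 1. If $r,\rho>0$ and constants $c_k,c_f>0$ are such that for all $m,n,p\ge0$ $$|\partial_u^m\partial_v^n\partial_w^ps_k(O)|\le c_k\frac{r^{m+p}(m+p)!\,\rho^nn!}{(m+1)^2(n+1)^2(p+1)^2},\qquad |\partial_u^m\partial_v^n\partial_w^pf(O)|\le c_f\frac{r^{m+p-1}(m+p)!\,\rho^nn!}{(m+1)^2(n+1)^2(p+1)^2}$$ for $k=0,\dots,4$ and for each $f$ among the $\hat e^a{}_{AB},\hat\Gamma_{ABCD},\zeta,\zeta_{AB},\hat s$, then for every $0<\alpha\le1$ all the series converge absolutely in the domain $|v|<\frac1{\alpha\rho}$, $|u|+|w|<\frac{\alpha^2}{r}$.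 2. If $P$ is an open neighbourhood of $O$ in which all the series converge absolutely, then their sums are holomorphic on $P$ and satisfy the complete set of conformal static vacuum field equations, not only the reduced system, at every point of $P\setminus U_0$ at which $1-\mu\zeta\ne0$ and $e_{00},e_{01},e_{11}$ are linearly independent. 3. There are constants $r,\rho,c_k,c_f>0$ for which the estimates in 1 hold and for which, on $\hat S=\bigcup_{0<\alpha\le1}\{|v|<\frac1{\alpha\rho},\ |u|+|w|<\frac{\alpha^2}{r}\}$, the sums of the series are a holomorphic solution which induces the datum $s_0$. It is unique: every holomorphic solution on a connected open set $Q$ with $O\in Q\subseteq\hat S$ which induces the datum $s_0$ coincides with it on $Q$. -/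

import Mathlib

open scoped Nat

noncomputable section

namespace StaticVacuum

/-! ## Unknowns

Spinor indices take values in `Fin 2`; the coordinates `(z 0, z 1, z 2)` are `(u, v, w)`. -/

/-- Labels of the independent components of the unknowns:
`frame01 a`, `frame11 a` for the regular parts `ê^{a+1}_{01}`, `ê^{a+1}_{11}` of the frame coefficients;
`conn01 k`, `conn11 k` for the regular parts of `Γ_{01CD}`, `Γ_{11CD}` with `C + D = k`;
`zeta` for `ζ`; `dzeta k` for `ζ_{AB}` with `A + B = k`; `scal` for `s`;
`ricci k` for the component `s_k` of the totally symmetric spinor `s_{ABCD}`, `A + B + C + D = k`.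
The remaining frame and connection coefficients are fixed by the gauge. -/
inductive FieldIndex
  | frame01 (a : Fin 2)
  | frame11 (a : Fin 2)
  | conn01 (k : Fin 3)
  | conn11 (k : Fin 3)
  | zeta
  | dzeta (k : Fin 3)
  | scal
  | ricci (k : Fin 5)

/-- `A + B` as an index of an essential component of a symmetric spinor of valence two. -/
def sum2 (A B : Fin 2) : Fin 3 := ⟨A.val + B.val, by omega⟩

/-- `A + B + C + D` as an index of an essential component of a symmetric spinor of valence four. -/
def sum4 (A B C D : Fin 2) : Fin 5 := ⟨A.val + B.val + C.val + D.val, by omega⟩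

/-! ## The spin frame calculus

All equations are algebraic in the values and first derivatives of the unknowns (and in `u⁻¹`).
They are written over an arbitrary field `K`, which is `ℂ` for the values of holomorphic functions
at a point, and the fraction field of `ℂ⟦u, v, w⟧` for formal power series. -/

/-- Values `val`, first partial derivatives `der b` (with respect to the coordinate number `b`)
and the value `u` of the first coordinate. -/
structure Jet (K : Type*) where
  u : K
  val : FieldIndex → K
  der : Fin 3 → FieldIndex → K

/-- The antisymmetric spinor `ε_{AB}`, `ε_{01} = 1`. Numerically `ε^{AB}` has the same components;
indices are moved by `ι_B = ι^A ε_{AB}`, `ι^A = ε^{AB} ι_B`. -/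
def eps (K : Type*) [Field K] (A B : Fin 2) : K := !![0, 1; -1, 0] A B

/-- The Kronecker symbol. -/
def delta (K : Type*) [Field K] (A B : Fin 2) : K := if A = B then 1 else 0

/-- `h_{ABCD} = - ε_{A(C} ε_{D)B}`. -/
def hMet (K : Type*) [Field K] (A B C D : Fin 2) : K :=
  -(eps K A C * eps K D B + eps K A D * eps K C B) / 2

section Calculus

variable {K : Type*} [Field K]

/-- Regular part `ê^a_{AB}` of the frame coefficients; in the gauge used here
`ê^a_{00} = 0` and `ê^3_{AB} = 0`. -/
def frameReg (X : FieldIndex → K) (a : Fin 3) (A B : Fin 2) : K :=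
  !![0, 0, 0;
     X (.frame01 0), X (.frame01 1), 0;
     X (.frame11 0), X (.frame11 1), 0] (sum2 A B) a

/-- Regular part of the connection coefficients `Γ_{ABCD}`; in the gauge used here `Γ_{00CD} = 0`. -/
def connReg (X : FieldIndex → K) (A B C D : Fin 2) : K :=
  ![0, X (.conn01 (sum2 C D)), X (.conn11 (sum2 C D))] (sum2 A B)

/-- Singular part of the frame: `e*_{00} = ∂_u`, `e*_{01} = (2u)⁻¹ ∂_v`, `e*_{11} = ∂_w`. -/
def frameSing (u : K) (a : Fin 3) (A B : Fin 2) : K :=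
  !![1, 0, 0;
     0, 1 / (2 * u), 0;
     0, 0, 1] (sum2 A B) a

/-- `∂_b` of the singular part of the frame. -/
def frameSingDer (u : K) (b a : Fin 3) (A B : Fin 2) : K :=
  if b = 0 ∧ a = 1 ∧ sum2 A B = 1 then -1 / (2 * u ^ 2) else 0

/-- Singular part of the connection coefficients: `Γ*_{0100} = Γ*_{1000} = - (2u)⁻¹`,
all other components vanish. -/
def connSing (u : K) (A B C D : Fin 2) : K :=
  if sum2 A B = 1 ∧ sum2 C D = 0 then -1 / (2 * u) else 0

/-- `∂_b` of the singular part of the connection coefficients. -/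
def connSingDer (u : K) (b : Fin 3) (A B C D : Fin 2) : K :=
  if b = 0 ∧ sum2 A B = 1 ∧ sum2 C D = 0 then 1 / (2 * u ^ 2) else 0

namespace Jet

variable (J : Jet K)

/-- Frame coefficients `e^a_{AB}`. -/
def e (a : Fin 3) (A B : Fin 2) : K := frameSing J.u a A B + frameReg J.val a A B

/-- `∂_b e^a_{AB}`. -/
def de (b a : Fin 3) (A B : Fin 2) : K := frameSingDer J.u b a A B + frameReg (J.der b) a A B

/-- Connection coefficients `Γ_{ABCD}`. -/
def conn (A B C D : Fin 2) : K := connSing J.u A B C D + connReg J.val A B C D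

/-- `∂_b Γ_{ABCD}`. -/
def dconn (b : Fin 3) (A B C D : Fin 2) : K :=
  connSingDer J.u b A B C D + connReg (J.der b) A B C D

/-- `Γ_{AB}{}^C{}_D = ε^{CE} Γ_{ABED}`. -/
def connUp (A B C D : Fin 2) : K := ∑ E, eps K C E * J.conn A B E D

/-- `Γ_{AB}{}^{EF}{}_{CD}`, the connection coefficients for spinors with a symmetric pair of indices. -/
def connPair (A B E F C D : Fin 2) : K :=
  J.connUp A B E C * delta K F D + delta K E C * J.connUp A B F D

def zeta : K := J.val .zeta

def scal : K := J.val .scal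

/-- `ζ_{AB}`. -/
def zetaAB (A B : Fin 2) : K := J.val (.dzeta (sum2 A B))

/-- `s_{ABCD}`. -/
def ricci (A B C D : Fin 2) : K := J.val (.ricci (sum4 A B C D))

/-- `e_{AB}(f)` for a function with partial derivatives `df b`. -/
def dir (A B : Fin 2) (df : Fin 3 → K) : K := ∑ b, J.e b A B * df b

/-- `t_{AB}{}^{EF}{}_{CD} e^a_{EF}`, the torsion as a tangent vector. -/
def torsionVec (A B C D : Fin 2) (a : Fin 3) : K :=
  (∑ E, ∑ F, (J.connPair A B E F C D - J.connPair C D E F A B) * J.e a E F)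
    - J.dir A B (fun b => J.de b a C D) + J.dir C D (fun b => J.de b a A B)

/-- The components `X^{EF}`, symmetric in `E, F`, of a vector `X^a` in the frame:
`X^a = X^{EF} e^a_{EF}`. -/
def frameComp (X : Fin 3 → K) (E F : Fin 2) : K :=
  ![X 0 - (X 1 - X 2 * J.e 1 1 1) / J.e 1 0 1 * J.e 0 0 1 - X 2 * J.e 0 1 1,
    (X 1 - X 2 * J.e 1 1 1) / J.e 1 0 1 / 2,
    X 2] (sum2 E F)

/-- `t_{AB}{}^{EF}{}_{CD}`. -/
def torsion (A B E F C D : Fin 2) : K := J.frameComp (J.torsionVec A B C D) E F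

/-- The curvature `r_{ABCDEF}` of the connection. The last three sums together are
`- Γ([e_{CD}, e_{EF}])_{AB}`, because `[e_{AB}, e_{CD}]` is
`(Γ_{AB}{}^{EF}{}_{CD} - Γ_{CD}{}^{EF}{}_{AB} - t_{AB}{}^{EF}{}_{CD}) e_{EF}`. -/
def curv (A B C D E F : Fin 2) : K :=
  J.dir C D (fun b => J.dconn b E F A B) - J.dir E F (fun b => J.dconn b C D A B)
    + (∑ H, (J.connUp E F H B * J.conn C D A H - J.connUp C D H B * J.conn E F A H))
    + (∑ H, (J.connUp E F H C * J.conn H D A B + J.connUp E F H D * J.conn C H A B))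
    - (∑ H, (J.connUp C D H E * J.conn H F A B + J.connUp C D H F * J.conn E H A B))
    + ∑ G, ∑ H, J.torsion C D G H E F * J.conn G H A B

/-- `R_{ABCDEF}`. -/
def curvDefect (A B C D E F : Fin 2) : K :=
  J.curv A B C D E F
    - (J.ricci A B C E * eps K D F + J.ricci A B D F * eps K C E) / 2

/-- `D_{AB} ζ_{CD}`. -/
def covZeta (A B C D : Fin 2) : K :=
  J.dir A B (fun b => J.der b (.dzeta (sum2 C D)))
    - ∑ H, (J.connUp A B H C * J.zetaAB H D + J.connUp A B H D * J.zetaAB C H)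

/-- `D_{AB} s_{CDEF}`. -/
def covRicci (A B C D E F : Fin 2) : K :=
  J.dir A B (fun b => J.der b (.ricci (sum4 C D E F)))
    - ∑ H, (J.connUp A B H C * J.ricci H D E F + J.connUp A B H D * J.ricci C H E F
        + J.connUp A B H E * J.ricci C D H F + J.connUp A B H F * J.ricci C D E H)

/-- `Σ_{AB} = D_{AB} ζ - ζ_{AB}`. -/
def sigma2 (A B : Fin 2) : K := J.dir A B (fun b => J.der b .zeta) - J.zetaAB A B

/-- `Σ_{ABCD} = D_{AB} ζ_{CD} - s h_{ABCD} + ζ (1 - μ ζ) s_{ABCD}`. -/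
def sigma4 (μ : K) (A B C D : Fin 2) : K :=
  J.covZeta A B C D - J.scal * hMet K A B C D
    + J.zeta * (1 - μ * J.zeta) * J.ricci A B C D

/-- `S_{AB} = D_{AB} s + (1 - μ ζ) s_{ABCD} ζ^{CD}`. -/
def scalDefect (μ : K) (A B : Fin 2) : K :=
  J.dir A B (fun b => J.der b .scal)
    + (1 - μ * J.zeta) *
      ∑ C, ∑ D, J.ricci A B C D * (∑ E, ∑ F, eps K C E * eps K D F * J.zetaAB E F)

/-- `ζ_A{}^E = ε^{EF} ζ_{AF}`. -/
def zetaUp (A E : Fin 2) : K := ∑ F, eps K E F * J.zetaAB A F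

/-- `s_{E(BCD} ζ_{A)}{}^E`; since `s_{ABCD}` is totally symmetric, only the position of the index
carried by `ζ` matters in the symmetrization. -/
def ricciZeta (A B C D : Fin 2) : K :=
  (∑ E, (J.ricci E B C D * J.zetaUp A E + J.ricci E A C D * J.zetaUp B E
    + J.ricci E A B D * J.zetaUp C E + J.ricci E A B C * J.zetaUp D E)) / 4

/-- `H_{ABCD} = D_A{}^E s_{BCDE} - 2 μ (1 - μ ζ)⁻¹ s_{E(BCD} ζ_{A)}{}^E`. -/
def hDefect (μ : K) (A B C D : Fin 2) : K :=
  (∑ E, ∑ F, eps K E F * J.covRicci A F B C D E)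
    - 2 * μ / (1 - μ * J.zeta) * J.ricciZeta A B C D

/-- The complete set of conformal static vacuum field equations. -/
def CompleteEquations (μ : K) : Prop :=
  (∀ A B C D a, J.torsionVec A B C D a = 0) ∧
  (∀ A B C D E F, J.curvDefect A B C D E F = 0) ∧
  (∀ A B, J.sigma2 A B = 0) ∧
  (∀ A B C D, J.sigma4 μ A B C D = 0) ∧
  (∀ A B, J.scalDefect μ A B = 0) ∧
  (∀ A B C D, J.hDefect μ A B C D = 0)

/-- The reduced system: the `∂_u`-equations and `H_{0100} + H_{1000} = 0`. -/
def ReducedEquations (μ : K) : Prop :=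
  (∀ A B a, J.torsionVec A B 0 0 a = 0) ∧
  (∀ A B E F, J.curvDefect A B 0 0 E F = 0) ∧
  J.sigma2 0 0 = 0 ∧
  (∀ C D, J.sigma4 μ 0 0 C D = 0) ∧
  J.scalDefect μ 0 0 = 0 ∧
  (∀ B C D, J.hDefect μ 0 B C D = 0) ∧
  J.hDefect μ 0 1 0 0 + J.hDefect μ 1 0 0 0 = 0

end Jet

end Calculus

/-! ## Null data -/

/-- A sequence `ψ_{A_p B_p … A_1 B_1 C D E F}`, `p = 0, 1, 2, …`, of spinors; the `p`-th one has
`2 p + 4` indices. -/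
abbrev NullData := (p : ℕ) → (Fin (2 * p + 4) → Fin 2) → ℂ

/-- All spinors of the sequence are totally symmetric. -/
def NullData.IsSymmetric (ψ : NullData) : Prop :=
  ∀ p (π : Equiv.Perm (Fin (2 * p + 4))) (I : Fin (2 * p + 4) → Fin 2), ψ p (I ∘ π) = ψ p I

/-- The essential component with `n` indices equal to `1` and the others equal to `0`. -/
def NullData.essential (ψ : NullData) (p n : ℕ) : ℂ := ψ p (fun j => if j.val < n then 1 else 0)

/-- The coefficient `ψ_{m,n} = (m!)⁻¹ (2m+4 choose n) ψ_{(…)_n}` of `u^m v^n` in the datum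
`s_0(u, v)`; it vanishes for `n > 2 m + 4`. -/
def NullData.datumCoeff (ψ : NullData) (m n : ℕ) : ℂ :=
  1 / (m ! : ℂ) * ((2 * m + 4).choose n : ℂ) * ψ.essential m n

/-! ## Formal expansions -/

/-- Formal power series in `u, v, w`. -/
abbrev Series := MvPowerSeries (Fin 3) ℂ

abbrev FormalFields := FieldIndex → Series

/-- The jet of a family of formal power series, in the fraction field of `ℂ⟦u, v, w⟧`. -/
def formalJet (X : FormalFields) : Jet (FractionRing Series) where
  u := algebraMap Series _ (MvPowerSeries.X 0)
  val i := algebraMap Series _ (X i)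
  der b i := algebraMap Series _ (MvPowerSeries.pderiv ℂ b (X i))

/-- The formal series vanishes on `U_0 = {u = 0}`. -/
def VanishesOnU (f : Series) : Prop := ∀ d : Fin 3 →₀ ℕ, d 0 = 0 → MvPowerSeries.coeff d f = 0

/-- The formal series vanishes on `I = {u = 0, w = 0}`. -/
def VanishesOnI (f : Series) : Prop :=
  ∀ d : Fin 3 →₀ ℕ, d 0 = 0 → d 2 = 0 → MvPowerSeries.coeff d f = 0

/-- The regular parts of the frame and connection coefficients. -/
def FieldIndex.IsGauge : FieldIndex → Prop
  | .frame01 _ => True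
  | .frame11 _ => True
  | .conn01 _ => True
  | .conn11 _ => True
  | _ => False

/-- `X` is the formal expansion at `O` calculated from the datum `s_0` by means of the
`∂_u`-equations, the equation `H_{0100} + H_{1000} = 0`, and the conditions imposed on
`U_0`, on `I` and on `W_0 = {w = 0}`. -/
structure IsFormalExpansion (μ : ℂ) (ψ : NullData) (X : FormalFields) : Prop where
  /-- the reduced system -/
  reduced : (formalJet X).ReducedEquations (algebraMap Series _ (MvPowerSeries.C μ))
  /-- the regular parts of frame and connection vanish on `U_0` -/
  gauge : ∀ i : FieldIndex, i.IsGauge → VanishesOnU (X i)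
  /-- `ζ = 0`, `ζ_{01} = 0`, `ζ_{11} = 0` on `U_0` -/
  zeta : VanishesOnU (X .zeta)
  zeta01 : VanishesOnU (X (.dzeta 1))
  zeta11 : VanishesOnU (X (.dzeta 2))
  /-- `∂_w ζ_{00} = s` and `∂_w s = - s_4 ζ_{00}` on `U_0` -/
  zeta00 : VanishesOnU (MvPowerSeries.pderiv ℂ 2 (X (.dzeta 0)) - X .scal)
  scal : VanishesOnU (MvPowerSeries.pderiv ℂ 2 (X .scal) + X (.ricci 4) * X (.dzeta 0))
  /-- `ζ_{00} = 0` and `s = - 2` on `I` -/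
  zeta00I : VanishesOnI (X (.dzeta 0))
  scalI : VanishesOnI (X .scal + MvPowerSeries.C 2)
  /-- `∂_v s_k = (4 - k) s_{k+1}` on `U_0`, `k = 0, …, 3` -/
  ricci : ∀ k : Fin 4, VanishesOnU (MvPowerSeries.pderiv ℂ 1 (X (.ricci k.castSucc))
    - MvPowerSeries.C (4 - (k.val : ℂ)) * X (.ricci k.succ))
  /-- on `W_0` the component `s_0` is the given datum -/
  datum : ∀ d : Fin 3 →₀ ℕ, d 2 = 0 →
    MvPowerSeries.coeff d (X (.ricci 0)) = ψ.datumCoeff (d 0) (d 1)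

/-- `∂_u^m ∂_v^n ∂_w^p f(O)` for the formal series `f`, where `d = (m, n, p)`. -/
def derivAtO (f : Series) (d : Fin 3 →₀ ℕ) : ℂ :=
  ((d 0)! : ℂ) * ((d 1)! : ℂ) * ((d 2)! : ℂ) * MvPowerSeries.coeff d f

/-- The function `r^{m+p+q} (m+p)! ρ^n n! / ((m+1)² (n+1)² (p+1)²)`, where `d = (m, n, p)`. -/
def majorant (r ρ : ℝ) (q : ℤ) (d : Fin 3 →₀ ℕ) : ℝ :=
  r ^ ((d 0 : ℤ) + (d 2 : ℤ) + q) * ((d 0 + d 2)! : ℝ) * ρ ^ (d 1) * ((d 1)! : ℝ)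
    / (((d 0 : ℝ) + 1) ^ 2 * ((d 1 : ℝ) + 1) ^ 2 * ((d 2 : ℝ) + 1) ^ 2)

/-- The estimates for the Taylor coefficients of an unknown `f`: with exponent `m + p` of `r` for
`s_0, …, s_4`, and with exponent `m + p - 1` for all other unknowns, where `s` is replaced by
`ŝ = s + 2`. -/
def SeriesEstimate (c r ρ : ℝ) (f : Series) : FieldIndex → Prop
  | .ricci _ => ∀ d, ‖derivAtO f d‖ ≤ c * majorant r ρ 0 d
  | .scal => ∀ d, ‖derivAtO (f + MvPowerSeries.C 2) d‖ ≤ c * majorant r ρ (-1) d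
  | _ => ∀ d, ‖derivAtO f d‖ ≤ c * majorant r ρ (-1) d

def Estimates (c : FieldIndex → ℝ) (r ρ : ℝ) (X : FormalFields) : Prop :=
  ∀ i, SeriesEstimate (c i) r ρ (X i) i

/-! ## Holomorphic fields -/

abbrev HolFields := FieldIndex → (Fin 3 → ℂ) → ℂ

/-- The monomial term of index `d` of the series `f` at `z`. -/
def term (f : Series) (z : Fin 3 → ℂ) (d : Fin 3 →₀ ℕ) : ℂ :=
  MvPowerSeries.coeff d f * ∏ j, z j ^ d j

/-- All the series converge absolutely at `z`. -/
def AbsConvergesAt (X : FormalFields) (z : Fin 3 → ℂ) : Prop :=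
  ∀ i, Summable (fun d => ‖term (X i) z d‖)

/-- The functions defined by the series. -/
def sumFields (X : FormalFields) : HolFields := fun i z => ∑' d, term (X i) z d

/-- The jet at `z` of a family of functions. -/
def holJet (F : HolFields) (z : Fin 3 → ℂ) : Jet ℂ where
  u := z 0
  val i := F i z
  der b i := fderiv ℂ (F i) z (Pi.single b 1)

/-- At `z` the denominator `1 - μ ζ` does not vanish, `u ≠ 0`, and the vectors
`e_{00}, e_{01}, e_{11}` are linearly independent. -/
def IsRegularPoint (μ : ℂ) (F : HolFields) (z : Fin 3 → ℂ) : Prop :=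
  1 - μ * F .zeta z ≠ 0 ∧ z 0 ≠ 0 ∧ (holJet F z).e 1 0 1 ≠ 0

/-- `F` is a holomorphic solution on the open set `P` of the complete set of conformal static vacuum
field equations, in the gauge adapted to the null cone. The frame and the connection coefficients
are singular on `U_0 = {u = 0}`, so the equations are required at the points with `u ≠ 0`; the
zero quantities then extend by `0` to `U_0`. -/
structure IsHolomorphicSolution (μ : ℂ) (P : Set (Fin 3 → ℂ)) (F : HolFields) : Prop where
  holomorphic : ∀ i, AnalyticOnNhd ℂ (F i) P
  /-- `1 - μ ζ` has no zero -/
  denom : ∀ z ∈ P, 1 - μ * F .zeta z ≠ 0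
  /-- `e_{00}, e_{01}, e_{11}` is a frame away from `U_0` -/
  frame : ∀ z ∈ P, z 0 ≠ 0 → (holJet F z).e 1 0 1 ≠ 0
  /-- the regular parts of frame and connection vanish on `U_0` -/
  gauge : ∀ z ∈ P, z 0 = 0 → ∀ i : FieldIndex, i.IsGauge → F i z = 0
  /-- the conditions at space-like infinity: `ζ = 0`, `ζ_{AB} = 0`, `s = - 2` on `I` -/
  vertex : ∀ z ∈ P, z 0 = 0 → z 2 = 0 →
    F .zeta z = 0 ∧ (∀ k, F (.dzeta k) z = 0) ∧ F .scal z = -2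
  equations : ∀ z ∈ P, z 0 ≠ 0 → (holJet F z).CompleteEquations μ

/-- On `W_0 = {w = 0}` the component `s_0` of `F` is the datum
`s_0(u, v) = ∑ ψ_{m,n} u^m v^n`. -/
def InducesDatum (ψ : NullData) (P : Set (Fin 3 → ℂ)) (F : HolFields) : Prop :=
  ∀ z ∈ P, z 2 = 0 →
    HasSum (fun k : ℕ × ℕ => ψ.datumCoeff k.1 k.2 * z 0 ^ k.1 * z 1 ^ k.2) (F (.ricci 0) z)

/-- The domain `|v| < 1 / (α ρ)`, `|u| + |w| < α² / r`. -/
def convDomain (r ρ α : ℝ) : Set (Fin 3 → ℂ) :=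
  {z | ‖z 1‖ < 1 / (α * ρ) ∧ ‖z 0‖ + ‖z 2‖ < α ^ 2 / r}

/-- The manifold `Ŝ`: the union of these domains for `0 < α ≤ 1`. -/
def sHat (r ρ : ℝ) : Set (Fin 3 → ℂ) := ⋃ α ∈ Set.Ioc (0 : ℝ) 1, convDomain r ρ α

end StaticVacuum

end

open StaticVacuum

/-!
The components of the reduced system which contain `∂_u`, multiplied by `u`, are Fuchsian equations
`u ∂_u f + k f = …` with `k ≥ 0`. Together with the conditions on `U_0` and the equation for `∂_w
s_0`, they can be solved for the unknowns one after the other, with right-hand sides which are of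
higher order in the weight `m + 2 p` of the monomials `u^m v^n w^p`. The formal expansions are thus
the fixed points of a map (`IsStep`, `exists_isStep_of_formal`, `formal_of_isStep`) which is
contracting for this weight (`IsStep.agree`), whence there is exactly one.

The other field equations propagate. In the frame of a solution of the reduced system (`NullFrame`)
the remaining zero quantities satisfy a linear homogeneous system along `e_{00} = ∂_u` (the lemmas
`NullFrame.D0_R0`, …, `NullFrame.D0_H3`). On `U_0` the zero quantities, multiplied by powers of `u`
where they are singular, vanish by the conditions imposed there (`exists_constraint_quantities`). As
the system is again Fuchsian, they vanish to all orders in `u` (`constraints_of_reduced`).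

For the convergence, weighted `ℓ¹`-norms of power series are used (`wNorm`). The weight is chosen
such that products are bounded, and the inverse of `u ∂_u + k` regains one power of `m + 1`. This
power pays for the derivatives: for `u ∂_u` directly, and for `∂_v` because the monomials of an
unknown satisfy `n ≤ 2 m + k` (`IsStep.vDegLE`). The latter bound comes from the `2 m + 4` indices
of the spinors of the datum. Hence the map preserves a ball (`exists_stepBounds`) and the
coefficients of its fixed point grow geometrically (`exists_coeff_bound`). This gives the estimates
for the derivatives at `O`. Conversely, the estimates and the bound `n ≤ 2 m + k` give absolute
convergence on the domains with `|v|` of the size `1 / α` and `|u| + |w|` of the size `α²`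
(`tsum_term_le`). If `r` is large, then `ζ` and `u ê²_{01}` are small there, so that the frame and
`1 - μ ζ` do not degenerate (`isHolomorphicSolution_sumFields`).

Taylor expansion at `O` is a ring homomorphism which commutes with the derivatives and is injective
on connected domains (`taylorHom`, `eqOn_zero_of_taylor`), and the Taylor series of the sum of a
power series is this series (`taylor_tsum_term`). Multiplied by powers of `u` and `1 - μ ζ`, the
field equations become polynomial in the unknowns and their derivatives (`reducedEquations_iff`,
`completeEquations_iff`), so that they are transferred from the series to their sums
(`complete_of_taylor`). In the other direction the Taylor series of a holomorphic solution is a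
formal expansion: the conditions on `U_0` follow by integrating the equations along `∂_w` from `I`
(`isFormalExpansion_of_complete`). The uniqueness of the holomorphic solution (`eqOn_sumFields`) is
thus reduced to the formal one.
-/

set_option linter.unusedSimpArgs false
set_option linter.unusedSectionVars false

noncomputable section

namespace StaticVacuum

section
open FieldIndex

/-! ### The equations without denominators -/

namespace Jet
section Regular
variable {R : Type*} [CommRing R]

/-- `2 u e_{01}(f)`, where `df` is the gradient of `f`. The factor removes the singularity of the
frame, so that the expression makes sense over a ring in which `u` is not invertible. -/
def dir01 (J : Jet R) (df : Fin 3 → R) : R :=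
  2 * J.u * J.val (frame01 0) * df 0 + (1 + 2 * J.u * J.val (frame01 1)) * df 1

/-- `e_{11}(f)`, where `df` is the gradient of `f`. -/
def dir11 (J : Jet R) (df : Fin 3 → R) : R :=
  J.val (frame11 0) * df 0 + J.val (frame11 1) * df 1 + df 2

/-- The gradient of the unknown `i`. -/
def grad (J : Jet R) (i : FieldIndex) : Fin 3 → R := fun b => J.der b i

theorem grad_def {R : Type*} (J : Jet R) (i : FieldIndex) : J.grad i = fun b => J.der b i := rfl

/-- The image of a jet under a map of the coefficient rings. -/
def map {S : Type*} (g : R → S) (J : Jet R) : Jet S where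
  u := g J.u
  val i := g (J.val i)
  der b i := g (J.der b i)

end Regular
end Jet

section Regular
variable {R : Type*} [CommRing R]

/-- The left-hand sides of the reduced system, component by component, multiplied by the powers of
`u` (and the last five by `2 (1 - μ ζ)`, up to sign) which clear the denominators, so that the
entries are polynomials in the jet. In order: `t_{01}{}^a{}_{00}`, `t_{11}{}^a{}_{00}`, the
equations for `Γ_{01CD}` and `Γ_{11CD}`, those for `ζ`, `ζ_{AB}` and `s`, and the Bianchi equations
`H_{0000}, …, H_{0111}`, `H_{1000}`. -/
def reducedList (μ : R) (J : Jet R) : List R :=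
  let u := J.u
  let f := J.val
  let d := J.der 0
  let α := 2 * u * f (conn01 0) - 1
  let ω := 1 - μ * f zeta
  [u * d (frame01 0) + f (frame01 0) - 2 * u * f (conn01 0) * f (frame01 0) + 2 * u * f (conn01 1),
   u * d (frame01 1) + f (frame01 1) - f (conn01 0) - 2 * u * f (frame01 1) * f (conn01 0),
   d (frame11 0) - 2 * f (frame01 0) * f (conn11 0) + 2 * f (conn11 1),
   u * d (frame11 1) - (1 + 2 * u * f (frame01 1)) * f (conn11 0),
   2 * u * d (conn01 0) + 4 * f (conn01 0) - u * f (ricci 0) - 4 * u * f (conn01 0) ^ 2,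
   u * d (conn11 0) + f (conn11 0) - u * f (ricci 1) - 2 * u * f (conn01 0) * f (conn11 0),
   2 * u * d (conn01 1) + 2 * f (conn01 1) - u * f (ricci 1) - 4 * u * f (conn01 0) * f (conn01 1),
   d (conn11 1) - f (ricci 2) - 2 * f (conn01 1) * f (conn11 0),
   2 * u * d (conn01 2) + 2 * f (conn01 2) - u * f (ricci 2) - 4 * u * f (conn01 0) * f (conn01 2),
   d (conn11 2) - f (ricci 3) - 2 * f (conn01 2) * f (conn11 0),
   d zeta - f (dzeta 0),
   d (dzeta 0) + f (ricci 0) * f zeta * ω,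
   d (dzeta 1) + f (ricci 1) * f zeta * ω,
   d (dzeta 2) - f scal + f (ricci 2) * f zeta * ω,
   d scal + ω * (f (ricci 0) * f (dzeta 2) - 2 * f (ricci 1) * f (dzeta 1)
     + f (ricci 2) * f (dzeta 0)),
   ω * (2 * u * d (ricci 1) - J.dir01 (J.grad (ricci 0)) - 4 * α * f (ricci 1)
       + 8 * u * f (conn01 1) * f (ricci 0))
     + 4 * u * μ * (f (ricci 0) * f (dzeta 1) - f (ricci 1) * f (dzeta 0)),
   ω * (2 * u * d (ricci 2) - J.dir01 (J.grad (ricci 1)) - 3 * α * f (ricci 2)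
       + 4 * u * f (conn01 1) * f (ricci 1) + 2 * u * f (conn01 2) * f (ricci 0))
     + u * μ * (f (ricci 0) * f (dzeta 2) + 2 * f (ricci 1) * f (dzeta 1)
       - 3 * f (ricci 2) * f (dzeta 0)),
   ω * (2 * u * d (ricci 3) - J.dir01 (J.grad (ricci 2)) - 2 * α * f (ricci 3)
       + 4 * u * f (conn01 2) * f (ricci 1))
     + 2 * u * μ * (f (ricci 1) * f (dzeta 2) - f (ricci 3) * f (dzeta 0)),
   ω * (2 * u * d (ricci 4) - J.dir01 (J.grad (ricci 3)) - α * f (ricci 4)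
       - 4 * u * f (conn01 1) * f (ricci 3) + 6 * u * f (conn01 2) * f (ricci 2))
     + u * μ * (3 * f (ricci 2) * f (dzeta 2) - 2 * f (ricci 3) * f (dzeta 1)
       - f (ricci 4) * f (dzeta 0)),
   ω * (2 * u * J.dir11 (J.grad (ricci 0)) - J.dir01 (J.grad (ricci 1)) - 3 * α * f (ricci 2)
       + 4 * u * f (conn01 1) * f (ricci 1) + 2 * u * f (conn01 2) * f (ricci 0)
       + 8 * u * f (conn11 0) * f (ricci 1) - 8 * u * f (conn11 1) * f (ricci 0))
     + u * μ * (3 * f (ricci 2) * f (dzeta 0) - 2 * f (ricci 1) * f (dzeta 1)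
       - f (ricci 0) * f (dzeta 2))]

/-- The left-hand sides of the equations which are not part of the reduced system, with
denominators cleared in the same way: `t_{01}{}^a{}_{11}` for `a = 3, 1, 2`, the curvature
components `R_{AB0111}`, then `Σ_{01}`, `Σ_{11}`, `Σ_{01CD}`, `Σ_{11CD}`, `S_{01}`, `S_{11}`,
`H_{1001}, H_{1011}, H_{1111}`. -/
def constraintList (μ : R) (J : Jet R) : List R :=
  let u := J.u
  let f := J.val
  let α := 2 * u * f (conn01 0) - 1
  let M := 1 + 2 * u * f (frame01 1)
  let ω := 1 - μ * f zeta
  [f (conn11 0) - 2 * f (conn01 1),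
   2 * u * (J.der 2 (frame01 0) - f (conn11 2) - f (frame01 0) * J.der 0 (frame11 0)
       + 2 * f (frame01 0) * f (conn01 2) + J.der 0 (frame01 0) * f (frame11 0)
       + J.der 1 (frame01 0) * f (frame11 1) - 2 * f (frame11 0) * f (conn01 1)
       + f (frame11 0) * f (conn11 0)) - M * J.der 1 (frame11 0),
   2 * u ^ 2 * (J.der 2 (frame01 1) - f (frame01 0) * J.der 0 (frame11 1)
       + J.der 1 (frame01 1) * f (frame11 1) + f (frame11 1) * (f (conn11 0) - 2 * f (conn01 1)))
     + u * M * (2 * f (conn01 2) - J.der 1 (frame11 1))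
     + (2 * u ^ 2 * J.der 0 (frame01 1) - 1) * f (frame11 0),
   u * (J.dir01 (J.grad (conn11 0)) - 2 * u * J.dir11 (J.grad (conn01 0)) - u * f (ricci 2)
       + 2 * α * (f (conn11 1) - f (conn01 2)) - 2 * u * f (conn11 0) ^ 2) - f (frame11 0),
   J.dir01 (J.grad (conn11 1)) - 2 * u * J.dir11 (J.grad (conn01 1)) - u * f (ricci 3)
     + α * f (conn11 2) + 2 * u * (2 * f (conn01 1) * f (conn11 1)
       - 2 * f (conn01 1) * f (conn01 2) - f (conn01 2) * f (conn11 0)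
       - f (conn11 0) * f (conn11 1)),
   J.dir01 (J.grad (conn11 2)) - 2 * u * J.dir11 (J.grad (conn01 2)) - u * f (ricci 4)
     + 2 * u * (4 * f (conn01 1) * f (conn11 2) - 2 * f (conn01 2) * f (conn11 1)
       - 2 * f (conn01 2) ^ 2 - f (conn11 0) * f (conn11 2)),
   J.dir01 (J.grad zeta) - 2 * u * f (dzeta 1),
   J.dir11 (J.grad zeta) - f (dzeta 2),
   J.dir01 (J.grad (dzeta 0)) + 2 * α * f (dzeta 1) - 4 * u * f (conn01 1) * f (dzeta 0)
     + 2 * u * f (ricci 1) * f zeta * ω,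
   J.dir01 (J.grad (dzeta 1)) + u * f scal + α * f (dzeta 2) - 2 * u * f (conn01 2) * f (dzeta 0)
     + 2 * u * f (ricci 2) * f zeta * ω,
   J.dir01 (J.grad (dzeta 2)) + 4 * u * f (conn01 1) * f (dzeta 2)
     - 4 * u * f (conn01 2) * f (dzeta 1) + 2 * u * f (ricci 3) * f zeta * ω,
   J.dir11 (J.grad (dzeta 0)) - f scal + 2 * f (conn11 0) * f (dzeta 1)
     - 2 * f (conn11 1) * f (dzeta 0) + f (ricci 2) * f zeta * ω,
   J.dir11 (J.grad (dzeta 1)) + f (conn11 0) * f (dzeta 2)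
     - f (conn11 2) * f (dzeta 0) + f (ricci 3) * f zeta * ω,
   J.dir11 (J.grad (dzeta 2)) + 2 * f (conn11 1) * f (dzeta 2)
     - 2 * f (conn11 2) * f (dzeta 1) + f (ricci 4) * f zeta * ω,
   J.dir01 (J.grad scal) + 2 * u * ω * (f (ricci 1) * f (dzeta 2)
     - 2 * f (ricci 2) * f (dzeta 1) + f (ricci 3) * f (dzeta 0)),
   J.dir11 (J.grad scal) + ω * (f (ricci 2) * f (dzeta 2)
     - 2 * f (ricci 3) * f (dzeta 1) + f (ricci 4) * f (dzeta 0)),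
   ω * (2 * u * J.dir11 (J.grad (ricci 1)) - J.dir01 (J.grad (ricci 2)) - 2 * α * f (ricci 3)
       + 4 * u * f (conn01 2) * f (ricci 1) + 6 * u * f (conn11 0) * f (ricci 2)
       - 4 * u * f (conn11 1) * f (ricci 1) - 2 * u * f (conn11 2) * f (ricci 0))
     + 2 * u * μ * (f (ricci 3) * f (dzeta 0) - f (ricci 1) * f (dzeta 2)),
   ω * (2 * u * J.dir11 (J.grad (ricci 2)) - J.dir01 (J.grad (ricci 3)) - α * f (ricci 4)
       - 4 * u * f (conn01 1) * f (ricci 3) + 6 * u * f (conn01 2) * f (ricci 2)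
       + 4 * u * f (conn11 0) * f (ricci 3) - 4 * u * f (conn11 2) * f (ricci 1))
     + u * μ * (2 * f (ricci 3) * f (dzeta 1) + f (ricci 4) * f (dzeta 0)
       - 3 * f (ricci 2) * f (dzeta 2)),
   ω * (2 * u * J.dir11 (J.grad (ricci 3)) - J.dir01 (J.grad (ricci 4))
       - 8 * u * f (conn01 1) * f (ricci 4) + 8 * u * f (conn01 2) * f (ricci 3)
       + 2 * u * f (conn11 0) * f (ricci 4) + 4 * u * f (conn11 1) * f (ricci 3)
       - 6 * u * f (conn11 2) * f (ricci 2))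
     + 4 * u * μ * (f (ricci 4) * f (dzeta 1) - f (ricci 3) * f (dzeta 2))]

theorem map_reducedList {S : Type*} [CommRing S] (g : R →+* S) (μ : R) (J : Jet R) :
    (reducedList μ J).map g = reducedList (g μ) (J.map g) := by
  simp [reducedList, Jet.map, Jet.dir01, Jet.dir11, Jet.grad, map_ofNat g]

theorem map_constraintList {S : Type*} [CommRing S] (g : R →+* S) (μ : R) (J : Jet R) :
    (constraintList μ J).map g = constraintList (g μ) (J.map g) := by
  simp [constraintList, Jet.map, Jet.dir01, Jet.dir11, Jet.grad, map_ofNat g]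

end Regular

namespace Jet
section FieldLemmas
variable {K : Type*} [Field K] (J : Jet K)

theorem torsionVec_swap (A B C D : Fin 2) (a : Fin 3) :
    J.torsionVec C D A B a = - J.torsionVec A B C D a := by
  simp only [torsionVec, Fin.sum_univ_two]; ring

theorem torsion_zero (A B C D : Fin 2) (h : ∀ a, J.torsionVec A B C D a = 0) (E F : Fin 2) :
    J.torsion A B E F C D = 0 := by
  have : J.torsionVec A B C D = fun _ => 0 := funext h
  simp only [torsion, this, frameComp]
  fin_cases E <;> fin_cases F <;> simp [sum2]

@[simp] theorem sum2_zero_zero : sum2 0 0 = 0 := rfl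
@[simp] theorem sum2_zero_one : sum2 0 1 = 1 := rfl
@[simp] theorem sum2_one_zero : sum2 1 0 = 1 := rfl
@[simp] theorem sum2_one_one : sum2 1 1 = 2 := rfl

end FieldLemmas
end Jet

/-! ### Components of the torsion and the curvature -/

section Components
variable {K : Type*} [Field K] (J : Jet K)

@[simp] theorem conn_zero_zero (C D : Fin 2) : J.conn 0 0 C D = 0 := by
  simp [Jet.conn, connSing, connReg]
@[simp] theorem conn_one_zero (C D : Fin 2) : J.conn 1 0 C D = J.conn 0 1 C D := rfl
@[simp] theorem conn_swap (A B : Fin 2) : J.conn A B 1 0 = J.conn A B 0 1 := rfl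
@[simp] theorem dconn_zero_zero (b : Fin 3) (C D : Fin 2) : J.dconn b 0 0 C D = 0 := by
  simp [Jet.dconn, connSingDer, connReg]
@[simp] theorem dconn_one_zero (b : Fin 3) (C D : Fin 2) :
    J.dconn b 1 0 C D = J.dconn b 0 1 C D := rfl
@[simp] theorem dconn_swap (b : Fin 3) (A B : Fin 2) : J.dconn b A B 1 0 = J.dconn b A B 0 1 := rfl
@[simp] theorem e_one_zero (a : Fin 3) : J.e a 1 0 = J.e a 0 1 := rfl
@[simp] theorem e_zero_zero_zero : J.e 0 0 0 = 1 := by simp [Jet.e, frameSing, frameReg]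
@[simp] theorem e_one_zero_zero : J.e 1 0 0 = 0 := by simp [Jet.e, frameSing, frameReg]
@[simp] theorem e_two_zero_zero : J.e 2 0 0 = 0 := by simp [Jet.e, frameSing, frameReg]
@[simp] theorem e_two_zero_one : J.e 2 0 1 = 0 := by simp [Jet.e, frameSing, frameReg]
@[simp] theorem e_two_one_one : J.e 2 1 1 = 1 := by simp [Jet.e, frameSing, frameReg]
@[simp] theorem de_one_zero (b a : Fin 3) : J.de b a 1 0 = J.de b a 0 1 := rfl
@[simp] theorem de_zero_zero (b a : Fin 3) : J.de b a 0 0 = 0 := by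
  fin_cases a <;> simp [Jet.de, frameSingDer, frameReg]
@[simp] theorem de_two (b : Fin 3) (A B : Fin 2) : J.de b 2 A B = 0 := by
  have h : ∀ k : Fin 3, (!![0, 0, 0; J.der b (frame01 0), J.der b (frame01 1), 0;
      J.der b (frame11 0), J.der b (frame11 1), 0] : Matrix (Fin 3) (Fin 3) K) k 2 = 0 := by
    intro k; fin_cases k <;> rfl
  simp [Jet.de, frameSingDer, frameReg, h]
@[simp] theorem dir_zero_zero (df : Fin 3 → K) : J.dir 0 0 df = df 0 := by
  simp [Jet.dir, Fin.sum_univ_three]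
@[simp] theorem dir_one_zero (df : Fin 3 → K) : J.dir 1 0 df = J.dir 0 1 df := rfl
@[simp] theorem dir_zero (A B : Fin 2) : J.dir A B (fun _ => 0) = 0 := by simp [Jet.dir]

@[simp] theorem zetaAB_one_zero {K : Type*} (J : Jet K) : J.zetaAB 1 0 = J.zetaAB 0 1 := rfl
theorem sum4_eq (A B C D : Fin 2) : sum4 A B C D =
    ![![![![0, 1], ![1, 2]], ![![1, 2], ![2, 3]]], ![![![1, 2], ![2, 3]], ![![2, 3], ![3, 4]]]]
      A B C D := by
  revert A B C D; decide

@[simp] theorem eps_zero_zero : eps K 0 0 = 0 := rfl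
@[simp] theorem eps_zero_one : eps K 0 1 = 1 := rfl
@[simp] theorem eps_one_zero : eps K 1 0 = -1 := rfl
@[simp] theorem eps_one_one : eps K 1 1 = 0 := rfl
@[simp] theorem connUp_zero (A B D : Fin 2) : J.connUp A B 0 D = J.conn A B 1 D := by
  simp [Jet.connUp]
@[simp] theorem connUp_one (A B D : Fin 2) : J.connUp A B 1 D = -J.conn A B 0 D := by
  simp [Jet.connUp]

/-- The components `t_{AB}{}^{EF}{}_{CD} e^a_{EF}` as a function of `A + B`, `C + D`, `a`. -/
def torsionMat (j k a : Fin 3) : K :=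
  let a0 := J.conn 0 1 0 0
  let a1 := J.conn 0 1 0 1
  let a2 := J.conn 0 1 1 1
  let b0 := J.conn 1 1 0 0
  let b1 := J.conn 1 1 0 1
  let b2 := J.conn 1 1 1 1
  let t01 := ![J.de 0 0 0 1 + 2 * a1 - 2 * J.e 0 0 1 * a0, J.de 0 1 0 1 - 2 * J.e 1 0 1 * a0, 0]
  let t02 := ![J.de 0 0 1 1 + 2 * b1 - 2 * J.e 0 0 1 * b0, J.de 0 1 1 1 - 2 * J.e 1 0 1 * b0, 0]
  let t12 := ![J.dir 1 1 (fun b => J.de b 0 0 1) - J.dir 0 1 (fun b => J.de b 0 1 1) - b2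
      + 2 * J.e 0 0 1 * a2 + J.e 0 1 1 * (b0 - 2 * a1),
    J.dir 1 1 (fun b => J.de b 1 0 1) - J.dir 0 1 (fun b => J.de b 1 1 1)
      + 2 * J.e 1 0 1 * a2 + J.e 1 1 1 * (b0 - 2 * a1),
    b0 - 2 * a1]
  (![![0, -t01, -t02], ![t01, 0, t12], ![t02, -t12, 0]] : Fin 3 → Fin 3 → Fin 3 → K) j k a

theorem torsionVec_eq (A B C D : Fin 2) (a : Fin 3) :
    J.torsionVec A B C D a = torsionMat J (sum2 A B) (sum2 C D) a := by
  revert A B C D a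
  simp only [Fin.forall_fin_succ, Fin.forall_fin_zero]
  and_intros <;> simp [Jet.torsionVec, torsionMat, Jet.connPair, delta] <;> ring

/-- The components `R_{ABCDEF}` as a function of `A + B`, `C + D`, `E + F`, for a connection
without torsion. -/
def curvMat (i j k : Fin 3) : K :=
  let a0 := J.conn 0 1 0 0
  let a1 := J.conn 0 1 0 1
  let a2 := J.conn 0 1 1 1
  let b0 := J.conn 1 1 0 0
  let b1 := J.conn 1 1 0 1
  let b2 := J.conn 1 1 1 1
  let s := fun k => J.val (ricci k)
  let r01 := ![J.dconn 0 0 1 0 0 - s 0 / 2 - 2 * a0 ^ 2, J.dconn 0 0 1 0 1 - s 1 / 2 - 2 * a0 * a1,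
    J.dconn 0 0 1 1 1 - s 2 / 2 - 2 * a0 * a2]
  let r02 := ![J.dconn 0 1 1 0 0 - s 1 - 2 * a0 * b0, J.dconn 0 1 1 0 1 - s 2 - 2 * a1 * b0,
    J.dconn 0 1 1 1 1 - s 3 - 2 * a2 * b0]
  let r12 := ![J.dir 0 1 (fun b => J.dconn b 1 1 0 0) - J.dir 1 1 (fun b => J.dconn b 0 1 0 0)
      - s 2 / 2 - 2 * a0 * a2 + 2 * a0 * b1 - b0 ^ 2,
    J.dir 0 1 (fun b => J.dconn b 1 1 0 1) - J.dir 1 1 (fun b => J.dconn b 0 1 0 1)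
      - s 3 / 2 + a0 * b2 - 2 * a1 * a2 + 2 * a1 * b1 - a2 * b0 - b0 * b1,
    J.dir 0 1 (fun b => J.dconn b 1 1 1 1) - J.dir 1 1 (fun b => J.dconn b 0 1 1 1)
      - s 4 / 2 + 4 * a1 * b2 - 2 * a2 * b1 - 2 * a2 ^ 2 - b0 * b2]
  (![![0, r01, r02], ![-r01, 0, r12], ![-r02, -r12, 0]] : Fin 3 → Fin 3 → Fin 3 → K) j k i

set_option maxHeartbeats 4000000 in
theorem curvDefect_eq [CharZero K] (A B C D E F : Fin 2) (h : ∀ a, J.torsionVec C D E F a = 0) :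
    J.curvDefect A B C D E F = curvMat J (sum2 A B) (sum2 C D) (sum2 E F) := by
  have ht : ∀ G H, J.torsion C D G H E F = 0 := J.torsion_zero C D E F h
  simp only [Jet.curvDefect, Jet.curv, ht, zero_mul, Finset.sum_const_zero, add_zero]
  clear ht h
  revert A B C D E F
  simp only [Fin.forall_fin_two]
  and_intros <;> simp [Jet.ricci, sum4_eq, curvMat] <;> ring

end Components

/-! ### Components of the remaining zero quantities -/

section Components
variable {K : Type*} [Field K] (J : Jet K)

/-- The components `Σ_{ABCD}` as a function of `A + B`, `C + D`. -/
def sigmaMat (μ : K) (j k : Fin 3) : K :=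
  let a0 := J.conn 0 1 0 0
  let a1 := J.conn 0 1 0 1
  let a2 := J.conn 0 1 1 1
  let b0 := J.conn 1 1 0 0
  let b1 := J.conn 1 1 0 1
  let b2 := J.conn 1 1 1 1
  let s := fun k => J.val (ricci k)
  let z := fun k => J.val (dzeta k)
  let q := J.val zeta * (1 - μ * J.val zeta)
  (![![J.der 0 (dzeta 0) + q * s 0, J.der 0 (dzeta 1) + q * s 1,
      J.der 0 (dzeta 2) - J.val scal + q * s 2],
    ![J.dir 0 1 (J.grad (dzeta 0)) + 2 * a0 * z 1 - 2 * a1 * z 0 + q * s 1,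
      J.dir 0 1 (J.grad (dzeta 1)) + J.val scal / 2 + a0 * z 2 - a2 * z 0 + q * s 2,
      J.dir 0 1 (J.grad (dzeta 2)) + 2 * a1 * z 2 - 2 * a2 * z 1 + q * s 3],
    ![J.dir 1 1 (J.grad (dzeta 0)) - J.val scal + 2 * b0 * z 1 - 2 * b1 * z 0 + q * s 2,
      J.dir 1 1 (J.grad (dzeta 1)) + b0 * z 2 - b2 * z 0 + q * s 3,
      J.dir 1 1 (J.grad (dzeta 2)) + 2 * b1 * z 2 - 2 * b2 * z 1 + q * s 4]] :
    Fin 3 → Fin 3 → K) j k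

theorem sigma4_eq [CharZero K] (μ : K) (A B C D : Fin 2) :
    J.sigma4 μ A B C D = sigmaMat J μ (sum2 A B) (sum2 C D) := by
  revert A B C D
  simp only [Fin.forall_fin_two]
  and_intros <;>
  simp [Jet.sigma4, Jet.covZeta, Jet.ricci, sum4_eq, sigmaMat, hMet, Jet.zeta,
    Jet.scal, Jet.zetaAB, Jet.grad_def] <;> ring

/-- The components `S_{AB}` as a function of `A + B`. -/
def scalVec (μ : K) (j : Fin 3) : K :=
  let s := fun k => J.val (ricci k)
  let z := fun k => J.val (dzeta k)
  let ω := 1 - μ * J.val zeta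
  (![J.der 0 scal + ω * (s 0 * z 2 - 2 * s 1 * z 1 + s 2 * z 0),
    J.dir 0 1 (J.grad scal) + ω * (s 1 * z 2 - 2 * s 2 * z 1 + s 3 * z 0),
    J.dir 1 1 (J.grad scal) + ω * (s 2 * z 2 - 2 * s 3 * z 1 + s 4 * z 0)] : Fin 3 → K) j

theorem scalDefect_eq (μ : K) (A B : Fin 2) : J.scalDefect μ A B = scalVec J μ (sum2 A B) := by
  revert A B
  simp only [Fin.forall_fin_two]
  and_intros <;>
  simp [-mul_eq_mul_left_iff, Jet.scalDefect, Jet.ricci, sum4_eq, scalVec, Jet.zeta, Jet.zetaAB,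
    Jet.grad_def] <;> ring

/-- The components `H_{ABCD}` as a function of `A` and `B + C + D`. -/
def bianchiMat (μ : K) (A : Fin 2) (k : Fin 5) : K :=
  let a0 := J.conn 0 1 0 0
  let a1 := J.conn 0 1 0 1
  let a2 := J.conn 0 1 1 1
  let b0 := J.conn 1 1 0 0
  let b1 := J.conn 1 1 0 1
  let b2 := J.conn 1 1 1 1
  let s := fun k => J.val (ricci k)
  let z := fun k => J.val (dzeta k)
  let κ := 2 * μ / (1 - μ * J.val zeta)
  let q0 := s 0 * z 1 - s 1 * z 0
  let q1 := s 0 * z 2 / 4 + s 1 * z 1 / 2 - 3 * s 2 * z 0 / 4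
  let q2 := s 1 * z 2 / 2 - s 3 * z 0 / 2
  let q3 := 3 * s 2 * z 2 / 4 - s 3 * z 1 / 2 - s 4 * z 0 / 4
  let q4 := s 3 * z 2 - s 4 * z 1
  let d1 := fun k => J.dir 0 1 (J.grad (ricci k))
  let d2 := fun k => J.dir 1 1 (J.grad (ricci k))
  (![![d1 0 - J.der 0 (ricci 1) + 4 * a0 * s 1 - 4 * a1 * s 0 - κ * q0,
      d1 1 - J.der 0 (ricci 2) + 3 * a0 * s 2 - 2 * a1 * s 1 - a2 * s 0 - κ * q1,
      d1 2 - J.der 0 (ricci 3) + 2 * a0 * s 3 - 2 * a2 * s 1 - κ * q2,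
      d1 3 - J.der 0 (ricci 4) + a0 * s 4 + 2 * a1 * s 3 - 3 * a2 * s 2 - κ * q3, 0],
    ![d2 0 - d1 1 - 3 * a0 * s 2 + 2 * a1 * s 1 + a2 * s 0 + 4 * b0 * s 1 - 4 * b1 * s 0 - κ * q1,
      d2 1 - d1 2 - 2 * a0 * s 3 + 2 * a2 * s 1 + 3 * b0 * s 2 - 2 * b1 * s 1 - b2 * s 0 - κ * q2,
      d2 2 - d1 3 - a0 * s 4 - 2 * a1 * s 3 + 3 * a2 * s 2 + 2 * b0 * s 3 - 2 * b2 * s 1 - κ * q3,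
      d2 3 - d1 4 - 4 * a1 * s 4 + 4 * a2 * s 3 + b0 * s 4 + 2 * b1 * s 3 - 3 * b2 * s 2
        - κ * q4, 0]] : Fin 2 → Fin 5 → K) A k

set_option maxHeartbeats 2000000 in
theorem hDefect_eq [CharZero K] (μ : K) (A B C D : Fin 2) :
    J.hDefect μ A B C D = bianchiMat J μ A (sum4 0 B C D) := by
  have hκ : 2 * μ / (1 - μ * J.zeta) = 2 * μ / (1 - μ * J.val zeta) := rfl
  simp only [Jet.hDefect, bianchiMat, hκ]
  generalize 2 * μ / (1 - μ * J.val zeta) = κ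
  revert A B C D
  simp only [Fin.forall_fin_two]
  and_intros <;>
  simp [Jet.covRicci, Jet.ricci, sum4_eq, Jet.ricciZeta, Jet.zetaUp, Jet.zetaAB,
    Jet.grad_def] <;> ring

variable [CharZero K] {J} {μ : K}

theorem reducedList_eq (hu : J.u ≠ 0) (hω : 1 - μ * J.val zeta ≠ 0) :
    reducedList μ J =
      [J.u * torsionMat J 1 0 0, J.u * torsionMat J 1 0 1, torsionMat J 2 0 0,
        J.u * torsionMat J 2 0 1, 2 * J.u * curvMat J 0 0 1, J.u * curvMat J 0 0 2,
        2 * J.u * curvMat J 1 0 1, curvMat J 1 0 2, 2 * J.u * curvMat J 2 0 1, curvMat J 2 0 2,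
        J.sigma2 0 0, sigmaMat J μ 0 0, sigmaMat J μ 0 1, sigmaMat J μ 0 2, scalVec J μ 0,
        -2 * J.u * (1 - μ * J.val zeta) * bianchiMat J μ 0 0,
        -2 * J.u * (1 - μ * J.val zeta) * bianchiMat J μ 0 1,
        -2 * J.u * (1 - μ * J.val zeta) * bianchiMat J μ 0 2,
        -2 * J.u * (1 - μ * J.val zeta) * bianchiMat J μ 0 3,
        2 * J.u * (1 - μ * J.val zeta) * bianchiMat J μ 1 0] := by
  simp only [reducedList, List.cons.injEq, and_true]
  and_intros <;>
  simp [torsionMat, curvMat, Jet.sigma2, sigmaMat, scalVec, bianchiMat, Jet.conn, Jet.dconn, Jet.e,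
    Jet.de, connSing, connSingDer, connReg, frameSing, frameSingDer, frameReg, Jet.dir,
    Jet.grad_def, Fin.sum_univ_three, Jet.dir01, Jet.dir11, Jet.zetaAB] <;> field_simp <;> ring

theorem constraintList_eq (hu : J.u ≠ 0) (hω : 1 - μ * J.val zeta ≠ 0) :
    constraintList μ J =
      [torsionMat J 1 2 2, 2 * J.u * torsionMat J 1 2 0, 2 * J.u ^ 2 * torsionMat J 1 2 1,
        2 * J.u ^ 2 * curvMat J 0 1 2, 2 * J.u * curvMat J 1 1 2, 2 * J.u * curvMat J 2 1 2,
        2 * J.u * J.sigma2 0 1, J.sigma2 1 1, 2 * J.u * sigmaMat J μ 1 0,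
        2 * J.u * sigmaMat J μ 1 1, 2 * J.u * sigmaMat J μ 1 2, sigmaMat J μ 2 0,
        sigmaMat J μ 2 1, sigmaMat J μ 2 2, 2 * J.u * scalVec J μ 1, scalVec J μ 2,
        2 * J.u * (1 - μ * J.val zeta) * bianchiMat J μ 1 1,
        2 * J.u * (1 - μ * J.val zeta) * bianchiMat J μ 1 2,
        2 * J.u * (1 - μ * J.val zeta) * bianchiMat J μ 1 3] := by
  simp only [constraintList, List.cons.injEq, and_true]
  and_intros <;>
  simp [torsionMat, curvMat, Jet.sigma2, sigmaMat, scalVec, bianchiMat, Jet.conn, Jet.dconn, Jet.e,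
    Jet.de, connSing, connSingDer, connReg, frameSing, frameSingDer, frameReg, Jet.dir,
    Jet.grad_def, Fin.sum_univ_three, Jet.dir01, Jet.dir11, Jet.zetaAB] <;> field_simp <;> ring

end Components

/-! ### The reduced system and the complete set of equations -/

section Components
variable {K : Type*} [Field K] [CharZero K] {J : Jet K} {μ : K}

/-- The reduced system is equivalent to the equations of `reducedList`, which have no denominators:
they are the components of the zero quantities, multiplied by powers of `2 u` and `1 - μ ζ` where
necessary. -/
theorem reducedEquations_iff (hu : J.u ≠ 0) (hω : 1 - μ * J.val zeta ≠ 0) :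
    J.ReducedEquations μ ↔ ∀ x ∈ reducedList μ J, x = 0 := by
  have h2 : (2 : K) ≠ 0 := two_ne_zero
  rw [reducedList_eq hu hω]
  simp only [List.forall_mem_cons, List.not_mem_nil, false_imp_iff, implies_true, and_true,
    mul_eq_zero, hu, hω, h2, false_or, neg_eq_zero]
  constructor
  · rintro ⟨ht, hR, hσ, hG, hS, hH, hH'⟩
    have hR' : ∀ A B E F, curvMat J (sum2 A B) 0 (sum2 E F) = 0 := fun A B E F => by
      rw [← hR A B E F, curvDefect_eq J _ _ _ _ _ _
        (fun a => by rw [J.torsionVec_swap, ht, neg_zero])]; rfl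
    have hT : ∀ A B a, torsionMat J (sum2 A B) 0 a = 0 := fun A B a => by
      rw [← ht A B a, torsionVec_eq]; rfl
    have hQ : ∀ C D, sigmaMat J μ 0 (sum2 C D) = 0 := fun C D => by
      rw [← hG C D, sigma4_eq]; rfl
    have hB : ∀ B C D, bianchiMat J μ 0 (sum4 0 B C D) = 0 := fun B C D => by
      rw [← hH B C D, hDefect_eq]
    rw [hH, zero_add, hDefect_eq] at hH'
    exact ⟨hT 0 1 0, hT 0 1 1, hT 1 1 0, hT 1 1 1, hR' 0 0 0 1, hR' 0 0 1 1, hR' 0 1 0 1,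
      hR' 0 1 1 1, hR' 1 1 0 1, hR' 1 1 1 1, hσ, hQ 0 0, hQ 0 1, hQ 1 1,
      by rw [← hS, scalDefect_eq]; rfl, hB 0 0 0, hB 0 0 1, hB 0 1 1, hB 1 1 1, hH'⟩
  · rintro ⟨t10, t11, t20, t21, r001, r002, r101, r102, r201, r202, σ0, q0, q1, q2, s0,
      h0, h1, h2, h3, h10⟩
    have hT : ∀ A B a, J.torsionVec A B 0 0 a = 0 := by
      simp only [torsionVec_eq]
      simp only [Fin.forall_fin_succ, Fin.forall_fin_zero]
      and_intros <;> first | assumption | simp [torsionMat]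
    refine ⟨hT, ?_, σ0, ?_, by rw [scalDefect_eq]; exact s0, ?_, ?_⟩
    · intro A B E F
      rw [curvDefect_eq J _ _ _ _ _ _ (fun a => by rw [J.torsionVec_swap, hT, neg_zero])]
      revert A B E F
      simp only [Fin.forall_fin_two]
      and_intros <;> first | assumption | simp [curvMat]
    · simp only [sigma4_eq, Fin.forall_fin_two]
      and_intros <;> assumption
    · simp only [hDefect_eq, Fin.forall_fin_two]
      and_intros <;> assumption
    · rw [hDefect_eq, hDefect_eq]
      exact (congrArg₂ (· + ·) h1 h10).trans (add_zero 0)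

set_option maxHeartbeats 1000000 in
/-- The complete set of equations consists of the reduced system and the constraints of
`constraintList`. -/
theorem completeEquations_iff (hu : J.u ≠ 0) (hω : 1 - μ * J.val zeta ≠ 0) :
    J.CompleteEquations μ ↔
      (∀ x ∈ reducedList μ J, x = 0) ∧ ∀ x ∈ constraintList μ J, x = 0 := by
  have h2 : (2 : K) ≠ 0 := two_ne_zero
  have hu2 : J.u ^ 2 ≠ 0 := pow_ne_zero _ hu
  constructor
  · rintro ⟨ht, hR, hσ, hG, hS, hH⟩
    refine ⟨(reducedEquations_iff hu hω).1 ⟨fun A B => ht A B 0 0, fun A B => hR A B 0 0, hσ 0 0,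
      hG 0 0, hS 0 0, hH 0, by rw [hH, hH, add_zero]⟩, ?_⟩
    rw [constraintList_eq hu hω]
    simp only [List.forall_mem_cons, List.not_mem_nil, false_imp_iff, implies_true, and_true,
      mul_eq_zero, hu, hω, h2, hu2, false_or]
    have hR' : ∀ A B E F, curvMat J (sum2 A B) 1 (sum2 E F) = 0 := fun A B E F => by
      rw [← hR A B 0 1 E F, curvDefect_eq J _ _ _ _ _ _ (ht 0 1 E F)]; rfl
    have hT : ∀ A B a, torsionMat J 1 (sum2 A B) a = 0 := fun A B a => by
      rw [← ht 0 1 A B a, torsionVec_eq]; rfl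
    have hQ : ∀ A C D, sigmaMat J μ (sum2 A 1) (sum2 C D) = 0 := fun A C D => by
      rw [← hG A 1 C D, sigma4_eq]
    have hB : ∀ B C D, bianchiMat J μ 1 (sum4 0 B C D) = 0 := fun B C D => by
      rw [← hH 1 B C D, hDefect_eq]
    have hV : ∀ A, scalVec J μ (sum2 A 1) = 0 := fun A => by
      rw [← hS A 1, scalDefect_eq]
    exact ⟨hT 1 1 2, hT 1 1 0, hT 1 1 1, hR' 0 0 1 1, hR' 0 1 1 1, hR' 1 1 1 1, hσ 0 1, hσ 1 1,
      hQ 0 0 0, hQ 0 0 1, hQ 0 1 1, hQ 1 0 0, hQ 1 0 1, hQ 1 1 1, hV 0, hV 1,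
      hB 0 0 1, hB 0 1 1, hB 1 1 1⟩
  · rintro ⟨hred, hcon⟩
    have hred' := hred
    rw [reducedList_eq hu hω] at hred'
    rw [constraintList_eq hu hω] at hcon
    simp only [List.forall_mem_cons, List.not_mem_nil, false_imp_iff, implies_true, and_true,
      mul_eq_zero, hu, hω, h2, hu2, false_or, neg_eq_zero] at hcon hred'
    obtain ⟨t10, t11, t20, t21, r001, r002, r101, r102, r201, r202, σ0, q0, q1, q2, s0,
      h0, h1, h2, h3, h10⟩ := hred'
    obtain ⟨t122, t120, t121, r012, r112, r212, σ1, σ2, q10, q11, q12, q20, q21, q22, s1, s2,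
      h11, h12, h13⟩ := hcon
    have hT : ∀ A B C D a, J.torsionVec A B C D a = 0 := by
      have key : ∀ j k a, torsionMat J j k a = 0 := by
        have n10 : torsionMat J 0 1 0 = -torsionMat J 1 0 0 := rfl
        have n11 : torsionMat J 0 1 1 = -torsionMat J 1 0 1 := rfl
        have n20 : torsionMat J 0 2 0 = -torsionMat J 2 0 0 := rfl
        have n21 : torsionMat J 0 2 1 = -torsionMat J 2 0 1 := rfl
        have n12 : ∀ a, torsionMat J 2 1 a = -torsionMat J 1 2 a := fun a => rfl
        simp only [Fin.forall_fin_succ, Fin.forall_fin_zero]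
        and_intros <;> first | assumption | (simp [torsionMat]; done) |
          (exact n10.trans (by rw [t10, neg_zero])) | (exact n11.trans (by rw [t11, neg_zero])) |
          (exact n20.trans (by rw [t20, neg_zero])) | (exact n21.trans (by rw [t21, neg_zero])) |
          (exact (n12 0).trans (by rw [t120, neg_zero])) |
          (exact (n12 1).trans (by rw [t121, neg_zero])) |
          (exact (n12 2).trans (by rw [t122, neg_zero]))
      intro A B C D a
      rw [torsionVec_eq, key]
    have hRm : ∀ i j k, curvMat J i j k = 0 := by
      have n1 : ∀ i, curvMat J i 1 0 = -curvMat J i 0 1 := fun i => by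
        fin_cases i <;> rfl
      have n2 : ∀ i, curvMat J i 2 0 = -curvMat J i 0 2 := fun i => by
        fin_cases i <;> rfl
      have n3 : ∀ i, curvMat J i 2 1 = -curvMat J i 1 2 := fun i => by
        fin_cases i <;> rfl
      have p1 : ∀ i, curvMat J i 0 1 = 0 := by
        intro i; fin_cases i <;> assumption
      have p2 : ∀ i, curvMat J i 0 2 = 0 := by
        intro i; fin_cases i <;> assumption
      have p3 : ∀ i, curvMat J i 1 2 = 0 := by
        intro i; fin_cases i <;> assumption
      intro i j k
      fin_cases j <;> fin_cases k
      · simp [curvMat]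
      · exact p1 i
      · exact p2 i
      · exact (n1 i).trans (by rw [p1, neg_zero])
      · simp [curvMat]
      · exact p3 i
      · exact (n2 i).trans (by rw [p2, neg_zero])
      · exact (n3 i).trans (by rw [p3, neg_zero])
      · simp [curvMat]
    refine ⟨hT, fun A B C D E F => by rw [curvDefect_eq J _ _ _ _ _ _ (hT C D E F), hRm], ?_, ?_,
        ?_,
      ?_⟩
    · simp only [Fin.forall_fin_two]
      exact ⟨⟨σ0, σ1⟩, σ1, σ2⟩
    · simp only [sigma4_eq, Fin.forall_fin_two]
      and_intros <;> assumption
    · simp only [scalDefect_eq, Fin.forall_fin_two]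
      and_intros <;> assumption
    · simp only [hDefect_eq, Fin.forall_fin_two]
      have h10' : bianchiMat J μ 1 0 = 0 := h10
      and_intros <;> assumption

end Components

end

/-! ### The subsidiary system -/

/-- The field `K` with the three frame derivations `e_{00}, e_{01}, e_{11}`, the connection
coefficients `Γ_{01CD} = a_k`, `Γ_{11CD} = b_k` (`C + D = k`), and the other unknowns, subject to
the reduced system. The factor `(1 - μ ζ)⁻¹` is denoted by `h`. -/
structure NullFrame (K : Type*) [Field K] where
  (D0 D1 D2 : Derivation ℤ K K)
  (a0 a1 a2 b0 b1 b2 z z0 z1 z2 s s0 s1 s2 s3 s4 μ h : K)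
  comm01 (f : K) : D0 (D1 f) = D1 (D0 f) + 2 * a0 * D1 f - 2 * a1 * D0 f
  comm02 (f : K) : D0 (D2 f) = D2 (D0 f) + 2 * b0 * D1 f - 2 * b1 * D0 f
  h_mul : h * (1 - μ * z) = 1
  D0_μ : D0 μ = 0
  D1_μ : D1 μ = 0
  D2_μ : D2 μ = 0
  D0_a0 : D0 a0 = s0 / 2 + 2 * a0 ^ 2
  D0_a1 : D0 a1 = s1 / 2 + 2 * a0 * a1
  D0_a2 : D0 a2 = s2 / 2 + 2 * a0 * a2
  D0_b0 : D0 b0 = s1 + 2 * a0 * b0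
  D0_b1 : D0 b1 = s2 + 2 * a1 * b0
  D0_b2 : D0 b2 = s3 + 2 * a2 * b0
  D0_z : D0 z = z0
  D0_z0 : D0 z0 = -(s0 * z * (1 - μ * z))
  D0_z1 : D0 z1 = -(s1 * z * (1 - μ * z))
  D0_z2 : D0 z2 = s - s2 * z * (1 - μ * z)
  D0_s : D0 s = -((1 - μ * z) * (s0 * z2 - 2 * s1 * z1 + s2 * z0))
  D0_s1 : D0 s1 = D1 s0 + 4 * a0 * s1 - 4 * a1 * s0 - 2 * h * μ * (s0 * z1 - s1 * z0)
  D0_s2 : D0 s2 = D1 s1 + 3 * a0 * s2 - 2 * a1 * s1 - a2 * s0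
    - h * μ * (s0 * z2 / 2 + s1 * z1 - 3 * s2 * z0 / 2)
  D0_s3 : D0 s3 = D1 s2 + 2 * a0 * s3 - 2 * a2 * s1 - h * μ * (s1 * z2 - s3 * z0)
  D0_s4 : D0 s4 = D1 s3 + a0 * s4 + 2 * a1 * s3 - 3 * a2 * s2
    - h * μ * (3 * s2 * z2 / 2 - s3 * z1 - s4 * z0 / 2)
  D2_s0 : D2 s0 = D1 s1 + 3 * a0 * s2 - 2 * a1 * s1 - a2 * s0 - 4 * b0 * s1 + 4 * b1 * s0
    + h * μ * (s0 * z2 / 2 + s1 * z1 - 3 * s2 * z0 / 2)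

namespace NullFrame
variable {K : Type*} [Field K] [CharZero K] (N : NullFrame K)

theorem der_ofNat (D : Derivation ℤ K K) (n : ℕ) [n.AtLeastTwo] :
    D (no_index (OfNat.ofNat n : K)) = 0 := by
  rw [← Nat.cast_ofNat]; exact D.map_natCast _

theorem der_half (D : Derivation ℤ K K) (f : K) : D (f / 2) = D f / 2 := by
  have h : D (2 * (f / 2)) = D f := by rw [mul_div_cancel₀ _ two_ne_zero]
  rw [D.leibniz, der_ofNat] at h
  simp only [smul_eq_mul, mul_zero, add_zero] at h
  field_simp
  linear_combination h

/-- The torsion applied to a function: `∇_{01} e_{11} - ∇_{11} e_{01} - [e_{01}, e_{11}]`, where the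
coefficient of `e_{11}` is dropped. -/
def T (f : K) : K := N.D2 (N.D1 f) - N.D1 (N.D2 f) + 2 * N.a2 * N.D1 f - N.b2 * N.D0 f

/-- The zero quantity `R_{000111}`. -/
def R0 : K := N.D1 N.b0 - N.D2 N.a0 - N.s2 / 2 - 2 * N.a0 * N.a2 + 2 * N.a0 * N.b1 - N.b0 ^ 2
/-- The zero quantity `R_{010111}`. -/
def R1 : K := N.D1 N.b1 - N.D2 N.a1 - N.s3 / 2 + N.a0 * N.b2 - 2 * N.a1 * N.a2 + 2 * N.a1 * N.b1
  - N.a2 * N.b0 - N.b0 * N.b1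
/-- The zero quantity `R_{110111}`. -/
def R2 : K := N.D1 N.b2 - N.D2 N.a2 - N.s4 / 2 + 4 * N.a1 * N.b2 - 2 * N.a2 * N.b1 - 2 * N.a2 ^ 2
  - N.b0 * N.b2
/-- The zero quantity `Σ_{01}`. -/
def Z1 : K := N.D1 N.z - N.z1
/-- The zero quantity `Σ_{11}`. -/
def Z2 : K := N.D2 N.z - N.z2
/-- The zero quantity `Σ_{0100}`. -/
def Y0 : K := N.D1 N.z0 + 2 * N.a0 * N.z1 - 2 * N.a1 * N.z0 + N.s1 * N.z * (1 - N.μ * N.z)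
/-- The zero quantity `Σ_{0101}`. -/
def Y1 : K := N.D1 N.z1 + N.s / 2 + N.a0 * N.z2 - N.a2 * N.z0 + N.s2 * N.z * (1 - N.μ * N.z)
/-- The zero quantity `Σ_{0111}`. -/
def Y2 : K := N.D1 N.z2 + 2 * N.a1 * N.z2 - 2 * N.a2 * N.z1 + N.s3 * N.z * (1 - N.μ * N.z)
/-- The zero quantity `Σ_{1100}`. -/
def X0 : K := N.D2 N.z0 - N.s + 2 * N.b0 * N.z1 - 2 * N.b1 * N.z0 + N.s2 * N.z * (1 - N.μ * N.z)
/-- The zero quantity `Σ_{1101}`. -/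
def X1 : K := N.D2 N.z1 + N.b0 * N.z2 - N.b2 * N.z0 + N.s3 * N.z * (1 - N.μ * N.z)
/-- The zero quantity `Σ_{1111}`. -/
def X2 : K := N.D2 N.z2 + 2 * N.b1 * N.z2 - 2 * N.b2 * N.z1 + N.s4 * N.z * (1 - N.μ * N.z)
/-- The zero quantity `S_{01}`. -/
def S1 : K := N.D1 N.s + (1 - N.μ * N.z) * (N.s1 * N.z2 - 2 * N.s2 * N.z1 + N.s3 * N.z0)
/-- The zero quantity `S_{11}`. -/
def S2 : K := N.D2 N.s + (1 - N.μ * N.z) * (N.s2 * N.z2 - 2 * N.s3 * N.z1 + N.s4 * N.z0)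
/-- The zero quantity `H_{1001}`. -/
def H1 : K := N.D2 N.s1 - N.D1 N.s2 - 2 * N.a0 * N.s3 + 2 * N.a2 * N.s1 + 3 * N.b0 * N.s2
  - 2 * N.b1 * N.s1 - N.b2 * N.s0 - N.h * N.μ * (N.s1 * N.z2 - N.s3 * N.z0)
/-- The zero quantity `H_{1011}`. -/
def H2 : K := N.D2 N.s2 - N.D1 N.s3 - N.a0 * N.s4 - 2 * N.a1 * N.s3 + 3 * N.a2 * N.s2
  + 2 * N.b0 * N.s3 - 2 * N.b2 * N.s1
  - N.h * N.μ * (3 * N.s2 * N.z2 / 2 - N.s3 * N.z1 - N.s4 * N.z0 / 2)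
/-- The zero quantity `H_{1111}`. -/
def H3 : K := N.D2 N.s3 - N.D1 N.s4 - 4 * N.a1 * N.s4 + 4 * N.a2 * N.s3 + N.b0 * N.s4
  + 2 * N.b1 * N.s3 - 3 * N.b2 * N.s2 - 2 * N.h * N.μ * (N.s3 * N.z2 - N.s4 * N.z1)

theorem h_rel : N.h * N.μ * N.z - N.h + 1 = 0 := by linear_combination -N.h_mul

theorem der_h (D : Derivation ℤ K K) (hμ : D N.μ = 0) : D N.h = N.μ * N.h ^ 2 * D N.z := by
  have e := congrArg D N.h_mul
  have h1 : D (1 : K) = 0 := D.map_one_eq_zero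
  simp only [D.leibniz, map_sub, hμ, h1, smul_eq_mul, mul_zero, add_zero] at e
  linear_combination N.h * e - D N.h * N.h_mul

variable (ht : N.b0 = 2 * N.a1)
include ht

/-- Since the torsion has no component along `e_{11}`, which is the meaning of `ht`, the equation for
`R0` contains no other zero quantity. -/
theorem D0_R0 : N.D0 N.R0 = 4 * N.a0 * N.R0 := by
  simp only [R0, map_sub, map_add, Derivation.leibniz, Derivation.leibniz_pow, der_ofNat, der_half,
    smul_eq_mul, nsmul_eq_mul, N.comm01, N.comm02, N.D0_a0, N.D0_a2, N.D0_b0, N.D0_b1, N.D0_s2,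
    N.D2_s0, ht, N.D0_a1, map_zero]
  push_cast
  ring

/-- For `e_{00} f = 0` and `R0 = 0` this is a homogeneous equation for `T f` alone. -/
theorem D0_T (f : K) :
    N.D0 (N.T f) = N.T (N.D0 f) + 2 * N.R1 * N.D0 f - 2 * N.R0 * N.D1 f + 2 * N.a0 * N.T f := by
  simp only [T, R0, R1, map_sub, map_add, Derivation.leibniz, der_ofNat,
    smul_eq_mul, N.comm01, N.comm02, N.D0_a2, N.D0_b2, ht]
  ring

variable (hR : N.R0 = 0) (t : K) (hT : ∀ f, N.T f = t * N.D0 f)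
include hR

theorem D2_a0 : N.D2 N.a0 = 2 * N.D1 N.a1 - N.s2 / 2 - 2 * N.a0 * N.a2 + 2 * N.a0 * N.b1
    - 4 * N.a1 ^ 2 := by
  have := hR
  simp only [R0, ht, Derivation.leibniz, der_ofNat, smul_eq_mul] at this
  linear_combination -this

omit ht hR in
theorem D1_z : N.D1 N.z = N.z1 + N.Z1 := by unfold Z1; ring
omit ht hR in
theorem D2_z : N.D2 N.z = N.z2 + N.Z2 := by unfold Z2; ring
omit ht hR in
theorem D1_z0 : N.D1 N.z0 = N.Y0 - (2 * N.a0 * N.z1 - 2 * N.a1 * N.z0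
    + N.s1 * N.z * (1 - N.μ * N.z)) := by unfold Y0; ring
omit ht hR in
theorem D1_z1 : N.D1 N.z1 = N.Y1 - (N.s / 2 + N.a0 * N.z2 - N.a2 * N.z0
    + N.s2 * N.z * (1 - N.μ * N.z)) := by unfold Y1; ring
omit ht hR in
theorem D1_z2 : N.D1 N.z2 = N.Y2 - (2 * N.a1 * N.z2 - 2 * N.a2 * N.z1
    + N.s3 * N.z * (1 - N.μ * N.z)) := by unfold Y2; ring
omit hR in
theorem D2_z0 : N.D2 N.z0 = N.X0 - (-N.s + 4 * N.a1 * N.z1 - 2 * N.b1 * N.z0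
    + N.s2 * N.z * (1 - N.μ * N.z)) := by unfold X0; rw [ht]; ring
omit hR in
theorem D2_z1 : N.D2 N.z1 = N.X1 - (2 * N.a1 * N.z2 - N.b2 * N.z0
    + N.s3 * N.z * (1 - N.μ * N.z)) := by unfold X1; rw [ht]; ring
omit ht hR in
theorem D2_z2 : N.D2 N.z2 = N.X2 - (2 * N.b1 * N.z2 - 2 * N.b2 * N.z1
    + N.s4 * N.z * (1 - N.μ * N.z)) := by unfold X2; ring
omit ht hR in
theorem D1_s : N.D1 N.s = N.S1 - (1 - N.μ * N.z) *
    (N.s1 * N.z2 - 2 * N.s2 * N.z1 + N.s3 * N.z0) := by unfold S1; ring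
omit ht hR in
theorem D2_s : N.D2 N.s = N.S2 - (1 - N.μ * N.z) *
    (N.s2 * N.z2 - 2 * N.s3 * N.z1 + N.s4 * N.z0) := by unfold S2; ring
omit hR in
theorem D2_a1 : N.D2 N.a1 = -N.R1 + (N.D1 N.b1 - N.s3 / 2 + N.a0 * N.b2 - 4 * N.a1 * N.a2) := by
  unfold R1; rw [ht]; ring
omit hR in
theorem D2_a2 : N.D2 N.a2 = -N.R2 + (N.D1 N.b2 - N.s4 / 2 + 2 * N.a1 * N.b2 - 2 * N.a2 * N.b1
    - 2 * N.a2 ^ 2) := by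
  unfold R2; rw [ht]; ring
omit hR in
theorem D2_s1 : N.D2 N.s1 = N.H1 + N.D1 N.s2 + 2 * N.a0 * N.s3 - 2 * N.a2 * N.s1
    - 6 * N.a1 * N.s2 + 2 * N.b1 * N.s1 + N.b2 * N.s0
    + N.h * N.μ * (N.s1 * N.z2 - N.s3 * N.z0) := by
  unfold H1; rw [ht]; ring
omit hR in
theorem D2_s2 : N.D2 N.s2 = N.H2 + N.D1 N.s3 + N.a0 * N.s4 - 2 * N.a1 * N.s3 - 3 * N.a2 * N.s2
    + 2 * N.b2 * N.s1 + N.h * N.μ * (3 * N.s2 * N.z2 / 2 - N.s3 * N.z1 - N.s4 * N.z0 / 2) := by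
  unfold H2; rw [ht]; ring
omit hR in
theorem D2_s3 : N.D2 N.s3 = N.H3 + N.D1 N.s4 + 2 * N.a1 * N.s4 - 4 * N.a2 * N.s3
    - 2 * N.b1 * N.s3 + 3 * N.b2 * N.s2 + 2 * N.h * N.μ * (N.s3 * N.z2 - N.s4 * N.z1) := by
  unfold H3; rw [ht]; ring

omit ht hR in
include hT in
theorem D2_D1 (f : K) : N.D2 (N.D1 f) = N.D1 (N.D2 f) - 2 * N.a2 * N.D1 f + N.b2 * N.D0 f
    + t * N.D0 f := by
  rw [← hT, T]; ring

set_option maxHeartbeats 1000000 in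
include hT in
theorem D0_R1 : N.D0 N.R1 = 2 * N.a0 * N.R1 - N.H1 / 2 := by
  rw [R1]
  simp only [map_sub, map_add, map_neg, map_zero, Derivation.leibniz, Derivation.leibniz_pow,
    der_ofNat, der_half, Derivation.map_one_eq_zero, smul_eq_mul, nsmul_eq_mul, N.comm01,
    N.comm02, N.D0_μ, N.D0_a0, N.D0_a1, N.D0_a2, N.D0_b0, N.D0_b1, N.D0_b2, N.D0_z, N.D0_z0,
        N.D0_z1,
    N.D0_z2, N.D0_s, N.D0_s1, N.D0_s2, N.D0_s3, N.D0_s4, N.D1_μ, N.D2_μ, ht, N.der_h _ N.D0_μ]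
  simp only [map_sub, map_add, map_neg, map_zero, Derivation.leibniz, Derivation.leibniz_pow,
    der_ofNat, der_half, Derivation.map_one_eq_zero, smul_eq_mul, nsmul_eq_mul, N.D1_μ, N.D2_μ,
    N.D0_s1, N.D0_s2, N.D0_s3, N.D0_s4, N.D2_D1 t hT,
    N.D2_a0 ht hR, N.D2_a1 ht, N.D2_a2 ht, N.D1_z, N.D2_z, N.D1_z0, N.D1_z1, N.D1_z2, N.D2_z0 ht,
    N.D2_z1 ht, N.D2_z2, N.D1_s, N.D2_s, N.D2_s0, N.D2_s1 ht, N.D2_s2 ht, N.D2_s3 ht, ht,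
    N.der_h _ N.D1_μ, N.der_h _ N.D2_μ]
  ring

set_option maxHeartbeats 1000000 in
include hT in
theorem D0_R2 : N.D0 N.R2 = 2 * N.a0 * N.R2 - N.H2 / 2 := by
  rw [R2]
  simp only [map_sub, map_add, map_neg, map_zero, Derivation.leibniz, Derivation.leibniz_pow,
    der_ofNat, der_half, Derivation.map_one_eq_zero, smul_eq_mul, nsmul_eq_mul, N.comm01,
    N.comm02, N.D0_μ, N.D0_a0, N.D0_a1, N.D0_a2, N.D0_b0, N.D0_b1, N.D0_b2, N.D0_z, N.D0_z0,
        N.D0_z1,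
    N.D0_z2, N.D0_s, N.D0_s1, N.D0_s2, N.D0_s3, N.D0_s4, N.D1_μ, N.D2_μ, ht, N.der_h _ N.D0_μ]
  simp only [map_sub, map_add, map_neg, map_zero, Derivation.leibniz, Derivation.leibniz_pow,
    der_ofNat, der_half, Derivation.map_one_eq_zero, smul_eq_mul, nsmul_eq_mul, N.D1_μ, N.D2_μ,
    N.D0_s1, N.D0_s2, N.D0_s3, N.D0_s4, N.D2_D1 t hT,
    N.D2_a0 ht hR, N.D2_a1 ht, N.D2_a2 ht, N.D1_z, N.D2_z, N.D1_z0, N.D1_z1, N.D1_z2, N.D2_z0 ht,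
    N.D2_z1 ht, N.D2_z2, N.D1_s, N.D2_s, N.D2_s0, N.D2_s1 ht, N.D2_s2 ht, N.D2_s3 ht, ht,
    N.der_h _ N.D1_μ, N.der_h _ N.D2_μ]
  push_cast
  ring

set_option maxHeartbeats 1000000 in
include hT in
theorem D0_Z1 : N.D0 N.Z1 = 2 * N.a0 * N.Z1 + N.Y0 := by
  rw [Z1]
  simp only [map_sub, map_add, map_neg, map_zero, Derivation.leibniz, Derivation.leibniz_pow,
    der_ofNat, der_half, Derivation.map_one_eq_zero, smul_eq_mul, nsmul_eq_mul, N.comm01,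
    N.comm02, N.D0_μ, N.D0_a0, N.D0_a1, N.D0_a2, N.D0_b0, N.D0_b1, N.D0_b2, N.D0_z, N.D0_z0,
        N.D0_z1,
    N.D0_z2, N.D0_s, N.D0_s1, N.D0_s2, N.D0_s3, N.D0_s4, N.D1_μ, N.D2_μ, ht, N.der_h _ N.D0_μ]
  simp only [map_sub, map_add, map_neg, map_zero, Derivation.leibniz, Derivation.leibniz_pow,
    der_ofNat, der_half, Derivation.map_one_eq_zero, smul_eq_mul, nsmul_eq_mul, N.D1_μ, N.D2_μ,
    N.D0_s1, N.D0_s2, N.D0_s3, N.D0_s4, N.D2_D1 t hT,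
    N.D2_a0 ht hR, N.D2_a1 ht, N.D2_a2 ht, N.D1_z, N.D2_z, N.D1_z0, N.D1_z1, N.D1_z2, N.D2_z0 ht,
    N.D2_z1 ht, N.D2_z2, N.D1_s, N.D2_s, N.D2_s0, N.D2_s1 ht, N.D2_s2 ht, N.D2_s3 ht, ht,
    N.der_h _ N.D1_μ, N.der_h _ N.D2_μ]
  ring

set_option maxHeartbeats 1000000 in
include hT in
theorem D0_Z2 : N.D0 N.Z2 = N.X0 + 4 * N.a1 * N.Z1 := by
  rw [Z2]
  simp only [map_sub, map_add, map_neg, map_zero, Derivation.leibniz, Derivation.leibniz_pow,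
    der_ofNat, der_half, Derivation.map_one_eq_zero, smul_eq_mul, nsmul_eq_mul, N.comm01,
    N.comm02, N.D0_μ, N.D0_a0, N.D0_a1, N.D0_a2, N.D0_b0, N.D0_b1, N.D0_b2, N.D0_z, N.D0_z0,
        N.D0_z1,
    N.D0_z2, N.D0_s, N.D0_s1, N.D0_s2, N.D0_s3, N.D0_s4, N.D1_μ, N.D2_μ, ht, N.der_h _ N.D0_μ]
  simp only [map_sub, map_add, map_neg, map_zero, Derivation.leibniz, Derivation.leibniz_pow,
    der_ofNat, der_half, Derivation.map_one_eq_zero, smul_eq_mul, nsmul_eq_mul, N.D1_μ, N.D2_μ,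
    N.D0_s1, N.D0_s2, N.D0_s3, N.D0_s4, N.D2_D1 t hT,
    N.D2_a0 ht hR, N.D2_a1 ht, N.D2_a2 ht, N.D1_z, N.D2_z, N.D1_z0, N.D1_z1, N.D1_z2, N.D2_z0 ht,
    N.D2_z1 ht, N.D2_z2, N.D1_s, N.D2_s, N.D2_s0, N.D2_s1 ht, N.D2_s2 ht, N.D2_s3 ht, ht,
    N.der_h _ N.D1_μ, N.der_h _ N.D2_μ]
  ring

set_option maxHeartbeats 1000000 in
include hT in
theorem D0_Y0 : N.D0 N.Y0 = 2 * N.a0 * N.Y0 - N.s0 * (1 - 2 * N.μ * N.z) * N.Z1 := by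
  rw [Y0]
  simp only [map_sub, map_add, map_neg, map_zero, Derivation.leibniz, Derivation.leibniz_pow,
    der_ofNat, der_half, Derivation.map_one_eq_zero, smul_eq_mul, nsmul_eq_mul, N.comm01,
    N.comm02, N.D0_μ, N.D0_a0, N.D0_a1, N.D0_a2, N.D0_b0, N.D0_b1, N.D0_b2, N.D0_z, N.D0_z0,
        N.D0_z1,
    N.D0_z2, N.D0_s, N.D0_s1, N.D0_s2, N.D0_s3, N.D0_s4, N.D1_μ, N.D2_μ, ht, N.der_h _ N.D0_μ]
  simp only [map_sub, map_add, map_neg, map_zero, Derivation.leibniz, Derivation.leibniz_pow,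
    der_ofNat, der_half, Derivation.map_one_eq_zero, smul_eq_mul, nsmul_eq_mul, N.D1_μ, N.D2_μ,
    N.D0_s1, N.D0_s2, N.D0_s3, N.D0_s4, N.D2_D1 t hT,
    N.D2_a0 ht hR, N.D2_a1 ht, N.D2_a2 ht, N.D1_z, N.D2_z, N.D1_z0, N.D1_z1, N.D1_z2, N.D2_z0 ht,
    N.D2_z1 ht, N.D2_z2, N.D1_s, N.D2_s, N.D2_s0, N.D2_s1 ht, N.D2_s2 ht, N.D2_s3 ht, ht,
    N.der_h _ N.D1_μ, N.der_h _ N.D2_μ]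
  linear_combination N.μ * N.z *
    (2 * N.s0 * N.z1 - 2 * N.s1 * N.z0) * N.h_rel

set_option maxHeartbeats 1000000 in
include hT in
theorem D0_Y1 : N.D0 N.Y1 = 2 * N.a0 * N.Y1 - N.s1 * (1 - 2 * N.μ * N.z) * N.Z1 := by
  rw [Y1]
  simp only [map_sub, map_add, map_neg, map_zero, Derivation.leibniz, Derivation.leibniz_pow,
    der_ofNat, der_half, Derivation.map_one_eq_zero, smul_eq_mul, nsmul_eq_mul, N.comm01,
    N.comm02, N.D0_μ, N.D0_a0, N.D0_a1, N.D0_a2, N.D0_b0, N.D0_b1, N.D0_b2, N.D0_z, N.D0_z0,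
        N.D0_z1,
    N.D0_z2, N.D0_s, N.D0_s1, N.D0_s2, N.D0_s3, N.D0_s4, N.D1_μ, N.D2_μ, ht, N.der_h _ N.D0_μ]
  simp only [map_sub, map_add, map_neg, map_zero, Derivation.leibniz, Derivation.leibniz_pow,
    der_ofNat, der_half, Derivation.map_one_eq_zero, smul_eq_mul, nsmul_eq_mul, N.D1_μ, N.D2_μ,
    N.D0_s1, N.D0_s2, N.D0_s3, N.D0_s4, N.D2_D1 t hT,
    N.D2_a0 ht hR, N.D2_a1 ht, N.D2_a2 ht, N.D1_z, N.D2_z, N.D1_z0, N.D1_z1, N.D1_z2, N.D2_z0 ht,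
    N.D2_z1 ht, N.D2_z2, N.D1_s, N.D2_s, N.D2_s0, N.D2_s1 ht, N.D2_s2 ht, N.D2_s3 ht, ht,
    N.der_h _ N.D1_μ, N.der_h _ N.D2_μ]
  linear_combination N.μ * N.z *
    (N.s0 * N.z2 / 2 + N.s1 * N.z1 - 3 * N.s2 * N.z0 / 2) * N.h_rel

set_option maxHeartbeats 1000000 in
include hT in
theorem D0_Y2 : N.D0 N.Y2 = N.S1 + 2 * N.a0 * N.Y2 - N.s2 * (1 - 2 * N.μ * N.z) * N.Z1 := by
  rw [Y2]
  simp only [map_sub, map_add, map_neg, map_zero, Derivation.leibniz, Derivation.leibniz_pow,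
    der_ofNat, der_half, Derivation.map_one_eq_zero, smul_eq_mul, nsmul_eq_mul, N.comm01,
    N.comm02, N.D0_μ, N.D0_a0, N.D0_a1, N.D0_a2, N.D0_b0, N.D0_b1, N.D0_b2, N.D0_z, N.D0_z0,
        N.D0_z1,
    N.D0_z2, N.D0_s, N.D0_s1, N.D0_s2, N.D0_s3, N.D0_s4, N.D1_μ, N.D2_μ, ht, N.der_h _ N.D0_μ]
  simp only [map_sub, map_add, map_neg, map_zero, Derivation.leibniz, Derivation.leibniz_pow,
    der_ofNat, der_half, Derivation.map_one_eq_zero, smul_eq_mul, nsmul_eq_mul, N.D1_μ, N.D2_μ,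
    N.D0_s1, N.D0_s2, N.D0_s3, N.D0_s4, N.D2_D1 t hT,
    N.D2_a0 ht hR, N.D2_a1 ht, N.D2_a2 ht, N.D1_z, N.D2_z, N.D1_z0, N.D1_z1, N.D1_z2, N.D2_z0 ht,
    N.D2_z1 ht, N.D2_z2, N.D1_s, N.D2_s, N.D2_s0, N.D2_s1 ht, N.D2_s2 ht, N.D2_s3 ht, ht,
    N.der_h _ N.D1_μ, N.der_h _ N.D2_μ]
  linear_combination N.μ * N.z *
    (N.s1 * N.z2 - N.s3 * N.z0) * N.h_rel

set_option maxHeartbeats 1000000 in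
include hT in
theorem D0_X0 : N.D0 N.X0 = 4 * N.a1 * N.Y0 - N.s0 * (1 - 2 * N.μ * N.z) * N.Z2 := by
  rw [X0]
  simp only [map_sub, map_add, map_neg, map_zero, Derivation.leibniz, Derivation.leibniz_pow,
    der_ofNat, der_half, Derivation.map_one_eq_zero, smul_eq_mul, nsmul_eq_mul, N.comm01,
    N.comm02, N.D0_μ, N.D0_a0, N.D0_a1, N.D0_a2, N.D0_b0, N.D0_b1, N.D0_b2, N.D0_z, N.D0_z0,
        N.D0_z1,
    N.D0_z2, N.D0_s, N.D0_s1, N.D0_s2, N.D0_s3, N.D0_s4, N.D1_μ, N.D2_μ, ht, N.der_h _ N.D0_μ]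
  simp only [map_sub, map_add, map_neg, map_zero, Derivation.leibniz, Derivation.leibniz_pow,
    der_ofNat, der_half, Derivation.map_one_eq_zero, smul_eq_mul, nsmul_eq_mul, N.D1_μ, N.D2_μ,
    N.D0_s1, N.D0_s2, N.D0_s3, N.D0_s4, N.D2_D1 t hT,
    N.D2_a0 ht hR, N.D2_a1 ht, N.D2_a2 ht, N.D1_z, N.D2_z, N.D1_z0, N.D1_z1, N.D1_z2, N.D2_z0 ht,
    N.D2_z1 ht, N.D2_z2, N.D1_s, N.D2_s, N.D2_s0, N.D2_s1 ht, N.D2_s2 ht, N.D2_s3 ht, ht,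
    N.der_h _ N.D1_μ, N.der_h _ N.D2_μ]
  linear_combination N.μ * N.z *
    (N.s0 * N.z2 + 2 * N.s1 * N.z1 - 3 * N.s2 * N.z0) * N.h_rel

set_option maxHeartbeats 1000000 in
include hT in
theorem D0_X1 : N.D0 N.X1 = 4 * N.a1 * N.Y1 - N.s1 * (1 - 2 * N.μ * N.z) * N.Z2
    - N.z * (1 - N.μ * N.z) * N.H1 := by
  rw [X1]
  simp only [map_sub, map_add, map_neg, map_zero, Derivation.leibniz, Derivation.leibniz_pow,
    der_ofNat, der_half, Derivation.map_one_eq_zero, smul_eq_mul, nsmul_eq_mul, N.comm01,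
    N.comm02, N.D0_μ, N.D0_a0, N.D0_a1, N.D0_a2, N.D0_b0, N.D0_b1, N.D0_b2, N.D0_z, N.D0_z0,
        N.D0_z1,
    N.D0_z2, N.D0_s, N.D0_s1, N.D0_s2, N.D0_s3, N.D0_s4, N.D1_μ, N.D2_μ, ht, N.der_h _ N.D0_μ]
  simp only [map_sub, map_add, map_neg, map_zero, Derivation.leibniz, Derivation.leibniz_pow,
    der_ofNat, der_half, Derivation.map_one_eq_zero, smul_eq_mul, nsmul_eq_mul, N.D1_μ, N.D2_μ,
    N.D0_s1, N.D0_s2, N.D0_s3, N.D0_s4, N.D2_D1 t hT,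
    N.D2_a0 ht hR, N.D2_a1 ht, N.D2_a2 ht, N.D1_z, N.D2_z, N.D1_z0, N.D1_z1, N.D1_z2, N.D2_z0 ht,
    N.D2_z1 ht, N.D2_z2, N.D1_s, N.D2_s, N.D2_s0, N.D2_s1 ht, N.D2_s2 ht, N.D2_s3 ht, ht,
    N.der_h _ N.D1_μ, N.der_h _ N.D2_μ]
  linear_combination N.μ * N.z *
    (2 * N.s1 * N.z2 - 2 * N.s3 * N.z0) * N.h_rel

set_option maxHeartbeats 1000000 in
include hT in
theorem D0_X2 : N.D0 N.X2 = N.S2 + 4 * N.a1 * N.Y2 - N.s2 * (1 - 2 * N.μ * N.z) * N.Z2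
    - N.z * (1 - N.μ * N.z) * N.H2 := by
  rw [X2]
  simp only [map_sub, map_add, map_neg, map_zero, Derivation.leibniz, Derivation.leibniz_pow,
    der_ofNat, der_half, Derivation.map_one_eq_zero, smul_eq_mul, nsmul_eq_mul, N.comm01,
    N.comm02, N.D0_μ, N.D0_a0, N.D0_a1, N.D0_a2, N.D0_b0, N.D0_b1, N.D0_b2, N.D0_z, N.D0_z0,
        N.D0_z1,
    N.D0_z2, N.D0_s, N.D0_s1, N.D0_s2, N.D0_s3, N.D0_s4, N.D1_μ, N.D2_μ, ht, N.der_h _ N.D0_μ]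
  simp only [map_sub, map_add, map_neg, map_zero, Derivation.leibniz, Derivation.leibniz_pow,
    der_ofNat, der_half, Derivation.map_one_eq_zero, smul_eq_mul, nsmul_eq_mul, N.D1_μ, N.D2_μ,
    N.D0_s1, N.D0_s2, N.D0_s3, N.D0_s4, N.D2_D1 t hT,
    N.D2_a0 ht hR, N.D2_a1 ht, N.D2_a2 ht, N.D1_z, N.D2_z, N.D1_z0, N.D1_z1, N.D1_z2, N.D2_z0 ht,
    N.D2_z1 ht, N.D2_z2, N.D1_s, N.D2_s, N.D2_s0, N.D2_s1 ht, N.D2_s2 ht, N.D2_s3 ht, ht,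
    N.der_h _ N.D1_μ, N.der_h _ N.D2_μ]
  linear_combination N.μ * N.z *
    (3 * N.s2 * N.z2 - 2 * N.s3 * N.z1 - N.s4 * N.z0) * N.h_rel

set_option maxHeartbeats 1000000 in
include hT in
theorem D0_S1 : N.D0 N.S1 = 2 * N.a0 * N.S1
    - (1 - N.μ * N.z) * (N.s2 * N.Y0 - 2 * N.s1 * N.Y1 + N.s0 * N.Y2)
    + N.μ * (N.s0 * N.z2 - 2 * N.s1 * N.z1 + N.s2 * N.z0) * N.Z1 := by
  rw [S1]
  simp only [map_sub, map_add, map_neg, map_zero, Derivation.leibniz, Derivation.leibniz_pow,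
    der_ofNat, der_half, Derivation.map_one_eq_zero, smul_eq_mul, nsmul_eq_mul, N.comm01,
    N.comm02, N.D0_μ, N.D0_a0, N.D0_a1, N.D0_a2, N.D0_b0, N.D0_b1, N.D0_b2, N.D0_z, N.D0_z0,
        N.D0_z1,
    N.D0_z2, N.D0_s, N.D0_s1, N.D0_s2, N.D0_s3, N.D0_s4, N.D1_μ, N.D2_μ, ht, N.der_h _ N.D0_μ]
  simp only [map_sub, map_add, map_neg, map_zero, Derivation.leibniz, Derivation.leibniz_pow,
    der_ofNat, der_half, Derivation.map_one_eq_zero, smul_eq_mul, nsmul_eq_mul, N.D1_μ, N.D2_μ,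
    N.D0_s1, N.D0_s2, N.D0_s3, N.D0_s4, N.D2_D1 t hT,
    N.D2_a0 ht hR, N.D2_a1 ht, N.D2_a2 ht, N.D1_z, N.D2_z, N.D1_z0, N.D1_z1, N.D1_z2, N.D2_z0 ht,
    N.D2_z1 ht, N.D2_z2, N.D1_s, N.D2_s, N.D2_s0, N.D2_s1 ht, N.D2_s2 ht, N.D2_s3 ht, ht,
    N.der_h _ N.D1_μ, N.der_h _ N.D2_μ]
  linear_combination N.μ *
    (N.s0 * N.z1 * N.z2 - N.s1 * N.z0 * N.z2 - 2 * N.s1 * N.z1 ^ 2 + 3 * N.s2 * N.z0 * N.z1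
    - N.s3 * N.z0 ^ 2) * N.h_rel

set_option maxHeartbeats 1000000 in
include hT in
theorem D0_S2 : N.D0 N.S2 = 4 * N.a1 * N.S1 + (1 - N.μ * N.z) * (2 * N.z1 * N.H1 - N.z0 * N.H2
    - N.s2 * N.X0 + 2 * N.s1 * N.X1 - N.s0 * N.X2)
    + N.μ * (N.s0 * N.z2 - 2 * N.s1 * N.z1 + N.s2 * N.z0) * N.Z2 := by
  rw [S2]
  simp only [map_sub, map_add, map_neg, map_zero, Derivation.leibniz, Derivation.leibniz_pow,
    der_ofNat, der_half, Derivation.map_one_eq_zero, smul_eq_mul, nsmul_eq_mul, N.comm01,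
    N.comm02, N.D0_μ, N.D0_a0, N.D0_a1, N.D0_a2, N.D0_b0, N.D0_b1, N.D0_b2, N.D0_z, N.D0_z0,
        N.D0_z1,
    N.D0_z2, N.D0_s, N.D0_s1, N.D0_s2, N.D0_s3, N.D0_s4, N.D1_μ, N.D2_μ, ht, N.der_h _ N.D0_μ]
  simp only [map_sub, map_add, map_neg, map_zero, Derivation.leibniz, Derivation.leibniz_pow,
    der_ofNat, der_half, Derivation.map_one_eq_zero, smul_eq_mul, nsmul_eq_mul, N.D1_μ, N.D2_μ,
    N.D0_s1, N.D0_s2, N.D0_s3, N.D0_s4, N.D2_D1 t hT,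
    N.D2_a0 ht hR, N.D2_a1 ht, N.D2_a2 ht, N.D1_z, N.D2_z, N.D1_z0, N.D1_z1, N.D1_z2, N.D2_z0 ht,
    N.D2_z1 ht, N.D2_z2, N.D1_s, N.D2_s, N.D2_s0, N.D2_s1 ht, N.D2_s2 ht, N.D2_s3 ht, ht,
    N.der_h _ N.D1_μ, N.der_h _ N.D2_μ]
  linear_combination N.μ *
    (N.s0 * N.z2 ^ 2 - 2 * N.s1 * N.z1 * N.z2 + 2 * N.s3 * N.z0 * N.z1 - N.s4 * N.z0 ^ 2) * N.h_rel

set_option maxHeartbeats 1000000 in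
include hT in
theorem D0_H1 : N.D0 N.H1 = 4 * N.a0 * N.H1 + 4 * N.s0 * N.R1 + t * N.D0 N.s0
    + N.h * N.μ * (2 * N.z0 * N.H1 + 2 * N.s1 * N.X0 - 2 * N.s0 * N.X1 - 3 * N.s2 * N.Y0
      + 2 * N.s1 * N.Y1 + N.s0 * N.Y2)
    + (N.h * N.μ) ^ 2 * ((N.s0 * N.z2 + 2 * N.s1 * N.z1 - 3 * N.s2 * N.z0) * N.Z1
      - 2 * (N.s0 * N.z1 - N.s1 * N.z0) * N.Z2) := by
  rw [H1]
  simp only [map_sub, map_add, map_neg, map_zero, Derivation.leibniz, Derivation.leibniz_pow,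
    der_ofNat, der_half, Derivation.map_one_eq_zero, smul_eq_mul, nsmul_eq_mul, N.comm01,
    N.comm02, N.D0_μ, N.D0_a0, N.D0_a1, N.D0_a2, N.D0_b0, N.D0_b1, N.D0_b2, N.D0_z, N.D0_z0,
        N.D0_z1,
    N.D0_z2, N.D0_s, N.D0_s1, N.D0_s2, N.D0_s3, N.D0_s4, N.D1_μ, N.D2_μ, ht, N.der_h _ N.D0_μ]
  simp only [map_sub, map_add, map_neg, map_zero, Derivation.leibniz, Derivation.leibniz_pow,
    der_ofNat, der_half, Derivation.map_one_eq_zero, smul_eq_mul, nsmul_eq_mul, N.D1_μ, N.D2_μ,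
    N.D0_s1, N.D0_s2, N.D0_s3, N.D0_s4, N.D2_D1 t hT,
    N.D2_a0 ht hR, N.D2_a1 ht, N.D2_a2 ht, N.D1_z, N.D2_z, N.D1_z0, N.D1_z1, N.D1_z2, N.D2_z0 ht,
    N.D2_z1 ht, N.D2_z2, N.D1_s, N.D2_s, N.D2_s0, N.D2_s1 ht, N.D2_s2 ht, N.D2_s3 ht, ht,
    N.der_h _ N.D1_μ, N.der_h _ N.D2_μ]
  ring

set_option maxHeartbeats 1000000 in
include hT in
theorem D0_H2 : N.D0 N.H2 = N.D1 N.H1 - 2 * N.a1 * N.H1 + 3 * N.a0 * N.H2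
    + 2 * N.s1 * N.R1 + N.s0 * N.R2
    + t * (N.D0 N.s1)
    + N.h * N.μ * (3 * N.z0 * N.H2 / 2 - N.z1 * N.H1 + 3 * N.s2 * N.X0 / 2 - N.s1 * N.X1
      - N.s0 * N.X2 / 2 - 2 * N.s3 * N.Y0 + 2 * N.s1 * N.Y2)
    + (N.h * N.μ) ^ 2 * (2 * (N.s1 * N.z2 - N.s3 * N.z0) * N.Z1
      - (N.s0 * N.z2 / 2 + N.s1 * N.z1 - 3 * N.s2 * N.z0 / 2) * N.Z2) := by
  rw [H2]
  simp only [map_sub, map_add, map_neg, map_zero, Derivation.leibniz, Derivation.leibniz_pow,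
    der_ofNat, der_half, Derivation.map_one_eq_zero, smul_eq_mul, nsmul_eq_mul, N.comm01,
    N.comm02, N.D0_μ, N.D0_a0, N.D0_a1, N.D0_a2, N.D0_b0, N.D0_b1, N.D0_b2, N.D0_z, N.D0_z0,
        N.D0_z1,
    N.D0_z2, N.D0_s, N.D0_s1, N.D0_s2, N.D0_s3, N.D0_s4, N.D1_μ, N.D2_μ, ht, N.der_h _ N.D0_μ]
  simp only [map_sub, map_add, map_neg, map_zero, Derivation.leibniz, Derivation.leibniz_pow,
    der_ofNat, der_half, Derivation.map_one_eq_zero, smul_eq_mul, nsmul_eq_mul, N.D1_μ, N.D2_μ,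
    N.D0_s1, N.D0_s2, N.D0_s3, N.D0_s4, N.D2_D1 t hT,
    N.D2_a0 ht hR, N.D2_a1 ht, N.D2_a2 ht, N.D1_z, N.D2_z, N.D1_z0, N.D1_z1, N.D1_z2, N.D2_z0 ht,
    N.D2_z1 ht, N.D2_z2, N.D1_s, N.D2_s, N.D2_s0, N.D2_s1 ht, N.D2_s2 ht, N.D2_s3 ht, ht,
    N.der_h _ N.D1_μ, N.der_h _ N.D2_μ]
  ring

set_option maxHeartbeats 1000000 in
include hT in
theorem D0_H3 : N.D0 N.H3 = N.D1 N.H2 - 2 * N.a2 * N.H1 + 2 * N.a0 * N.H3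
    + 2 * N.s1 * N.R2 + t * (N.D0 N.s2)
    + N.h * N.μ * (N.z0 * N.H3 - N.z2 * N.H1 + N.s3 * N.X0 - N.s1 * N.X2 - N.s4 * N.Y0
      - 2 * N.s3 * N.Y1 + 3 * N.s2 * N.Y2)
    + (N.h * N.μ) ^ 2 * ((3 * N.s2 * N.z2 - 2 * N.s3 * N.z1 - N.s4 * N.z0) * N.Z1
      - (N.s1 * N.z2 - N.s3 * N.z0) * N.Z2) := by
  rw [H3]
  simp only [map_sub, map_add, map_neg, map_zero, Derivation.leibniz, Derivation.leibniz_pow,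
    der_ofNat, der_half, Derivation.map_one_eq_zero, smul_eq_mul, nsmul_eq_mul, N.comm01,
    N.comm02, N.D0_μ, N.D0_a0, N.D0_a1, N.D0_a2, N.D0_b0, N.D0_b1, N.D0_b2, N.D0_z, N.D0_z0,
        N.D0_z1,
    N.D0_z2, N.D0_s, N.D0_s1, N.D0_s2, N.D0_s3, N.D0_s4, N.D1_μ, N.D2_μ, ht, N.der_h _ N.D0_μ]
  simp only [map_sub, map_add, map_neg, map_zero, Derivation.leibniz, Derivation.leibniz_pow,
    der_ofNat, der_half, Derivation.map_one_eq_zero, smul_eq_mul, nsmul_eq_mul, N.D1_μ, N.D2_μ,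
    N.D0_s1, N.D0_s2, N.D0_s3, N.D0_s4, N.D2_D1 t hT,
    N.D2_a0 ht hR, N.D2_a1 ht, N.D2_a2 ht, N.D1_z, N.D2_z, N.D1_z0, N.D1_z1, N.D1_z2, N.D2_z0 ht,
    N.D2_z1 ht, N.D2_z2, N.D1_s, N.D2_s, N.D2_s0, N.D2_s1 ht, N.D2_s2 ht, N.D2_s3 ht, ht,
    N.der_h _ N.D1_μ, N.der_h _ N.D2_μ]
  ring

end NullFrame

open FieldIndex MvPowerSeries

/-! ### Derivations of the field of fractions and orders in `u` -/

section Extension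
variable {S L : Type*} [CommRing S] [IsDomain S] [Field L] [Algebra S L] [IsFractionRing S L]

/-- `f ↦ f + ε D f`, a ring homomorphism into the dual numbers over the field of fractions. -/
def dualHom (L : Type*) [Field L] [Algebra S L] (D : S →+ S)
    (hD : ∀ f g, D (f * g) = f * D g + g * D f) : S →+* TrivSqZeroExt L L where
  toFun f := TrivSqZeroExt.inl (algebraMap S L f) + TrivSqZeroExt.inr (algebraMap S L (D f))
  map_one' := by
    have h : D 1 = 0 := by simpa using hD 1 1
    ext <;> simp [h]
  map_mul' f g := by
    ext
    · simp
    · simp [hD, -DualNumber.inr_eq_smul_eps, mul_comm]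
  map_zero' := by ext <;> simp
  map_add' f g := by
    ext
    · simp
    · simp [-DualNumber.inr_eq_smul_eps]

theorem isUnit_dualHom (D : S →+ S) (hD : ∀ f g, D (f * g) = f * D g + g * D f)
    (y : nonZeroDivisors S) : IsUnit (dualHom L D hD y) := by
  rw [TrivSqZeroExt.isUnit_iff_isUnit_fst]
  simp [dualHom]

/-- The extension of a derivation of a domain to the field of fractions. -/
def extendDer (L : Type*) [Field L] [Algebra S L] [IsFractionRing S L] (D : S →+ S)
    (hD : ∀ f g, D (f * g) = f * D g + g * D f) : Derivation ℤ L L :=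
  let g : L →+* TrivSqZeroExt L L :=
    IsLocalization.lift (M := nonZeroDivisors S) (g := dualHom L D hD) (isUnit_dualHom D hD)
  have hg : ∀ f, (g f).fst = f := by
    have : ((TrivSqZeroExt.fstHom L L L : TrivSqZeroExt L L →+* L)).comp g = RingHom.id L := by
      apply IsLocalization.ringHom_ext (nonZeroDivisors S)
      ext f
      simp [g, dualHom]
    intro f
    exact congrArg (fun h : L →+* L => h f) this
  Derivation.mk' (((TrivSqZeroExt.sndHom L L).toAddMonoidHom.comp g.toAddMonoidHom).toIntLinearMap)
    (fun a b => by simp [hg, mul_comm])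

theorem extendDer_algebraMap (D : S →+ S) (hD : ∀ f g, D (f * g) = f * D g + g * D f) (f : S) :
    extendDer L D hD (algebraMap S L f) = algebraMap S L (D f) := by
  simp [extendDer, dualHom, -DualNumber.inr_eq_smul_eps]

/-- A derivation of the field of fractions is determined by its values on the ring. -/
theorem derivation_ext_fractionRing {D D' : Derivation ℤ L L}
    (h : ∀ f : S, D (algebraMap S L f) = D' (algebraMap S L f)) : D = D' := by
  ext x
  obtain ⟨a, b, hb, rfl⟩ := IsFractionRing.div_surjective (A := S) x
  have hb' : algebraMap S L b ≠ 0 := by simpa using nonZeroDivisors.ne_zero hb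
  have key : ∀ E : Derivation ℤ L L, algebraMap S L b * E (algebraMap S L a / algebraMap S L b) =
      E (algebraMap S L a) - algebraMap S L a / algebraMap S L b * E (algebraMap S L b) := by
    intro E
    have : E (algebraMap S L b * (algebraMap S L a / algebraMap S L b)) = E (algebraMap S L a) := by
      rw [mul_div_cancel₀ _ hb']
    rw [E.leibniz, smul_eq_mul, smul_eq_mul] at this
    linear_combination this
  apply mul_left_cancel₀ hb'
  rw [key, key, h, h]

theorem extendDer_comm {D D' : S →+ S} (hD : ∀ f g, D (f * g) = f * D g + g * D f)
    (hD' : ∀ f g, D' (f * g) = f * D' g + g * D' f) (h : ∀ f, D (D' f) = D' (D f)) (x : L) :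
    extendDer L D hD (extendDer L D' hD' x) = extendDer L D' hD' (extendDer L D hD x) := by
  have : ⁅extendDer L D hD, extendDer L D' hD'⁆ = 0 := by
    apply derivation_ext_fractionRing (S := S)
    intro f
    simp [Derivation.commutator_apply, extendDer_algebraMap, h]
  have := congrArg (fun E : Derivation ℤ L L => E x) this
  simpa [Derivation.commutator_apply, sub_eq_zero] using this

end Extension

instance : IsDomain Series := NoZeroDivisors.to_isDomain _

theorem pderiv_comm (i j : Fin 3) (f : Series) :
    pderiv ℂ i (pderiv ℂ j f) = pderiv ℂ j (pderiv ℂ i f) := by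
  by_cases hij : i = j
  · rw [hij]
  ext d
  simp only [coeff_pderiv, Finsupp.add_apply, Finsupp.single_apply, hij, Ne.symm hij, if_false]
  rw [add_right_comm]
  push_cast
  ring

theorem pderiv_mul (b : Fin 3) (f g : Series) :
    pderiv ℂ b (f * g) = f * pderiv ℂ b g + g * pderiv ℂ b f := by
  simp [Derivation.leibniz]

section
variable (L : Type*) [Field L] [Algebra Series L] [IsFractionRing Series L]

/-- The partial derivatives on the field of fractions. -/
def fracDer (b : Fin 3) : Derivation ℤ L L :=
  extendDer (S := Series) L (pderiv ℂ b : Series →+ Series) (pderiv_mul b)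

theorem fracDer_algebraMap (b : Fin 3) (f : Series) :
    fracDer L b (algebraMap Series L f) = algebraMap Series L (pderiv ℂ b f) :=
  extendDer_algebraMap (S := Series) _ _ f

theorem fracDer_comm (b c : Fin 3) (x : L) :
    fracDer L b (fracDer L c x) = fracDer L c (fracDer L b x) :=
  extendDer_comm (S := Series) _ _ (pderiv_comm b c) x
end

/-- The jet of a family of formal power series, in the ring of power series. -/
def seriesJet (X : FormalFields) : Jet Series where
  u := MvPowerSeries.X 0
  val := X
  der b i := pderiv ℂ b (X i)

theorem formalJet_eq (X : FormalFields) :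
    formalJet X = (seriesJet X).map (algebraMap Series (FractionRing Series)) := rfl

theorem coeff_single_add_X_mul (b : Fin 3) (d : Fin 3 →₀ ℕ) (f : Series) :
    coeff (Finsupp.single b 1 + d) (MvPowerSeries.X b * f) = coeff d f := by
  rw [MvPowerSeries.X, coeff_add_monomial_mul, one_mul]

theorem eq_single_add {b : Fin 3} {d : Fin 3 →₀ ℕ} (h : d b ≠ 0) :
    d = Finsupp.single b 1 + (d - Finsupp.single b 1) := by
  rw [add_tsub_cancel_of_le]
  exact Finsupp.single_le_iff.2 (Nat.one_le_iff_ne_zero.2 h)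

theorem coeff_u_mul_of_eq_zero {d : Fin 3 →₀ ℕ} (h : d 0 = 0) (f : Series) :
    coeff d (MvPowerSeries.X 0 * f) = 0 := by
  classical
  rw [coeff_mul]
  refine Finset.sum_eq_zero fun x hx => ?_
  have : x.1 0 + x.2 0 = d 0 := by
    rw [← Finsupp.add_apply, Finset.HasAntidiagonal.mem_antidiagonal.1 hx]
  rw [coeff_X, if_neg, zero_mul]
  intro e
  rw [e] at this
  simp at this
  omega

/-- The operator `u ∂_u` multiplies the coefficient of `u^m v^n w^p` by `m`. -/
theorem coeff_u_mul_pderiv (d : Fin 3 →₀ ℕ) (f : Series) :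
    coeff d (MvPowerSeries.X 0 * pderiv ℂ 0 f) = d 0 * coeff d f := by
  by_cases h : d 0 = 0
  · rw [coeff_u_mul_of_eq_zero h, h, Nat.cast_zero, zero_mul]
  · obtain ⟨e, he⟩ : ∃ e, d = Finsupp.single 0 1 + e := ⟨_, eq_single_add h⟩
    rw [he, coeff_single_add_X_mul, coeff_pderiv, add_comm e]
    simp
    ring

/-- The coefficients of `f` with fewer than `q` powers of `u` vanish. -/
def UOrd (q : ℕ) (f : Series) : Prop := ∀ d : Fin 3 →₀ ℕ, d 0 < q → coeff d f = 0

theorem vanishesOnU_iff {f : Series} : VanishesOnU f ↔ UOrd 1 f :=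
  forall_congr' fun d => by rw [Nat.lt_one_iff]

namespace UOrd
variable {p q : ℕ} {f g : Series}

theorem zero (f : Series) : UOrd 0 f := fun _ h => absurd h (Nat.not_lt_zero _)
theorem mono (h : UOrd q f) (hpq : p ≤ q) : UOrd p f := fun d hd => h d (hd.trans_le hpq)
theorem add (hf : UOrd q f) (hg : UOrd q g) : UOrd q (f + g) := fun d hd => by
  rw [map_add, hf d hd, hg d hd, add_zero]
theorem neg (hf : UOrd q f) : UOrd q (-f) := fun d hd => by
  rw [map_neg, hf d hd, neg_zero]
theorem sub (hf : UOrd q f) (hg : UOrd q g) : UOrd q (f - g) := by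
  rw [sub_eq_add_neg]; exact hf.add hg.neg
theorem mul (hf : UOrd p f) (hg : UOrd q g) : UOrd (p + q) (f * g) := fun d hd => by
  classical
  rw [coeff_mul]
  refine Finset.sum_eq_zero fun x hx => ?_
  have : x.1 0 + x.2 0 = d 0 := by
    rw [← Finsupp.add_apply, Finset.HasAntidiagonal.mem_antidiagonal.1 hx]
  rcases lt_or_ge (x.1 0) p with h | h
  · rw [hf _ h, zero_mul]
  · rw [hg _ (by omega), mul_zero]
theorem mul_left (a : Series) (hf : UOrd q f) : UOrd q (a * f) := by
  simpa using (UOrd.zero a).mul hf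
theorem X_one : UOrd 1 (X 0 : Series) := fun d hd => by
  classical
  rw [coeff_X, if_neg]
  rintro rfl
  simp at hd
theorem u_mul (hf : UOrd q f) : UOrd (q + 1) (X 0 * f) := by
  rw [add_comm]; exact X_one.mul hf
theorem eq_zero (h : ∀ q, UOrd q f) : f = 0 := by
  ext d; exact h (d 0 + 1) d (Nat.lt_succ_self _)
theorem pderiv_of_ne {b : Fin 3} (hb : b ≠ 0) (hf : UOrd q f) : UOrd q (pderiv ℂ b f) :=
  fun d hd => by
    rw [coeff_pderiv, hf, zero_mul]
    simpa [Finsupp.single_apply, hb] using hd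
theorem u_mul_pderiv (hf : UOrd q f) : UOrd q (X 0 * pderiv ℂ 0 f) := fun d hd => by
  rw [coeff_u_mul_pderiv, hf d hd, mul_zero]

/-- The step in the uniqueness argument for a Fuchsian equation `2 u ∂_u f + n f = g`. -/
theorem fuchs_step {n : ℤ} (h : 2 * X 0 * pderiv ℂ 0 f + (n : Series) * f = g)
    (hg : UOrd (q + 1) g) (hf : UOrd q f) (hn : 2 * (q : ℤ) + n ≠ 0) : UOrd (q + 1) f := by
  intro d hd
  rcases Nat.lt_succ_iff_lt_or_eq.1 hd with h' | h'
  · exact hf d h'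
  have e := hg d hd
  have hC : ((n : Series)) = C (n : ℂ) := (map_intCast (C : ℂ →+* Series) n).symm
  have h2 : (2 : Series) = C (2 : ℂ) := (map_ofNat (C : ℂ →+* Series) 2).symm
  rw [← h, map_add, mul_assoc, hC, h2, coeff_C_mul, coeff_C_mul, coeff_u_mul_pderiv, h'] at e
  have hn' : (2 * (q : ℂ) + n) ≠ 0 := by exact_mod_cast hn
  apply mul_left_cancel₀ hn'
  linear_combination e

end UOrd

/-! ### The null frame of a formal solution -/

section
variable (L : Type*) [Field L] [Algebra Series L] [IsFractionRing Series L]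

/-- A formal solution of the reduced system defines a `NullFrame` on the field of fractions. -/
theorem exists_nullFrame {X : FormalFields} {μ : ℂ} {η : Series}
    (hη : η * (1 - C μ * X zeta) = 1)
    (hred : ∀ x ∈ reducedList (C μ) (seriesJet X), x = 0) :
    ∃ N : NullFrame L, (∀ f, N.D0 f = fracDer L 0 f) ∧
      (∀ f, N.D1 f = algebraMap Series L (X (frame01 0)) * fracDer L 0 f +
        (1 / (2 * algebraMap Series L (MvPowerSeries.X 0)) + algebraMap Series L (X (frame01 1))) *
          fracDer L 1 f) ∧
      (∀ f, N.D2 f = fracDer L 2 f + algebraMap Series L (X (frame11 0)) * fracDer L 0 f +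
        algebraMap Series L (X (frame11 1)) * fracDer L 1 f) ∧
      N.a0 = algebraMap Series L (X (conn01 0)) - 1 / (2 * algebraMap Series L (MvPowerSeries.X 0))
          ∧
      N.a1 = algebraMap Series L (X (conn01 1)) ∧ N.a2 = algebraMap Series L (X (conn01 2)) ∧
      N.b0 = algebraMap Series L (X (conn11 0)) ∧ N.b1 = algebraMap Series L (X (conn11 1)) ∧
      N.b2 = algebraMap Series L (X (conn11 2)) ∧ N.z = algebraMap Series L (X zeta) ∧
      N.z0 = algebraMap Series L (X (dzeta 0)) ∧ N.z1 = algebraMap Series L (X (dzeta 1)) ∧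
      N.z2 = algebraMap Series L (X (dzeta 2)) ∧ N.s = algebraMap Series L (X scal) ∧
      N.s0 = algebraMap Series L (X (ricci 0)) ∧ N.s1 = algebraMap Series L (X (ricci 1)) ∧
      N.s2 = algebraMap Series L (X (ricci 2)) ∧ N.s3 = algebraMap Series L (X (ricci 3)) ∧
      N.s4 = algebraMap Series L (X (ricci 4)) ∧ N.μ = algebraMap Series L (C μ) ∧
      N.h = algebraMap Series L η := by
  have hS : CharZero Series := charZero_of_injective_ringHom (f := (C : ℂ →+* Series)) C_injective
  have : CharZero L := charZero_of_injective_algebraMap (IsFractionRing.injective Series L)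
  have hred' : ∀ x ∈ reducedList (algebraMap Series L (C μ))
      ((seriesJet X).map (algebraMap Series L)),
      x = 0 := by
    rw [← map_reducedList]
    intro x hx
    obtain ⟨y, hy, rfl⟩ := List.mem_map.1 hx
    rw [hred y hy, map_zero]
  have hη' := congrArg (algebraMap Series L) hη
  have hu : algebraMap Series L (MvPowerSeries.X 0) ≠ 0 := by
    rw [Ne, IsFractionRing.to_map_eq_zero_iff]
    intro h
    have := coeff_index_single_self_X (R := ℂ) (0 : Fin 3)
    rw [h] at this
    simp at this
  have hdu : fracDer L 0 (algebraMap Series L (MvPowerSeries.X 0)) = 1 := by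
    rw [fracDer_algebraMap, pderiv_X_self, map_one]
  have hdC : ∀ b, fracDer L b (algebraMap Series L (C μ)) = 0 := fun b => by
    rw [fracDer_algebraMap, pderiv_C, map_zero]
  have hdi : fracDer L 0 (1 / (2 * algebraMap Series L (MvPowerSeries.X 0))) =
      -1 / (2 * algebraMap Series L (MvPowerSeries.X 0) ^ 2) := by
    have e : 1 / (2 * algebraMap Series L (MvPowerSeries.X 0)) =
      ((algebraMap Series L (MvPowerSeries.X 0))⁻¹) / 2 := by field_simp
    rw [e, NullFrame.der_half, Derivation.leibniz_inv, hdu]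
    simp
    field_simp
  simp only [map_mul, map_sub, map_one] at hη'
  simp only [reducedList, List.forall_mem_cons, List.not_mem_nil, false_imp_iff, implies_true,
    and_true, Jet.map, seriesJet, Jet.dir01, Jet.dir11, Jet.grad, ← fracDer_algebraMap] at hred'
  have hη0 : algebraMap Series L η ≠ 0 := left_ne_zero_of_mul_eq_one hη'
  have hω : 1 - algebraMap Series L (C μ) * algebraMap Series L (X zeta) ≠ 0 :=
    right_ne_zero_of_mul_eq_one hη'
  have hinv : algebraMap Series L η =
      (1 - algebraMap Series L (C μ) * algebraMap Series L (X zeta))⁻¹ :=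
    eq_inv_of_mul_eq_one_left hη'
  generalize algebraMap Series L (MvPowerSeries.X 0) = u at *
  generalize algebraMap Series L (C μ) = m at *
  generalize algebraMap Series L (X zeta) = z at *
  generalize algebraMap Series L η = h at *
  generalize algebraMap Series L (X (frame01 0)) = E0 at *
  generalize algebraMap Series L (X (frame01 1)) = E1 at *
  generalize algebraMap Series L (X (frame11 0)) = F0 at *
  generalize algebraMap Series L (X (frame11 1)) = F1 at *
  generalize algebraMap Series L (X (conn01 0)) = p at *
  generalize algebraMap Series L (X (conn01 1)) = a1 at *
  generalize algebraMap Series L (X (conn01 2)) = a2 at *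
  generalize algebraMap Series L (X (conn11 0)) = b0 at *
  generalize algebraMap Series L (X (conn11 1)) = b1 at *
  generalize algebraMap Series L (X (conn11 2)) = b2 at *
  generalize algebraMap Series L (X (dzeta 0)) = z0 at *
  generalize algebraMap Series L (X (dzeta 1)) = z1 at *
  generalize algebraMap Series L (X (dzeta 2)) = z2 at *
  generalize algebraMap Series L (X scal) = s at *
  generalize algebraMap Series L (X (ricci 0)) = s0 at *
  generalize algebraMap Series L (X (ricci 1)) = s1 at *
  generalize algebraMap Series L (X (ricci 2)) = s2 at *
  generalize algebraMap Series L (X (ricci 3)) = s3 at *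
  generalize algebraMap Series L (X (ricci 4)) = s4 at *
  obtain ⟨e1, e2, e3, e4, e5, e6, e7, e8, e9, e10, e11, e12, e13, e14, e15, e16, e17, e18, e19,
    e20⟩ := hred'
  have d1 : fracDer L 0 E0 = 2 * (p - 1 / (2 * u)) * E0 - 2 * a1 := by
    field_simp; linear_combination e1
  have d2 : fracDer L 0 E1 = 2 * (p - 1 / (2 * u)) * (1 / (2 * u) + E1) + 1 / (2 * u ^ 2) := by
    field_simp; linear_combination (2 * u) * e2
  have d3 : fracDer L 0 F0 = 2 * E0 * b0 - 2 * b1 := by linear_combination e3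
  have d4 : fracDer L 0 F1 = 2 * (1 / (2 * u) + E1) * b0 := by
    field_simp; linear_combination e4
  let D1 : Derivation ℤ L L := E0 • fracDer L 0 + (1 / (2 * u) + E1) • fracDer L 1
  let D2 : Derivation ℤ L L := fracDer L 2 + F0 • fracDer L 0 + F1 • fracDer L 1
  have hD1 : ∀ f, D1 f = E0 * fracDer L 0 f + (1 / (2 * u) + E1) * fracDer L 1 f := fun f => rfl
  have hD2 : ∀ f, D2 f = fracDer L 2 f + F0 * fracDer L 0 f + F1 * fracDer L 1 f := fun f => rfl
  refine ⟨{ D0 := fracDer L 0, D1 := D1, D2 := D2, a0 := p - 1 / (2 * u), a1 := a1, a2 := a2,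
            b0 := b0, b1 := b1, b2 := b2, z := z, z0 := z0, z1 := z1, z2 := z2, s := s, s0 := s0,
            s1 := s1, s2 := s2, s3 := s3, s4 := s4, μ := m, h := h, comm01 := ?_, comm02 := ?_,
            h_mul := hη', D0_μ := hdC 0, D1_μ := by rw [hD1, hdC, hdC]; ring,
            D2_μ := by rw [hD2, hdC, hdC, hdC]; ring,
            D0_a0 := ?_, D0_a1 := ?_, D0_a2 := ?_, D0_b0 := ?_, D0_b1 := ?_, D0_b2 := ?_,
            D0_z := ?_, D0_z0 := ?_, D0_z1 := ?_, D0_z2 := ?_, D0_s := ?_, D0_s1 := ?_,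
            D0_s2 := ?_, D0_s3 := ?_, D0_s4 := ?_, D2_s0 := ?_ },
    fun f => rfl, hD1, hD2, rfl, rfl, rfl, rfl, rfl, rfl, rfl, rfl, rfl, rfl, rfl, rfl, rfl, rfl,
      rfl, rfl, rfl, rfl⟩
  · intro f
    simp only [hD1, map_add, Derivation.leibniz, smul_eq_mul, d1, d2, hdi, fracDer_comm L 1 0]
    field_simp
    ring
  · intro f
    simp only [hD1, hD2, map_add, Derivation.leibniz, smul_eq_mul, d3, d4, fracDer_comm L 1 0,
      fracDer_comm L 2 0]
    ring
  · rw [map_sub, hdi]; field_simp; linear_combination u * e5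
  · field_simp; linear_combination e7
  · field_simp; linear_combination e9
  · field_simp; linear_combination e6
  · linear_combination e8
  · linear_combination e10
  · linear_combination e11
  · linear_combination e12
  · linear_combination e13
  · linear_combination e14
  · linear_combination e15
  · rw [hD1, hinv]; field_simp; linear_combination e16
  · rw [hD1, hinv]; field_simp; linear_combination e17
  · rw [hD1, hinv]; field_simp; linear_combination e18
  · rw [hD1, hinv]; field_simp; linear_combination e19
  · rw [hD1, hD2, hinv]; field_simp; linear_combination e20

end

/-! ### The constraint quantities on `U_0` -/

/-- The conditions on `U_0` from which the constraints propagate. -/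
structure ConeConditions (X : FormalFields) : Prop where
  gauge : ∀ i : FieldIndex, i.IsGauge → UOrd 1 (X i)
  zeta : UOrd 1 (X zeta)
  dzeta1 : UOrd 1 (X (dzeta 1))
  dzeta2 : UOrd 1 (X (dzeta 2))
  dw_dzeta0 : UOrd 1 (pderiv ℂ 2 (X (dzeta 0)) - X scal)
  dw_scal : UOrd 1 (pderiv ℂ 2 (X scal) + X (ricci 4) * X (dzeta 0))
  dv_dzeta0 : UOrd 1 (pderiv ℂ 1 (X (dzeta 0)))
  dv_scal : UOrd 1 (pderiv ℂ 1 (X scal))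
  dv_ricci2 : UOrd 1 (pderiv ℂ 1 (X (ricci 2)) - 2 * X (ricci 3))
  dv_ricci3 : UOrd 1 (pderiv ℂ 1 (X (ricci 3)) - X (ricci 4))
  dv_ricci4 : UOrd 1 (pderiv ℂ 1 (X (ricci 4)))

/-- The ideal of the series which vanish on `U_0` to the order `q`. -/
def uIdeal (q : ℕ) : Ideal Series where
  carrier := {f | UOrd q f}
  add_mem' := UOrd.add
  zero_mem' := fun d _ => by simp
  smul_mem' := fun a _ h => h.mul_left a

theorem mk_uIdeal_eq_zero {q : ℕ} {f : Series} :
    Ideal.Quotient.mk (uIdeal q) f = 0 ↔ UOrd q f :=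
  Ideal.Quotient.eq_zero_iff_mem

/-- The residue classes modulo `u ^ q`, as a ring without further structure: computations in it are
cheaper than those in the quotient. -/
theorem exists_ringHom_eq_zero_iff_uOrd (q : ℕ) : ∃ (A : Type) (_ : CommRing A) (π : Series →+* A),
    ∀ f, π f = 0 ↔ UOrd q f :=
  ⟨_, inferInstance, Ideal.Quotient.mk (uIdeal q), fun _ => mk_uIdeal_eq_zero⟩

section
variable (L : Type*) [Field L] [Algebra Series L] [IsFractionRing Series L]

local notation "ι" => algebraMap Series L

theorem charZero_of_isFractionRing : CharZero L :=
  have : CharZero Series := charZero_of_injective_ringHom (f := (C : ℂ →+* Series)) C_injective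
  charZero_of_injective_algebraMap (IsFractionRing.injective Series L)

theorem algebraMap_u_ne_zero : ι (MvPowerSeries.X 0) ≠ 0 := by
  rw [Ne, IsFractionRing.to_map_eq_zero_iff]
  intro h
  have := coeff_index_single_self_X (R := ℂ) (0 : Fin 3)
  rw [h] at this
  simp at this

/-- The component of the torsion `t_{01}{}^{a}{}_{11}` along `e_{11}` vanishes by the reduced system
alone: `Γ_{1100} - 2 Γ_{0101}` satisfies a Fuchsian equation with positive exponent. -/
theorem conn11_zero_eq {X : FormalFields} {μ : ℂ}
    (hred : ∀ x ∈ reducedList (C μ) (seriesJet X), x = 0) :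
    X (conn11 0) = 2 * X (conn01 1) := by
  simp only [reducedList, List.forall_mem_cons, List.not_mem_nil, false_imp_iff, implies_true,
    and_true, seriesJet] at hred
  obtain ⟨e1, e2, e3, e4, e5, e6, e7, e8⟩ := hred
  have d2 : pderiv ℂ 0 (2 : Series) = 0 := Derivation.map_natCast _ 2
  rw [← sub_eq_zero]
  refine UOrd.eq_zero fun q => ?_
  induction q with
  | zero => exact UOrd.zero _
  | succ q ih =>
    refine UOrd.fuchs_step (n := 2) (g := MvPowerSeries.X 0 *
      (4 * X (conn01 0) * (X (conn11 0) - 2 * X (conn01 1)))) ?_ (ih.mul_left _).u_mul ih (by omega)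
    rw [map_sub, Derivation.leibniz, d2]
    simp only [smul_eq_mul, mul_zero, add_zero]
    push_cast
    linear_combination 2 * e6 - 2 * e7

set_option maxHeartbeats 4000000 in
/-- The frame data of a formal solution of the reduced system, together with the expressions
of the constraint quantities. -/
theorem exists_constraint_quantities {X : FormalFields} {μ : ℂ} {η : Series}
    (hη : η * (1 - C μ * X zeta) = 1)
    (hred : ∀ x ∈ reducedList (C μ) (seriesJet X), x = 0) (hX : ConeConditions X) :
    ∃ N : NullFrame L, (∀ f, N.D0 f = fracDer L 0 f) ∧
      (∀ f, N.D1 f = ι (X (frame01 0)) * fracDer L 0 f +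
        (1 / (2 * ι (MvPowerSeries.X 0)) + ι (X (frame01 1))) * fracDer L 1 f) ∧
      (∀ f, N.D2 f = fracDer L 2 f + ι (X (frame11 0)) * fracDer L 0 f +
        ι (X (frame11 1)) * fracDer L 1 f) ∧
      (N.a0 = ι (X (conn01 0)) - 1 / (2 * ι (MvPowerSeries.X 0)) ∧
      N.a1 = ι (X (conn01 1)) ∧ N.a2 = ι (X (conn01 2)) ∧
      N.b0 = ι (X (conn11 0)) ∧ N.b1 = ι (X (conn11 1)) ∧
      N.b2 = ι (X (conn11 2)) ∧ N.z = ι (X zeta) ∧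
      N.z0 = ι (X (dzeta 0)) ∧ N.z1 = ι (X (dzeta 1)) ∧
      N.z2 = ι (X (dzeta 2)) ∧ N.s = ι (X scal) ∧
      N.s0 = ι (X (ricci 0)) ∧ N.s1 = ι (X (ricci 1)) ∧
      N.s2 = ι (X (ricci 2)) ∧ N.s3 = ι (X (ricci 3)) ∧
      N.s4 = ι (X (ricci 4)) ∧ N.μ = ι (C μ) ∧ N.h = ι η) ∧
    ∃ t2 tu tv r0 r1 r2 z1 z2 y0 y1 y2 x0 x1 x2 σ1 σ2 h1 h2 h3 : Series,
      constraintList (C μ) (seriesJet X) = [t2, tu, tv, r0, r1, r2, z1, z2, y0, y1, y2,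
        x0, x1, x2, σ1, σ2, (1 - C μ * X zeta) * h1, (1 - C μ * X zeta) * h2,
        (1 - C μ * X zeta) * h3] ∧
      ι t2 = N.b0 - 2 * N.a1 ∧ ι tu = 2 * ι (MvPowerSeries.X 0) * N.T (ι (MvPowerSeries.X 0)) ∧
      ι tv = 2 * ι (MvPowerSeries.X 0) ^ 2 * N.T (ι (MvPowerSeries.X 1)) ∧
      ι r0 = 2 * ι (MvPowerSeries.X 0) ^ 2 * N.R0 ∧
      ι r1 = 2 * ι (MvPowerSeries.X 0) * N.R1 ∧ ι r2 = 2 * ι (MvPowerSeries.X 0) * N.R2 ∧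
      ι z1 = 2 * ι (MvPowerSeries.X 0) * N.Z1 ∧ ι z2 = N.Z2 ∧
      ι y0 = 2 * ι (MvPowerSeries.X 0) * N.Y0 ∧ ι y1 = 2 * ι (MvPowerSeries.X 0) * N.Y1 ∧
      ι y2 = 2 * ι (MvPowerSeries.X 0) * N.Y2 ∧
      ι x0 = N.X0 ∧ ι x1 = N.X1 ∧ ι x2 = N.X2 ∧
      ι σ1 = 2 * ι (MvPowerSeries.X 0) * N.S1 ∧ ι σ2 = N.S2 ∧
      ι h1 = 2 * ι (MvPowerSeries.X 0) * N.H1 ∧ ι h2 = 2 * ι (MvPowerSeries.X 0) * N.H2 ∧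
      ι h3 = 2 * ι (MvPowerSeries.X 0) * N.H3 ∧
      (UOrd 1 t2 ∧ UOrd 1 tu ∧ UOrd 2 tv ∧ UOrd 1 r0) ∧
      UOrd 1 r1 ∧ UOrd 1 r2 ∧ UOrd 1 z1 ∧ UOrd 1 z2 ∧
      UOrd 1 y0 ∧ UOrd 1 y1 ∧ UOrd 1 y2 ∧ UOrd 1 x0 ∧ UOrd 1 x1 ∧ UOrd 1 x2 ∧ UOrd 1 σ1 ∧
      UOrd 1 σ2 ∧ UOrd 1 h1 ∧ UOrd 1 h2 ∧ UOrd 1 h3 := by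
  have : CharZero L := charZero_of_isFractionRing L
  have hu := algebraMap_u_ne_zero L
  obtain ⟨N, h0, h1, h2, ha0, ha1, ha2, hb0, hb1, hb2, hz, hz0, hz1, hz2, hs, hs0, hs1, hs2, hs3,
    hs4, hμ, hh⟩ := exists_nullFrame L hη hred
  have hF0 : UOrd 2 (X (frame11 0)) := by
    have e3 : pderiv ℂ 0 (X (frame11 0)) = 2 * X (frame01 0) * X (conn11 0) - 2 * X (conn11 1) := by
      have := hred (pderiv ℂ 0 (X (frame11 0)) - 2 * X (frame01 0) * X (conn11 0)
        + 2 * X (conn11 1)) (by simp [reducedList, seriesJet])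
      linear_combination this
    have g : UOrd 1 (2 * X (frame01 0) * X (conn11 0) - 2 * X (conn11 1)) :=
      ((hX.gauge (conn11 0) trivial).mul_left _).sub ((hX.gauge (conn11 1) trivial).mul_left _)
    refine UOrd.fuchs_step (n := 0) (g := MvPowerSeries.X 0 *
      (2 * (2 * X (frame01 0) * X (conn11 0) - 2 * X (conn11 1)))) ?_ (g.mul_left _).u_mul
      (hX.gauge _ trivial) (by norm_num)
    rw [e3]; push_cast; ring
  have hF0' := hF0.mono one_le_two
  have hE0 : UOrd 1 (X (frame01 0)) := hX.gauge _ trivial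
  have hF1 : UOrd 1 (X (frame11 1)) := hX.gauge _ trivial
  have ga : ∀ k, UOrd 1 (X (conn01 k)) := fun k => hX.gauge _ trivial
  have gb : ∀ k, UOrd 1 (X (conn11 k)) := fun k => hX.gauge _ trivial
  have ht := conn11_zero_eq hred
  have htι : ι (X (conn11 0)) = 2 * ι (X (conn01 1)) := by rw [ht, map_mul, map_ofNat]
  have hηι := congrArg ι hη
  simp only [map_mul, map_sub, map_one] at hηι
  have hη0 : ι η ≠ 0 := left_ne_zero_of_mul_eq_one hηι
  have hω : 1 - ι (C μ) * ι (X zeta) ≠ 0 := right_ne_zero_of_mul_eq_one hηι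
  have hinv : ι η = (1 - ι (C μ) * ι (X zeta))⁻¹ := eq_inv_of_mul_eq_one_left hηι
  have hdu : fracDer L 0 (ι (MvPowerSeries.X 0)) = 1 := by
    rw [fracDer_algebraMap, pderiv_X_self, map_one]
  have hdu1 : fracDer L 1 (ι (MvPowerSeries.X 0)) = 0 := by
    rw [fracDer_algebraMap, pderiv_X_of_ne (by decide), map_zero]
  have hdu2 : fracDer L 2 (ι (MvPowerSeries.X 0)) = 0 := by
    rw [fracDer_algebraMap, pderiv_X_of_ne (by decide), map_zero]
  have hdv : fracDer L 0 (ι (MvPowerSeries.X 1)) = 0 := by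
    rw [fracDer_algebraMap, pderiv_X_of_ne (by decide), map_zero]
  have hdv1 : fracDer L 1 (ι (MvPowerSeries.X 1)) = 1 := by
    rw [fracDer_algebraMap, pderiv_X_self, map_one]
  have hdv2 : fracDer L 2 (ι (MvPowerSeries.X 1)) = 0 := by
    rw [fracDer_algebraMap, pderiv_X_of_ne (by decide), map_zero]
  have hdi : ∀ b, fracDer L b (1 / (2 * ι (MvPowerSeries.X 0))) =
      - fracDer L b (ι (MvPowerSeries.X 0)) / (2 * ι (MvPowerSeries.X 0) ^ 2) := by
    intro b
    have e : 1 / (2 * ι (MvPowerSeries.X 0)) = ((ι (MvPowerSeries.X 0))⁻¹) / 2 := by field_simp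
    rw [e, NullFrame.der_half, Derivation.leibniz_inv]
    simp
    field_simp
  have d1 : ∀ b, fracDer L b (1 : L) = 0 := fun b => Derivation.map_one_eq_zero _
  obtain ⟨A, _, π, hπ⟩ := exists_ringHom_eq_zero_iff_uOrd 1
  have g0 : ∀ {f : Series}, UOrd 1 f → π f = 0 := fun h => (hπ _).2 h
  have gu := g0 UOrd.X_one
  have gg : ∀ i : FieldIndex, i.IsGauge → π (X i) = 0 ∧
      ∀ b : Fin 3, b ≠ 0 → π (pderiv ℂ b (X i)) = 0 := fun i hi =>
    ⟨g0 (hX.gauge i hi), fun b hb => g0 ((hX.gauge i hi).pderiv_of_ne hb)⟩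
  have gE := fun a : Fin 2 => (gg (frame01 a) trivial).1
  have gE1 := fun a : Fin 2 => (gg (frame01 a) trivial).2 1 (by decide)
  have gE2 := fun a : Fin 2 => (gg (frame01 a) trivial).2 2 (by decide)
  have gF := fun a : Fin 2 => (gg (frame11 a) trivial).1
  have gF1 := fun a : Fin 2 => (gg (frame11 a) trivial).2 1 (by decide)
  have gF2 := fun a : Fin 2 => (gg (frame11 a) trivial).2 2 (by decide)
  have ga := fun k : Fin 3 => (gg (conn01 k) trivial).1
  have ga1 := fun k : Fin 3 => (gg (conn01 k) trivial).2 1 (by decide)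
  have ga2 := fun k : Fin 3 => (gg (conn01 k) trivial).2 2 (by decide)
  have gb := fun k : Fin 3 => (gg (conn11 k) trivial).1
  have gb1 := fun k : Fin 3 => (gg (conn11 k) trivial).2 1 (by decide)
  have gb2 := fun k : Fin 3 => (gg (conn11 k) trivial).2 2 (by decide)
  have gz := g0 hX.zeta
  have gz1 := g0 (hX.zeta.pderiv_of_ne (b := 1) (by decide))
  have gz2 := g0 (hX.zeta.pderiv_of_ne (b := 2) (by decide))
  have gζ1 := g0 hX.dzeta1
  have gζ11 := g0 (hX.dzeta1.pderiv_of_ne (b := 1) (by decide))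
  have gζ12 := g0 (hX.dzeta1.pderiv_of_ne (b := 2) (by decide))
  have gζ2 := g0 hX.dzeta2
  have gζ21 := g0 (hX.dzeta2.pderiv_of_ne (b := 1) (by decide))
  have gζ22 := g0 (hX.dzeta2.pderiv_of_ne (b := 2) (by decide))
  have gζ0 := g0 hX.dw_dzeta0
  have gs := g0 hX.dw_scal
  have gζv := g0 hX.dv_dzeta0
  have gsv := g0 hX.dv_scal
  have gr2 := g0 hX.dv_ricci2
  have gr3 := g0 hX.dv_ricci3
  have gr4 := g0 hX.dv_ricci4
  rw [map_sub, sub_eq_zero] at gζ0 gr2 gr3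
  rw [map_add, map_mul] at gs
  have gs' := eq_neg_of_add_eq_zero_left gs
  clear gg
  let cc : ℕ → Series := fun i => (constraintList (C μ) (seriesJet X)).getD i 0
  have hcc : ∀ i, cc i = (constraintList (C μ) (seriesJet X)).getD i 0 := fun i => rfl
  have hcancel : ∀ x : Series, (1 - C μ * X zeta) * (η * x) = x := fun x => by
    linear_combination x * hη
  refine ⟨N, h0, h1, h2, ⟨ha0, ha1, ha2, hb0, hb1, hb2, hz, hz0, hz1, hz2, hs, hs0, hs1, hs2, hs3,
    hs4, hμ, hh⟩, cc 0, cc 1, cc 2, cc 3, cc 4, cc 5, cc 6, cc 7, cc 8, cc 9, cc 10, cc 11, cc 12,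
    cc 13, cc 14, cc 15, η * cc 16, η * cc 17, η * cc 18, ?_, ?_, ?_, ?_, ?_, ?_, ?_, ?_, ?_, ?_,
    ?_, ?_, ?_, ?_, ?_, ?_, ?_, ?_, ?_, ?_, ⟨?_, ?_, ?_, ?_⟩, ?_⟩
  · simp only [hcancel]; rfl
  iterate 19
    · simp only [hcc, constraintList, List.getD_cons_zero, List.getD_cons_succ]
      simp only [NullFrame.T, NullFrame.R0, NullFrame.R1, NullFrame.R2, NullFrame.Z1, NullFrame.Z2,
          NullFrame.Y0,
        NullFrame.Y1, NullFrame.Y2, NullFrame.X0, NullFrame.X1, NullFrame.X2, NullFrame.S1,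
        NullFrame.S2, NullFrame.H1, NullFrame.H2, NullFrame.H3,
        ha0, ha1, ha2, hb0, hb1, hb2, hz, hz0, hz1, hz2, hs, hs0, hs1, hs2, hs3, hs4, hμ, hh, hinv,
        h0, h1, h2, seriesJet, Jet.dir01, Jet.dir11, Jet.grad, map_mul, map_add, map_sub, map_one,
        map_pow, map_ofNat, ← fracDer_algebraMap L, Derivation.leibniz, smul_eq_mul, hdi, hdu, hdu1,
        hdu2, hdv, hdv1, hdv2, map_zero, d1,
        htι, NullFrame.der_ofNat]
      try field_simp
      try ring
  · rw [hcc]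
    simp only [constraintList, List.getD_cons_zero, List.getD_cons_succ, seriesJet, ht, sub_self]
    exact fun d _ => by simp
  · rw [← hπ]
    simp only [hcc, constraintList, List.getD_cons_zero, List.getD_cons_succ]
    simp [seriesJet, Jet.dir01, Jet.dir11, Jet.grad, gu, gE, gE1, gE2, gF, gF1, gF2, ga, ga1, ga2,
      gb, gb1, gb2]
  · have a2 : UOrd 1 (2 * X (conn01 2) - pderiv ℂ 1 (X (frame11 1))) :=
      ((hX.gauge (conn01 2) trivial).mul_left 2).sub
        ((hX.gauge (frame11 1) trivial).pderiv_of_ne (by decide))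
    have e : cc 2 = MvPowerSeries.X 0 * (MvPowerSeries.X 0 * (2 * (pderiv ℂ 2 (X (frame01 1)) -
        X (frame01 0) * pderiv ℂ 0 (X (frame11 1)) + pderiv ℂ 1 (X (frame01 1)) * X (frame11 1)
        + X (frame11 1) * (X (conn11 0) - 2 * X (conn01 1))))) +
        MvPowerSeries.X 0 * ((1 + 2 * MvPowerSeries.X 0 * X (frame01 1)) *
          (2 * X (conn01 2) - pderiv ℂ 1 (X (frame11 1)))) +
        (2 * MvPowerSeries.X 0 ^ 2 * pderiv ℂ 0 (X (frame01 1)) - 1) * X (frame11 0) := by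
      simp only [hcc, constraintList, List.getD_cons_zero, List.getD_cons_succ, seriesJet]
      ring
    rw [e]
    exact ((UOrd.zero _).u_mul.u_mul.add (a2.mul_left _).u_mul).add (hF0.mul_left _)
  · rw [← hπ]
    simp only [hcc, constraintList, List.getD_cons_zero, List.getD_cons_succ]
    simp [seriesJet, Jet.dir01, Jet.dir11, Jet.grad, gu, gE, gE1, gE2, gF, gF1, gF2, ga, ga1, ga2,
      gb, gb1, gb2]
  and_intros
  all_goals
    rw [← hπ]
    simp only [hcc, constraintList, List.getD_cons_zero, List.getD_cons_succ]
    simp only [seriesJet, Jet.dir01, Jet.dir11, Jet.grad, map_add, map_sub, map_mul, map_ofNat,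
      map_one, map_pow, gu, gE, gE1, gE2, gF, gF1, gF2, ga, ga1, ga2, gb, gb1, gb2, gz, gz1, gz2,
      gζ1, gζ11, gζ12, gζ2, gζ21, gζ22, gζ0, gs', gζv, gsv, gr2, gr3, gr4, mul_zero, zero_mul,
      add_zero, zero_add, sub_zero] <;> ring

end

/-! ### Propagation of the constraints -/

section
variable (L : Type*) [Field L] [Algebra Series L] [IsFractionRing Series L]

local notation "ι" => algebraMap Series L

/-- A zero quantity `Z` which is singular on `U_0` enters through the series `f = 2 u Z`; the
Leibniz rule turns an equation for `∂_u Z` into a Fuchsian equation for `f`. -/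
theorem fracDer_scaled {f : Series} {Z : L} (h : ι f = 2 * ι (MvPowerSeries.X 0) * Z) :
    ι (pderiv ℂ 0 f) = 2 * Z + 2 * ι (MvPowerSeries.X 0) * fracDer L 0 Z := by
  have hdu : fracDer L 0 (ι (MvPowerSeries.X 0)) = 1 := by
    rw [fracDer_algebraMap, pderiv_X_self, map_one]
  have := charZero_of_isFractionRing L
  rw [← fracDer_algebraMap L, h]
  simp only [Derivation.leibniz, smul_eq_mul, hdu, NullFrame.der_ofNat]
  ring

/-- The same for a zero quantity which has to be multiplied by `2 u ^ 2`. -/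
theorem fracDer_scaled_sq {f : Series} {Z : L} (h : ι f = 2 * ι (MvPowerSeries.X 0) ^ 2 * Z) :
    ι (pderiv ℂ 0 f) = 4 * ι (MvPowerSeries.X 0) * Z +
      2 * ι (MvPowerSeries.X 0) ^ 2 * fracDer L 0 Z := by
  have hdu : fracDer L 0 (ι (MvPowerSeries.X 0)) = 1 := by
    rw [fracDer_algebraMap, pderiv_X_self, map_one]
  have := charZero_of_isFractionRing L
  rw [← fracDer_algebraMap L, h]
  simp only [Derivation.leibniz, smul_eq_mul, hdu, NullFrame.der_ofNat, pow_two]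
  ring

end

section
variable {X : FormalFields}

/-- A Fuchsian equation with a right-hand side divisible by `u f` has only the solution `0`. -/
theorem UOrd.eq_zero_of_fuchs {f a : Series} {n : ℤ} {q₀ : ℕ} (hf : UOrd q₀ f)
    (h : 2 * MvPowerSeries.X 0 * pderiv ℂ 0 f + (n : Series) * f = MvPowerSeries.X 0 * (a * f))
    (hn : 0 < 2 * (q₀ : ℤ) + n) : f = 0 := by
  refine UOrd.eq_zero fun q => ?_
  rcases le_total q q₀ with hq | hq
  · exact hf.mono hq
  induction q, hq using Nat.le_induction with
  | base => exact hf
  | succ q hq ih => exact UOrd.fuchs_step h (ih.mul_left _).u_mul ih (by omega)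

end

section
local notation "ι" => algebraMap Series _
local notation "u" => (MvPowerSeries.X 0 : Series)
local notation "∂u" => pderiv ℂ (0 : Fin 3)

set_option maxHeartbeats 4000000 in
/-- The subsidiary system is a linear homogeneous Fuchsian system in `∂_u`, triangular up to
coefficients which vanish on `U_0`, so that all constraint quantities vanish on `U_0` to every order.
The torsion along `e_{11}`, the curvature `R0` and the torsion along `∂_v` decouple and are treated
first. The torsion is then a multiple `t e_{00}`, and the sixteen quantities which remain are treated
simultaneously. -/
theorem constraints_of_reduced_aux (L : Type*) [Field L] [Algebra Series L]
    [IsFractionRing Series L] {X : FormalFields} {μ : ℂ} {η : Series}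
    (hη : η * (1 - C μ * X zeta) = 1)
    (hred : ∀ x ∈ reducedList (C μ) (seriesJet X), x = 0) (hX : ConeConditions X) :
    ∀ x ∈ constraintList (C μ) (seriesJet X), x = 0 := by
  have ht := conn11_zero_eq hred
  obtain ⟨N, d0, d1, d2, ⟨ha0, ha1, ha2, hb0, hb1, hb2, hz, hz0, hz1, hz2, hs, hs0, hs1, hs2, hs3,
    hs4, hμ, hh⟩, t2, tu, tv, r0, r1, r2, z1, z2, y0, y1, y2, x0, x1, x2, σ1, σ2, h1, h2, h3, hlist,
    et2, etu, etv, er0, er1, er2, ez1, ez2, ey0, ey1, ey2, ex0, ex1, ex2, es1, es2, eh1, eh2, eh3,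
    ⟨ut2, utu, utv, ur0⟩, U⟩ := exists_constraint_quantities L hη hred hX
  have hch : CharZero L := charZero_of_isFractionRing L
  have hu := algebraMap_u_ne_zero L
  have hdu : fracDer L 0 (ι u) = 1 := by
    rw [fracDer_algebraMap, pderiv_X_self, map_one]
  have hdu1 : fracDer L 1 (ι u) = 0 := by
    rw [fracDer_algebraMap, pderiv_X_of_ne (by decide), map_zero]
  have htN : N.b0 = 2 * N.a1 := by rw [hb0, ht, ha1, map_mul, map_ofNat]
  have ht2 : t2 = 0 := by
    apply IsFractionRing.injective Series L
    rw [et2, htN, sub_self, map_zero]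
  have hr0 : r0 = 0 := by
    refine ur0.eq_zero_of_fuchs (a := 8 * X (conn01 0)) (n := 0) ?_ (by norm_num)
    apply IsFractionRing.injective Series L
    simp only [map_mul, map_add, map_ofNat, fracDer_scaled_sq L er0, er0, ← d0, N.D0_R0 htN, ha0,
      map_intCast]
    field_simp
    push_cast
    ring
  have hR : N.R0 = 0 := by
    rw [hr0, map_zero] at er0
    simpa [hu] using er0.symm
  have T0 : N.T 0 = 0 := by simp [NullFrame.T]
  have T1 : N.T 1 = 0 := by simp [NullFrame.T, Derivation.map_one_eq_zero]
  have htv : tv = 0 := by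
    refine utv.eq_zero_of_fuchs (a := 4 * X (conn01 0)) (n := -2) ?_ (by norm_num)
    have e : N.D0 (ι (MvPowerSeries.X 1)) = 0 := by
      rw [d0, fracDer_algebraMap, pderiv_X_of_ne (by decide), map_zero]
    apply IsFractionRing.injective Series L
    simp only [map_mul, map_add, map_ofNat, fracDer_scaled_sq L etv, etv, ← d0, N.D0_T htN, ha0,
      map_intCast, e, T0, hR]
    field_simp
    push_cast
    ring
  have hTv : N.T (ι (MvPowerSeries.X 1)) = 0 := by
    rw [htv, map_zero] at etv
    simpa [hu] using etv.symm
  obtain ⟨t, hT, htu⟩ : ∃ t, (∀ f, N.T f = t * N.D0 f) ∧ t = N.T (ι u) := by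
    refine ⟨N.T (ι u), fun f => ?_, rfl⟩
    have hdi : ∀ b, fracDer L b (1 / (2 * ι u)) = - fracDer L b (ι u) / (2 * ι u ^ 2) := by
      intro b
      have e : 1 / (2 * ι u) = ((ι u : L)⁻¹) / 2 := by field_simp
      rw [e, NullFrame.der_half, Derivation.leibniz_inv]
      simp
      field_simp
    have hdv1 : fracDer L 1 (ι (MvPowerSeries.X 1)) = 1 := by
      rw [fracDer_algebraMap, pderiv_X_self, map_one]
    have hdv0 : fracDer L 0 (ι (MvPowerSeries.X 1)) = 0 := by
      rw [fracDer_algebraMap, pderiv_X_of_ne (by decide), map_zero]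
    have hdv2 : fracDer L 2 (ι (MvPowerSeries.X 1)) = 0 := by
      rw [fracDer_algebraMap, pderiv_X_of_ne (by decide), map_zero]
    have hdu2 : fracDer L 2 (ι u) = 0 := by
      rw [fracDer_algebraMap, pderiv_X_of_ne (by decide), map_zero]
    have e : N.T f = N.T (ι u) * fracDer L 0 f + N.T (ι (MvPowerSeries.X 1)) * fracDer L 1 f := by
      simp only [NullFrame.T, d0, d1, d2, map_add, Derivation.leibniz, smul_eq_mul, hdi, hdu, hdu1,
        hdu2, hdv0, hdv1, hdv2, Derivation.map_one_eq_zero, map_zero, fracDer_comm L 1 0,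
        fracDer_comm L 2 0, fracDer_comm L 2 1]
      field_simp
      ring
    rw [e, hTv, d0, zero_mul, add_zero]
  rw [← htu] at etu
  have dt : N.D0 t = 2 * N.R1 + 2 * N.a0 * t := by
    have := N.D0_T htN (ι u)
    rw [← htu, d0 (ι u), hdu, T1, hR] at this
    linear_combination this
  obtain ⟨Q1, Q2, Q3, Q4, Q5, Q6, Q7, Q8, Q9, Q10, Q11, Q12, Q13, Q14, Q15, Q16⟩ :
      2 * u * ∂u h1 + ((2 : ℤ) : Series) * h1 = 8 * X (conn01 0) * (u * h1) +
        8 * X (ricci 0) * (u * r1) + 2 * ∂u (X (ricci 0)) * (u * tu) +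
        2 * η * C μ * (2 * X (dzeta 0) * (u * h1) + 4 * X (ricci 1) * u * (u * x0) -
          4 * X (ricci 0) * u * (u * x1) - 3 * X (ricci 2) * (u * y0) +
          2 * X (ricci 1) * (u * y1) + X (ricci 0) * (u * y2)) +
        2 * (η * C μ) ^ 2 * ((X (ricci 0) * X (dzeta 2) + 2 * X (ricci 1) * X (dzeta 1) -
          3 * X (ricci 2) * X (dzeta 0)) * (u * z1) - 4 * u * (X (ricci 0) * X (dzeta 1) -
          X (ricci 1) * X (dzeta 0)) * (u * z2)) ∧
      2 * u * ∂u h2 + ((1 : ℤ) : Series) * h2 = 2 * X (frame01 0) * (u * ∂u h1) +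
        (1 + 2 * u * X (frame01 1)) * pderiv ℂ 1 h1 - 2 * X (frame01 0) * h1 -
        4 * X (conn01 1) * (u * h1) + 6 * X (conn01 0) * (u * h2) + 4 * X (ricci 1) * (u * r1) +
        2 * X (ricci 0) * (u * r2) + 2 * ∂u (X (ricci 1)) * (u * tu) +
        η * C μ * (3 * X (dzeta 0) * (u * h2) - 2 * X (dzeta 1) * (u * h1) +
          6 * X (ricci 2) * u * (u * x0) - 4 * X (ricci 1) * u * (u * x1) -
          2 * X (ricci 0) * u * (u * x2) - 4 * X (ricci 3) * (u * y0) +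
          4 * X (ricci 1) * (u * y2)) +
        2 * (η * C μ) ^ 2 * (2 * (X (ricci 1) * X (dzeta 2) - X (ricci 3) * X (dzeta 0)) * (u * z1)
          - u * (X (ricci 0) * X (dzeta 2) + 2 * X (ricci 1) * X (dzeta 1) -
          3 * X (ricci 2) * X (dzeta 0)) * (u * z2)) ∧
      2 * u * ∂u h3 + ((0 : ℤ) : Series) * h3 = 2 * X (frame01 0) * (u * ∂u h2) +
        (1 + 2 * u * X (frame01 1)) * pderiv ℂ 1 h2 - 2 * X (frame01 0) * h2 -
        4 * X (conn01 2) * (u * h1) + 4 * X (conn01 0) * (u * h3) + 4 * X (ricci 1) * (u * r2) +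
        2 * ∂u (X (ricci 2)) * (u * tu) +
        2 * η * C μ * (X (dzeta 0) * (u * h3) - X (dzeta 2) * (u * h1) +
          2 * X (ricci 3) * u * (u * x0) - 2 * X (ricci 1) * u * (u * x2) -
          X (ricci 4) * (u * y0) - 2 * X (ricci 3) * (u * y1) + 3 * X (ricci 2) * (u * y2)) +
        2 * (η * C μ) ^ 2 * ((3 * X (ricci 2) * X (dzeta 2) - 2 * X (ricci 3) * X (dzeta 1) -
          X (ricci 4) * X (dzeta 0)) * (u * z1)
          - 2 * u * (X (ricci 1) * X (dzeta 2) - X (ricci 3) * X (dzeta 0)) * (u * z2)) ∧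
      2 * u * ∂u r1 + ((0 : ℤ) : Series) * r1 = 4 * X (conn01 0) * (u * r1) - 1 * (u * h1) ∧
      2 * u * ∂u r2 + ((0 : ℤ) : Series) * r2 = 4 * X (conn01 0) * (u * r2) - 1 * (u * h2) ∧
      2 * u * ∂u tu + ((0 : ℤ) : Series) * tu = 4 * X (conn01 0) * (u * tu) + 4 * (u * r1) ∧
      2 * u * ∂u z1 + ((0 : ℤ) : Series) * z1 = 4 * X (conn01 0) * (u * z1) + 2 * (u * y0) ∧
      2 * u * ∂u z2 + ((0 : ℤ) : Series) * z2 = 4 * (X (conn01 1) * z1) + 2 * (u * x0) ∧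
      2 * u * ∂u y0 + ((0 : ℤ) : Series) * y0 = 4 * X (conn01 0) * (u * y0) -
        2 * X (ricci 0) * (1 - 2 * C μ * X zeta) * (u * z1) ∧
      2 * u * ∂u y1 + ((0 : ℤ) : Series) * y1 = 4 * X (conn01 0) * (u * y1) -
        2 * X (ricci 1) * (1 - 2 * C μ * X zeta) * (u * z1) ∧
      2 * u * ∂u y2 + ((0 : ℤ) : Series) * y2 = 2 * (u * σ1) + 4 * X (conn01 0) * (u * y2) -
        2 * X (ricci 2) * (1 - 2 * C μ * X zeta) * (u * z1) ∧
      2 * u * ∂u x0 + ((0 : ℤ) : Series) * x0 = 4 * (X (conn01 1) * y0) -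
        2 * X (ricci 0) * (1 - 2 * C μ * X zeta) * (u * z2) ∧
      2 * u * ∂u x1 + ((0 : ℤ) : Series) * x1 = 4 * (X (conn01 1) * y1) -
        2 * X (ricci 1) * (1 - 2 * C μ * X zeta) * (u * z2) - (1 - C μ * X zeta) * (X zeta * h1) ∧
      2 * u * ∂u x2 + ((0 : ℤ) : Series) * x2 = 2 * (u * σ2) + 4 * (X (conn01 1) * y2) -
        2 * X (ricci 2) * (1 - 2 * C μ * X zeta) * (u * z2) - (1 - C μ * X zeta) * (X zeta * h2) ∧
      2 * u * ∂u σ1 + ((0 : ℤ) : Series) * σ1 = 4 * X (conn01 0) * (u * σ1) -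
        2 * (1 - C μ * X zeta) * (X (ricci 2) * (u * y0) - 2 * X (ricci 1) * (u * y1) +
          X (ricci 0) * (u * y2)) + 2 * C μ * (X (ricci 0) * X (dzeta 2) -
          2 * X (ricci 1) * X (dzeta 1) + X (ricci 2) * X (dzeta 0)) * (u * z1) ∧
      2 * u * ∂u σ2 + ((0 : ℤ) : Series) * σ2 = 4 * (X (conn01 1) * σ1) +
        (1 - C μ * X zeta) * (2 * (X (dzeta 1) * h1) - X (dzeta 0) * h2
          - 2 * X (ricci 2) * (u * x0) + 4 * X (ricci 1) * (u * x1) - 2 * X (ricci 0) * (u * x2)) +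
        2 * C μ * (X (ricci 0) * X (dzeta 2) - 2 * X (ricci 1) * X (dzeta 1) +
          X (ricci 2) * X (dzeta 0)) * (u * z2) := by
    and_intros
    all_goals
      apply IsFractionRing.injective Series L
      simp only [map_mul, map_add, map_sub, map_one, map_ofNat, map_intCast, map_pow,
        fracDer_scaled L er1, fracDer_scaled L er2,
        fracDer_scaled L ez1, fracDer_scaled L ey0, fracDer_scaled L ey1, fracDer_scaled L ey2,
        fracDer_scaled L es1, fracDer_scaled L eh1, fracDer_scaled L eh2, fracDer_scaled L eh3,
        fracDer_scaled L etu, ← fracDer_algebraMap L 0 z2, ← fracDer_algebraMap L 0 x0,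
        ← fracDer_algebraMap L 0 x1, ← fracDer_algebraMap L 0 x2, ← fracDer_algebraMap L 0 σ2,
        ← fracDer_algebraMap L 1, ← fracDer_algebraMap L 0 (X (ricci 0)),
        ← fracDer_algebraMap L 0 (X (ricci 1)), ← fracDer_algebraMap L 0 (X (ricci 2)),
        er1, er2, ez1, ez2, ey0, ey1, ey2, ex0, ex1, ex2, es1, es2, eh1, eh2, eh3, etu,
        Derivation.leibniz, NullFrame.der_ofNat, hdu1, smul_eq_mul]
      simp only [← d0, dt, N.D0_R1 htN hR t hT, N.D0_R2 htN hR t hT, N.D0_Z1 htN hR t hT,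
        N.D0_Z2 htN hR t hT, N.D0_Y0 htN hR t hT, N.D0_Y1 htN hR t hT, N.D0_Y2 htN hR t hT,
        N.D0_X0 htN hR t hT, N.D0_X1 htN hR t hT, N.D0_X2 htN hR t hT, N.D0_S1 htN hR t hT,
        N.D0_S2 htN hR t hT, N.D0_H1 htN hR t hT, N.D0_H2 htN hR t hT, N.D0_H3 htN hR t hT,
        d1 N.H1, d1 N.H2, ha0, ← ha1, ← ha2, ← hz, ← hz0, ← hz1, ← hz2, ← hs0, ← hs1, ← hs2,
        ← hs3, ← hs4, ← hμ, ← hh]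
      field_simp
      push_cast
      ring
  -- If all quantities vanish to the order `q` on `U_0`, then the right-hand sides vanish to the order
  -- `q + 1`, provided that `h1`, `h2`, `h3` are improved in this order and before the others: the
  -- right-hand sides of `h2` and `h3` contain `∂_v h1` and `∂_v h2` without a factor `u`.
  have step : ∀ q, 1 ≤ q → UOrd q tu ∧ UOrd q r1 ∧ UOrd q r2 ∧ UOrd q z1 ∧ UOrd q z2 ∧ UOrd q y0 ∧
      UOrd q y1 ∧ UOrd q y2 ∧ UOrd q x0 ∧ UOrd q x1 ∧ UOrd q x2 ∧ UOrd q σ1 ∧ UOrd q σ2 ∧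
      UOrd q h1 ∧ UOrd q h2 ∧ UOrd q h3 := by
    intro q hq
    induction q, hq using Nat.le_induction with
    | base => exact ⟨utu, U⟩
    | succ q hq ih =>
      obtain ⟨itu, ir1, ir2, iz1, iz2, iy0, iy1, iy2, ix0, ix1, ix2, is1, is2, ih1, ih2, ih3⟩ := ih
      -- `π` is the reduction modulo `u ^ (q + 1)`.
      obtain ⟨A, _, π, hπ⟩ := exists_ringHom_eq_zero_iff_uOrd (q + 1)
      have g0 : ∀ {f : Series}, UOrd (q + 1) f → π f = 0 := fun h => (hπ _).2 h
      have G : ∀ {f : Series}, UOrd q f → π u * π f = 0 := fun h => by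
        rw [← map_mul]; exact g0 h.u_mul
      have Ga : ∀ {f : Series}, UOrd q f → π (X (conn01 1)) * π f = 0 := fun h => by
        rw [← map_mul]; exact g0 (add_comm 1 q ▸ (hX.gauge (conn01 1) trivial).mul h)
      have Gz : π (X zeta) * π h1 = 0 := by
        rw [← map_mul]; exact g0 (add_comm 1 q ▸ hX.zeta.mul ih1)
      have j1 : UOrd (q + 1) h1 := by
        refine UOrd.fuchs_step Q1 ((hπ _).1 ?_) ih1 (by omega)
        simp only [map_add, map_sub, map_mul, G itu, G ir1, G iz1, G iz2, G iy0, G iy1, G iy2,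
          G ix0, G ix1, G ih1, mul_zero, add_zero, sub_zero]
      have j2 : UOrd (q + 1) h2 := by
        refine UOrd.fuchs_step Q2 ((hπ _).1 ?_) ih2 (by omega)
        have e := g0 j1.u_mul_pderiv
        rw [map_mul] at e
        simp only [map_add, map_sub, map_mul, G itu, G ir1, G ir2, G iz1, G iz2, G iy0, G iy1,
          G iy2, G ix0, G ix1, G ix2, G ih1, G ih2, mul_zero, add_zero, sub_zero, g0 j1, e,
          g0 (j1.pderiv_of_ne (b := 1) (by decide))]
      have j3 : UOrd (q + 1) h3 := by
        refine UOrd.fuchs_step Q3 ((hπ _).1 ?_) ih3 (by omega)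
        have e := g0 j2.u_mul_pderiv
        rw [map_mul] at e
        simp only [map_add, map_sub, map_mul, G itu, G ir1, G ir2, G iz1, G iz2, G iy0, G iy1,
          G iy2, G ix0, G ix1, G ix2, G ih1, G ih2, G ih3, mul_zero, add_zero, sub_zero, g0 j2, e,
          g0 (j2.pderiv_of_ne (b := 1) (by decide))]
      refine ⟨UOrd.fuchs_step Q6 ?_ itu (by omega), UOrd.fuchs_step Q4 ?_ ir1 (by omega),
        UOrd.fuchs_step Q5 ?_ ir2 (by omega), UOrd.fuchs_step Q7 ?_ iz1 (by omega),
        UOrd.fuchs_step Q8 ?_ iz2 (by omega), UOrd.fuchs_step Q9 ?_ iy0 (by omega),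
        UOrd.fuchs_step Q10 ?_ iy1 (by omega), UOrd.fuchs_step Q11 ?_ iy2 (by omega),
        UOrd.fuchs_step Q12 ?_ ix0 (by omega), UOrd.fuchs_step Q13 ?_ ix1 (by omega),
        UOrd.fuchs_step Q14 ?_ ix2 (by omega), UOrd.fuchs_step Q15 ?_ is1 (by omega),
        UOrd.fuchs_step Q16 ?_ is2 (by omega), j1, j2, j3⟩
      all_goals
        rw [← hπ]
        simp only [map_add, map_sub, map_mul, G itu, G ir1, G ir2, G iz1, G iz2, G iy0, G iy1,
          G iy2, G ix0, G ix1, G ix2, G is1, G is2, G ih1, G ih2, G ih3, mul_zero, add_zero,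
          sub_zero, g0 j1, g0 j2, Ga iz1, Ga iy0, Ga iy1, Ga iy2, Ga is1]
  have Z : tu = 0 ∧ r1 = 0 ∧ r2 = 0 ∧ z1 = 0 ∧ z2 = 0 ∧ y0 = 0 ∧ y1 = 0 ∧ y2 = 0 ∧ x0 = 0 ∧
      x1 = 0 ∧ x2 = 0 ∧ σ1 = 0 ∧ σ2 = 0 ∧ h1 = 0 ∧ h2 = 0 ∧ h3 = 0 := by
    have hq : ∀ q, UOrd (q + 1) tu ∧ UOrd (q + 1) r1 ∧ _ := fun q => step (q + 1) (by omega)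
    simp only [forall_and] at hq
    have z : ∀ {f : Series}, (∀ q, UOrd (q + 1) f) → f = 0 := fun h =>
      UOrd.eq_zero fun q => (h q).mono (Nat.le_succ q)
    obtain ⟨q1, q2, q3, q4, q5, q6, q7, q8, q9, q10, q11, q12, q13, q14, q15, q16⟩ := hq
    exact ⟨z q1, z q2, z q3, z q4, z q5, z q6, z q7, z q8, z q9, z q10, z q11, z q12, z q13, z q14,
      z q15, z q16⟩
  obtain ⟨c1, c2, c3, c4, c5, c6, c7, c8, c9, c10, c11, c12, c13, c14, c15, c16⟩ := Z
  rw [hlist, ht2, htv, hr0, c1, c2, c3, c4, c5, c6, c7, c8, c9, c10, c11, c12, c13, c14, c15, c16]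
  simp

end

/-- The constraints hold for every formal solution of the reduced system which satisfies the
conditions on the null cone. -/
theorem constraints_of_reduced {X : FormalFields} {μ : ℂ} {η : Series}
    (hη : η * (1 - C μ * X zeta) = 1)
    (hred : ∀ x ∈ reducedList (C μ) (seriesJet X), x = 0) (hX : ConeConditions X) :
    ∀ x ∈ constraintList (C μ) (seriesJet X), x = 0 :=
  constraints_of_reduced_aux (FractionRing Series) hη hred hX

/-! ### The solution step for the reduced system -/

/-- Inverse of `u ∂_u + k`. For `k = 0` the coefficients with no power of `u` are set to `0`. -/
def fuchs (k : ℂ) (f : Series) : Series := fun d => coeff d f / ((d 0 : ℂ) + k)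

/-- Antiderivative with respect to `w` of the restriction to `U_0`, vanishing for `w = 0`. -/
def wPrimitive (f : Series) : Series := fun d =>
  if d 0 = 0 ∧ d 2 ≠ 0 then coeff (d - Finsupp.single 2 1) f / (d 2 : ℂ) else 0

/-- The solution `g` of `u ∂_w g = f`, where `f` vanishes on `U_0`, with initial value
`g = ∑ a m n u^m v^n` for `w = 0`. -/
def uwPrimitive (a : ℕ → ℕ → ℂ) (f : Series) : Series := fun d =>
  if d 2 = 0 then a (d 0) (d 1)
  else coeff (d - Finsupp.single 2 1 + Finsupp.single 0 1) f / (d 2 : ℂ)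

theorem coeff_fuchs (k : ℂ) (f : Series) (d : Fin 3 →₀ ℕ) :
    coeff d (fuchs k f) = coeff d f / ((d 0 : ℂ) + k) := rfl

theorem coeff_wPrimitive (f : Series) (d : Fin 3 →₀ ℕ) : coeff d (wPrimitive f) =
    if d 0 = 0 ∧ d 2 ≠ 0 then coeff (d - Finsupp.single 2 1) f / (d 2 : ℂ) else 0 := rfl

theorem coeff_uwPrimitive (a : ℕ → ℕ → ℂ) (f : Series) (d : Fin 3 →₀ ℕ) :
    coeff d (uwPrimitive a f) = if d 2 = 0 then a (d 0) (d 1)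
      else coeff (d - Finsupp.single 2 1 + Finsupp.single 0 1) f / (d 2 : ℂ) := rfl

theorem fuchs_spec {k : ℂ} (hk : ∀ n : ℕ, (n : ℂ) + k ≠ 0) (f : Series) :
    X 0 * pderiv ℂ 0 (fuchs k f) + C k * fuchs k f = f := by
  ext d
  rw [map_add, coeff_u_mul_pderiv, coeff_C_mul, coeff_fuchs, ← add_mul, mul_div_cancel₀ _ (hk _)]

theorem fuchs_zero_spec {f : Series} (hf : UOrd 1 f) :
    X 0 * pderiv ℂ 0 (fuchs 0 f) = f := by
  ext d
  rw [coeff_u_mul_pderiv, coeff_fuchs, add_zero]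
  by_cases h : d 0 = 0
  · rw [hf d (by omega), h, zero_div, mul_zero]
  · field_simp

theorem eq_fuchs {k : ℂ} (hk : ∀ n : ℕ, (n : ℂ) + k ≠ 0) {f g : Series}
    (h : X 0 * pderiv ℂ 0 f + C k * f = g) : f = fuchs k g := by
  ext d
  rw [coeff_fuchs, ← h, map_add, coeff_u_mul_pderiv, coeff_C_mul, ← add_mul,
    mul_div_cancel_left₀ _ (hk _)]

theorem eq_fuchs_zero {f g : Series} (hf : UOrd 1 f)
    (h : X 0 * pderiv ℂ 0 f = g) : f = fuchs 0 g := by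
  ext d
  rw [coeff_fuchs, ← h, coeff_u_mul_pderiv, add_zero]
  by_cases h : d 0 = 0
  · rw [hf d (by omega), h]; simp
  · field_simp

theorem UOrd.fuchs {q : ℕ} {f : Series} (k : ℂ) (hf : UOrd q f) :
    UOrd q (StaticVacuum.fuchs k f) := fun d hd => by
  rw [coeff_fuchs, hf d hd, zero_div]

theorem uOrd_fuchs_zero (f : Series) : UOrd 1 (fuchs 0 f) := fun d hd => by
  rw [coeff_fuchs, Nat.lt_one_iff.1 hd]; simp

/-- `Z` is obtained from `Y` by evaluating the reduced system, solved for the unknowns one after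
the other: an entry of `Z` on a right-hand side is one which has already been computed. The entry
`none` stands for `(1 - μ ζ)⁻¹`. -/
structure IsStep (μ : ℂ) (a : ℕ → ℕ → ℂ) (Y Z : Option FieldIndex → Series) : Prop where
  eta : Z none = 1 + fuchs 0 (X 0 * (C μ * Y (some (dzeta 0)) * Y none * Y none))
  frame01_0 : Z (some (frame01 0)) = fuchs 1 (X 0 * (2 * Y (some (conn01 0)) * Y (some (frame01 0))
      - 2 * Y (some (conn01 1))))
  conn01_0 : Z (some (conn01 0)) = fuchs 2 (X 0 * (C (1 / 2) * Y (some (ricci 0)) + 2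
      * Y (some (conn01 0)) * Y (some (conn01 0))))
  conn01_1 : Z (some (conn01 1)) = fuchs 1 (X 0 * (C (1 / 2) * Y (some (ricci 1)) + 2
      * Y (some (conn01 0)) * Y (some (conn01 1))))
  conn01_2 : Z (some (conn01 2)) = fuchs 1 (X 0 * (C (1 / 2) * Y (some (ricci 2)) + 2
      * Y (some (conn01 0)) * Y (some (conn01 2))))
  conn11_0 : Z (some (conn11 0)) = fuchs 1 (X 0 * (Y (some (ricci 1)) + 2 * Y (some (conn01 0))
      * Y (some (conn11 0))))
  conn11_1 : Z (some (conn11 1)) = fuchs 0 (X 0 * (Y (some (ricci 2)) + 2 * Y (some (conn01 1))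
      * Y (some (conn11 0))))
  conn11_2 : Z (some (conn11 2)) = fuchs 0 (X 0 * (Y (some (ricci 3)) + 2 * Y (some (conn01 2))
      * Y (some (conn11 0))))
  frame01_1 : Z (some (frame01 1)) = fuchs 1 (Z (some (conn01 0)) + X 0 *
      (2 * Y (some (frame01 1)) * Y (some (conn01 0))))
  frame11_0 : Z (some (frame11 0)) = fuchs 0 (X 0 * (2 * Y (some (frame01 0)) * Y (some (conn11 0))
      - 2 * Y (some (conn11 1))))
  frame11_1 : Z (some (frame11 1)) = fuchs 0 (Z (some (conn11 0)) + X 0 *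
      (2 * Y (some (frame01 1)) * Y (some (conn11 0))))
  eq_zeta : Z (some zeta) = fuchs 0 (X 0 * Y (some (dzeta 0)))
  dzeta_0 : Z (some (dzeta 0)) = wPrimitive (Y (some scal)) - fuchs 0
      (X 0 * (Y (some (ricci 0)) * Y (some zeta) * (1 - C μ * Y (some zeta))))
  dzeta_1 : Z (some (dzeta 1)) = -fuchs 0 (X 0 * (Y (some (ricci 1)) * Y (some zeta) *
      (1 - C μ * Y (some zeta))))
  dzeta_2 : Z (some (dzeta 2)) = fuchs 0 (X 0 * (Y (some scal) - Y (some (ricci 2)) * Y (some zeta)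
      * (1 - C μ * Y (some zeta))))
  eq_scal : Z (some scal) = -C 2 - wPrimitive (Y (some (ricci 4)) * Y (some (dzeta 0))) - fuchs 0
      (X 0 * ((1 - C μ * Y (some zeta)) *
    (Y (some (ricci 0)) * Y (some (dzeta 2)) - 2 * Y (some (ricci 1)) * Y (some (dzeta 1))
        + Y (some (ricci 2)) * Y (some (dzeta 0)))))
  ricci_0 : Z (some (ricci 0)) = uwPrimitive a (C (1 / 2) * pderiv ℂ 1 (Y (some (ricci 1)))
    + Y (some (frame01 0)) * (X 0 * pderiv ℂ 0 (Y (some (ricci 1))))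
    - Y (some (frame11 0)) * (X 0 * pderiv ℂ 0 (Y (some (ricci 0)))) - C (3 / 2)
        * Y (some (ricci 2))
    + X 0 * (Y (some (frame01 1)) * pderiv ℂ 1 (Y (some (ricci 1))) - Y (some (frame11 1)) *
        pderiv ℂ 1 (Y (some (ricci 0)))
      + (3 * Y (some (conn01 0)) * Y (some (ricci 2)) - 2 * Y (some (conn01 1)) * Y (some (ricci 1))
      - Y (some (conn01 2)) * Y (some (ricci 0)) - 4 * Y (some (conn11 0)) * Y (some (ricci 1))
      + 4 * Y (some (conn11 1)) * Y (some (ricci 0)) + Y none * C μ *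
          (C (1 / 2) * Y (some (ricci 0)) * Y (some (dzeta 2))
        + Y (some (ricci 1)) * Y (some (dzeta 1)) - C (3 / 2) * Y (some (ricci 2))
            * Y (some (dzeta 0))))))
  ricci_1 : Z (some (ricci 1)) = fuchs 2 (C (1 / 2) * pderiv ℂ 1 (Z (some (ricci 0)))
    + Z (some (frame01 0)) * (X 0 * pderiv ℂ 0 (Z (some (ricci 0))))
    + X 0 * (Y (some (frame01 1)) * pderiv ℂ 1 (Y (some (ricci 0)))
      + (4 * Y (some (conn01 0)) * Y (some (ricci 1)) - 4 * Y (some (conn01 1)) * Y (some (ricci 0))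
      - 2 * Y none * C μ * (Y (some (ricci 0)) * Y (some (dzeta 1)) - Y (some (ricci 1))
          * Y (some (dzeta 0))))))
  ricci_2 : Z (some (ricci 2)) = fuchs (3 / 2) (C (1 / 2) * pderiv ℂ 1 (Z (some (ricci 1)))
    + Z (some (frame01 0)) * (X 0 * pderiv ℂ 0 (Z (some (ricci 1))))
    + X 0 * (Y (some (frame01 1)) * pderiv ℂ 1 (Y (some (ricci 1)))
      + (3 * Y (some (conn01 0)) * Y (some (ricci 2)) - 2 * Y (some (conn01 1)) * Y (some (ricci 1))
      - Y (some (conn01 2)) * Y (some (ricci 0)) - Y none * C μ *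
          (C (1 / 2) * Y (some (ricci 0)) * Y (some (dzeta 2))
        + Y (some (ricci 1)) * Y (some (dzeta 1)) - C (3 / 2) * Y (some (ricci 2))
            * Y (some (dzeta 0))))))
  ricci_3 : Z (some (ricci 3)) = fuchs 1 (C (1 / 2) * pderiv ℂ 1 (Z (some (ricci 2)))
    + Z (some (frame01 0)) * (X 0 * pderiv ℂ 0 (Z (some (ricci 2))))
    + X 0 * (Y (some (frame01 1)) * pderiv ℂ 1 (Y (some (ricci 2)))
      + (2 * Y (some (conn01 0)) * Y (some (ricci 3)) - 2 * Y (some (conn01 2)) * Y (some (ricci 1))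
      - Y none * C μ * (Y (some (ricci 1)) * Y (some (dzeta 2)) - Y (some (ricci 3))
          * Y (some (dzeta 0))))))
  ricci_4 : Z (some (ricci 4)) = fuchs (1 / 2) (C (1 / 2) * pderiv ℂ 1 (Z (some (ricci 3)))
    + Z (some (frame01 0)) * (X 0 * pderiv ℂ 0 (Z (some (ricci 3))))
    + X 0 * (Y (some (frame01 1)) * pderiv ℂ 1 (Y (some (ricci 3)))
      + (Y (some (conn01 0)) * Y (some (ricci 4)) + 2 * Y (some (conn01 1)) * Y (some (ricci 3))
      - 3 * Y (some (conn01 2)) * Y (some (ricci 2)) - Y none * C μ *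
          (C (3 / 2) * Y (some (ricci 2)) * Y (some (dzeta 2))
        - Y (some (ricci 3)) * Y (some (dzeta 1)) - C (1 / 2) * Y (some (ricci 4))
            * Y (some (dzeta 0))))))

theorem exists_isStep (μ : ℂ) (a : ℕ → ℕ → ℂ) (Y : Option FieldIndex → Series) :
    ∃ Z, IsStep μ a Y Z := by
  obtain ⟨a0, h_a0⟩ : ∃ f, f = fuchs 2 (X 0 * (C (1 / 2) * Y (some (ricci 0)) + 2
      * Y (some (conn01 0)) * Y (some (conn01 0)))) := ⟨_, rfl⟩
  obtain ⟨b0, h_b0⟩ : ∃ f, f = fuchs 1 (X 0 * (Y (some (ricci 1)) + 2 * Y (some (conn01 0))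
      * Y (some (conn11 0)))) := ⟨_, rfl⟩
  obtain ⟨e0, h_e0⟩ : ∃ f, f = fuchs 1 (X 0 * (2 * Y (some (conn01 0)) * Y (some (frame01 0)) - 2 *
      Y (some (conn01 1)))) := ⟨_, rfl⟩
  obtain ⟨s0, h_s0⟩ : ∃ f, f = uwPrimitive a (C (1 / 2) * pderiv ℂ 1 (Y (some (ricci 1)))
    + Y (some (frame01 0)) * (X 0 * pderiv ℂ 0 (Y (some (ricci 1))))
    - Y (some (frame11 0)) * (X 0 * pderiv ℂ 0 (Y (some (ricci 0)))) - C (3 / 2)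
        * Y (some (ricci 2))
    + X 0 * (Y (some (frame01 1)) * pderiv ℂ 1 (Y (some (ricci 1))) - Y (some (frame11 1)) *
        pderiv ℂ 1 (Y (some (ricci 0)))
      + (3 * Y (some (conn01 0)) * Y (some (ricci 2)) - 2 * Y (some (conn01 1)) * Y (some (ricci 1))
      - Y (some (conn01 2)) * Y (some (ricci 0)) - 4 * Y (some (conn11 0)) * Y (some (ricci 1))
      + 4 * Y (some (conn11 1)) * Y (some (ricci 0)) + Y none * C μ *
          (C (1 / 2) * Y (some (ricci 0)) * Y (some (dzeta 2))
        + Y (some (ricci 1)) * Y (some (dzeta 1)) - C (3 / 2) * Y (some (ricci 2))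
            * Y (some (dzeta 0)))))) := ⟨_, rfl⟩
  obtain ⟨s1, h_s1⟩ : ∃ f, f = fuchs 2 (C (1 / 2) * pderiv ℂ 1 (s0)
    + e0 * (X 0 * pderiv ℂ 0 (s0))
    + X 0 * (Y (some (frame01 1)) * pderiv ℂ 1 (Y (some (ricci 0)))
      + (4 * Y (some (conn01 0)) * Y (some (ricci 1)) - 4 * Y (some (conn01 1)) * Y (some (ricci 0))
      - 2 * Y none * C μ * (Y (some (ricci 0)) * Y (some (dzeta 1)) - Y (some (ricci 1))
          * Y (some (dzeta 0)))))) := ⟨_, rfl⟩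
  obtain ⟨s2, h_s2⟩ : ∃ f, f = fuchs (3 / 2) (C (1 / 2) * pderiv ℂ 1 (s1)
    + e0 * (X 0 * pderiv ℂ 0 (s1))
    + X 0 * (Y (some (frame01 1)) * pderiv ℂ 1 (Y (some (ricci 1)))
      + (3 * Y (some (conn01 0)) * Y (some (ricci 2)) - 2 * Y (some (conn01 1)) * Y (some (ricci 1))
      - Y (some (conn01 2)) * Y (some (ricci 0)) - Y none * C μ *
          (C (1 / 2) * Y (some (ricci 0)) * Y (some (dzeta 2))
        + Y (some (ricci 1)) * Y (some (dzeta 1)) - C (3 / 2) * Y (some (ricci 2))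
            * Y (some (dzeta 0)))))) := ⟨_, rfl⟩
  obtain ⟨s3, h_s3⟩ : ∃ f, f = fuchs 1 (C (1 / 2) * pderiv ℂ 1 (s2)
    + e0 * (X 0 * pderiv ℂ 0 (s2))
    + X 0 * (Y (some (frame01 1)) * pderiv ℂ 1 (Y (some (ricci 2)))
      + (2 * Y (some (conn01 0)) * Y (some (ricci 3)) - 2 * Y (some (conn01 2)) * Y (some (ricci 1))
      - Y none * C μ * (Y (some (ricci 1)) * Y (some (dzeta 2)) - Y (some (ricci 3))
          * Y (some (dzeta 0)))))) := ⟨_, rfl⟩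
  obtain ⟨s4, h_s4⟩ : ∃ f, f = fuchs (1 / 2) (C (1 / 2) * pderiv ℂ 1 (s3)
    + e0 * (X 0 * pderiv ℂ 0 (s3))
    + X 0 * (Y (some (frame01 1)) * pderiv ℂ 1 (Y (some (ricci 3)))
      + (Y (some (conn01 0)) * Y (some (ricci 4)) + 2 * Y (some (conn01 1)) * Y (some (ricci 3))
      - 3 * Y (some (conn01 2)) * Y (some (ricci 2)) - Y none * C μ *
          (C (3 / 2) * Y (some (ricci 2)) * Y (some (dzeta 2))
        - Y (some (ricci 3)) * Y (some (dzeta 1)) - C (1 / 2) * Y (some (ricci 4))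
            * Y (some (dzeta 0)))))) := ⟨_, rfl⟩
  refine ⟨fun i => match i with
    | none => 1 + fuchs 0 (X 0 * (C μ * Y (some (dzeta 0)) * Y none * Y none))
    | some (frame01 k) => ![e0,
      fuchs 1 (a0 + X 0 * (2 * Y (some (frame01 1)) * Y (some (conn01 0))))] k
    | some (frame11 k) => ![fuchs 0 (X 0 * (2 * Y (some (frame01 0)) * Y (some (conn11 0)) - 2
        * Y (some (conn11 1)))),
      fuchs 0 (b0 + X 0 * (2 * Y (some (frame01 1)) * Y (some (conn11 0))))] k
    | some (conn01 k) => ![a0,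
      fuchs 1 (X 0 * (C (1 / 2) * Y (some (ricci 1)) + 2 * Y (some (conn01 0))
          * Y (some (conn01 1)))),
      fuchs 1 (X 0 * (C (1 / 2) * Y (some (ricci 2)) + 2 * Y (some (conn01 0))
          * Y (some (conn01 2))))] k
    | some (conn11 k) => ![b0,
      fuchs 0 (X 0 * (Y (some (ricci 2)) + 2 * Y (some (conn01 1)) * Y (some (conn11 0)))),
      fuchs 0 (X 0 * (Y (some (ricci 3)) + 2 * Y (some (conn01 2)) * Y (some (conn11 0))))] k
    | some (dzeta k) => ![wPrimitive (Y (some scal)) - fuchs 0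
        (X 0 * (Y (some (ricci 0)) * Y (some zeta) * (1 - C μ * Y (some zeta)))),
      -fuchs 0 (X 0 * (Y (some (ricci 1)) * Y (some zeta) * (1 - C μ * Y (some zeta)))),
      fuchs 0 (X 0 * (Y (some scal) - Y (some (ricci 2)) * Y (some zeta) *
          (1 - C μ * Y (some zeta))))] k
    | some (ricci k) => ![s0,
      s1,
      s2,
      s3,
      s4] k
    | some zeta => fuchs 0 (X 0 * Y (some (dzeta 0)))
    | some scal => -C 2 - wPrimitive (Y (some (ricci 4)) * Y (some (dzeta 0))) - fuchs 0
        (X 0 * ((1 - C μ * Y (some zeta)) *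
    (Y (some (ricci 0)) * Y (some (dzeta 2)) - 2 * Y (some (ricci 1)) * Y (some (dzeta 1))
        + Y (some (ricci 2)) * Y (some (dzeta 0))))),
    ?_⟩
  exact ⟨rfl, h_e0, h_a0, rfl, rfl, h_b0, rfl, rfl, rfl, rfl, rfl, rfl, rfl, rfl, rfl, rfl, h_s0,
      h_s1, h_s2, h_s3, h_s4⟩

/-! ### Formal expansions are fixed points -/

/-- For power series the reduced system means the equations of `reducedList`, which contain no
denominators. -/
theorem seriesJet_reducedEquations_iff {X : FormalFields} {μ : ℂ}
    (hω : 1 - C μ * X zeta ≠ 0) :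
    (formalJet X).ReducedEquations (algebraMap Series _ (C μ)) ↔
      ∀ x ∈ reducedList (C μ) (seriesJet X), x = 0 := by
  have inj := IsFractionRing.injective Series (FractionRing Series)
  have := charZero_of_isFractionRing (FractionRing Series)
  rw [formalJet_eq, reducedEquations_iff (algebraMap_u_ne_zero (FractionRing Series)),
    ← map_reducedList]
  · simp only [List.forall_mem_map]
    refine forall₂_congr fun x _ => ?_
    rw [map_eq_zero_iff _ inj]
  · intro h
    apply hω
    apply inj
    rw [map_zero, ← h, map_sub, map_one, map_mul]
    rfl

theorem natCast_add_ne_zero {k : ℂ} (hk : 0 < k.re) (n : ℕ) : (n : ℂ) + k ≠ 0 := by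
  intro h
  have := congrArg Complex.re h
  simp only [Complex.add_re, Complex.natCast_re, Complex.zero_re] at this
  have := n.cast_nonneg (α := ℝ)
  linarith

theorem two_mul_C_half : (2 : Series) * C (1 / 2) = 1 := by
  rw [← map_ofNat C, ← map_mul]; norm_num
theorem C_three_halves : (C (3 / 2) : Series) = 3 * C (1 / 2) := by
  rw [← map_ofNat C, ← map_mul]; norm_num
theorem C_two : (C 2 : Series) = 2 := map_ofNat C 2

theorem u_ne_zero : (X 0 : Series) ≠ 0 := fun h => by
  have := coeff_index_single_self_X (R := ℂ) (0 : Fin 3)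
  rw [h] at this
  simp at this

theorem wPrimitive_neg (f : Series) : wPrimitive (-f) = -wPrimitive f := by
  ext d; simp only [map_neg, coeff_wPrimitive]; split_ifs <;> ring
theorem fuchs_neg (k : ℂ) (f : Series) : fuchs k (-f) = -fuchs k f := by
  ext d; simp only [map_neg, coeff_fuchs]; ring

theorem u_mul_pderiv_wPrimitive (f : Series) : X 0 * pderiv ℂ 0 (wPrimitive f) = 0 := by
  ext d
  rw [coeff_u_mul_pderiv, coeff_wPrimitive]
  by_cases h : d 0 = 0 <;> simp [h]

theorem uOrd_pderiv_wPrimitive (f : Series) : UOrd 1 (pderiv ℂ 2 (wPrimitive f) - f) := by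
  intro d hd
  rw [map_sub, coeff_pderiv, coeff_wPrimitive, if_pos (by simpa [Finsupp.single_apply] using hd)]
  simp
  field_simp
  simp

/-- The values of `f` on `U_0` are recovered from `∂_w f` on `U_0` and from the values on `I`, which
vanish; `g` determines the dependence on `u`. -/
theorem eq_wPrimitive_add {f g h : Series} (hI : VanishesOnI f)
    (hw : VanishesOnU (pderiv ℂ 2 f - h)) (hu : X 0 * pderiv ℂ 0 f = g) :
    f = wPrimitive h + fuchs 0 g := by
  ext d
  rw [map_add, coeff_wPrimitive, coeff_fuchs, ← hu, coeff_u_mul_pderiv, add_zero]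
  by_cases h0 : d 0 = 0
  · by_cases h2 : d 2 = 0
    · simp [h0, h2, hI d h0 h2]
    · have e := hw (d - Finsupp.single 2 1) (by simp [h0])
      rw [map_sub, coeff_pderiv, sub_eq_zero, tsub_add_cancel_of_le
        (Finsupp.single_le_iff.2 (Nat.one_le_iff_ne_zero.2 h2))] at e
      rw [if_pos ⟨h0, h2⟩, ← e, h0]
      have e2 : ((d - Finsupp.single 2 1 : Fin 3 →₀ ℕ) 2 : ℂ) + 1 = d 2 := by
        simp [Nat.cast_sub (Nat.one_le_iff_ne_zero.2 h2)]
      rw [e2]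
      field_simp
      simp
  · rw [if_neg (fun h => h0 h.1)]; field_simp; simp

/-- The equation `u ∂_w f = g` and the datum on `W_0` determine `f`. -/
theorem eq_uwPrimitive {a : ℕ → ℕ → ℂ} {f g : Series}
    (ha : ∀ d : Fin 3 →₀ ℕ, d 2 = 0 → coeff d f = a (d 0) (d 1))
    (h : X 0 * pderiv ℂ 2 f = g) : f = uwPrimitive a g := by
  ext d
  rw [coeff_uwPrimitive]
  split_ifs with h2
  · exact ha d h2
  · rw [← h, add_comm, coeff_single_add_X_mul, coeff_pderiv, tsub_add_cancel_of_le
        (Finsupp.single_le_iff.2 (Nat.one_le_iff_ne_zero.2 h2))]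
    have e2 : ((d - Finsupp.single 2 1 : Fin 3 →₀ ℕ) 2 : ℂ) + 1 = d 2 := by
        simp [Nat.cast_sub (Nat.one_le_iff_ne_zero.2 h2)]
    rw [e2]
    field_simp

theorem uwPrimitive_spec {a : ℕ → ℕ → ℂ} {g : Series} (hg : UOrd 1 g) :
    X 0 * pderiv ℂ 2 (uwPrimitive a g) = g := by
  ext d
  by_cases h0 : d 0 = 0
  · rw [coeff_u_mul_of_eq_zero h0, hg d (by omega)]
  · obtain ⟨e, he⟩ : ∃ e, d = Finsupp.single 0 1 + e := ⟨_, eq_single_add h0⟩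
    rw [he, coeff_single_add_X_mul, coeff_pderiv, coeff_uwPrimitive, if_neg (by simp)]
    rw [add_tsub_cancel_right, add_comm e]
    have : ((e + Finsupp.single 2 1 : Fin 3 →₀ ℕ) 2 : ℂ) = e 2 + 1 := by simp
    rw [this]
    have : (e 2 : ℂ) + 1 ≠ 0 := Nat.cast_add_one_ne_zero _
    field_simp

set_option maxHeartbeats 2000000 in
/-- A formal expansion, supplemented by the inverse of `1 - μ ζ`, is a fixed point. -/
theorem exists_isStep_of_formal {μ : ℂ} {ψ : NullData} {F : FormalFields}
    (h : IsFormalExpansion μ ψ F) :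
    ∃ Y : Option FieldIndex → Series, (∀ i, Y (some i) = F i) ∧ IsStep μ ψ.datumCoeff Y Y := by
  have hz : UOrd 1 (F zeta) := vanishesOnU_iff.1 h.zeta
  have hc : constantCoeff (1 - C μ * F zeta) ≠ 0 := by
    rw [map_sub, map_mul, map_one, ← coeff_zero_eq_constantCoeff_apply (F zeta), hz 0 (by simp)]
    simp
  obtain ⟨η, hη⟩ : ∃ η, η * (1 - C μ * F zeta) = 1 :=
    ⟨_, MvPowerSeries.inv_mul_cancel _ hc⟩
  have hω := right_ne_zero_of_mul_eq_one hη
  have hred := (seriesJet_reducedEquations_iff hω).1 h.reduced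
  simp only [reducedList, List.forall_mem_cons, List.not_mem_nil, false_imp_iff, implies_true,
    and_true, seriesJet, Jet.dir01, Jet.dir11, Jet.grad] at hred
  obtain ⟨e1, e2, e3, e4, e5, e6, e7, e8, e9, e10, e11, e12, e13, e14, e15, e16, e17, e18, e19,
    e20⟩ := hred
  have c := two_mul_C_half
  have c2 : (2 : Series) ≠ 0 := left_ne_zero_of_mul_eq_one c
  have g : ∀ i : FieldIndex, i.IsGauge → UOrd 1 (F i) := fun i hi => vanishesOnU_iff.1
      (h.gauge i hi)
  have hdm : pderiv ℂ 0 (C μ : Series) = 0 := pderiv_C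
  have hdz : (1 - C μ * F zeta) * pderiv ℂ 0 η = η * (C μ * F (dzeta 0)) := by
    have := congrArg (pderiv ℂ 0) hη
    rw [Derivation.leibniz, map_sub, Derivation.leibniz, hdm, Derivation.map_one_eq_zero] at this
    simp only [smul_eq_mul] at this
    linear_combination this + η * C μ * e11
  refine ⟨fun i => i.elim η F, fun i => rfl, ?_⟩
  constructor <;> simp only [Option.elim]
  · have := eq_fuchs_zero (f := η - 1) (g := X 0 * (C μ * F (dzeta 0) * η * η)) ?_ ?_
    · rw [← this]; ring
    · have : η - 1 = η * C μ * F zeta := by linear_combination hη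
      rw [this]; exact hz.mul_left _
    · rw [map_sub, Derivation.map_one_eq_zero]
      linear_combination X 0 * η * hdz - X 0 * pderiv ℂ 0 η * hη
  · exact eq_fuchs (natCast_add_ne_zero (by norm_num)) (by rw [map_one]; linear_combination e1)
  · refine eq_fuchs (natCast_add_ne_zero (by norm_num)) ?_
    rw [C_two]
    linear_combination C (1 / 2) * e5 - (X 0 * pderiv ℂ 0 (F (conn01 0)) + 2 * F (conn01 0)
      - 2 * X 0 * F (conn01 0) ^ 2) * c
  · refine eq_fuchs (natCast_add_ne_zero (by norm_num)) ?_
    rw [map_one]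
    linear_combination C (1 / 2) * e7 - (X 0 * pderiv ℂ 0 (F (conn01 1)) + F (conn01 1)
      - 2 * X 0 * F (conn01 0) * F (conn01 1)) * c
  · refine eq_fuchs (natCast_add_ne_zero (by norm_num)) ?_
    rw [map_one]
    linear_combination C (1 / 2) * e9 - (X 0 * pderiv ℂ 0 (F (conn01 2)) + F (conn01 2)
      - 2 * X 0 * F (conn01 0) * F (conn01 2)) * c
  · exact eq_fuchs (natCast_add_ne_zero (by norm_num)) (by rw [map_one]; linear_combination e6)
  · exact eq_fuchs_zero (g _ trivial) (by linear_combination X 0 * e8)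
  · exact eq_fuchs_zero (g _ trivial) (by linear_combination X 0 * e10)
  · exact eq_fuchs (natCast_add_ne_zero (by norm_num)) (by rw [map_one]; linear_combination e2)
  · exact eq_fuchs_zero (g _ trivial) (by linear_combination X 0 * e3)
  · exact eq_fuchs_zero (g _ trivial) (by linear_combination e4)
  · exact eq_fuchs_zero hz (by linear_combination X 0 * e11)
  · rw [sub_eq_add_neg, ← fuchs_neg]
    exact eq_wPrimitive_add h.zeta00I h.zeta00 (by linear_combination X 0 * e12)
  · rw [← fuchs_neg]
    exact eq_fuchs_zero (vanishesOnU_iff.1 h.zeta01) (by linear_combination X 0 * e13)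
  · exact eq_fuchs_zero (vanishesOnU_iff.1 h.zeta11) (by linear_combination X 0 * e14)
  · have := eq_wPrimitive_add (f := F scal + C 2) (h := -(F (ricci 4) * F (dzeta 0)))
      (g := -(X 0 * ((1 - C μ * F zeta) *
    (F (ricci 0) * F (dzeta 2) - 2 * F (ricci 1) * F (dzeta 1) + F (ricci 2) * F (dzeta 0)))))
      h.scalI ?_ ?_
    · rw [wPrimitive_neg, fuchs_neg] at this
      linear_combination this
    · rw [map_add, pderiv_C, add_zero, sub_neg_eq_add]; exact h.scal
    · rw [map_add, pderiv_C]; linear_combination X 0 * e15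
  · refine eq_uwPrimitive h.datum ?_
    rw [C_three_halves]
    apply mul_left_cancel₀ c2
    apply mul_left_cancel₀ hω
    linear_combination e20 + X 0 * C μ * (3 * F (ricci 2) * F (dzeta 0)
      - 2 * F (ricci 1) * F (dzeta 1) - F (ricci 0) * F (dzeta 2)) * hη - (1 - C μ * F zeta) *
      (pderiv ℂ 1 (F (ricci 1)) - 3 * F (ricci 2) + X 0 * η * C μ * (F (ricci 0) * F (dzeta 2)
      - 3 * F (ricci 2) * F (dzeta 0))) * c
  · refine eq_fuchs (natCast_add_ne_zero (by norm_num)) ?_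
    rw [C_two]
    apply mul_left_cancel₀ c2
    apply mul_left_cancel₀ hω
    linear_combination e16 + 4 * X 0 * C μ * (F (ricci 0) * F (dzeta 1)
      - F (ricci 1) * F (dzeta 0)) * hη - (1 - C μ * F zeta) * pderiv ℂ 1 (F (ricci 0)) * c
  · refine eq_fuchs (natCast_add_ne_zero (by norm_num)) ?_
    rw [C_three_halves]
    apply mul_left_cancel₀ c2
    apply mul_left_cancel₀ hω
    linear_combination e17 + X 0 * C μ * (F (ricci 0) * F (dzeta 2)
      + 2 * F (ricci 1) * F (dzeta 1) - 3 * F (ricci 2) * F (dzeta 0)) * hη - (1 - C μ * F zeta) *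
      (pderiv ℂ 1 (F (ricci 1)) - 3 * F (ricci 2) - X 0 * η * C μ * (F (ricci 0) * F (dzeta 2)
      - 3 * F (ricci 2) * F (dzeta 0))) * c
  · refine eq_fuchs (natCast_add_ne_zero (by norm_num)) ?_
    rw [map_one]
    apply mul_left_cancel₀ c2
    apply mul_left_cancel₀ hω
    linear_combination e18 + 2 * X 0 * C μ * (F (ricci 1) * F (dzeta 2)
      - F (ricci 3) * F (dzeta 0)) * hη - (1 - C μ * F zeta) * pderiv ℂ 1 (F (ricci 2)) * c
  · refine eq_fuchs (natCast_add_ne_zero (by norm_num)) ?_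
    rw [C_three_halves]
    apply mul_left_cancel₀ c2
    apply mul_left_cancel₀ hω
    linear_combination e19 + X 0 * C μ * (3 * F (ricci 2) * F (dzeta 2)
      - 2 * F (ricci 3) * F (dzeta 1) - F (ricci 4) * F (dzeta 0)) * hη - (1 - C μ * F zeta) *
      (pderiv ℂ 1 (F (ricci 3)) - F (ricci 4) - X 0 * η * C μ * (3 * F (ricci 2) * F (dzeta 2)
      - F (ricci 4) * F (dzeta 0))) * c

/-! ### Fixed points are formal expansions -/

/-- The monomials `u^m v^n w^p` of `f` satisfy `n ≤ 2 m + k`. -/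
def VDegLE (k : ℤ) (f : Series) : Prop :=
  ∀ d : Fin 3 →₀ ℕ, coeff d f ≠ 0 → (d 1 : ℤ) ≤ 2 * d 0 + k

theorem VDegLE.uOrd_pderiv {f : Series} (h : VDegLE 0 f) : UOrd 1 (pderiv ℂ 1 f) := by
  intro d hd
  rw [coeff_pderiv]
  by_contra hc
  have := h _ (left_ne_zero_of_mul hc)
  simp only [Finsupp.add_apply, Finsupp.single_apply] at this
  simp at this
  omega

theorem spec_of_eq_fuchs {k : ℂ} (hk : 0 < k.re) {f g : Series} (h : f = fuchs k g) :
    X 0 * pderiv ℂ 0 f + C k * f = g := by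
  rw [h, fuchs_spec (natCast_add_ne_zero hk)]

theorem pderiv_of_eq_fuchs {f g : Series} (h : f = fuchs 0 (X 0 * g)) : pderiv ℂ 0 f = g := by
  apply mul_left_cancel₀ u_ne_zero
  rw [h, fuchs_zero_spec (by simpa using (UOrd.zero g).u_mul)]

theorem uOrd_u_mul (f : Series) : UOrd 1 (X 0 * f) := by simpa using (UOrd.zero f).u_mul

theorem vanishesOnI_wPrimitive (f : Series) : VanishesOnI (wPrimitive f) := fun d _ h2 => by
  rw [coeff_wPrimitive, if_neg (fun h => h.2 h2)]

theorem UOrd.vanishesOnI {f : Series} (h : UOrd 1 f) : VanishesOnI f := fun d h0 _ =>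
  h d (by omega)

set_option maxHeartbeats 2000000 in
/-- A fixed point is a formal expansion. -/
theorem formal_of_isStep {μ : ℂ} {ψ : NullData} {Y : Option FieldIndex → Series}
    (h : IsStep μ ψ.datumCoeff Y Y) :
    IsFormalExpansion μ ψ (fun i => Y (some i)) ∧ Y none * (1 - C μ * Y (some zeta)) = 1 ∧
      (∀ x ∈ reducedList (C μ) (seriesJet fun i => Y (some i)), x = 0) ∧
      (VDegLE 0 (Y (some (dzeta 0))) → VDegLE 0 (Y (some scal)) → VDegLE 0 (Y (some (ricci 4))) →
        ConeConditions fun i => Y (some i)) := by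
  have c := two_mul_C_half
  obtain ⟨A, _, π, hπ⟩ := exists_ringHom_eq_zero_iff_uOrd 1
  have c2 : (2 : Series) ≠ 0 := left_ne_zero_of_mul_eq_one c
  have gE0 : UOrd 1 (Y (some (frame01 0))) := by rw [h.frame01_0]; exact (uOrd_u_mul _).fuchs _
  have ga0 : UOrd 1 (Y (some (conn01 0))) := by rw [h.conn01_0]; exact (uOrd_u_mul _).fuchs _
  have ga1 : UOrd 1 (Y (some (conn01 1))) := by rw [h.conn01_1]; exact (uOrd_u_mul _).fuchs _
  have ga2 : UOrd 1 (Y (some (conn01 2))) := by rw [h.conn01_2]; exact (uOrd_u_mul _).fuchs _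
  have gb0 : UOrd 1 (Y (some (conn11 0))) := by rw [h.conn11_0]; exact (uOrd_u_mul _).fuchs _
  have gb1 : UOrd 1 (Y (some (conn11 1))) := by rw [h.conn11_1]; exact (uOrd_u_mul _).fuchs _
  have gb2 : UOrd 1 (Y (some (conn11 2))) := by rw [h.conn11_2]; exact (uOrd_u_mul _).fuchs _
  have gE1 : UOrd 1 (Y (some (frame01 1))) := by
    rw [h.frame01_1]; exact (ga0.add (uOrd_u_mul _)).fuchs _
  have gF0 : UOrd 1 (Y (some (frame11 0))) := by rw [h.frame11_0]; exact (uOrd_u_mul _).fuchs _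
  have gF1' := gb0.add (uOrd_u_mul (2 * Y (some (frame01 1)) * Y (some (conn11 0))))
  have gF1 : UOrd 1 (Y (some (frame11 1))) := by rw [h.frame11_1]; exact gF1'.fuchs _
  have gz : UOrd 1 (Y (some zeta)) := by rw [h.eq_zeta]; exact uOrd_fuchs_zero _
  have gz1 : UOrd 1 (Y (some (dzeta 1))) := by rw [h.dzeta_1]; exact (uOrd_fuchs_zero _).neg
  have gz2 : UOrd 1 (Y (some (dzeta 2))) := by rw [h.dzeta_2]; exact uOrd_fuchs_zero _
  have q_z := pderiv_of_eq_fuchs h.eq_zeta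
  have q_η : pderiv ℂ 0 (Y none) = C μ * Y (some (dzeta 0)) * Y none * Y none := by
    have := pderiv_of_eq_fuchs (sub_eq_of_eq_add' h.eta)
    rw [← this, map_sub, Derivation.map_one_eq_zero, sub_zero]
  have q_z0 : pderiv ℂ 0 (Y (some (dzeta 0))) =
      -(Y (some (ricci 0)) * Y (some zeta) * (1 - C μ * Y (some zeta))) := by
    apply mul_left_cancel₀ u_ne_zero
    rw [h.dzeta_0, map_sub, mul_sub, u_mul_pderiv_wPrimitive, fuchs_zero_spec (uOrd_u_mul _)]
    ring
  have q_z1 : pderiv ℂ 0 (Y (some (dzeta 1))) =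
      -(Y (some (ricci 1)) * Y (some zeta) * (1 - C μ * Y (some zeta))) :=
    pderiv_of_eq_fuchs (by rw [mul_neg, fuchs_neg]; exact h.dzeta_1)
  have q_z2 := pderiv_of_eq_fuchs h.dzeta_2
  have q_s : pderiv ℂ 0 (Y (some scal)) = -((1 - C μ * Y (some zeta)) *
      (Y (some (ricci 0)) * Y (some (dzeta 2)) - 2 * Y (some (ricci 1)) * Y (some (dzeta 1))
        + Y (some (ricci 2)) * Y (some (dzeta 0)))) := by
    apply mul_left_cancel₀ u_ne_zero
    rw [h.eq_scal]
    simp only [map_sub, map_neg, pderiv_C, mul_sub, u_mul_pderiv_wPrimitive]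
    rw [fuchs_zero_spec (uOrd_u_mul _)]
    ring
  have q_E0 := spec_of_eq_fuchs (by norm_num) h.frame01_0
  have q_E1 := spec_of_eq_fuchs (by norm_num) h.frame01_1
  have q_F0 := pderiv_of_eq_fuchs h.frame11_0
  have q_F1 := fuchs_zero_spec gF1'
  rw [← h.frame11_1] at q_F1
  have q_a0 := spec_of_eq_fuchs (by norm_num) h.conn01_0
  have q_a1 := spec_of_eq_fuchs (by norm_num) h.conn01_1
  have q_a2 := spec_of_eq_fuchs (by norm_num) h.conn01_2
  have q_b0 := spec_of_eq_fuchs (by norm_num) h.conn11_0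
  have q_b1 := pderiv_of_eq_fuchs h.conn11_1
  have q_b2 := pderiv_of_eq_fuchs h.conn11_2
  have q_s1 := spec_of_eq_fuchs (by norm_num) h.ricci_1
  have q_s2 := spec_of_eq_fuchs (by norm_num) h.ricci_2
  have q_s3 := spec_of_eq_fuchs (by norm_num) h.ricci_3
  have q_s4 := spec_of_eq_fuchs (by norm_num) h.ricci_4
  rw [C_two] at q_a0 q_s1
  rw [C_three_halves] at q_s2 q_s4
  rw [map_one] at q_a1 q_a2 q_b0 q_E0 q_E1 q_s3
  have q_s0 := uwPrimitive_spec (a := ψ.datumCoeff) (g := C (1 / 2) * pderiv ℂ 1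
      (Y (some (ricci 1)))
    + Y (some (frame01 0)) * (X 0 * pderiv ℂ 0 (Y (some (ricci 1))))
    - Y (some (frame11 0)) * (X 0 * pderiv ℂ 0 (Y (some (ricci 0)))) - C (3 / 2)
        * Y (some (ricci 2))
    + X 0 * (Y (some (frame01 1)) * pderiv ℂ 1 (Y (some (ricci 1))) -
      Y (some (frame11 1)) * pderiv ℂ 1 (Y (some (ricci 0)))
      + (3 * Y (some (conn01 0)) * Y (some (ricci 2)) - 2 * Y (some (conn01 1)) * Y (some (ricci 1))
      - Y (some (conn01 2)) * Y (some (ricci 0)) - 4 * Y (some (conn11 0)) * Y (some (ricci 1))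
      + 4 * Y (some (conn11 1)) * Y (some (ricci 0)) + Y none * C μ *
        (C (1 / 2) * Y (some (ricci 0)) * Y (some (dzeta 2))
        + Y (some (ricci 1)) * Y (some (dzeta 1))
        - C (3 / 2) * Y (some (ricci 2)) * Y (some (dzeta 0)))))) (by
      rw [← hπ]
      have hu := (hπ _).2 UOrd.X_one
      have e := congrArg (π) q_s2
      simp only [map_add, map_sub, map_mul, hu, zero_mul, mul_zero, add_zero, sub_zero, zero_add,
        C_three_halves] at e ⊢
      rw [e, sub_self])
  rw [← h.ricci_0, C_three_halves] at q_s0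
  have hη : Y none * (1 - C μ * Y (some zeta)) = 1 := by
    have h1 : UOrd 1 (Y none - 1) := by
      rw [h.eta, add_sub_cancel_left]; exact uOrd_fuchs_zero _
    have hq : Y none * (1 - C μ * Y (some zeta)) - 1 = 0 := by
      refine UOrd.eq_zero_of_fuchs (q₀ := 1) (n := 0) (a := 2 * C μ * Y (some (dzeta 0)) * Y none)
        ?_ ?_ (by norm_num)
      · have : Y none * (1 - C μ * Y (some zeta)) - 1 =
          (1 - C μ * Y (some zeta)) * (Y none - 1) - C μ * Y (some zeta) := by ring
        rw [this]
        exact (h1.mul_left _).sub (gz.mul_left _)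
      · rw [map_sub, Derivation.leibniz, map_sub, Derivation.leibniz, Derivation.map_one_eq_zero,
          pderiv_C, q_z, q_η]
        simp only [smul_eq_mul]
        push_cast
        ring
    exact sub_eq_zero.1 hq
  have hω := right_ne_zero_of_mul_eq_one hη
  have hred : ∀ x ∈ reducedList (C μ) (seriesJet fun i => Y (some i)), x = 0 := by
    simp only [reducedList, List.forall_mem_cons, List.not_mem_nil, false_imp_iff, implies_true,
      and_true, seriesJet, Jet.dir01, Jet.dir11, Jet.grad]
    generalize Y none = η at *
    generalize Y (some (dzeta 0)) = z0 at *
    generalize Y (some (dzeta 1)) = z1 at *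
    generalize Y (some (dzeta 2)) = z2 at *
    generalize Y (some zeta) = z at *
    generalize Y (some (ricci 0)) = s0 at *
    generalize Y (some (ricci 1)) = s1 at *
    generalize Y (some (ricci 2)) = s2 at *
    generalize Y (some (ricci 3)) = s3 at *
    generalize Y (some (ricci 4)) = s4 at *
    refine ⟨?_, ?_, ?_, ?_, ?_, ?_, ?_, ?_, ?_, ?_, ?_, ?_, ?_, ?_, ?_, ?_, ?_, ?_, ?_, ?_⟩
    · linear_combination q_E0
    · linear_combination q_E1
    · linear_combination q_F0
    · linear_combination q_F1
    · linear_combination 2 * q_a0 + X 0 * s0 * c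
    · linear_combination q_b0
    · linear_combination 2 * q_a1 + X 0 * s1 * c
    · linear_combination q_b1
    · linear_combination 2 * q_a2 + X 0 * s2 * c
    · linear_combination q_b2
    · linear_combination q_z
    · linear_combination q_z0
    · linear_combination q_z1
    · linear_combination q_z2
    · linear_combination q_s
    · linear_combination (1 - C μ * z) * 2 * q_s1 - 4 * X 0 * C μ * (s0 * z1 - s1 * z0) * hη +
        (1 - C μ * z) * pderiv ℂ 1 s0 * c
    · linear_combination (1 - C μ * z) * 2 * q_s2 - X 0 * C μ * (s0 * z2 + 2 * s1 * z1
        - 3 * s2 * z0) * hη + (1 - C μ * z) * (pderiv ℂ 1 s1 - 3 * s2 - X 0 * η * C μ * (s0 * z2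
        - 3 * s2 * z0)) * c
    · linear_combination (1 - C μ * z) * 2 * q_s3 - 2 * X 0 * C μ * (s1 * z2 - s3 * z0) * hη +
        (1 - C μ * z) * pderiv ℂ 1 s2 * c
    · linear_combination (1 - C μ * z) * 2 * q_s4 - X 0 * C μ * (3 * s2 * z2
        - 2 * s3 * z1 - s4 * z0) * hη + (1 - C μ * z) * (pderiv ℂ 1 s3 - s4 - X 0 * η * C μ *
        (3 * s2 * z2 - s4 * z0)) * c
    · linear_combination (1 - C μ * z) * 2 * q_s0 - X 0 * C μ * (3 * s2 * z0
        - 2 * s1 * z1 - s0 * z2) * hη + (1 - C μ * z) * (pderiv ℂ 1 s1 - 3 * s2 + X 0 * η * C μ *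
        (s0 * z2 - 3 * s2 * z0)) * c
  have gauge : ∀ i : FieldIndex, i.IsGauge → UOrd 1 (Y (some i)) := by
    intro i hi
    rcases i with k | k | k | k | _ | k | _ | k
    all_goals try fin_cases k
    all_goals first | assumption | exact hi.elim
  have w_z0 : UOrd 1 (pderiv ℂ 2 (Y (some (dzeta 0))) - Y (some scal)) := by
    rw [h.dzeta_0, map_sub, sub_right_comm]
    exact (uOrd_pderiv_wPrimitive _).sub ((uOrd_fuchs_zero _).pderiv_of_ne (by decide))
  have w_s : UOrd 1 (pderiv ℂ 2 (Y (some scal)) + Y (some (ricci 4)) * Y (some (dzeta 0))) := by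
    rw [h.eq_scal, map_sub, map_sub, map_neg, pderiv_C]
    have := ((uOrd_pderiv_wPrimitive (Y (some (ricci 4)) * Y (some (dzeta 0)))).add
      ((uOrd_fuchs_zero (X 0 * ((1 - C μ * Y (some zeta)) *
      (Y (some (ricci 0)) * Y (some (dzeta 2)) - 2 * Y (some (ricci 1)) * Y (some (dzeta 1))
        + Y (some (ricci 2)) * Y (some (dzeta 0)))))).pderiv_of_ne (b := 2) (by decide))).neg
    convert this using 1
    ring
  have hu := (hπ _).2 UOrd.X_one
  have hcm : 2 * π (C (1 / 2)) = 1 := by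
    rw [← map_ofNat (π), ← map_mul, c, map_one]
  have gv0 : UOrd 1 (pderiv ℂ 1 (Y (some (ricci 0))) - 4 * Y (some (ricci 1))) := by
    rw [← hπ]
    have e := congrArg (π) q_s1
    simp only [map_add, map_sub, map_mul, hu, zero_mul, mul_zero, add_zero, sub_zero, zero_add,
      map_ofNat, map_one, one_mul] at e ⊢
    linear_combination -2 * e - π (pderiv ℂ 1 (Y (some (ricci 0)))) * hcm
  have gv1 : UOrd 1 (pderiv ℂ 1 (Y (some (ricci 1))) - 3 * Y (some (ricci 2))) := by
    rw [← hπ]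
    have e := congrArg (π) q_s2
    simp only [map_add, map_sub, map_mul, hu, zero_mul, mul_zero, add_zero, sub_zero, zero_add,
      map_ofNat, map_one, one_mul] at e ⊢
    linear_combination -2 * e - (π (pderiv ℂ 1 (Y (some (ricci 1))))
      - 3 * π (Y (some (ricci 2)))) * hcm
  have gv2 : UOrd 1 (pderiv ℂ 1 (Y (some (ricci 2))) - 2 * Y (some (ricci 3))) := by
    rw [← hπ]
    have e := congrArg (π) q_s3
    simp only [map_add, map_sub, map_mul, hu, zero_mul, mul_zero, add_zero, sub_zero, zero_add,
      map_ofNat, map_one, one_mul] at e ⊢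
    linear_combination -2 * e - π (pderiv ℂ 1 (Y (some (ricci 2)))) * hcm
  have gv3 : UOrd 1 (pderiv ℂ 1 (Y (some (ricci 3))) - Y (some (ricci 4))) := by
    rw [← hπ]
    have e := congrArg (π) q_s4
    simp only [map_add, map_sub, map_mul, hu, zero_mul, mul_zero, add_zero, sub_zero, zero_add,
      map_ofNat, map_one, one_mul] at e ⊢
    linear_combination -2 * e - (π (pderiv ℂ 1 (Y (some (ricci 3))))
      - π (Y (some (ricci 4)))) * hcm
  have hR := (seriesJet_reducedEquations_iff (X := fun i => Y (some i)) hω).2 hred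
  refine ⟨⟨hR,
    fun i hi => vanishesOnU_iff.2 (gauge i hi), vanishesOnU_iff.2 gz, vanishesOnU_iff.2 gz1,
    vanishesOnU_iff.2 gz2, vanishesOnU_iff.2 w_z0, vanishesOnU_iff.2 w_s, ?_, ?_, ?_, ?_⟩, hη, hred,
    fun t0 ts t4 => ⟨gauge, gz, gz1, gz2, w_z0, w_s, t0.uOrd_pderiv, ts.uOrd_pderiv, gv2, gv3,
      t4.uOrd_pderiv⟩⟩
  · intro d h0 h2
    rw [h.dzeta_0, map_sub, vanishesOnI_wPrimitive _ d h0 h2,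
      (uOrd_fuchs_zero _).vanishesOnI d h0 h2, sub_zero]
  · intro d h0 h2
    rw [h.eq_scal, map_add, map_sub, map_sub, vanishesOnI_wPrimitive _ d h0 h2,
      (uOrd_fuchs_zero _).vanishesOnI d h0 h2, map_neg]
    ring
  · intro k
    rw [vanishesOnU_iff]
    have n3 : (4 : ℂ) - 1 = 3 := by norm_num
    have n2 : (4 : ℂ) - 2 = 2 := by norm_num
    have n1 : (4 : ℂ) - 3 = 1 := by norm_num
    fin_cases k
    · simpa [map_ofNat (C : ℂ →+* Series)] using gv0
    · simpa [n3, map_ofNat (C : ℂ →+* Series)] using gv1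
    · simpa [n2, map_ofNat (C : ℂ →+* Series)] using gv2
    · simpa [n1] using gv3
  · intro d h2
    rw [h.ricci_0, coeff_uwPrimitive, if_pos h2]

/-! ### Contraction, and the degree in `v` -/

/-- The weight in which the map of `IsStep` is contracting. -/
def wt (d : Fin 3 →₀ ℕ) : ℕ := d 0 + 2 * d 2

theorem wt_add (d e : Fin 3 →₀ ℕ) : wt (d + e) = wt d + wt e := by
  simp only [wt, Finsupp.add_apply]; ring

/-- The coefficients of weight less than `q` agree. -/
def Agree (q : ℕ) (f g : Series) : Prop := ∀ d : Fin 3 →₀ ℕ, wt d < q → coeff d f = coeff d g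

namespace Agree
variable {q : ℕ} {f f' g g' : Series}

theorem rfl' (f : Series) : Agree q f f := fun _ _ => rfl
theorem symm (h : Agree q f g) : Agree q g f := fun d hd => (h d hd).symm
theorem trans {k : Series} (h : Agree q f g) (h' : Agree q g k) : Agree q f k :=
  fun d hd => (h d hd).trans (h' d hd)
theorem mono {p : ℕ} (h : Agree q f g) (hp : p ≤ q) : Agree p f g := fun d hd => h d
    (hd.trans_le hp)
theorem zero (f g : Series) : Agree 0 f g := fun _ h => absurd h (Nat.not_lt_zero _)
theorem add (h : Agree q f g) (h' : Agree q f' g') : Agree q (f + f') (g + g') := fun d hd => by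
  rw [map_add, map_add, h d hd, h' d hd]
theorem neg (h : Agree q f g) : Agree q (-f) (-g) := fun d hd => by
  rw [map_neg, map_neg, h d hd]
theorem sub (h : Agree q f g) (h' : Agree q f' g') : Agree q (f - f') (g - g') := fun d hd => by
  rw [map_sub, map_sub, h d hd, h' d hd]
theorem mul (h : Agree q f g) (h' : Agree q f' g') : Agree q (f * f') (g * g') := fun d hd => by
  classical
  rw [coeff_mul, coeff_mul]
  refine Finset.sum_congr rfl fun x hx => ?_
  have := wt_add x.1 x.2
  rw [Finset.HasAntidiagonal.mem_antidiagonal.1 hx] at this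
  rw [h _ (by omega), h' _ (by omega)]
theorem u_mul (h : Agree q f g) : Agree (q + 1) (X 0 * f) (X 0 * g) := fun d hd => by
  by_cases h0 : d 0 = 0
  · rw [coeff_u_mul_of_eq_zero h0, coeff_u_mul_of_eq_zero h0]
  · obtain ⟨e, rfl⟩ : ∃ e, d = Finsupp.single 0 1 + e := ⟨_, eq_single_add h0⟩
    rw [coeff_single_add_X_mul, coeff_single_add_X_mul, h]
    rw [wt_add] at hd
    simp [wt] at hd ⊢
    omega
theorem pderiv1 (h : Agree q f g) : Agree q (pderiv ℂ 1 f) (pderiv ℂ 1 g) := fun d hd => by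
  rw [coeff_pderiv, coeff_pderiv, h]
  rw [wt_add]
  simpa [wt] using hd
theorem u_mul_pderiv (h : Agree q f g) : Agree q (X 0 * pderiv ℂ 0 f) (X 0 * pderiv ℂ 0 g) :=
  fun d hd => by
    rw [coeff_u_mul_pderiv, coeff_u_mul_pderiv, h d hd]
theorem fuchs (k : ℂ) (h : Agree q f g) :
    Agree q (StaticVacuum.fuchs k f) (StaticVacuum.fuchs k g) := fun d hd => by
  rw [coeff_fuchs, coeff_fuchs, h d hd]
theorem wPrimitive (h : Agree q f g) :
    Agree (q + 1) (StaticVacuum.wPrimitive f) (StaticVacuum.wPrimitive g) := fun d hd => by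
  rw [coeff_wPrimitive, coeff_wPrimitive]
  split_ifs with h0
  · rw [h]
    simp [wt] at hd ⊢
    omega
  · rfl
theorem uwPrimitive (a : ℕ → ℕ → ℂ) (h : Agree q f g) :
    Agree (q + 1) (StaticVacuum.uwPrimitive a f) (StaticVacuum.uwPrimitive a g) := fun d hd => by
  rw [coeff_uwPrimitive, coeff_uwPrimitive]
  split_ifs with h0
  · rfl
  · rw [h]
    simp [wt] at hd ⊢
    omega
theorem eq (h : ∀ q, Agree q f g) : f = g := by
  ext d; exact h _ d (Nat.lt_succ_self _)
end Agree

set_option maxHeartbeats 2000000 in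
/-- The step is contracting for the weight `m + 2 p`: a factor `u` raises the weight by one and an
integration over `w` by two, of which the quotient by `u` in the equation for `s_0` costs one, while
`∂_v` and `u ∂_u` preserve it. Terms without any gain contain only entries of `Z` which have been
treated before. -/
theorem IsStep.agree {μ : ℂ} {a : ℕ → ℕ → ℂ} {Y Y' Z Z' : Option FieldIndex → Series}
    (h : IsStep μ a Y Z) (h' : IsStep μ a Y' Z') {q : ℕ} (hY : ∀ i, Agree q (Y i) (Y' i)) :
    ∀ i, Agree (q + 1) (Z i) (Z' i) := by
  have key : ∀ G G', Agree q G G' → ∀ k, Agree (q + 1) (fuchs k (X 0 * G)) (fuchs k (X 0 * G')) :=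
    fun G G' hG k => hG.u_mul.fuchs k
  have e0 : Agree (q + 1) (Z (some (frame01 0))) (Z' (some (frame01 0))) := by
    rw [h.frame01_0, h'.frame01_0]
    apply key
    repeat' with_reducible first
      | exact hY _ | exact Agree.rfl' _ | apply Agree.sub | apply Agree.mul
  have a0 : Agree (q + 1) (Z (some (conn01 0))) (Z' (some (conn01 0))) := by
    rw [h.conn01_0, h'.conn01_0]
    apply key
    repeat' with_reducible first
      | exact hY _ | exact Agree.rfl' _ | apply Agree.add | apply Agree.mul
  have b0 : Agree (q + 1) (Z (some (conn11 0))) (Z' (some (conn11 0))) := by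
    rw [h.conn11_0, h'.conn11_0]
    apply key
    repeat' with_reducible first
      | exact hY _ | exact Agree.rfl' _ | apply Agree.add | apply Agree.mul
  have s0 : Agree (q + 1) (Z (some (ricci 0))) (Z' (some (ricci 0))) := by
    rw [h.ricci_0, h'.ricci_0]
    apply Agree.uwPrimitive
    repeat' with_reducible first
      | exact hY _ | exact Agree.rfl' _ | apply Agree.u_mul_pderiv | apply Agree.pderiv1
      | apply Agree.add | apply Agree.sub | apply Agree.mul
  have tail : ∀ {k : ℂ} {A A' G G' : Series}, Agree (q + 1) A A' → Agree q G G' → Agree (q + 1)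
      (fuchs k (C (1 / 2) * pderiv ℂ 1 A + Z (some (frame01 0)) * (X 0 * pderiv ℂ 0 A) + X 0 * G))
      (fuchs k (C (1 / 2) * pderiv ℂ 1 A' + Z' (some (frame01 0)) * (X 0 * pderiv ℂ 0 A') +
        X 0 * G')) := fun hA hG =>
    ((((Agree.rfl' _).mul hA.pderiv1).add (e0.mul hA.u_mul_pderiv)).add hG.u_mul).fuchs _
  have s1 : Agree (q + 1) (Z (some (ricci 1))) (Z' (some (ricci 1))) := by
    rw [h.ricci_1, h'.ricci_1]
    apply tail s0
    repeat' with_reducible first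
      | exact hY _ | exact Agree.rfl' _ | apply Agree.pderiv1
      | apply Agree.add | apply Agree.sub | apply Agree.mul
  have s2 : Agree (q + 1) (Z (some (ricci 2))) (Z' (some (ricci 2))) := by
    rw [h.ricci_2, h'.ricci_2]
    apply tail s1
    repeat' with_reducible first
      | exact hY _ | exact Agree.rfl' _ | apply Agree.pderiv1
      | apply Agree.add | apply Agree.sub | apply Agree.mul
  have s3 : Agree (q + 1) (Z (some (ricci 3))) (Z' (some (ricci 3))) := by
    rw [h.ricci_3, h'.ricci_3]
    apply tail s2
    repeat' with_reducible first
      | exact hY _ | exact Agree.rfl' _ | apply Agree.pderiv1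
      | apply Agree.add | apply Agree.sub | apply Agree.mul
  have s4 : Agree (q + 1) (Z (some (ricci 4))) (Z' (some (ricci 4))) := by
    rw [h.ricci_4, h'.ricci_4]
    apply tail s3
    repeat' with_reducible first
      | exact hY _ | exact Agree.rfl' _ | apply Agree.pderiv1
      | apply Agree.add | apply Agree.sub | apply Agree.mul
  intro i
  rcases i with _ | (k | k | k | k | _ | k | _ | k)
  all_goals try fin_cases k
  all_goals first | assumption | skip
  all_goals try simp only [Fin.zero_eta, Fin.mk_one, Fin.reduceFinMk, Fin.isValue]
  all_goals first
    | rw [h.eta, h'.eta] | rw [h.frame01_1, h'.frame01_1] | rw [h.frame11_0, h'.frame11_0]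
    | rw [h.frame11_1, h'.frame11_1] | rw [h.conn01_1, h'.conn01_1] | rw [h.conn01_2, h'.conn01_2]
    | rw [h.conn11_1, h'.conn11_1] | rw [h.conn11_2, h'.conn11_2] | rw [h.eq_zeta, h'.eq_zeta]
    | rw [h.dzeta_0, h'.dzeta_0] | rw [h.dzeta_1, h'.dzeta_1] | rw [h.dzeta_2, h'.dzeta_2]
    | rw [h.eq_scal, h'.eq_scal]
  all_goals repeat' with_reducible first
    | exact hY _ | exact Agree.rfl' _ | assumption | apply key | apply Agree.u_mul
    | apply Agree.wPrimitive
    | apply Agree.fuchs | apply Agree.neg | apply Agree.add | apply Agree.sub | apply Agree.mul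

theorem IsStep.fixedPoint_unique {μ : ℂ} {a : ℕ → ℕ → ℂ} {Y Y' : Option FieldIndex → Series}
    (h : IsStep μ a Y Y) (h' : IsStep μ a Y' Y') : Y = Y' := by
  have : ∀ q i, Agree q (Y i) (Y' i) := by
    intro q
    induction q with
    | zero => exact fun i => Agree.zero _ _
    | succ q ih => exact h.agree h' ih
  exact funext fun i => Agree.eq fun q => this q i

/-- The fixed point exists, and it is the limit of the iterates, so that it inherits their
properties. -/
theorem exists_fixedPoint (μ : ℂ) (a : ℕ → ℕ → ℂ) :
    ∃ Y, IsStep μ a Y Y ∧ ∀ P : (Option FieldIndex → Series) → Prop, P 0 →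
      (∀ Y Z, P Y → IsStep μ a Y Z → P Z) → ∀ q, ∃ Z, P Z ∧ ∀ i, Agree q (Y i) (Z i) := by
  choose T hT using exists_isStep μ a
  let S : ℕ → Option FieldIndex → Series := fun n => T^[n] 0
  have hS : ∀ n, IsStep μ a (S n) (S (n + 1)) := fun n => by
    simp only [S, Function.iterate_succ_apply']; exact hT _
  have hA : ∀ n i, Agree n (S n i) (S (n + 1) i) := by
    intro n
    induction n with
    | zero => exact fun i => Agree.zero _ _
    | succ n ih => exact (hS n).agree (hS (n + 1)) ih
  have hA' : ∀ n k i, Agree n (S n i) (S (n + k) i) := by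
    intro n k i
    induction k with
    | zero => exact Agree.rfl' _
    | succ k ih => exact ih.trans ((hA (n + k) i).mono (Nat.le_add_right _ _))
  let Y : Option FieldIndex → Series := fun i d => coeff d (S (wt d + 1) i)
  have hY : ∀ n i, Agree n (Y i) (S n i) := by
    intro n i d hd
    have e : coeff d (Y i) = coeff d (S (wt d + 1) i) := rfl
    obtain ⟨k, rfl⟩ := Nat.exists_eq_add_of_le (Nat.succ_le_of_lt hd)
    rw [e, hA' _ k i d (Nat.lt_succ_self _)]
  refine ⟨Y, ?_, fun P h0 hP q => ⟨S q, ?_, hY q⟩⟩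
  · have : Y = T Y := funext fun i => Agree.eq fun q => by
      refine Agree.mono ?_ (Nat.le_succ q)
      exact (hY (q + 1) i).trans ((hT Y).agree (hS q) (fun i => hY q i) i).symm
    have h := hT Y
    rwa [← this] at h
  · induction q with
    | zero => exact h0
    | succ q ih => exact hP _ _ ih (hS q)

namespace VDegLE
variable {k l : ℤ} {f g : Series}

theorem mono (h : VDegLE k f) (hkl : k ≤ l) : VDegLE l f := fun d hd => (h d hd).trans (by omega)
theorem add (hf : VDegLE k f) (hg : VDegLE k g) : VDegLE k (f + g) := fun d hd => by
  by_contra hc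
  apply hd
  rw [map_add, not_imp_comm.1 (hf d) hc, not_imp_comm.1 (hg d) hc, add_zero]
theorem neg (hf : VDegLE k f) : VDegLE k (-f) := fun d hd => hf d (by simpa using hd)
theorem sub (hf : VDegLE k f) (hg : VDegLE k g) : VDegLE k (f - g) := by
  rw [sub_eq_add_neg]; exact hf.add hg.neg
theorem mul (hf : VDegLE k f) (hg : VDegLE l g) : VDegLE (k + l) (f * g) := fun d hd => by
  classical
  rw [coeff_mul] at hd
  obtain ⟨x, hx, h⟩ := Finset.exists_ne_zero_of_sum_ne_zero hd
  have h1 := hf _ (left_ne_zero_of_mul h)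
  have h2 := hg _ (right_ne_zero_of_mul h)
  rw [← Finset.HasAntidiagonal.mem_antidiagonal.1 hx]
  simp only [Finsupp.add_apply]
  push_cast
  omega
theorem const (c : ℂ) : VDegLE 0 (C c) := fun d hd => by
  classical
  rw [coeff_C] at hd
  have : d = 0 := by by_contra h; simp [h] at hd
  simp [this]
theorem u_mul (hf : VDegLE k f) : VDegLE (k - 2) (X 0 * f) := fun d hd => by
  by_cases h0 : d 0 = 0
  · rw [coeff_u_mul_of_eq_zero h0] at hd; exact absurd rfl hd
  · obtain ⟨e, rfl⟩ : ∃ e, d = Finsupp.single 0 1 + e := ⟨_, eq_single_add h0⟩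
    rw [coeff_single_add_X_mul] at hd
    have := hf e hd
    simp only [Finsupp.add_apply]
    simp
    omega
theorem pderiv1 (hf : VDegLE k f) : VDegLE (k - 1) (pderiv ℂ 1 f) := fun d hd => by
  rw [coeff_pderiv] at hd
  have := hf _ (left_ne_zero_of_mul hd)
  simp only [Finsupp.add_apply] at this
  simp at this
  omega
theorem u_mul_pderiv (hf : VDegLE k f) : VDegLE k (X 0 * pderiv ℂ 0 f) := fun d hd => by
  rw [coeff_u_mul_pderiv] at hd
  exact hf d (right_ne_zero_of_mul hd)
theorem fuchs (c : ℂ) (hf : VDegLE k f) : VDegLE k (StaticVacuum.fuchs c f) := fun d hd => by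
  rw [coeff_fuchs] at hd
  exact hf d (fun h => hd (by rw [h, zero_div]))
theorem wPrimitive (hf : VDegLE k f) : VDegLE k (StaticVacuum.wPrimitive f) := fun d hd => by
  rw [coeff_wPrimitive] at hd
  split_ifs at hd with h
  · have := hf _ (fun h => hd (by rw [h, zero_div]))
    simpa using this
  · exact absurd rfl hd
theorem uwPrimitive {a : ℕ → ℕ → ℂ} (ha : ∀ m n, a m n ≠ 0 → (n : ℤ) ≤ 2 * m + (k + 2))
    (hf : VDegLE k f) : VDegLE (k + 2) (StaticVacuum.uwPrimitive a f) := fun d hd => by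
  rw [coeff_uwPrimitive] at hd
  split_ifs at hd with h
  · exact ha _ _ hd
  · have := hf _ (fun h => hd (by rw [h, zero_div]))
    simp at this
    omega
theorem zero : VDegLE k 0 := fun _ hd => absurd rfl hd
theorem of_agree (h : ∀ q, ∃ g, VDegLE k g ∧ Agree q f g) : VDegLE k f := fun d hd => by
  obtain ⟨g, hg, h⟩ := h (wt d + 1)
  rw [h d (Nat.lt_succ_self _)] at hd
  exact hg d hd
end VDegLE

/-- The exponent `k` for which the monomials of an unknown satisfy `n ≤ 2 m + k`. -/
def vDeg : Option FieldIndex → ℤ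
  | none => 0
  | some (frame01 k) => ![-1, 2] k
  | some (frame11 k) => ![-2, 1] k
  | some (conn01 k) => ![2, 1, 0] k
  | some (conn11 k) => ![1, 0, -1] k
  | some zeta => -2
  | some (dzeta k) => ![0, -1, -2] k
  | some scal => 0
  | some (ricci k) => ![4, 3, 2, 1, 0] k

set_option maxHeartbeats 2000000 in
/-- The step preserves the bounds `n ≤ 2 m + k` for the monomials `u^m v^n w^p`: a factor `u` lowers
`k` by two, `∂_v` lowers it by one, and the datum `s_0` has `n ≤ 2 m + 4`. -/
theorem IsStep.vDegLE {μ : ℂ} {a : ℕ → ℕ → ℂ} {Y Z : Option FieldIndex → Series}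
    (h : IsStep μ a Y Z) (ha : ∀ m n, a m n ≠ 0 → (n : ℤ) ≤ 2 * m + 4)
    (hY : ∀ i, VDegLE (vDeg i) (Y i)) : ∀ i, VDegLE (vDeg i) (Z i) := by
  have two : VDegLE 0 2 := by rw [← C_two]; exact VDegLE.const _
  have three : VDegLE 0 3 := by
    rw [← map_ofNat (C : ℂ →+* Series)]; exact VDegLE.const _
  have four : VDegLE 0 4 := by
    rw [← map_ofNat (C : ℂ →+* Series)]; exact VDegLE.const _
  have one : VDegLE 0 1 := by
    rw [← map_one (C : ℂ →+* Series)]; exact VDegLE.const _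
  have const : ∀ c, VDegLE 0 (C c) := VDegLE.const
  have xu : VDegLE (-2) (X 0) := by simpa using one.u_mul
  have s0 : VDegLE (vDeg (some (ricci 0))) (Z (some (ricci 0))) := by
    rw [h.ricci_0]
    refine VDegLE.uwPrimitive (k := 2) (by simpa using ha) ?_
    simp only [mul_add, mul_sub]
    repeat' with_reducible first | apply VDegLE.add | apply VDegLE.sub
    all_goals apply VDegLE.mono
    all_goals try
      repeat' with_reducible first
        | exact hY _ | exact const _ | assumption
        | apply VDegLE.u_mul_pderiv | apply VDegLE.pderiv1 | apply VDegLE.mul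
    all_goals simp [vDeg]
  have e0 : VDegLE (vDeg (some (frame01 0))) (Z (some (frame01 0))) := by
    rw [h.frame01_0]
    apply VDegLE.fuchs
    simp only [mul_add, mul_sub]
    repeat' with_reducible first | apply VDegLE.add | apply VDegLE.sub
    all_goals apply VDegLE.mono
    all_goals try
      repeat' with_reducible first
        | exact hY _ | exact const _ | assumption
        | apply VDegLE.u_mul_pderiv | apply VDegLE.pderiv1 | apply VDegLE.mul
    all_goals simp [vDeg]
  have a0 : VDegLE (vDeg (some (conn01 0))) (Z (some (conn01 0))) := by
    rw [h.conn01_0]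
    apply VDegLE.fuchs
    simp only [mul_add, mul_sub]
    repeat' with_reducible first | apply VDegLE.add | apply VDegLE.sub
    all_goals apply VDegLE.mono
    all_goals try
      repeat' with_reducible first
        | exact hY _ | exact const _ | assumption
        | apply VDegLE.u_mul_pderiv | apply VDegLE.pderiv1 | apply VDegLE.mul
    all_goals simp [vDeg]
  have b0 : VDegLE (vDeg (some (conn11 0))) (Z (some (conn11 0))) := by
    rw [h.conn11_0]
    apply VDegLE.fuchs
    simp only [mul_add, mul_sub]
    repeat' with_reducible first | apply VDegLE.add | apply VDegLE.sub
    all_goals apply VDegLE.mono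
    all_goals try
      repeat' with_reducible first
        | exact hY _ | exact const _ | assumption
        | apply VDegLE.u_mul_pderiv | apply VDegLE.pderiv1 | apply VDegLE.mul
    all_goals simp [vDeg]
  have s1 : VDegLE (vDeg (some (ricci 1))) (Z (some (ricci 1))) := by
    rw [h.ricci_1]
    apply VDegLE.fuchs
    simp only [mul_add, mul_sub]
    repeat' with_reducible first | apply VDegLE.add | apply VDegLE.sub
    all_goals apply VDegLE.mono
    all_goals try
      repeat' with_reducible first
        | exact hY _ | exact const _ | assumption
        | apply VDegLE.u_mul_pderiv | apply VDegLE.pderiv1 | apply VDegLE.mul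
    all_goals simp [vDeg]
  have s2 : VDegLE (vDeg (some (ricci 2))) (Z (some (ricci 2))) := by
    rw [h.ricci_2]
    apply VDegLE.fuchs
    simp only [mul_add, mul_sub]
    repeat' with_reducible first | apply VDegLE.add | apply VDegLE.sub
    all_goals apply VDegLE.mono
    all_goals try
      repeat' with_reducible first
        | exact hY _ | exact const _ | assumption
        | apply VDegLE.u_mul_pderiv | apply VDegLE.pderiv1 | apply VDegLE.mul
    all_goals simp [vDeg]
  have s3 : VDegLE (vDeg (some (ricci 3))) (Z (some (ricci 3))) := by
    rw [h.ricci_3]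
    apply VDegLE.fuchs
    simp only [mul_add, mul_sub]
    repeat' with_reducible first | apply VDegLE.add | apply VDegLE.sub
    all_goals apply VDegLE.mono
    all_goals try
      repeat' with_reducible first
        | exact hY _ | exact const _ | assumption
        | apply VDegLE.u_mul_pderiv | apply VDegLE.pderiv1 | apply VDegLE.mul
    all_goals simp [vDeg]
  have s4 : VDegLE (vDeg (some (ricci 4))) (Z (some (ricci 4))) := by
    rw [h.ricci_4]
    apply VDegLE.fuchs
    simp only [mul_add, mul_sub]
    repeat' with_reducible first | apply VDegLE.add | apply VDegLE.sub
    all_goals apply VDegLE.mono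
    all_goals try
      repeat' with_reducible first
        | exact hY _ | exact const _ | assumption
        | apply VDegLE.u_mul_pderiv | apply VDegLE.pderiv1 | apply VDegLE.mul
    all_goals simp [vDeg]
  intro i
  rcases i with _ | (k | k | k | k | _ | k | _ | k)
  all_goals try fin_cases k
  all_goals first | assumption | skip
  all_goals try simp only [Fin.zero_eta, Fin.mk_one, Fin.reduceFinMk, Fin.isValue]
  all_goals first
    | rw [h.eta] | rw [h.frame01_1] | rw [h.frame11_0] | rw [h.frame11_1] | rw [h.conn01_1]
    | rw [h.conn01_2] | rw [h.conn11_1] | rw [h.conn11_2] | rw [h.eq_zeta] | rw [h.dzeta_0]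
    | rw [h.dzeta_1] | rw [h.dzeta_2] | rw [h.eq_scal]
  all_goals try simp only [mul_add, mul_sub, sub_mul, one_mul]
  all_goals repeat' with_reducible first
    | apply VDegLE.neg | apply VDegLE.fuchs | apply VDegLE.wPrimitive | apply VDegLE.add
    | apply VDegLE.sub
  all_goals apply VDegLE.mono
  all_goals try
    repeat' with_reducible first | exact hY _ | exact const _ | assumption | apply VDegLE.mul
  all_goals simp [vDeg]

open scoped NNReal ENNReal

/-! ### Weighted norms -/

/-- The weight `x^{m+p} y^p / (m+p choose m)` of the monomial `u^m v^n w^p`. -/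
def weight (x y : ℝ≥0) (d : Fin 3 →₀ ℕ) : ℝ≥0 :=
  x ^ (d 0 + d 2) * y ^ d 2 / ((d 0 + d 2).choose (d 0) : ℝ≥0)

/-- The weighted `ℓ¹`-norm of a series, with values in `[0, ∞]`; the index `j` counts lost
derivatives. -/
def wNorm (x y : ℝ≥0) (j : ℕ) (f : Series) : ℝ≥0∞ :=
  ∑' d, ((‖coeff d f‖₊ * weight x y d / ((d 0 : ℝ≥0) + 1) ^ j : ℝ≥0) : ℝ≥0∞)

/-- A term of the Vandermonde identity. -/
theorem choose_mul_choose_le (a b c d : ℕ) :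
    (a + b).choose a * (c + d).choose c ≤ (a + b + (c + d)).choose (a + c) := by
  rw [Nat.add_choose_eq (a + b) (c + d) (a + c)]
  exact Finset.single_le_sum (f := fun ij : ℕ × ℕ => (a + b).choose ij.1 * (c + d).choose ij.2)
    (fun _ _ => Nat.zero_le _) (Finset.HasAntidiagonal.mem_antidiagonal.2
        (rfl : (a, c).1 + (a, c).2 = a + c))

/-- The weights are submultiplicative, so that `wNorm` is an algebra norm. -/
theorem weight_add_le (x y : ℝ≥0) (d e : Fin 3 →₀ ℕ) :
    weight x y (d + e) ≤ weight x y d * weight x y e := by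
  simp only [weight, Finsupp.add_apply]
  rw [div_mul_div_comm]
  have h := choose_mul_choose_le (d 0) (d 2) (e 0) (e 2)
  have h1 : (0 : ℝ≥0) < (d 0 + d 2).choose (d 0) := by
    exact_mod_cast Nat.choose_pos (Nat.le_add_right _ _)
  have h2 : (0 : ℝ≥0) < (e 0 + e 2).choose (e 0) := by
    exact_mod_cast Nat.choose_pos (Nat.le_add_right _ _)
  have e1 : d 0 + e 0 + (d 2 + e 2) = d 0 + d 2 + (e 0 + e 2) := by ring
  rw [e1]
  have e2 : x ^ (d 0 + d 2) * y ^ d 2 * (x ^ (e 0 + e 2) * y ^ e 2) =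
    x ^ (d 0 + d 2 + (e 0 + e 2)) * y ^ (d 2 + e 2) := by ring
  rw [e2]
  gcongr
  exact_mod_cast h

theorem nnnorm_natCast_add_one (n : ℕ) : ‖(n : ℂ) + 1‖₊ = (n : ℝ≥0) + 1 := by
  rw [← NNReal.coe_inj, coe_nnnorm]
  exact_mod_cast Complex.norm_natCast (n + 1)

section
variable {x y : ℝ≥0} {j : ℕ} {f g : Series}

theorem wNorm_add_le : wNorm x y j (f + g) ≤ wNorm x y j f + wNorm x y j g := by
  rw [wNorm, wNorm, wNorm, ← ENNReal.tsum_add]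
  refine ENNReal.tsum_le_tsum fun d => ?_
  rw [← ENNReal.coe_add, ENNReal.coe_le_coe, ← add_div, ← add_mul, map_add]
  gcongr
  exact nnnorm_add_le _ _

theorem wNorm_neg : wNorm x y j (-f) = wNorm x y j f := by
  simp only [wNorm, map_neg, nnnorm_neg]

theorem wNorm_sub_le : wNorm x y j (f - g) ≤ wNorm x y j f + wNorm x y j g := by
  rw [sub_eq_add_neg]; exact wNorm_add_le.trans (by rw [wNorm_neg])

theorem wNorm_zero : wNorm x y j 0 = 0 := by simp [wNorm]

theorem wNorm_one_le : wNorm x y 1 f ≤ wNorm x y 0 f := by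
  refine ENNReal.tsum_le_tsum fun d => ?_
  rw [ENNReal.coe_le_coe, pow_one, pow_zero, div_one]
  exact div_le_self (by positivity) (by simp)

theorem wNorm_mul_le : wNorm x y j (f * g) ≤ wNorm x y 0 f * wNorm x y j g := by
  classical
  let F : (Fin 3 →₀ ℕ) → ℝ≥0∞ := fun d =>
    ((‖coeff d f‖₊ * weight x y d / ((d 0 : ℝ≥0) + 1) ^ 0 : ℝ≥0) : ℝ≥0∞)
  let G : (Fin 3 →₀ ℕ) → ℝ≥0∞ := fun d =>
    ((‖coeff d g‖₊ * weight x y d / ((d 0 : ℝ≥0) + 1) ^ j : ℝ≥0) : ℝ≥0∞)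
  have h1 : wNorm x y 0 f * wNorm x y j g =
      ∑' d : Fin 3 →₀ ℕ, ∑ z ∈ Finset.HasAntidiagonal.antidiagonal d, F z.1 * G z.2 := by
    have e : wNorm x y 0 f * wNorm x y j g = ∑' z : (Fin 3 →₀ ℕ) × (Fin 3 →₀ ℕ), F z.1 * G z.2 := by
      rw [ENNReal.tsum_prod (f := fun a b => F a * G b), wNorm, wNorm, ← ENNReal.tsum_mul_right]
      simp only [ENNReal.tsum_mul_left]
      rfl
    rw [e, ← (Finset.HasAntidiagonal.sigmaAntidiagonalEquivProd (A := Fin 3 →₀ ℕ)).tsum_eq]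
    refine (ENNReal.tsum_sigma fun (a : Fin 3 →₀ ℕ)
      (b : Finset.HasAntidiagonal.antidiagonal a) => F b.1.1 * G b.1.2).trans ?_
    refine tsum_congr fun d => ?_
    rw [tsum_fintype]
    exact Finset.sum_coe_sort (Finset.HasAntidiagonal.antidiagonal d) fun z => F z.1 * G z.2
  rw [h1]
  refine ENNReal.tsum_le_tsum fun d => ?_
  simp only [F, G, ← ENNReal.coe_mul]
  rw [← ENNReal.ofNNReal_finsetSum, ENNReal.coe_le_coe, coeff_mul]
  calc ‖∑ z ∈ Finset.HasAntidiagonal.antidiagonal d, coeff z.1 f * coeff z.2 g‖₊ * weight x y d /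
        ((d 0 : ℝ≥0) + 1) ^ j
      ≤ (∑ z ∈ Finset.HasAntidiagonal.antidiagonal d, ‖coeff z.1 f * coeff z.2 g‖₊) * weight x y d /
        ((d 0 : ℝ≥0) + 1) ^ j := by gcongr; exact nnnorm_sum_le _ _
    _ = ∑ z ∈ Finset.HasAntidiagonal.antidiagonal d, ‖coeff z.1 f * coeff z.2 g‖₊ * weight x y d /
        ((d 0 : ℝ≥0) + 1) ^ j := by rw [Finset.sum_mul, Finset.sum_div]
    _ ≤ _ := by
      refine Finset.sum_le_sum fun z hz => ?_
      rw [← Finset.HasAntidiagonal.mem_antidiagonal.1 hz, nnnorm_mul, pow_zero, div_one]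
      have hw := weight_add_le x y z.1 z.2
      calc _ ≤ ‖coeff z.1 f‖₊ * ‖coeff z.2 g‖₊ * (weight x y z.1 * weight x y z.2) /
            ((z.2 0 : ℝ≥0) + 1) ^ j := by
            gcongr
            simp
        _ = _ := by ring

theorem wNorm_C (c : ℂ) : wNorm x y 0 (C c) ≤ ‖c‖₊ := by
  classical
  rw [wNorm, tsum_eq_single 0]
  · simp [weight]
  · intro d hd
    rw [coeff_C, if_neg hd]; simp

theorem wNorm_X : wNorm x y 0 (X 0) ≤ x := by
  classical
  rw [wNorm, tsum_eq_single (Finsupp.single 0 1)]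
  · simp [weight]
  · intro d hd
    rw [coeff_X, if_neg hd]; simp

theorem wNorm_u_mul_le : wNorm x y j (X 0 * f) ≤ x * wNorm x y j f :=
  wNorm_mul_le.trans (by gcongr; exact wNorm_X)

/-- A derivative with respect to `v` costs the factor `n`, which is at most `2 m + 4` and is
therefore absorbed by one power of `m + 1`. -/
theorem wNorm_pderiv_le (hf : VDegLE 4 f) : wNorm x y 1 (pderiv ℂ 1 f) ≤ 4 * wNorm x y 0 f := by
  have hinj : Function.Injective fun d : Fin 3 →₀ ℕ => d + Finsupp.single 1 1 :=
    add_left_injective _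
  refine le_trans ?_ (mul_le_mul_right (ENNReal.tsum_comp_le_tsum_of_injective hinj _) 4)
  rw [← ENNReal.tsum_mul_left, wNorm]
  refine ENNReal.tsum_le_tsum fun d => ?_
  have e4 : (4 : ℝ≥0∞) = ((4 : ℝ≥0) : ℝ≥0∞) := rfl
  rw [e4, ← ENNReal.coe_mul, ENNReal.coe_le_coe, coeff_pderiv]
  have hw : weight x y (d + Finsupp.single 1 1) = weight x y d := by simp [weight]
  rw [hw, nnnorm_mul, pow_zero, pow_one, div_one]
  by_cases h0 : coeff (d + Finsupp.single 1 1) f = 0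
  · simp [h0]
  have h := hf _ h0
  simp only [Finsupp.add_apply] at h
  simp at h
  have h' : ‖(d 1 : ℂ) + 1‖₊ ≤ 4 * ((d 0 : ℝ≥0) + 1) := by
    rw [nnnorm_natCast_add_one]
    have h2 : d 1 + 1 ≤ 4 * (d 0 + 1) := by omega
    exact_mod_cast h2
  rw [div_le_iff₀ (by positivity)]
  calc _ ≤ ‖coeff (d + Finsupp.single 1 1) f‖₊ * (4 * ((d 0 : ℝ≥0) + 1)) * weight x y d := by gcongr
    _ = _ := by ring

theorem wNorm_u_mul_pderiv_le : wNorm x y 1 (X 0 * pderiv ℂ 0 f) ≤ wNorm x y 0 f := by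
  refine ENNReal.tsum_le_tsum fun d => ?_
  rw [ENNReal.coe_le_coe, coeff_u_mul_pderiv, nnnorm_mul, pow_zero, pow_one, div_one,
    div_le_iff₀ (by positivity)]
  have : ‖(d 0 : ℂ)‖₊ ≤ (d 0 : ℝ≥0) + 1 := by simp
  calc _ ≤ ((d 0 : ℝ≥0) + 1) * ‖coeff d f‖₊ * weight x y d := by gcongr
    _ = _ := by ring

/-- The inverse of `u ∂_u + k` gains the power of `m + 1` which is lost by a derivative. -/
theorem wNorm_fuchs_le {k : ℝ} (hk : 1 / 2 ≤ k) :
    wNorm x y 0 (fuchs (k : ℂ) f) ≤ 2 * wNorm x y 1 f := by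
  rw [wNorm, wNorm, ← ENNReal.tsum_mul_left]
  refine ENNReal.tsum_le_tsum fun d => ?_
  have e4 : (2 : ℝ≥0∞) = ((2 : ℝ≥0) : ℝ≥0∞) := rfl
  rw [e4, ← ENNReal.coe_mul, ENNReal.coe_le_coe, coeff_fuchs, nnnorm_div, pow_zero, pow_one,
      div_one]
  have hn : ((d 0 : ℝ≥0) + 1) / 2 ≤ ‖(d 0 : ℂ) + k‖₊ := by
    rw [← NNReal.coe_le_coe]
    have : (d 0 : ℂ) + k = ((d 0 + k : ℝ) : ℂ) := by push_cast; rfl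
    rw [coe_nnnorm, this, Complex.norm_real, Real.norm_of_nonneg (by positivity)]
    push_cast
    have := (d 0).cast_nonneg (α := ℝ)
    linarith
  calc _ ≤ ‖coeff d f‖₊ / (((d 0 : ℝ≥0) + 1) / 2) * weight x y d := by gcongr
    _ = _ := by field_simp

theorem wNorm_wPrimitive_le : wNorm x y 0 (wPrimitive f) ≤ x * y * wNorm x y 0 f := by
  have hinj : Function.Injective fun d : Fin 3 →₀ ℕ => d + Finsupp.single 2 1 :=
    add_left_injective _
  rw [wNorm, ← hinj.tsum_eq]
  · rw [wNorm, ← ENNReal.coe_mul, ← ENNReal.tsum_mul_left]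
    refine ENNReal.tsum_le_tsum fun d => ?_
    rw [← ENNReal.coe_mul, ENNReal.coe_le_coe, coeff_wPrimitive]
    by_cases h0 : d 0 = 0
    · rw [if_pos (by simp [h0])]
      simp only [add_tsub_cancel_right, nnnorm_div, weight]
      simp [h0]
      rw [nnnorm_natCast_add_one, div_mul_eq_mul_div, div_le_iff₀ (by positivity)]
      calc _ = x * y * (‖coeff d f‖₊ * (x ^ d 2 * y ^ d 2)) * 1 := by ring
        _ ≤ _ := by
          gcongr
          simp
    · rw [if_neg (by simp [h0])]; simp
  · intro d hd
    refine ⟨d - Finsupp.single 2 1, tsub_add_cancel_of_le (Finsupp.single_le_iff.2 ?_)⟩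
    by_contra h
    apply hd
    simp only []
    rw [coeff_wPrimitive, if_neg (by rintro ⟨-, h'⟩; omega)]
    simp

/-- The norm of the initial value in `uwPrimitive`. -/
def datumNorm (x : ℝ≥0) (a : ℕ → ℕ → ℂ) : ℝ≥0∞ :=
  ∑' d : Fin 3 →₀ ℕ, if d 2 = 0 then ((‖a (d 0) (d 1)‖₊ * x ^ d 0 : ℝ≥0) : ℝ≥0∞) else 0

/-- The shift of the exponents changes the weight by a factor `y p / (m + 1)` and the integration
divides by `p`, so that the lost power of `m + 1` is regained together with a small factor `y`. -/
theorem wNorm_uwPrimitive_le {a : ℕ → ℕ → ℂ} :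
    wNorm x y 0 (uwPrimitive a f) ≤ datumNorm x a + 2 * y * wNorm x y 1 f := by
  have hinj : Function.Injective fun d : Fin 3 →₀ ℕ => d + Finsupp.single 2 1 :=
    add_left_injective _
  have hinj0 : Function.Injective fun d : Fin 3 →₀ ℕ => d + Finsupp.single 0 1 :=
    add_left_injective _
  let t : (Fin 3 →₀ ℕ) → ℝ≥0∞ := fun d => if d 2 = 0 then 0 else
    ((‖coeff d (uwPrimitive a f)‖₊ * weight x y d : ℝ≥0) : ℝ≥0∞)
  have h1 : wNorm x y 0 (uwPrimitive a f) = datumNorm x a + ∑' d, t d := by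
    rw [wNorm, datumNorm, ← ENNReal.tsum_add]
    refine tsum_congr fun d => ?_
    simp only [t]
    split_ifs with h
    · rw [coeff_uwPrimitive, if_pos h]; simp [weight, h]
    · simp
  rw [h1]
  gcongr
  rw [← hinj.tsum_eq]
  · refine le_trans ?_ (mul_le_mul_right (ENNReal.tsum_comp_le_tsum_of_injective hinj0 _) _)
    rw [← ENNReal.tsum_mul_left]
    refine ENNReal.tsum_le_tsum fun d => ?_
    have e2 : (2 : ℝ≥0∞) = ((2 : ℝ≥0) : ℝ≥0∞) := rfl
    simp only [t]
    rw [if_neg (by simp), e2, ← ENNReal.coe_mul, ← ENNReal.coe_mul, ENNReal.coe_le_coe,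
      coeff_uwPrimitive, if_neg (by simp)]
    simp only [add_tsub_cancel_right, nnnorm_div, weight, pow_one]
    simp
    rw [nnnorm_natCast_add_one]
    have e1 : d 0 + 1 + d 2 = d 0 + (d 2 + 1) := by ring
    rw [e1]
    have hc : ((d 0 + (d 2 + 1)).choose (d 0 + 1) : ℝ≥0) * ((d 0 : ℝ≥0) + 1) =
        ((d 0 + (d 2 + 1)).choose (d 0) : ℝ≥0) * ((d 2 : ℝ≥0) + 1) := by
      have := Nat.choose_succ_right_eq (d 0 + (d 2 + 1)) (d 0)
      rw [Nat.add_sub_cancel_left] at this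
      exact_mod_cast this
    have p1 : (0 : ℝ≥0) < (d 0 + (d 2 + 1)).choose (d 0) := by
      exact_mod_cast Nat.choose_pos (Nat.le_add_right _ _)
    have p2 : (0 : ℝ≥0) < (d 0 + (d 2 + 1)).choose (d 0 + 1) := by
      exact_mod_cast Nat.choose_pos (by omega)
    generalize ((d 0 + (d 2 + 1)).choose (d 0) : ℝ≥0) = c0 at *
    generalize ((d 0 + (d 2 + 1)).choose (d 0 + 1) : ℝ≥0) = c1 at *
    generalize ‖coeff (d + Finsupp.single 0 1) f‖₊ = F
    have k1 : F / ((d 2 : ℝ≥0) + 1) * (x ^ (d 0 + (d 2 + 1)) * y ^ (d 2 + 1) / c0) =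
        F * x ^ (d 0 + (d 2 + 1)) * y ^ (d 2 + 1) / (c1 * ((d 0 : ℝ≥0) + 1)) := by
      rw [hc]; field_simp
    rw [k1]
    have k2 : 2 * y * (F * (x ^ (d 0 + (d 2 + 1)) * y ^ d 2 / c1) / ((d 0 : ℝ≥0) + 1 + 1)) =
        F * x ^ (d 0 + (d 2 + 1)) * y ^ (d 2 + 1) / (c1 * (((d 0 : ℝ≥0) + 1 + 1) / 2)) := by
      field_simp
      ring
    rw [k2]
    gcongr
    rw [div_le_iff₀ (by norm_num), mul_two]
    gcongr
    simp
  · intro d hd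
    refine ⟨d - Finsupp.single 2 1, tsub_add_cancel_of_le (Finsupp.single_le_iff.2 ?_)⟩
    by_contra h
    apply hd
    simp only [t]
    rw [if_pos (by omega)]

/-- The balls are closed under limits in the sense of `Agree`. -/
theorem wNorm_le_of_agree {K : ℝ≥0∞} (h : ∀ q, ∃ g, wNorm x y 0 g ≤ K ∧ Agree q f g) :
    wNorm x y 0 f ≤ K := by
  rw [wNorm, ENNReal.tsum_eq_iSup_sum]
  refine iSup_le fun s => ?_
  obtain ⟨g, hg, ha⟩ := h (s.sup wt + 1)
  refine le_trans ?_ ((ENNReal.sum_le_tsum s).trans hg)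
  refine Finset.sum_le_sum fun d hd => ?_
  rw [ha d (Nat.lt_succ_of_le (Finset.le_sup hd))]

end

/-! ### Growth of the coefficients -/

/-- Exponents as triples of natural numbers. -/
def expEquiv : ℕ × ℕ × ℕ ≃ (Fin 3 →₀ ℕ) where
  toFun k := Finsupp.equivFunOnFinite.symm ![k.1, k.2.1, k.2.2]
  invFun d := (d 0, d 1, d 2)
  left_inv _ := rfl
  right_inv d := by ext j; fin_cases j <;> rfl

@[simp] theorem expEquiv_zero (k : ℕ × ℕ × ℕ) : expEquiv k 0 = k.1 := rfl
@[simp] theorem expEquiv_one (k : ℕ × ℕ × ℕ) : expEquiv k 1 = k.2.1 := rfl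
@[simp] theorem expEquiv_two (k : ℕ × ℕ × ℕ) : expEquiv k 2 = k.2.2 := rfl

theorem tsum_exp (F : (Fin 3 →₀ ℕ) → ℝ≥0∞) :
    ∑' d, F d = ∑' m, ∑' n, ∑' p, F (expEquiv (m, n, p)) := by
  rw [← expEquiv.tsum_eq, ENNReal.tsum_prod (f := fun a b => F (expEquiv (a, b)))]
  refine tsum_congr fun m => ?_
  rw [ENNReal.tsum_prod (f := fun a b => F (expEquiv (m, a, b)))]

theorem datumCoeff_eq_zero (ψ : NullData) {m n : ℕ} (h : 2 * m + 4 < n) : ψ.datumCoeff m n = 0 := by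
  rw [NullData.datumCoeff, Nat.choose_eq_zero_of_lt h]; simp

/-- The estimate of the datum in terms of the coefficients of `s_0(u, v)`. -/
theorem datumCoeff_bound {ψ : NullData} {M r : ℝ}
    (hest : ∀ p I, ‖ψ p I‖ ≤ (p ! : ℝ) * M / r ^ p) (m n : ℕ) :
    ‖ψ.datumCoeff m n‖ ≤ (2 * m + 4).choose n * (M / r ^ m) := by
  have h := hest m (fun j => if j.val < n then 1 else 0)
  rw [NullData.datumCoeff, NullData.essential, norm_mul, norm_mul, norm_div, norm_one,
    Complex.norm_natCast, Complex.norm_natCast]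
  have hm : (0 : ℝ) < m ! := by exact_mod_cast Nat.factorial_pos m
  calc _ ≤ 1 / (m ! : ℝ) * (2 * m + 4).choose n * ((m ! : ℝ) * M / r ^ m) := by gcongr
    _ = _ := by field_simp

/-- The series `s_0(u, v)` converges absolutely for all `v` if `u` is small. -/
theorem exists_datumNorm_le {ψ : NullData} (hest : ∃ M r : ℝ, 0 < M ∧ 0 < r ∧
    ∀ p I, ‖ψ p I‖ ≤ (p ! : ℝ) * M / r ^ p) :
    ∃ x₀ D : ℝ≥0, 0 < x₀ ∧ x₀ ≤ 1 ∧ ∀ x ≤ x₀, datumNorm x ψ.datumCoeff ≤ D := by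
  obtain ⟨M, r, hM, hr, hest⟩ := hest
  lift M to ℝ≥0 using hM.le
  lift r to ℝ≥0 using hr.le
  norm_cast at hr
  refine ⟨min 1 (r / 8), 32 * M, by positivity, min_le_left _ _, fun x hx => ?_⟩
  have hx8 : 4 * x / r ≤ 1 / 2 := by
    have := hx.trans (min_le_right _ _)
    rw [div_le_iff₀ hr]
    rw [le_div_iff₀ (by norm_num)] at this
    rw [← NNReal.coe_le_coe] at this ⊢
    push_cast at this ⊢
    linarith
  rw [datumNorm, tsum_exp]
  have key : ∀ m, ∑' n, ∑' p, (if (expEquiv (m, n, p)) 2 = 0 then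
      ((‖ψ.datumCoeff (expEquiv (m, n, p) 0) (expEquiv (m, n, p) 1)‖₊ *
        x ^ (expEquiv (m, n, p) 0) : ℝ≥0) : ℝ≥0∞) else 0) ≤
      ((16 * M * (1 / 2) ^ m : ℝ≥0) : ℝ≥0∞) := by
    intro m
    have e : ∀ n, ∑' p, (if (expEquiv (m, n, p)) 2 = 0 then
      ((‖ψ.datumCoeff (expEquiv (m, n, p) 0) (expEquiv (m, n, p) 1)‖₊ *
        x ^ (expEquiv (m, n, p) 0) : ℝ≥0) : ℝ≥0∞) else 0) =
        ((‖ψ.datumCoeff m n‖₊ * x ^ m : ℝ≥0) : ℝ≥0∞) := by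
      intro n
      rw [tsum_eq_single 0]
      · simp
      · intro p hp; simp [hp]
    simp only [e]
    rw [tsum_eq_sum (s := Finset.range (2 * m + 4 + 1)), ← ENNReal.ofNNReal_finsetSum,
        ENNReal.coe_le_coe]
    · have h1 : ∀ n, ‖ψ.datumCoeff m n‖₊ * x ^ m ≤
          ((2 * m + 4).choose n : ℝ≥0) * (M * (x / r) ^ m) := by
        intro n
        have := datumCoeff_bound hest m n
        have : ‖ψ.datumCoeff m n‖₊ ≤ ((2 * m + 4).choose n : ℝ≥0) * (M / r ^ m) := by
          exact_mod_cast this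
        calc _ ≤ ((2 * m + 4).choose n : ℝ≥0) * (M / r ^ m) * x ^ m := by gcongr
          _ = _ := by rw [div_pow]; ring
      refine (Finset.sum_le_sum fun n _ => h1 n).trans ?_
      rw [← Finset.sum_mul, ← Nat.cast_sum, Nat.sum_range_choose]
      calc _ = 16 * M * (4 * x / r) ^ m := by
            push_cast
            rw [mul_div_assoc, mul_pow, pow_add, pow_mul]
            ring
        _ ≤ _ := by gcongr
    · intro n hn
      rw [datumCoeff_eq_zero ψ (by simpa using hn)]; simp
  refine (ENNReal.tsum_le_tsum key).trans ?_
  simp only [ENNReal.coe_mul, ENNReal.tsum_mul_left]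
  rw [show (32 : ℝ≥0) = 16 * 2 by norm_num]
  have : ∑' m : ℕ, (((1 / 2 : ℝ≥0) ^ m : ℝ≥0) : ℝ≥0∞) = 2 := by
    have := NNReal.hasSum_geometric (r := 1 / 2) (by rw [← NNReal.coe_lt_coe]; norm_num)
    rw [← ENNReal.coe_tsum this.summable, this.tsum_eq]
    have h2 : (1 - 1 / 2 : ℝ≥0)⁻¹ = 2 := by
      rw [← NNReal.coe_inj, NNReal.coe_inv, NNReal.coe_sub (by rw [← NNReal.coe_le_coe]; norm_num)]
      norm_num
    rw [h2]; rfl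
  rw [this]
  push_cast
  rw [mul_right_comm]

/-- The analogue of `wNorm_fuchs_le` for the exponent zero, where the coefficients with `m = 0` are
dropped. -/
theorem wNorm_fuchs_zero_le {x y : ℝ≥0} {f : Series} :
    wNorm x y 0 (fuchs 0 f) ≤ 2 * wNorm x y 1 f := by
  rw [wNorm, wNorm, ← ENNReal.tsum_mul_left]
  refine ENNReal.tsum_le_tsum fun d => ?_
  have e4 : (2 : ℝ≥0∞) = ((2 : ℝ≥0) : ℝ≥0∞) := rfl
  rw [e4, ← ENNReal.coe_mul, ENNReal.coe_le_coe, coeff_fuchs, nnnorm_div, add_zero, pow_zero,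
    pow_one, div_one]
  rcases Nat.eq_zero_or_pos (d 0) with h | h
  · simp [h]
  have hn : ((d 0 : ℝ≥0) + 1) / 2 ≤ ‖(d 0 : ℂ)‖₊ := by
    rw [← NNReal.coe_le_coe]
    have : (1 : ℝ) ≤ d 0 := by exact_mod_cast h
    rw [coe_nnnorm, Complex.norm_natCast]
    push_cast
    linarith
  calc _ ≤ ‖coeff d f‖₊ / (((d 0 : ℝ≥0) + 1) / 2) * weight x y d := by gcongr
    _ = _ := by field_simp

/-- The ball of radius `K` for the norm with parameters `x = y = t`. -/
def NormBall (K t : ℝ≥0) (Y : Option FieldIndex → Series) : Prop :=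
  ∀ i, wNorm t t 0 (Y i) ≤ K ∧ VDegLE (vDeg i) (Y i)

/-- The functional `G` is bounded on balls, uniformly for `t ≤ t₀`. -/
def BallBounded (K t₀ : ℝ≥0) (j : ℕ) (G : (Option FieldIndex → Series) → Series) : Prop :=
  ∃ B : ℝ≥0, ∀ t ≤ t₀, ∀ Y, NormBall K t Y → wNorm t t j (G Y) ≤ B

/-- The functional `G` is bounded by `b + O(t)` on balls. -/
def BallNear (K t₀ : ℝ≥0) (j : ℕ) (b : ℝ≥0) (G : (Option FieldIndex → Series) → Series) : Prop :=
  ∃ B : ℝ≥0, ∀ t ≤ t₀, ∀ Y, NormBall K t Y → wNorm t t j (G Y) ≤ b + t * B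

section
variable {K t₀ : ℝ≥0} {j : ℕ} {b c : ℝ≥0} {F G : (Option FieldIndex → Series) → Series}

namespace BallBounded

theorem apply (i) : BallBounded K t₀ 0 (fun Y => Y i) := ⟨K, fun _ _ _ hY => (hY i).1⟩

theorem const (c : ℂ) : BallBounded K t₀ 0 (fun _ => C c) := ⟨‖c‖₊, fun _ _ _ _ => wNorm_C c⟩

theorem X_zero : BallBounded K t₀ 0 (fun _ => X 0) :=
  ⟨t₀, fun _ ht _ _ => wNorm_X.trans (by exact_mod_cast ht)⟩

theorem one (hF : BallBounded K t₀ 0 F) : BallBounded K t₀ 1 F := by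
  obtain ⟨B, h⟩ := hF
  exact ⟨B, fun t ht Y hY => wNorm_one_le.trans (h t ht Y hY)⟩

theorem add (hF : BallBounded K t₀ j F) (hG : BallBounded K t₀ j G) :
    BallBounded K t₀ j (fun Y => F Y + G Y) := by
  obtain ⟨B, h⟩ := hF
  obtain ⟨B', h'⟩ := hG
  refine ⟨B + B', fun t ht Y hY => wNorm_add_le.trans ?_⟩
  push_cast
  exact add_le_add (h t ht Y hY) (h' t ht Y hY)

theorem sub (hF : BallBounded K t₀ j F) (hG : BallBounded K t₀ j G) :
    BallBounded K t₀ j (fun Y => F Y - G Y) := by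
  obtain ⟨B, h⟩ := hF
  obtain ⟨B', h'⟩ := hG
  refine ⟨B + B', fun t ht Y hY => wNorm_sub_le.trans ?_⟩
  push_cast
  exact add_le_add (h t ht Y hY) (h' t ht Y hY)

theorem mul (hF : BallBounded K t₀ 0 F) (hG : BallBounded K t₀ j G) :
    BallBounded K t₀ j (fun Y => F Y * G Y) := by
  obtain ⟨B, h⟩ := hF
  obtain ⟨B', h'⟩ := hG
  refine ⟨B * B', fun t ht Y hY => wNorm_mul_le.trans ?_⟩
  push_cast
  exact mul_le_mul' (h t ht Y hY) (h' t ht Y hY)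

theorem pderiv1 (i) (hi : vDeg i ≤ 4) : BallBounded K t₀ 1 (fun Y => pderiv ℂ 1 (Y i)) :=
  ⟨4 * K, fun _ _ _ hY => (wNorm_pderiv_le ((hY i).2.mono hi)).trans
    (by push_cast; gcongr; exact (hY i).1)⟩

theorem u_mul_pderiv (i) : BallBounded K t₀ 1 (fun Y => X 0 * pderiv ℂ 0 (Y i)) :=
  ⟨K, fun _ _ _ hY => wNorm_u_mul_pderiv_le.trans (hY i).1⟩

end BallBounded

namespace BallNear

theorem bounded (hF : BallNear K t₀ j b F) : BallBounded K t₀ j F := by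
  obtain ⟨B, h⟩ := hF
  refine ⟨b + t₀ * B, fun t ht Y hY => (h t ht Y hY).trans ?_⟩
  push_cast
  gcongr

theorem mono (hF : BallNear K t₀ j b F) (hbc : b ≤ c) : BallNear K t₀ j c F := by
  obtain ⟨B, h⟩ := hF
  exact ⟨B, fun t ht Y hY => (h t ht Y hY).trans (by gcongr)⟩

theorem one (hF : BallNear K t₀ 0 b F) : BallNear K t₀ 1 b F := by
  obtain ⟨B, h⟩ := hF
  exact ⟨B, fun t ht Y hY => wNorm_one_le.trans (h t ht Y hY)⟩

theorem const (c : ℂ) : BallNear K t₀ 0 ‖c‖₊ (fun _ => C c) :=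
  ⟨0, fun _ _ _ _ => by simpa using wNorm_C c⟩

theorem neg (hF : BallNear K t₀ j b F) : BallNear K t₀ j b (fun Y => -F Y) := by
  obtain ⟨B, h⟩ := hF
  exact ⟨B, fun t ht Y hY => by rw [wNorm_neg]; exact h t ht Y hY⟩

theorem add (hF : BallNear K t₀ j b F) (hG : BallNear K t₀ j c G) :
    BallNear K t₀ j (b + c) (fun Y => F Y + G Y) := by
  obtain ⟨B, h⟩ := hF
  obtain ⟨B', h'⟩ := hG
  refine ⟨B + B', fun t ht Y hY => (wNorm_add_le.trans
    (add_le_add (h t ht Y hY) (h' t ht Y hY))).trans (le_of_eq ?_)⟩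
  push_cast
  ring

theorem sub (hF : BallNear K t₀ j b F) (hG : BallNear K t₀ j c G) :
    BallNear K t₀ j (b + c) (fun Y => F Y - G Y) := by
  simpa only [sub_eq_add_neg] using hF.add hG.neg

theorem small_mul (hF : BallNear K t₀ 0 0 F) (hG : BallBounded K t₀ j G) :
    BallNear K t₀ j 0 (fun Y => F Y * G Y) := by
  obtain ⟨B, h⟩ := hF
  obtain ⟨B', h'⟩ := hG
  refine ⟨B * B', fun t ht Y hY => (wNorm_mul_le.trans
    (mul_le_mul' (h t ht Y hY) (h' t ht Y hY))).trans (le_of_eq ?_)⟩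
  push_cast
  ring

theorem u_mul (hG : BallBounded K t₀ j G) : BallNear K t₀ j 0 (fun Y => X 0 * G Y) := by
  obtain ⟨B, h⟩ := hG
  refine ⟨B, fun t ht Y hY => wNorm_u_mul_le.trans ?_⟩
  rw [ENNReal.coe_zero, zero_add]
  gcongr
  exact h t ht Y hY

theorem fuchs {k : ℂ} {κ : ℝ} (hk : k = κ) (hκ : 1 / 2 ≤ κ) (hF : BallNear K t₀ 1 b F) :
    BallNear K t₀ 0 (2 * b) (fun Y => fuchs k (F Y)) := by
  obtain ⟨B, h⟩ := hF
  subst hk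
  refine ⟨2 * B, fun t ht Y hY => (wNorm_fuchs_le hκ).trans
    ((mul_le_mul_right (h t ht Y hY) 2).trans (le_of_eq ?_))⟩
  push_cast
  ring

theorem fuchs_zero (hF : BallNear K t₀ 1 b F) :
    BallNear K t₀ 0 (2 * b) (fun Y => StaticVacuum.fuchs 0 (F Y)) := by
  obtain ⟨B, h⟩ := hF
  refine ⟨2 * B, fun t ht Y hY => wNorm_fuchs_zero_le.trans
    ((mul_le_mul_right (h t ht Y hY) 2).trans (le_of_eq ?_))⟩
  push_cast
  ring

theorem wPrimitive (ht₀ : t₀ ≤ 1) (hG : BallBounded K t₀ 0 G) :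
    BallNear K t₀ 0 0 (fun Y => wPrimitive (G Y)) := by
  obtain ⟨B, h⟩ := hG
  refine ⟨B, fun t ht Y hY => wNorm_wPrimitive_le.trans ?_⟩
  rw [ENNReal.coe_zero, zero_add, mul_assoc]
  gcongr
  refine le_trans (mul_le_of_le_one_left' ?_) (h t ht Y hY)
  exact_mod_cast ht.trans ht₀

theorem uwPrimitive {a : ℕ → ℕ → ℂ} (ha : ∀ t ≤ t₀, datumNorm t a ≤ b)
    (hG : BallBounded K t₀ 1 G) : BallNear K t₀ 0 b (fun Y => uwPrimitive a (G Y)) := by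
  obtain ⟨B, h⟩ := hG
  refine ⟨2 * B, fun t ht Y hY => wNorm_uwPrimitive_le.trans (add_le_add (ha t ht) ?_)⟩
  calc _ ≤ 2 * (t : ℝ≥0∞) * B := by gcongr; exact h t ht Y hY
    _ = _ := by push_cast; ring

/-- The step from `s_k` to `s_{k+1}`. The derivative `∂_v s_k` costs the factor `4` by the bound for
the degree in `v`, and everything else is of order `t`. -/
theorem ricci_succ {k : ℂ} {κ : ℝ} (hk : k = κ) (hκ : 1 / 2 ≤ κ)
    {E S : (Option FieldIndex → Series) → Series} (hE : BallNear K t₀ 0 0 E)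
    (hS : BallNear K t₀ 0 b S) (hS4 : ∀ Y, (∀ i, VDegLE (vDeg i) (Y i)) → VDegLE 4 (S Y))
    (hG : BallBounded K t₀ 1 G) :
    BallNear K t₀ 0 (4 * b) (fun Y => StaticVacuum.fuchs k (C (1 / 2) * pderiv ℂ 1 (S Y)
      + E Y * (X 0 * pderiv ℂ 0 (S Y)) + X 0 * G Y)) := by
  have h1 : BallNear K t₀ 1 (2 * b) (fun Y => C (1 / 2) * pderiv ℂ 1 (S Y)) := by
    obtain ⟨B, h⟩ := hS
    refine ⟨2 * B, fun t ht Y hY => (wNorm_mul_le.trans (mul_le_mul' (wNorm_C _)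
      ((wNorm_pderiv_le (hS4 Y fun i => (hY i).2)).trans
        (mul_le_mul_right (h t ht Y hY) 4)))).trans (le_of_eq ?_)⟩
    have : ((‖(1 / 2 : ℂ)‖₊ : ℝ≥0) : ℝ≥0∞) * 4 = 2 := by
      have h : ‖(1 / 2 : ℂ)‖₊ * 4 = 2 := by
        rw [← NNReal.coe_inj]; push_cast; norm_num
      exact_mod_cast congrArg ((↑) : ℝ≥0 → ℝ≥0∞) h
    rw [← mul_assoc, this]
    push_cast
    ring
  have h2 : BallBounded K t₀ 1 (fun Y => X 0 * pderiv ℂ 0 (S Y)) := by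
    obtain ⟨B, h⟩ := hS.bounded
    exact ⟨B, fun t ht Y hY => wNorm_u_mul_pderiv_le.trans (h t ht Y hY)⟩
  exact (((h1.add (hE.small_mul h2)).add (u_mul hG)).fuchs hk hκ).mono (by
    rw [← NNReal.coe_le_coe]; push_cast; linarith)

end BallNear
end

theorem IsStep.unique {μ : ℂ} {a : ℕ → ℕ → ℂ} {Y Z Z' : Option FieldIndex → Series}
    (h : IsStep μ a Y Z) (h' : IsStep μ a Y Z') : Z = Z' :=
  funext fun i => Agree.eq fun q => (h.agree h' (fun i => Agree.rfl' (Y i)) i).mono (Nat.le_succ q)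

set_option maxHeartbeats 1000000 in
/-- On a ball of sufficiently large radius the map of `IsStep` is bounded by numbers which depend on
the radius only through terms of order `t`. The constant accounts for the four steps from `s_0`, of
norm at most `D`, to `s_4`, and for the value `-2` of `s` on `I`. -/
theorem exists_stepBounds {μ : ℂ} {a : ℕ → ℕ → ℂ} {T : (Option FieldIndex → Series) →
    Option FieldIndex → Series} (hT : ∀ Y, IsStep μ a Y (T Y)) {t₀ D : ℝ≥0} (ht₀ : t₀ ≤ 1)
    (hD : ∀ t ≤ t₀, datumNorm t a ≤ D) (ha : ∀ m n, a m n ≠ 0 → (n : ℤ) ≤ 2 * m + 4) (K : ℝ≥0) :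
    ∀ i, BallNear K t₀ 0 (256 * D + 2) (fun Y => T Y i) := by
  have two : BallBounded K t₀ 0 (fun _ => 2) := by rw [← C_two]; exact BallBounded.const _
  have three : BallBounded K t₀ 0 (fun _ => 3) := by
    rw [← map_ofNat (C : ℂ →+* Series)]; exact BallBounded.const _
  have four : BallBounded K t₀ 0 (fun _ => 4) := by
    rw [← map_ofNat (C : ℂ →+* Series)]; exact BallBounded.const _
  have one : BallBounded K t₀ 0 (fun _ => 1) := by
    rw [← map_one (C : ℂ →+* Series)]; exact BallBounded.const _
  have fu : ∀ {k : ℂ} {κ : ℝ} {G : (Option FieldIndex → Series) → Series}, k = κ → 1 / 2 ≤ κ →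
      BallBounded K t₀ 0 G → BallNear K t₀ 0 0 (fun Y => fuchs k (X 0 * G Y)) :=
    fun hk hκ hG => by simpa using (BallNear.u_mul hG.one).fuchs hk hκ
  have fu0 : ∀ {G : (Option FieldIndex → Series) → Series},
      BallBounded K t₀ 0 G → BallNear K t₀ 0 0 (fun Y => fuchs 0 (X 0 * G Y)) :=
    fun hG => by simpa using (BallNear.u_mul hG.one).fuchs_zero
  have k1 : (1 : ℂ) = ((1 : ℝ) : ℂ) := by push_cast; rfl
  have k2 : (2 : ℂ) = ((2 : ℝ) : ℂ) := by push_cast; rfl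
  have k3 : (3 / 2 : ℂ) = ((3 / 2 : ℝ) : ℂ) := by push_cast; rfl
  have k4 : (1 / 2 : ℂ) = ((1 / 2 : ℝ) : ℂ) := by push_cast; rfl
  have a0 : BallNear K t₀ 0 0 (fun Y => T Y (some (conn01 0))) := by
    simp only [(hT _).conn01_0]
    apply fu k2 (by norm_num)
    repeat' with_reducible first
      | exact BallBounded.apply _ | exact BallBounded.const _ | assumption
      | apply BallBounded.add | apply BallBounded.sub | apply BallBounded.mul
  have b0 : BallNear K t₀ 0 0 (fun Y => T Y (some (conn11 0))) := by
    simp only [(hT _).conn11_0]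
    apply fu k1 (by norm_num)
    repeat' with_reducible first
      | exact BallBounded.apply _ | exact BallBounded.const _ | assumption
      | apply BallBounded.add | apply BallBounded.sub | apply BallBounded.mul
  have e0 : BallNear K t₀ 0 0 (fun Y => T Y (some (frame01 0))) := by
    simp only [(hT _).frame01_0]
    apply fu k1 (by norm_num)
    repeat' with_reducible first
      | exact BallBounded.apply _ | exact BallBounded.const _ | assumption
      | apply BallBounded.add | apply BallBounded.sub | apply BallBounded.mul
  have s0 : BallNear K t₀ 0 D (fun Y => T Y (some (ricci 0))) := by
    simp only [(hT _).ricci_0]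
    apply BallNear.uwPrimitive hD
    repeat' with_reducible first
      | apply BallBounded.add | apply BallBounded.sub
    all_goals try
      repeat' with_reducible first
        | exact BallBounded.apply _ | exact BallBounded.const _ | exact BallBounded.X_zero
        | assumption | exact BallBounded.u_mul_pderiv _
        | exact BallBounded.pderiv1 _ (by simp [vDeg])
        | apply BallBounded.add | apply BallBounded.sub | apply BallBounded.mul
        | apply BallBounded.one
  have deg : ∀ k, ∀ Y, (∀ i, VDegLE (vDeg i) (Y i)) → VDegLE 4 (T Y (some (ricci k))) :=
    fun k Y hY => ((hT Y).vDegLE ha hY _).mono (by fin_cases k <;> simp [vDeg])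
  have s1 : BallNear K t₀ 0 (4 * D) (fun Y => T Y (some (ricci 1))) := by
    simp only [(hT _).ricci_1]
    apply BallNear.ricci_succ k2 (by norm_num) e0 s0 (deg 0)
    repeat' with_reducible first
      | exact BallBounded.apply _ | exact BallBounded.const _ | assumption
      | exact BallBounded.pderiv1 _ (by simp [vDeg])
      | apply BallBounded.add | apply BallBounded.sub | apply BallBounded.mul
      | apply BallBounded.one
  have s2 : BallNear K t₀ 0 (4 * (4 * D)) (fun Y => T Y (some (ricci 2))) := by
    simp only [(hT _).ricci_2]
    apply BallNear.ricci_succ k3 (by norm_num) e0 s1 (deg 1)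
    repeat' with_reducible first
      | exact BallBounded.apply _ | exact BallBounded.const _ | assumption
      | exact BallBounded.pderiv1 _ (by simp [vDeg])
      | apply BallBounded.add | apply BallBounded.sub | apply BallBounded.mul
      | apply BallBounded.one
  have s3 : BallNear K t₀ 0 (4 * (4 * (4 * D))) (fun Y => T Y (some (ricci 3))) := by
    simp only [(hT _).ricci_3]
    apply BallNear.ricci_succ k1 (by norm_num) e0 s2 (deg 2)
    repeat' with_reducible first
      | exact BallBounded.apply _ | exact BallBounded.const _ | assumption
      | exact BallBounded.pderiv1 _ (by simp [vDeg])
      | apply BallBounded.add | apply BallBounded.sub | apply BallBounded.mul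
      | apply BallBounded.one
  have s4 : BallNear K t₀ 0 (4 * (4 * (4 * (4 * D)))) (fun Y => T Y (some (ricci 4))) := by
    simp only [(hT _).ricci_4]
    apply BallNear.ricci_succ k4 (by norm_num) e0 s3 (deg 3)
    repeat' with_reducible first
      | exact BallBounded.apply _ | exact BallBounded.const _ | assumption
      | exact BallBounded.pderiv1 _ (by simp [vDeg])
      | apply BallBounded.add | apply BallBounded.sub | apply BallBounded.mul
      | apply BallBounded.one
  have n1 : BallNear K t₀ 0 1 (fun _ => 1) := by
    rw [← map_one (C : ℂ →+* Series)]; simpa using BallNear.const (K := K) (t₀ := t₀) 1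
  have n2 : BallNear K t₀ 0 2 (fun _ => -C 2) := by
    simpa using (BallNear.const (K := K) (t₀ := t₀) 2).neg
  have wp : ∀ {G : (Option FieldIndex → Series) → Series}, BallBounded K t₀ 0 G →
      BallNear K t₀ 0 0 (fun Y => wPrimitive (G Y)) := fun h => BallNear.wPrimitive ht₀ h
  have add0 : ∀ {F G : (Option FieldIndex → Series) → Series}, BallNear K t₀ 1 0 F →
      BallNear K t₀ 1 0 G → BallNear K t₀ 1 0 (fun Y => F Y + G Y) :=
    fun hF hG => by simpa using hF.add hG
  have sub0 : ∀ {b} {F G : (Option FieldIndex → Series) → Series}, BallNear K t₀ 0 b F →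
      BallNear K t₀ 0 0 G → BallNear K t₀ 0 b (fun Y => F Y - G Y) :=
    fun hF hG => by simpa using hF.sub hG
  have z0 : 2 * (0 : ℝ≥0) ≤ 256 * D + 2 := by simp
  intro i
  have hs : ∀ {c : ℝ≥0}, c ≤ 2 → c ≤ 256 * D + 2 := fun h => h.trans (by simp)
  have hr : ∀ {c : ℝ≥0}, c ≤ 256 * D → c ≤ 256 * D + 2 := fun h => h.trans (by simp)
  have hm : ∀ {c : ℝ≥0}, c ≤ 256 → c * D ≤ 256 * D := fun h => by gcongr
  rcases i with _ | (k | k | k | k | _ | k | _ | k)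
  all_goals try fin_cases k
  all_goals try simp only [Fin.zero_eta, Fin.mk_one, Fin.reduceFinMk, Fin.isValue]
  all_goals first
    | exact a0.mono (hs (by norm_num)) | exact b0.mono (hs (by norm_num))
    | exact e0.mono (hs (by norm_num)) | exact s0.mono (hr
        (by simpa using hm (c := 1) (by norm_num)))
    | exact s1.mono (hr (hm (by norm_num)))
    | exact s2.mono (hr (by rw [← mul_assoc]; exact hm (by norm_num)))
    | exact s3.mono (hr (by simp only [← mul_assoc]; exact hm (by norm_num)))
    | exact s4.mono (hr (by simp only [← mul_assoc]; exact hm (by norm_num)))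
    | skip
  all_goals first
    | simp only [(hT _).eta] | simp only [(hT _).frame01_1] | simp only [(hT _).frame11_0]
    | simp only [(hT _).frame11_1] | simp only [(hT _).conn01_1] | simp only [(hT _).conn01_2]
    | simp only [(hT _).conn11_1] | simp only [(hT _).conn11_2] | simp only [(hT _).eq_zeta]
    | simp only [(hT _).dzeta_0] | simp only [(hT _).dzeta_1] | simp only [(hT _).dzeta_2]
    | simp only [(hT _).eq_scal]
  on_goal 1 => refine (n1.add (fu0 ?_)).mono (hs (by norm_num))
  on_goal 2 => refine ((add0 a0.one (BallNear.u_mul ?_)).fuchs k1 (by norm_num)).mono (hs (by simp))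
  on_goal 3 => refine (fu0 ?_).mono (hs (by simp))
  on_goal 4 => refine ((add0 b0.one (BallNear.u_mul ?_)).fuchs_zero).mono (hs (by simp))
  on_goal 5 => refine (fu k1 (by norm_num) ?_).mono (hs (by simp))
  on_goal 6 => refine (fu k1 (by norm_num) ?_).mono (hs (by simp))
  on_goal 7 => refine (fu0 ?_).mono (hs (by simp))
  on_goal 8 => refine (fu0 ?_).mono (hs (by simp))
  on_goal 9 => refine (fu0 ?_).mono (hs (by simp))
  on_goal 10 => refine (sub0 (wp (BallBounded.apply _)) (fu0 ?_)).mono (hs (by simp))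
  on_goal 11 => refine (fu0 ?_).neg.mono (hs (by simp))
  on_goal 12 => refine (fu0 ?_).mono (hs (by simp))
  on_goal 13 => refine (sub0 (sub0 n2 (wp ((BallBounded.apply _).mul (BallBounded.apply _))))
    (fu0 ?_)).mono (hs (by simp))
  all_goals repeat' with_reducible first
    | exact BallBounded.apply _ | exact BallBounded.const _ | assumption
    | apply BallBounded.one | apply BallBounded.add | apply BallBounded.sub | apply BallBounded.mul

instance : Finite FieldIndex :=
  Finite.of_surjective (α := Fin 2 ⊕ Fin 2 ⊕ Fin 3 ⊕ Fin 3 ⊕ Unit ⊕ Fin 3 ⊕ Unit ⊕ Fin 5)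
    (Sum.elim frame01 (Sum.elim frame11 (Sum.elim conn01 (Sum.elim conn11 (Sum.elim (fun _ => zeta)
      (Sum.elim dzeta (Sum.elim (fun _ => scal) ricci))))))) (by
    rintro (k | k | k | k | _ | k | _ | k)
    exacts [⟨.inl k, rfl⟩, ⟨.inr (.inl k), rfl⟩, ⟨.inr (.inr (.inl k)), rfl⟩,
      ⟨.inr (.inr (.inr (.inl k))), rfl⟩, ⟨.inr (.inr (.inr (.inr (.inl ())))), rfl⟩,
      ⟨.inr (.inr (.inr (.inr (.inr (.inl k))))), rfl⟩,
      ⟨.inr (.inr (.inr (.inr (.inr (.inr (.inl ())))))), rfl⟩,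
      ⟨.inr (.inr (.inr (.inr (.inr (.inr (.inr k)))))), rfl⟩])

/-- The coefficients of the fixed point have geometric growth: for small `t` the step maps a ball into
itself, and the fixed point is the limit of the iterates of `0`. -/
theorem exists_coeff_bound {μ : ℂ} {ψ : NullData} (hest : ∃ M r : ℝ, 0 < M ∧ 0 < r ∧
    ∀ p I, ‖ψ p I‖ ≤ (p ! : ℝ) * M / r ^ p) {Y : Option FieldIndex → Series}
    (hY : IsStep μ ψ.datumCoeff Y Y) :
    (∀ i, VDegLE (vDeg i) (Y i)) ∧ ∃ K R : ℝ≥0, ∀ i d,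
      ‖coeff d (Y i)‖₊ ≤ K * ((d 0 + d 2).choose (d 0) : ℝ≥0) * R ^ (d 0 + d 2) := by
  have ha : ∀ m n, ψ.datumCoeff m n ≠ 0 → (n : ℤ) ≤ 2 * m + 4 := fun m n h => by
    by_contra hc
    exact h (datumCoeff_eq_zero ψ (by omega))
  obtain ⟨t₀, D, ht₀, ht₁, hD⟩ := exists_datumNorm_le hest
  choose T hT using exists_isStep μ ψ.datumCoeff
  -- The radius exceeds the bound `256 * D + 2` by one, so that the terms of order `t` fit in for
  -- sufficiently small `t`.
  let K : ℝ≥0 := 256 * D + 3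
  choose B hB using exists_stepBounds hT ht₁ hD ha K
  obtain ⟨B', hB'⟩ : ∃ B', ∀ i, B i ≤ B' := by
    obtain ⟨B', h⟩ := Set.finite_range B |>.bddAbove
    exact ⟨B', fun i => h ⟨i, rfl⟩⟩
  let t : ℝ≥0 := min t₀ (1 / (B' + 1))
  have ht : 0 < t := lt_min ht₀ (by positivity)
  have htB : ∀ i, t * B i ≤ 1 := fun i => by
    calc t * B i ≤ 1 / (B' + 1) * (B' + 1) := by
          gcongr
          · exact min_le_right _ _
          · exact (hB' i).trans (by simp)
      _ = 1 := by field_simp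
  obtain ⟨Y', hY', hlim⟩ := exists_fixedPoint μ ψ.datumCoeff
  obtain rfl := hY.fixedPoint_unique hY'
  have hball : ∀ q, ∃ Z, NormBall K t Z ∧ ∀ i, Agree q (Y i) (Z i) := by
    refine hlim (NormBall K t) (fun i => ⟨by simp [wNorm_zero], VDegLE.zero⟩) fun Y Z hY hZ => ?_
    obtain rfl := hZ.unique (hT Y)
    refine fun i => ⟨(hB i t (min_le_left _ _) Y hY).trans ?_, (hT Y).vDegLE ha (fun i => (hY i).2)
        i⟩
    rw [← ENNReal.coe_mul, ← ENNReal.coe_add, ENNReal.coe_le_coe]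
    calc _ ≤ 256 * D + 2 + 1 := by gcongr; exact htB i
      _ = K := by simp only [K]; ring
  refine ⟨fun i => VDegLE.of_agree fun q => ?_, K, (t * t)⁻¹, fun i d => ?_⟩
  · obtain ⟨Z, hZ, h⟩ := hball q
    exact ⟨Z i, (hZ i).2, h i⟩
  · have h : wNorm t t 0 (Y i) ≤ K := wNorm_le_of_agree fun q => by
      obtain ⟨Z, hZ, h⟩ := hball q
      exact ⟨Z i, (hZ i).1, h i⟩
    have h := (ENNReal.le_tsum d).trans h
    rw [ENNReal.coe_le_coe, pow_zero, div_one, weight] at h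
    have hc : (0 : ℝ≥0) < (d 0 + d 2).choose (d 0) := by
      exact_mod_cast Nat.choose_pos (Nat.le_add_right _ _)
    have h1 : (t * t) ^ (d 0 + d 2) ≤ t ^ (d 0 + d 2) * t ^ d 2 := by
      rw [mul_pow]
      exact mul_le_mul' le_rfl (pow_le_pow_of_le_one zero_le ((min_le_left _ _).trans ht₁)
        (Nat.le_add_left _ _))
    rw [inv_pow, ← div_eq_mul_inv, le_div_iff₀ (by positivity)]
    rw [← mul_div_assoc, div_le_iff₀ hc] at h
    exact (mul_le_mul_right h1 _).trans h

/-! ### Absolute convergence -/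

/-- The binomial theorem, summed over the exponents from `q` on. -/
theorem tsum_choose_mul_pow (q : ℕ) (a b : ℝ≥0) :
    ∑' m, ∑' p, ((if q ≤ m + p then ((m + p).choose m : ℝ≥0) * a ^ m * b ^ p else 0 : ℝ≥0) : ℝ≥0∞) =
      ∑' j, ((if q ≤ j then (a + b) ^ j else 0 : ℝ≥0) : ℝ≥0∞) := by
  rw [← ENNReal.tsum_prod (f := fun m p : ℕ =>
    ((if q ≤ m + p then ((m + p).choose m : ℝ≥0) * a ^ m * b ^ p else 0 : ℝ≥0) : ℝ≥0∞)),
    ← (Finset.HasAntidiagonal.sigmaAntidiagonalEquivProd (A := ℕ)).tsum_eq]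
  refine (ENNReal.tsum_sigma fun (n : ℕ) (z : Finset.HasAntidiagonal.antidiagonal n) =>
    ((if q ≤ z.1.1 + z.1.2 then ((z.1.1 + z.1.2).choose z.1.1 : ℝ≥0) * a ^ z.1.1 * b ^ z.1.2
      else 0 : ℝ≥0) : ℝ≥0∞)).trans (tsum_congr fun n => ?_)
  rw [tsum_fintype, ← ENNReal.ofNNReal_finsetSum, ENNReal.coe_inj]
  rw [Finset.sum_coe_sort (Finset.HasAntidiagonal.antidiagonal n) fun z : ℕ × ℕ =>
    (if q ≤ z.1 + z.2 then ((z.1 + z.2).choose z.1 : ℝ≥0) * a ^ z.1 * b ^ z.2 else 0 : ℝ≥0)]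
  rw [(Commute.all a b).add_pow']
  split_ifs with h
  · refine Finset.sum_congr rfl fun z hz => ?_
    rw [Finset.HasAntidiagonal.mem_antidiagonal.1 hz, if_pos h, nsmul_eq_mul, mul_assoc]
  · refine Finset.sum_eq_zero fun z hz => ?_
    rw [Finset.HasAntidiagonal.mem_antidiagonal.1 hz, if_neg h]

/-- The terms of the series, summed over the domain `|v| ≤ 1 / (α ρ)`: the bound `n ≤ 2 m + k` on
the powers of `v` allows to trade the growth in `v` for the factor `α^{-2 m - k}`. -/
theorem tsum_term_le {f : Series} {K R ρ α : ℝ≥0} {g : ℕ → ℝ≥0} {q : ℕ} {k : ℤ}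
    (hf : ∀ d, ‖coeff d f‖₊ ≤ K * ((d 0 + d 2).choose (d 0) : ℝ≥0) * R ^ (d 0 + d 2) * g (d 1))
    (hq : UOrd q f) (hk : VDegLE k f) (hα : 0 < α) (hα1 : α ≤ 1) {z : Fin 3 → ℂ}
    (hz : ‖z 1‖₊ ≤ 1 / (α * ρ)) :
    ∑' d, (‖term f z d‖₊ : ℝ≥0∞) ≤ ((K * α ^ (-k) : ℝ≥0) : ℝ≥0∞) *
      (∑' n, ((g n * (ρ ^ n)⁻¹ : ℝ≥0) : ℝ≥0∞)) *
      ∑' j, ((if q ≤ j then (R * (‖z 0‖₊ + ‖z 2‖₊) / α ^ 2) ^ j else 0 : ℝ≥0) : ℝ≥0∞) := by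
  have hA : R * (‖z 0‖₊ + ‖z 2‖₊) / α ^ 2 = R * ‖z 0‖₊ / α ^ 2 + R * ‖z 2‖₊ / α ^ 2 := by ring
  rw [hA, ← tsum_choose_mul_pow, tsum_exp]
  have key : ∀ m n p, (‖term f z (expEquiv (m, n, p))‖₊ : ℝ≥0∞) ≤
      ((K * α ^ (-k) : ℝ≥0) : ℝ≥0∞) * ((g n * (ρ ^ n)⁻¹ : ℝ≥0) : ℝ≥0∞) *
      ((if q ≤ m + p then ((m + p).choose m : ℝ≥0) * (R * ‖z 0‖₊ / α ^ 2) ^ m *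
        (R * ‖z 2‖₊ / α ^ 2) ^ p else 0 : ℝ≥0) : ℝ≥0∞) := by
    intro m n p
    rw [← ENNReal.coe_mul, ← ENNReal.coe_mul, ENNReal.coe_le_coe]
    by_cases h0 : coeff (expEquiv (m, n, p)) f = 0
    · simp [term, h0]
    have hqm : q ≤ m + p := by
      by_contra hc
      exact h0 (hq _ (by simp; omega))
    have hn := hk _ h0
    simp only [expEquiv_zero, expEquiv_one] at hn
    rw [if_pos hqm, term, nnnorm_mul, Fin.prod_univ_three, nnnorm_mul, nnnorm_mul, nnnorm_pow,
      nnnorm_pow, nnnorm_pow]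
    have h1 := hf (expEquiv (m, n, p))
    simp only [expEquiv_zero, expEquiv_one, expEquiv_two] at h1 ⊢
    have h2 : ‖z 1‖₊ ^ n ≤ α ^ (-k) * (α ^ 2)⁻¹ ^ m * (α ^ 2)⁻¹ ^ p * (ρ ^ n)⁻¹ := by
      have e1 : ‖z 1‖₊ ^ n ≤ (α ^ n)⁻¹ * (ρ ^ n)⁻¹ := by
        calc _ ≤ (1 / (α * ρ)) ^ n := by gcongr
          _ = _ := by rw [one_div, inv_pow, mul_pow, mul_inv]
      refine e1.trans ?_
      gcongr
      have e2 : α ^ (-k) * (α ^ 2)⁻¹ ^ m * (α ^ 2)⁻¹ ^ p = α ^ (-(k + 2 * m + 2 * p)) := by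
        rw [inv_pow, inv_pow, ← pow_mul, ← pow_mul, ← zpow_natCast, ← zpow_natCast, ← zpow_neg,
          ← zpow_neg, ← zpow_add₀ hα.ne', ← zpow_add₀ hα.ne']
        congr 1
        push_cast
        ring
      rw [e2, ← zpow_natCast, ← zpow_neg]
      exact zpow_le_zpow_right_of_le_one₀ hα hα1 (by omega)
    calc _ ≤ K * ((m + p).choose m : ℝ≥0) * R ^ (m + p) * g n *
          (‖z 0‖₊ ^ m * (α ^ (-k) * (α ^ 2)⁻¹ ^ m * (α ^ 2)⁻¹ ^ p * (ρ ^ n)⁻¹) * ‖z 2‖₊ ^ p) := by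
          gcongr
      _ = _ := by rw [div_eq_mul_inv, div_eq_mul_inv]; ring
  refine (ENNReal.tsum_le_tsum fun m => ENNReal.tsum_le_tsum fun n =>
    ENNReal.tsum_le_tsum fun p => key m n p).trans (le_of_eq ?_)
  simp only [ENNReal.tsum_mul_left, ENNReal.tsum_mul_right]

theorem summable_of_tsum_ne_top {f : Series} {z : Fin 3 → ℂ}
    (h : ∑' d, (‖term f z d‖₊ : ℝ≥0∞) ≠ ⊤) : Summable fun d => ‖term f z d‖ := by
  have := ENNReal.tsum_coe_ne_top_iff_summable.1 h
  exact NNReal.summable_coe.2 this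

theorem norm_tsum_term_le {f : Series} {z : Fin 3 → ℂ} {B : ℝ≥0}
    (h : ∑' d, (‖term f z d‖₊ : ℝ≥0∞) ≤ B) : ‖∑' d, term f z d‖ ≤ B := by
  have hs := ENNReal.tsum_coe_ne_top_iff_summable.1 (h.trans_lt ENNReal.coe_lt_top).ne
  have h1 := nnnorm_tsum_le hs
  rw [← ENNReal.coe_tsum hs, ENNReal.coe_le_coe] at h
  exact_mod_cast h1.trans h

theorem tsum_ite_pow_le {A : ℝ≥0} (q : ℕ) :
    ∑' j, ((if q ≤ j then A ^ j else 0 : ℝ≥0) : ℝ≥0∞) ≤ A ^ q * (1 - A : ℝ≥0∞)⁻¹ := by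
  have hinj : Function.Injective fun j : ℕ => j + q := add_left_injective q
  rw [← hinj.tsum_eq]
  · rw [← ENNReal.tsum_geometric, ← ENNReal.tsum_mul_left]
    refine ENNReal.tsum_le_tsum fun j => ?_
    simp [pow_add, mul_comm]
  · intro j hj
    refine ⟨j - q, Nat.sub_add_cancel ?_⟩
    by_contra hc
    exact hj (by simp [hc])

/-- Absolute convergence from estimates of the Taylor coefficients. -/
theorem summable_term_of_bound {f : Series} {c r ρ : ℝ} {q : ℤ} (hc : 0 < c) (hr : 0 < r)
    (hρ : 0 < ρ) (h : ∀ d, ‖derivAtO f d‖ ≤ c * majorant r ρ q d) {k : ℤ} (hk : VDegLE k f) {α : ℝ}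
    (hα : 0 < α) (hα1 : α ≤ 1) {z : Fin 3 → ℂ} (hz : z ∈ convDomain r ρ α) :
    Summable fun d => ‖term f z d‖ := by
  lift c to ℝ≥0 using hc.le
  lift r to ℝ≥0 using hr.le
  lift ρ to ℝ≥0 using hρ.le
  lift α to ℝ≥0 using hα.le
  norm_cast at hc hr hρ hα hα1
  obtain ⟨hz1, hz2⟩ := hz
  have hz1 : ‖z 1‖₊ < 1 / (α * ρ) := by exact_mod_cast hz1
  have hz2 : ‖z 0‖₊ + ‖z 2‖₊ < α ^ 2 / r := by exact_mod_cast hz2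
  have hf : ∀ d, ‖coeff d f‖₊ ≤ (c * r ^ q) * ((d 0 + d 2).choose (d 0) : ℝ≥0) * r ^ (d 0 + d 2) *
      (ρ ^ d 1 * (((d 1 : ℝ≥0) + 1) ^ 2)⁻¹) := by
    intro d
    have h := h d
    rw [derivAtO, majorant] at h
    simp only [norm_mul, Complex.norm_natCast] at h
    have h : ((d 0)! : ℝ≥0) * ((d 1)! : ℝ≥0) * ((d 2)! : ℝ≥0) * ‖coeff d f‖₊ ≤
        c * (r ^ ((d 0 : ℤ) + (d 2 : ℤ) + q) * ((d 0 + d 2)! : ℝ≥0) * ρ ^ (d 1) * ((d 1)! : ℝ≥0)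
          / (((d 0 : ℝ≥0) + 1) ^ 2 * ((d 1 : ℝ≥0) + 1) ^ 2 * ((d 2 : ℝ≥0) + 1) ^ 2)) := by
      exact_mod_cast h
    have p0 : (0 : ℝ≥0) < (d 0)! := by exact_mod_cast Nat.factorial_pos _
    have p1 : (0 : ℝ≥0) < (d 1)! := by exact_mod_cast Nat.factorial_pos _
    have p2 : (0 : ℝ≥0) < (d 2)! := by exact_mod_cast Nat.factorial_pos _
    have hch : ((d 0 + d 2)! : ℝ≥0) = ((d 0 + d 2).choose (d 0) : ℝ≥0) * (d 0)! * (d 2)! := by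
      have := Nat.add_choose_mul_factorial_mul_factorial (d 0) (d 2)
      rw [← Nat.choose_symm_add] at this
      exact_mod_cast this.symm
    rw [hch, zpow_add₀ hr.ne', ← Nat.cast_add, zpow_natCast] at h
    have h' := (le_div_iff₀' (by positivity)).2 h
    refine h'.trans ?_
    calc _ = (c * r ^ q) * ((d 0 + d 2).choose (d 0) : ℝ≥0) * r ^ (d 0 + d 2) *
            (ρ ^ d 1 * (((d 1 : ℝ≥0) + 1) ^ 2)⁻¹) /
            (((d 0 : ℝ≥0) + 1) ^ 2 * ((d 2 : ℝ≥0) + 1) ^ 2) := by field_simp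
      _ ≤ _ := div_le_self zero_le (one_le_mul (one_le_pow₀ (by simp)) (one_le_pow₀ (by simp)))
  have hA : r * (‖z 0‖₊ + ‖z 2‖₊) / α ^ 2 < 1 := by
    rw [div_lt_one (by positivity)]
    rwa [lt_div_iff₀' hr] at hz2
  have hinv : Summable fun n : ℕ => (((n + 1 : ℕ) : ℝ≥0) ^ 2)⁻¹ := by
    have h : Summable fun n : ℕ => ((n : ℝ) ^ 2)⁻¹ := Real.summable_nat_pow_inv.2 one_lt_two
    have h := (summable_nat_add_iff 1).2 h
    rw [← NNReal.summable_coe]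
    refine h.congr fun n => ?_
    push_cast
    rfl
  apply summable_of_tsum_ne_top
  have hs : UOrd 0 f := fun d hd => absurd hd (by omega)
  refine ((tsum_term_le (g := fun n => ρ ^ n * (((n : ℝ≥0) + 1) ^ 2)⁻¹) hf hs hk hα hα1
      hz1.le).trans_lt ?_).ne
  refine ENNReal.mul_lt_top (ENNReal.mul_lt_top ENNReal.coe_lt_top ?_) ?_
  · refine lt_of_le_of_lt (le_of_eq (tsum_congr fun n => ?_)) (lt_top_iff_ne_top.2
      ((ENNReal.tsum_coe_ne_top_iff_summable
        (f := fun n : ℕ => (((n + 1 : ℕ) : ℝ≥0) ^ 2)⁻¹)).2 ?_))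
    · rw [ENNReal.coe_inj]
      push_cast
      field_simp
    · exact hinv
  · have hfin : ∀ A : ℝ≥0, A < 1 →
        ∑' j, ((if 0 ≤ j then A ^ j else 0 : ℝ≥0) : ℝ≥0∞) < ⊤ := fun A hA => by
      have h := tsum_ite_pow_le (A := A) 0
      have h1 : (1 - A : ℝ≥0∞)⁻¹ < ⊤ := by
        rw [ENNReal.inv_lt_top]
        exact tsub_pos_of_lt (by exact_mod_cast hA)
      rw [pow_zero, one_mul] at h
      exact h.trans_lt h1
    exact hfin _ hA

theorem succ_sq_le_four_pow (n : ℕ) : ((n : ℝ) + 1) ^ 2 ≤ 4 ^ n := by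
  have h : (n : ℝ) + 1 ≤ 2 ^ n := by exact_mod_cast Nat.lt_two_pow_self
  calc _ ≤ ((2 : ℝ) ^ n) ^ 2 := by gcongr
    _ = 4 ^ n := by rw [← pow_mul, mul_comm, pow_mul]; norm_num

/-- The rate `r ≥ 4 R` and the radius `ρ = 4` pay for the squares in the denominator of the
majorant. -/
theorem derivAtO_bound {f : Series} {K R : ℝ≥0} {r : ℝ} (hr : 0 < r) (hRr : 4 * R ≤ r)
    (hf : ∀ d, ‖coeff d f‖₊ ≤ K * ((d 0 + d 2).choose (d 0) : ℝ≥0) * R ^ (d 0 + d 2)) (q : ℤ)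
    (d : Fin 3 →₀ ℕ) : ‖derivAtO f d‖ ≤ (K * r ^ (-q)) * majorant r 4 q d := by
  have h : ‖coeff d f‖ ≤ K * ((d 0 + d 2).choose (d 0) : ℝ) * R ^ (d 0 + d 2) := by
    exact_mod_cast hf d
  rw [derivAtO, majorant]
  simp only [norm_mul, Complex.norm_natCast]
  have hch : ((d 0 + d 2)! : ℝ) = ((d 0 + d 2).choose (d 0) : ℝ) * (d 0)! * (d 2)! := by
    have := Nat.add_choose_mul_factorial_mul_factorial (d 0) (d 2)
    rw [← Nat.choose_symm_add] at this
    exact_mod_cast this.symm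
  rw [hch, zpow_add₀ hr.ne', ← Nat.cast_add, zpow_natCast, zpow_neg]
  calc _ ≤ ((d 0)! : ℝ) * (d 1)! * (d 2)! *
        (K * ((d 0 + d 2).choose (d 0) : ℝ) * R ^ (d 0 + d 2)) := by gcongr
    _ = K * (((d 0 + d 2).choose (d 0) : ℝ) * (d 0)! * (d 2)! * (d 1)!) * R ^ (d 0 + d 2) := by ring
    _ ≤ K * (((d 0 + d 2).choose (d 0) : ℝ) * (d 0)! * (d 2)! * (d 1)!) *
        (r ^ (d 0 + d 2) * 4 ^ d 1 /
        (((d 0 : ℝ) + 1) ^ 2 * ((d 1 : ℝ) + 1) ^ 2 * ((d 2 : ℝ) + 1) ^ 2)) := by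
      gcongr
      rw [le_div_iff₀ (by positivity)]
      calc (R : ℝ) ^ (d 0 + d 2) * (((d 0 : ℝ) + 1) ^ 2 * ((d 1 : ℝ) + 1) ^ 2 * ((d 2 : ℝ) + 1) ^ 2)
          ≤ (R : ℝ) ^ (d 0 + d 2) * (4 ^ d 0 * 4 ^ d 1 * 4 ^ d 2) := by
            gcongr <;> exact succ_sq_le_four_pow _
        _ = (4 * R) ^ (d 0 + d 2) * 4 ^ d 1 := by rw [mul_pow, pow_add 4]; ring
        _ ≤ _ := by gcongr
    _ = _ := by
      have := zpow_ne_zero q hr.ne'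
      field_simp

/-- On `sHat r 4` the sum of a series whose coefficients grow with a rate `R` smaller than `r` is
bounded by a power of `R / r`. -/
theorem norm_tsum_term_le_of_bound {f : Series} {K R r α : ℝ≥0} (hr : 0 < r) (hRr : 4 * R ≤ r)
    (hf : ∀ d, ‖coeff d f‖₊ ≤ K * ((d 0 + d 2).choose (d 0) : ℝ≥0) * R ^ (d 0 + d 2)) {q : ℕ}
    (hq : UOrd q f) {k : ℤ} (hk : VDegLE k f) (hα : 0 < α) (hα1 : α ≤ 1) {z : Fin 3 → ℂ}
    (hz : z ∈ convDomain r 4 α) : ‖∑' d, term f z d‖₊ ≤ K * α ^ (-k) * 4 * (R / r) ^ q := by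
  obtain ⟨hz1, hz2⟩ := hz
  have hz1 : ‖z 1‖₊ < 1 / (α * 4) := by exact_mod_cast hz1
  have hz2 : ‖z 0‖₊ + ‖z 2‖₊ < α ^ 2 / r := by exact_mod_cast hz2
  have hA : R * (‖z 0‖₊ + ‖z 2‖₊) / α ^ 2 ≤ R / r := by
    rw [div_le_iff₀ (by positivity)]
    calc _ ≤ R * (α ^ 2 / r) := by gcongr
      _ = _ := by ring
  have hRr' : R / r ≤ 1 / 2 := by
    rw [div_le_iff₀ hr, ← NNReal.coe_le_coe]
    have : (4 * R : ℝ) ≤ r := by exact_mod_cast hRr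
    push_cast
    linarith [R.coe_nonneg]
  have half : (1 - 1 / 2 : ℝ≥0)⁻¹ = 2 := by
    rw [← NNReal.coe_inj, NNReal.coe_inv, NNReal.coe_sub (by rw [← NNReal.coe_le_coe]; norm_num)]
    norm_num
  have hgeo : ∀ {A : ℝ≥0}, A ≤ 1 / 2 → (1 - A : ℝ≥0∞)⁻¹ ≤ 2 := fun {A} hA' => by
    have : (2 : ℝ≥0∞) = (1 - (1 / 2 : ℝ≥0) : ℝ≥0∞)⁻¹ := by
      have h2 : (2 : ℝ≥0∞) = ((2 : ℝ≥0) : ℝ≥0∞) := rfl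
      have h0 : (1 - 1 / 2 : ℝ≥0) ≠ 0 := fun h => by rw [h, inv_zero] at half; norm_num at half
      rw [h2, ← ENNReal.coe_one, ← ENNReal.coe_sub, ← ENNReal.coe_inv h0, half]
    rw [this]
    gcongr
  have h := tsum_term_le (g := fun _ => 1) (by simpa using hf) hq hk hα hα1 hz1.le
  have hB : ∑' d, (‖term f z d‖₊ : ℝ≥0∞) ≤ ((K * α ^ (-k) * 4 * (R / r) ^ q : ℝ≥0) : ℝ≥0∞) := by
    refine h.trans ?_
    have e1 : ∑' n : ℕ, ((1 * ((4 : ℝ≥0) ^ n)⁻¹ : ℝ≥0) : ℝ≥0∞) ≤ 2 := by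
      have := (tsum_ite_pow_le (A := 1 / 4) 0).trans (mul_le_mul_right (hgeo (A := 1 / 4) (by
        rw [← NNReal.coe_le_coe]; norm_num)) _)
      simpa using this
    have e2 := (tsum_ite_pow_le (A := R * (‖z 0‖₊ + ‖z 2‖₊) / α ^ 2) q).trans
      (mul_le_mul_right (hgeo (hA.trans hRr')) _)
    refine (mul_le_mul' (mul_le_mul' le_rfl e1) e2).trans ?_
    have e3 : ((R * (‖z 0‖₊ + ‖z 2‖₊) / α ^ 2 : ℝ≥0) : ℝ≥0∞) ^ q ≤ (((R / r) ^ q : ℝ≥0) : ℝ≥0∞) :=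
        by
      rw [← ENNReal.coe_pow, ENNReal.coe_le_coe]; gcongr
    refine (mul_le_mul' le_rfl (mul_le_mul' e3 le_rfl)).trans (le_of_eq ?_)
    have h2 : (2 : ℝ≥0∞) = ((2 : ℝ≥0) : ℝ≥0∞) := rfl
    rw [h2, ← ENNReal.coe_mul, ← ENNReal.coe_mul, ← ENNReal.coe_mul, ENNReal.coe_inj]
    ring
  exact norm_tsum_term_le hB

open scoped Topology

/-! ### Analyticity of the sums -/

/-- The exponents of total degree `n`. -/
def expOfDegree (n : ℕ) : Finset (Fin 3 →₀ ℕ) := Finset.finsuppAntidiag Finset.univ n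

theorem mem_expOfDegree {n : ℕ} {d : Fin 3 →₀ ℕ} : d ∈ expOfDegree n ↔ d 0 + d 1 + d 2 = n := by
  simp [expOfDegree, Fin.sum_univ_three]

/-- The exponents, sorted by their total degree. -/
def degreeEquiv : (Σ n, expOfDegree n) ≃ (Fin 3 →₀ ℕ) where
  toFun x := x.2.1
  invFun d := ⟨d 0 + d 1 + d 2, d, mem_expOfDegree.2 rfl⟩
  left_inv := by
    rintro ⟨n, d, h⟩
    obtain rfl := mem_expOfDegree.1 h
    rfl
  right_inv _ := rfl

/-- A multilinear form of degree `n` whose restriction to the diagonal is the monomial of exponent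
`d`, if `d` has degree `n`. -/
def monomialForm (d : Fin 3 →₀ ℕ) (n : ℕ) :
    ContinuousMultilinearMap ℂ (fun _ : Fin n => Fin 3 → ℂ) ℂ :=
  (ContinuousMultilinearMap.mkPiAlgebra ℂ (Fin n) ℂ).compContinuousLinearMap fun i =>
    ContinuousLinearMap.proj (if i.val < d 0 then 0 else if i.val < d 0 + d 1 then 1 else 2)

theorem monomialForm_apply (d : Fin 3 →₀ ℕ) {n : ℕ} (h : d 0 + d 1 + d 2 = n) (t : Fin 3 → ℂ) :
    (monomialForm d n fun _ => t) = ∏ j, t j ^ d j := by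
  subst h
  simp only [monomialForm, ContinuousMultilinearMap.compContinuousLinearMap_apply,
    ContinuousMultilinearMap.mkPiAlgebra_apply, ContinuousLinearMap.proj_apply]
  rw [Fin.prod_univ_add, Fin.prod_univ_add, Fin.prod_univ_three]
  congr 1
  · congr 1
    · rw [Finset.prod_congr rfl (g := fun _ => t 0)]
      · simp
      · intro i _
        rw [if_pos (by simp)]
    · rw [Finset.prod_congr rfl (g := fun _ => t 1)]
      · simp
      · intro i _
        rw [if_neg (by simp), if_pos (by simp)]
  · rw [Finset.prod_congr rfl (g := fun _ => t 2)]
    · simp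
    · intro i _
      rw [if_neg (by simp; omega), if_neg (by simp)]

theorem norm_monomialForm_le (d : Fin 3 →₀ ℕ) (n : ℕ) : ‖monomialForm d n‖ ≤ 1 := by
  refine ContinuousMultilinearMap.opNorm_le_bound zero_le_one fun v => ?_
  simp only [monomialForm, ContinuousMultilinearMap.compContinuousLinearMap_apply,
    ContinuousMultilinearMap.mkPiAlgebra_apply, ContinuousLinearMap.proj_apply]
  rw [norm_prod, one_mul]
  exact Finset.prod_le_prod (fun _ _ => norm_nonneg _) fun i _ => norm_le_pi_norm _ _

/-- The homogeneous parts of an absolutely summable power series are the terms of a formal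
multilinear series with radius of convergence at least `1`. -/
theorem analyticAt_tsum_monomials {c : (Fin 3 →₀ ℕ) → ℂ} (hc : Summable fun d => ‖c d‖)
    {t : Fin 3 → ℂ} (ht : ‖t‖ < 1) :
    AnalyticAt ℂ (fun t : Fin 3 → ℂ => ∑' d, c d * ∏ j, t j ^ d j) t := by
  let p : FormalMultilinearSeries ℂ (Fin 3 → ℂ) ℂ := fun n =>
    ∑ d ∈ expOfDegree n, c d • monomialForm d n
  have hp : HasFPowerSeriesOnBall (fun t : Fin 3 → ℂ => ∑' d, c d * ∏ j, t j ^ d j) p 0 1 := by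
    refine ⟨?_, zero_lt_one, fun {y} hy => ?_⟩
    · refine p.le_radius_of_bound (r := 1) (∑' d, ‖c d‖) fun n => ?_
      rw [NNReal.coe_one, one_pow, mul_one]
      refine (norm_sum_le _ _).trans (le_trans (Finset.sum_le_sum fun d _ => ?_)
        (hc.sum_le_tsum (expOfDegree n) fun _ _ => norm_nonneg _))
      rw [norm_smul]
      exact mul_le_of_le_one_right (norm_nonneg _) (norm_monomialForm_le d n)
    · have hy1 : ‖y‖ < 1 := by
        rwa [Metric.mem_eball, edist_zero_right, ← ofReal_norm, ENNReal.ofReal_lt_one] at hy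
      have hs : Summable fun d => c d * ∏ j, y j ^ d j := by
        refine Summable.of_norm_bounded hc fun d => ?_
        rw [norm_mul, norm_prod]
        refine mul_le_of_le_one_right (norm_nonneg _) (Finset.prod_le_one (fun _ _ => norm_nonneg _)
          fun j _ => ?_)
        rw [norm_pow]
        exact pow_le_one₀ (norm_nonneg _) ((norm_le_pi_norm y j).trans hy1.le)
      rw [zero_add]
      have h1 := (degreeEquiv.hasSum_iff).2 hs.hasSum
      refine h1.sigma fun n => ?_
      have : (p n fun _ => y) = ∑ d ∈ expOfDegree n, c d * ∏ j, y j ^ d j := by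
        simp only [p, sum_apply, smul_apply,
          smul_eq_mul]
        exact Finset.sum_congr rfl fun d hd => by rw [monomialForm_apply d (mem_expOfDegree.1 hd)]
      rw [this]
      exact (expOfDegree n).hasSum _
  exact hp.analyticAt_of_mem (by
    rwa [Metric.mem_eball, edist_zero_right, ← ofReal_norm, ENNReal.ofReal_lt_one])

/-- The open polydisc with centre `0` whose radii are the absolute values of the coordinates of
`w`. -/
def polydisc (w : Fin 3 → ℂ) : Set (Fin 3 → ℂ) := {z | ∀ j, ‖z j‖ < ‖w j‖}

theorem isOpen_polydisc (w : Fin 3 → ℂ) : IsOpen (polydisc w) := by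
  have : polydisc w = ⋂ j, {z | ‖z j‖ < ‖w j‖} := by ext; simp [polydisc]
  rw [this]
  exact isOpen_iInter_of_finite fun j =>
    isOpen_lt (continuous_apply j).norm continuous_const

theorem convex_polydisc (w : Fin 3 → ℂ) : Convex ℝ (polydisc w) := by
  have : polydisc w = Set.univ.pi fun j => Metric.ball (0 : ℂ) ‖w j‖ := by
    ext; simp [polydisc]
  rw [this]
  exact convex_pi fun j _ => convex_ball _ _

theorem zero_mem_polydisc {w z : Fin 3 → ℂ} (h : z ∈ polydisc w) : 0 ∈ polydisc w :=
  fun j => by simpa using (norm_nonneg _).trans_lt (h j)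

theorem exists_mem_polydisc {P : Set (Fin 3 → ℂ)} (hP : IsOpen P) {z : Fin 3 → ℂ} (hz : z ∈ P) :
    ∃ w ∈ P, z ∈ polydisc w := by
  obtain ⟨ε, hε, h⟩ := Metric.isOpen_iff.1 hP z hz
  refine ⟨fun j => z j + (if z j = 0 then 1 else z j / ‖z j‖) * ((ε / 2 : ℝ) : ℂ), h ?_, fun j =>
      ?_⟩
  · rw [mem_ball_iff_norm, pi_norm_lt_iff hε]
    intro j
    simp only [Pi.sub_apply, add_sub_cancel_left, norm_mul, Complex.norm_real]
    rw [Real.norm_of_nonneg (by positivity)]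
    split_ifs with h0
    · simp; linarith
    · simp [h0]; linarith
  · show ‖z j‖ < ‖z j + _‖
    split_ifs with h0
    · simp [h0, hε.ne']
    · have : z j + z j / ‖z j‖ * ((ε / 2 : ℝ) : ℂ) = z j * ((1 + ε / 2 / ‖z j‖ : ℝ) : ℂ) := by
        push_cast; ring
      rw [this, norm_mul, Complex.norm_real]
      have h1 : 0 < ‖z j‖ := norm_pos_iff.2 h0
      rw [Real.norm_of_nonneg (by positivity)]
      have : 0 < ε / 2 / ‖z j‖ := by positivity
      nlinarith

theorem summable_term_of_mem_polydisc {f : Series} {w z : Fin 3 → ℂ}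
    (hw : Summable fun d => ‖term f w d‖) (hz : ∀ j, ‖z j‖ ≤ ‖w j‖) :
    Summable fun d => ‖term f z d‖ := by
  refine Summable.of_nonneg_of_le (fun _ => norm_nonneg _) (fun d => ?_) hw
  simp only [term, norm_mul, norm_prod, norm_pow]
  gcongr
  exact hz _

/-- An absolutely convergent power series defines an analytic function on the open polydisc. -/
theorem analyticOnNhd_tsum_term {f : Series} {w : Fin 3 → ℂ}
    (hw : Summable fun d => ‖term f w d‖) :
    AnalyticOnNhd ℂ (fun z => ∑' d, term f z d) (polydisc w) := by
  intro z hz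
  have hw0 : ∀ j, w j ≠ 0 := fun j => norm_pos_iff.1 ((norm_nonneg _).trans_lt (hz j))
  let T : (Fin 3 → ℂ) →L[ℂ] (Fin 3 → ℂ) :=
    ContinuousLinearMap.pi fun j => (w j)⁻¹ • ContinuousLinearMap.proj j
  have hT : ∀ z j, T z j = (w j)⁻¹ * z j := fun z j => by simp [T]
  have e : (fun z => ∑' d, term f z d) =
      (fun t : Fin 3 → ℂ => ∑' d, term f w d * ∏ j, t j ^ d j) ∘ T := by
    funext z
    simp only [Function.comp]
    refine tsum_congr fun d => ?_
    rw [term, term, mul_assoc, ← Finset.prod_mul_distrib]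
    congr 1
    refine Finset.prod_congr rfl fun j _ => ?_
    rw [hT, ← mul_pow, mul_inv_cancel_left₀ (hw0 j)]
  rw [e]
  refine AnalyticAt.comp (analyticAt_tsum_monomials hw ?_) (T.analyticAt z)
  rw [pi_norm_lt_iff one_pos]
  intro j
  rw [hT, norm_mul, norm_inv, inv_mul_lt_one₀ (norm_pos_iff.2 (hw0 j))]
  exact hz j

/-! ### Taylor series -/

/-- The partial derivative. -/
def pd (b : Fin 3) (f : (Fin 3 → ℂ) → ℂ) : (Fin 3 → ℂ) → ℂ :=
  fun z => fderiv ℂ f z (Pi.single b 1)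

/-- The Taylor series at the origin. -/
def taylor (f : (Fin 3 → ℂ) → ℂ) : Series := fun d =>
  (pd 0)^[d 0] ((pd 1)^[d 1] ((pd 2)^[d 2] f)) 0 / ((d 0)! * (d 1)! * (d 2)!)

section
variable {f g : (Fin 3 → ℂ) → ℂ} {z : Fin 3 → ℂ}

theorem _root_.AnalyticAt.pd (hf : AnalyticAt ℂ f z) (b : Fin 3) :
    AnalyticAt ℂ (StaticVacuum.pd b f) z := by
  exact ((ContinuousLinearMap.apply ℂ ℂ (Pi.single b 1 : Fin 3 → ℂ)).analyticAt _).comp hf.fderiv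

theorem _root_.AnalyticAt.pd_iterate (hf : AnalyticAt ℂ f z) (b : Fin 3) (n : ℕ) :
    AnalyticAt ℂ ((StaticVacuum.pd b)^[n] f) z := by
  induction n with
  | zero => exact hf
  | succ n ih => rw [Function.iterate_succ_apply']; exact ih.pd b

theorem pd_congr (h : f =ᶠ[𝓝 z] g) (b : Fin 3) : pd b f =ᶠ[𝓝 z] pd b g :=
  h.fderiv.mono fun x hx => by rw [pd, pd, hx]

theorem pd_iterate_congr (h : f =ᶠ[𝓝 z] g) (b : Fin 3) (n : ℕ) :
    (pd b)^[n] f =ᶠ[𝓝 z] (pd b)^[n] g := by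
  induction n with
  | zero => exact h
  | succ n ih => simp only [Function.iterate_succ_apply']; exact pd_congr ih b

theorem taylor_congr (h : f =ᶠ[𝓝 0] g) : taylor f = taylor g := by
  funext d
  rw [taylor, taylor, ((pd_iterate_congr (pd_iterate_congr (pd_iterate_congr h 2 _) 1 _) 0
      _).eq_of_nhds)]

theorem pd_comm (hf : AnalyticAt ℂ f z) (b c : Fin 3) : pd b (pd c f) =ᶠ[𝓝 z] pd c (pd b f) := by
  have key : ∀ x, AnalyticAt ℂ f x → ∀ b c, pd b (pd c f) x =
      fderiv ℂ (fderiv ℂ f) x (Pi.single b 1) (Pi.single c 1) := by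
    intro x hx b c
    have h := (ContinuousLinearMap.apply ℂ ℂ (Pi.single c 1 : Fin 3 → ℂ)).hasFDerivAt.comp x
      hx.fderiv.differentiableAt.hasFDerivAt
    have e : pd c f = (ContinuousLinearMap.apply ℂ ℂ (Pi.single c 1 : Fin 3 → ℂ)) ∘ fderiv ℂ f :=
        rfl
    rw [pd, e, h.fderiv]
    rfl
  filter_upwards [hf.eventually_analyticAt] with x hx
  rw [key x hx, key x hx]
  exact hx.contDiffAt.isSymmSndFDerivAt_of_omega _ _

theorem pd_iterate_comm (hf : AnalyticAt ℂ f z) (b c : Fin 3) (n : ℕ) :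
    (pd b)^[n] (pd c f) =ᶠ[𝓝 z] pd c ((pd b)^[n] f) := by
  induction n with
  | zero => exact Filter.EventuallyEq.rfl
  | succ n ih =>
    simp only [Function.iterate_succ_apply']
    exact (pd_congr ih b).trans (pd_comm (hf.pd_iterate b n) b c)

theorem coeff_taylor (d : Fin 3 →₀ ℕ) : coeff d (taylor f) =
    (pd 0)^[d 0] ((pd 1)^[d 1] ((pd 2)^[d 2] f)) 0 / ((d 0)! * (d 1)! * (d 2)!) := rfl

theorem taylor_pd (hf : AnalyticAt ℂ f 0) (b : Fin 3) :
    taylor (pd b f) = pderiv ℂ b (taylor f) := by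
  ext d
  rw [coeff_pderiv, coeff_taylor, coeff_taylor]
  have e : (pd 0)^[d 0] ((pd 1)^[d 1] ((pd 2)^[d 2] (pd b f))) =ᶠ[𝓝 0]
      (pd 0)^[(d + Finsupp.single b 1 : Fin 3 →₀ ℕ) 0]
        ((pd 1)^[(d + Finsupp.single b 1 : Fin 3 →₀ ℕ) 1]
        ((pd 2)^[(d + Finsupp.single b 1 : Fin 3 →₀ ℕ) 2] f)) := by
    simp only [Finsupp.add_apply, Finsupp.single_apply]
    fin_cases b
    · have h1 := pd_iterate_comm hf 2 0 (d 2)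
      have h2 := (pd_iterate_congr h1 1 (d 1)).trans
        (pd_iterate_comm (hf.pd_iterate 2 (d 2)) 1 0 (d 1))
      have h3 := pd_iterate_congr h2 0 (d 0)
      rw [← Function.iterate_succ_apply] at h3
      exact h3
    · have h1 := pd_iterate_congr (pd_iterate_comm hf 2 1 (d 2)) 1 (d 1)
      rw [← Function.iterate_succ_apply] at h1
      exact pd_iterate_congr h1 0 (d 0)
    · exact Filter.EventuallyEq.rfl
  rw [e.eq_of_nhds]
  have h0 : ∀ n : ℕ, (n ! : ℂ) ≠ 0 := fun n => by exact_mod_cast Nat.factorial_ne_zero n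
  have h1 : ∀ n : ℕ, (n : ℂ) + 1 ≠ 0 := fun n => by exact_mod_cast Nat.succ_ne_zero n
  have h00 := h0 (d 0)
  have h01 := h0 (d 1)
  have h02 := h0 (d 2)
  have hb := h1 (d b)
  generalize (pd 0)^[(d + Finsupp.single b 1 : Fin 3 →₀ ℕ) 0]
    ((pd 1)^[(d + Finsupp.single b 1 : Fin 3 →₀ ℕ) 1]
      ((pd 2)^[(d + Finsupp.single b 1 : Fin 3 →₀ ℕ) 2] f)) 0 = A
  fin_cases b <;> simp [Nat.factorial_succ] at hb ⊢ <;> field_simp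

end

/-! ### The Taylor map -/

/-- The coefficients of total degree less than `q` vanish. -/
def LowVanish (q : ℕ) (f : Series) : Prop :=
  ∀ d : Fin 3 →₀ ℕ, d 0 + d 1 + d 2 < q → coeff d f = 0

namespace LowVanish
variable {q : ℕ} {f g : Series}

theorem zero_left (f : Series) : LowVanish 0 f := fun _ h => absurd h (by omega)
theorem add (hf : LowVanish q f) (hg : LowVanish q g) : LowVanish q (f + g) := fun d hd => by
  rw [map_add, hf d hd, hg d hd, add_zero]
theorem X_mul (hf : LowVanish q f) (b : Fin 3) : LowVanish (q + 1) (X b * f) := fun d hd => by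
  classical
  rw [X, coeff_monomial_mul]
  split_ifs with h
  · rw [one_mul]
    apply hf
    have h1 : 1 ≤ d b := Finsupp.single_le_iff.1 h
    fin_cases b <;> simp at h1 ⊢ <;> omega
  · rfl
/-- A series without constant term is controlled by its first derivatives. Identities of Taylor
series are proved by induction with this lemma. -/
theorem succ (h0 : coeff 0 f = 0) (h : ∀ b, LowVanish q (pderiv ℂ b f)) : LowVanish (q + 1) f := by
  intro d hd
  by_cases hd0 : d = 0
  · rw [hd0, h0]
  obtain ⟨b, hb⟩ : ∃ b, d b ≠ 0 := by
    by_contra hc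
    push Not at hc
    exact hd0 (Finsupp.ext hc)
  obtain ⟨e, rfl⟩ : ∃ e, d = e + Finsupp.single b 1 := ⟨d - Finsupp.single b 1,
    (tsub_add_cancel_of_le (Finsupp.single_le_iff.2 (Nat.one_le_iff_ne_zero.2 hb))).symm⟩
  have h1 := h b e (by fin_cases b <;> simp at hd <;> omega)
  rw [coeff_pderiv] at h1
  exact (mul_eq_zero.1 h1).resolve_right (by exact_mod_cast Nat.succ_ne_zero (e b))
theorem eq_zero (h : ∀ q, LowVanish q f) : f = 0 := by
  ext d; exact h _ d (Nat.lt_succ_self _)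
end LowVanish

section
variable {f g : (Fin 3 → ℂ) → ℂ}

theorem constantCoeff_taylor (f : (Fin 3 → ℂ) → ℂ) : constantCoeff (taylor f) = f 0 := by
  rw [← coeff_zero_eq_constantCoeff_apply, coeff_taylor]; simp

theorem pd_add (hf : AnalyticAt ℂ f 0) (hg : AnalyticAt ℂ g 0) (b : Fin 3) :
    pd b (f + g) =ᶠ[𝓝 0] pd b f + pd b g := by
  filter_upwards [hf.eventually_analyticAt, hg.eventually_analyticAt] with x hx hx'
  simp [pd, fderiv_add hx.differentiableAt hx'.differentiableAt]

theorem pd_mul (hf : AnalyticAt ℂ f 0) (hg : AnalyticAt ℂ g 0) (b : Fin 3) :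
    pd b (f * g) =ᶠ[𝓝 0] f * pd b g + g * pd b f := by
  filter_upwards [hf.eventually_analyticAt, hg.eventually_analyticAt] with x hx hx'
  simp [pd, fderiv_mul hx.differentiableAt hx'.differentiableAt]

theorem taylor_add (hf : AnalyticAt ℂ f 0) (hg : AnalyticAt ℂ g 0) :
    taylor (f + g) = taylor f + taylor g := by
  rw [← sub_eq_zero]
  refine LowVanish.eq_zero fun q => ?_
  induction q generalizing f g with
  | zero => exact LowVanish.zero_left _
  | succ q ih =>
    refine LowVanish.succ (by simp [constantCoeff_taylor]) fun b => ?_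
    rw [map_sub, map_add, ← taylor_pd hf, ← taylor_pd hg, ← taylor_pd (hf.add hg),
      taylor_congr (pd_add hf hg b)]
    exact ih (hf.pd b) (hg.pd b)

theorem taylor_mul (hf : AnalyticAt ℂ f 0) (hg : AnalyticAt ℂ g 0) :
    taylor (f * g) = taylor f * taylor g := by
  rw [← sub_eq_zero]
  refine LowVanish.eq_zero fun q => ?_
  induction q generalizing f g with
  | zero => exact LowVanish.zero_left _
  | succ q ih =>
    refine LowVanish.succ (by simp [constantCoeff_taylor]) fun b => ?_
    have h1 := ih hf (hg.pd b)
    have h2 := ih hg (hf.pd b)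
    have e : pderiv ℂ b (taylor (f * g) - taylor f * taylor g) =
        (taylor (f * pd b g) - taylor f * taylor (pd b g)) +
        (taylor (g * pd b f) - taylor g * taylor (pd b f)) := by
      rw [map_sub, Derivation.leibniz, smul_eq_mul, smul_eq_mul, ← taylor_pd hf, ← taylor_pd hg,
        ← taylor_pd (hf.mul hg), taylor_congr (pd_mul hf hg b),
        taylor_add (hf.mul (hg.pd b)) (hg.mul (hf.pd b))]
      ring
    rw [e]
    exact h1.add h2

theorem pd_const (c : ℂ) (b : Fin 3) : pd b (fun _ => c) = fun _ => 0 := by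
  funext z; simp [pd]

theorem taylor_const (c : ℂ) : taylor (fun _ => c) = C c := by
  have h0 : taylor (fun _ => 0) = 0 := by
    refine LowVanish.eq_zero fun q => ?_
    induction q with
    | zero => exact LowVanish.zero_left _
    | succ q ih =>
      refine LowVanish.succ (constantCoeff_taylor _) fun b => ?_
      rw [← taylor_pd analyticAt_const, pd_const]
      exact ih
  rw [← sub_eq_zero]
  refine LowVanish.eq_zero fun q => ?_
  cases q with
  | zero => exact LowVanish.zero_left _
  | succ q =>
    refine LowVanish.succ (by simp [constantCoeff_taylor]) fun b => ?_
    rw [map_sub, ← taylor_pd analyticAt_const, pd_const, h0, pderiv_C, sub_zero]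
    exact fun _ _ => rfl

theorem taylor_coord (j : Fin 3) : taylor (fun z => z j) = X j := by
  have ha : AnalyticAt ℂ (fun z : Fin 3 → ℂ => z j) 0 :=
    (ContinuousLinearMap.proj j : (Fin 3 → ℂ) →L[ℂ] ℂ).analyticAt 0
  rw [← sub_eq_zero]
  refine LowVanish.eq_zero fun q => ?_
  cases q with
  | zero => exact LowVanish.zero_left _
  | succ q =>
    refine LowVanish.succ (by simp [constantCoeff_taylor]) fun b => ?_
    have e : pd b (fun z : Fin 3 → ℂ => z j) = fun _ => if j = b then 1 else 0 := by
      funext z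
      have h := (ContinuousLinearMap.proj j : (Fin 3 → ℂ) →L[ℂ] ℂ).hasFDerivAt (x := z)
      have h' : fderiv ℂ (fun z : Fin 3 → ℂ => z j) z = _ := h.fderiv
      rw [pd, h']
      simp [Pi.single_apply]
    rw [map_sub, ← taylor_pd ha, e, taylor_const]
    have : pderiv ℂ b (X j : Series) = C (if j = b then 1 else 0) := by
      split_ifs with h
      · rw [h]; simp
      · rw [pderiv_X_of_ne h]; simp
    rw [this, sub_self]
    exact fun _ _ => rfl

/-- The derivative in the direction `y`. -/
def dirDeriv (y : Fin 3 → ℂ) (f : (Fin 3 → ℂ) → ℂ) : (Fin 3 → ℂ) → ℂ := fun z => fderiv ℂ f z y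

theorem analyticAt_dirDeriv {z : Fin 3 → ℂ} (hf : AnalyticAt ℂ f z) (y : Fin 3 → ℂ) :
    AnalyticAt ℂ (dirDeriv y f) z :=
  ((ContinuousLinearMap.apply ℂ ℂ y).analyticAt _).comp hf.fderiv

theorem dirDeriv_eq (y : Fin 3 → ℂ) (f : (Fin 3 → ℂ) → ℂ) : dirDeriv y f =
    (fun _ => y 0) * pd 0 f + ((fun _ => y 1) * pd 1 f + (fun _ => y 2) * pd 2 f) := by
  funext z
  have hy : y = y 0 • Pi.single 0 1 + (y 1 • Pi.single 1 1 + y 2 • Pi.single 2 1) := by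
    ext j; fin_cases j <;> simp
  simp only [dirDeriv, Pi.add_apply, Pi.mul_apply, pd]
  conv_lhs => rw [hy]
  simp only [map_add, map_smul, smul_eq_mul]

/-- The vanishing of the Taylor series is inherited by the directional derivatives. -/
theorem taylor_dirDeriv_eq_zero (hf : AnalyticAt ℂ f 0) (h : taylor f = 0) (y : Fin 3 → ℂ) :
    taylor (dirDeriv y f) = 0 := by
  have hc : ∀ b, AnalyticAt ℂ (fun _ : Fin 3 → ℂ => y b) 0 := fun _ => analyticAt_const
  rw [dirDeriv_eq, taylor_add ((hc 0).mul (hf.pd 0)) (((hc 1).mul (hf.pd 1)).add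
    ((hc 2).mul (hf.pd 2))), taylor_add ((hc 1).mul (hf.pd 1)) ((hc 2).mul (hf.pd 2)),
    taylor_mul (hc 0) (hf.pd 0), taylor_mul (hc 1) (hf.pd 1), taylor_mul (hc 2) (hf.pd 2),
    taylor_pd hf, taylor_pd hf, taylor_pd hf, h]
  simp

/-- An analytic function whose Taylor series vanishes is zero near the origin. -/
theorem eventually_eq_zero_of_taylor (hf : AnalyticAt ℂ f 0) (h : taylor f = 0) :
    f =ᶠ[𝓝 0] 0 := by
  obtain ⟨r, hr, han⟩ := Metric.eventually_nhds_iff_ball.1 hf.eventually_analyticAt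
  have hD : ∀ y n, AnalyticAt ℂ ((dirDeriv y)^[n] f) 0 ∧ taylor ((dirDeriv y)^[n] f) = 0 := by
    intro y n
    induction n with
    | zero => exact ⟨hf, h⟩
    | succ n ih =>
      rw [Function.iterate_succ_apply']
      exact ⟨analyticAt_dirDeriv ih.1 y, taylor_dirDeriv_eq_zero ih.1 ih.2 y⟩
  refine Metric.eventually_nhds_iff_ball.2 ⟨r, hr, fun y hy => ?_⟩
  -- the restriction of `f` to the complex line through `0` and `y`
  let l : ℂ →L[ℂ] (Fin 3 → ℂ) := ContinuousLinearMap.toSpanSingleton ℂ y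
  let U : Set ℂ := l ⁻¹' Metric.ball 0 r
  have hconv : Convex ℝ U := (convex_ball (0 : Fin 3 → ℂ) r).is_linear_preimage
    ((l.restrictScalars ℝ : ℂ →ₗ[ℝ] (Fin 3 → ℂ)).isLinear)
  have hU : AnalyticOnNhd ℂ (f ∘ l) U := fun t ht => (han (l t) ht).comp (l.analyticAt t)
  have h0 : (0 : ℂ) ∈ U := by simp [U, hr]
  have hit : ∀ n, ∀ᶠ t in 𝓝 (0 : ℂ), iteratedDeriv n (f ∘ l) t = (dirDeriv y)^[n] f (l t) := by
    intro n
    induction n with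
    | zero => exact Filter.Eventually.of_forall fun t => by simp
    | succ n ih =>
      have hl : Filter.Tendsto l (𝓝 0) (𝓝 0) := by simpa using l.continuous.tendsto 0
      filter_upwards [ih.eventually_nhds, hl.eventually (hD y n).1.eventually_analyticAt] with t ht
          ha
      rw [iteratedDeriv_succ, Function.iterate_succ_apply',
        Filter.EventuallyEq.deriv_eq (f₁ := iteratedDeriv n (f ∘ l))
          (f := ((dirDeriv y)^[n] f) ∘ l) ht]
      have := ha.differentiableAt.hasFDerivAt.comp_hasDerivAt t l.hasDerivAt
      rw [this.deriv]
      simp [dirDeriv, l]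
  have hord : analyticOrderAt (f ∘ l) 0 = ⊤ := by
    rw [ENat.eq_top_iff_forall_ge]
    intro n
    rw [natCast_le_analyticOrderAt_iff_iteratedDeriv_eq_zero (hU 0 h0)]
    intro i _
    have hc := constantCoeff_taylor ((dirDeriv y)^[i] f)
    rw [(hD y i).2, map_zero] at hc
    rw [(hit i).self_of_nhds, map_zero, ← hc]
  have hz := hU.eqOn_zero_of_preconnected_of_eventuallyEq_zero hconv.isPreconnected h0
    (analyticOrderAt_eq_top.1 hord)
  have h1 : (1 : ℂ) ∈ U := by simpa [U, l] using hy
  simpa [l] using hz h1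

end

/-- The functions which are analytic on `U`. -/
def analyticRing (U : Set (Fin 3 → ℂ)) : Subring ((Fin 3 → ℂ) → ℂ) where
  carrier := {f | AnalyticOnNhd ℂ f U}
  mul_mem' hf hg := hf.mul hg
  one_mem' := analyticOnNhd_const
  add_mem' hf hg := hf.add hg
  zero_mem' := analyticOnNhd_const
  neg_mem' hf := hf.neg

/-- The Taylor series at the origin as a ring homomorphism. -/
def taylorHom {U : Set (Fin 3 → ℂ)} (h0 : 0 ∈ U) : analyticRing U →+* Series where
  toFun f := taylor f.1
  map_one' := by rw [← map_one (C : ℂ →+* Series)]; exact taylor_const 1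
  map_mul' f g := taylor_mul (f.2 0 h0) (g.2 0 h0)
  map_zero' := by rw [← map_zero (C : ℂ →+* Series)]; exact taylor_const 0
  map_add' f g := taylor_add (f.2 0 h0) (g.2 0 h0)

/-- The value at a point. -/
def evalHom (U : Set (Fin 3 → ℂ)) (z : Fin 3 → ℂ) : analyticRing U →+* ℂ where
  toFun f := f.1 z
  map_one' := rfl
  map_mul' _ _ := rfl
  map_zero' := rfl
  map_add' _ _ := rfl

/-- The identity theorem in terms of Taylor series. -/
theorem eqOn_zero_of_taylor {U : Set (Fin 3 → ℂ)} (hU : IsPreconnected U) (h0 : 0 ∈ U)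
    {f : (Fin 3 → ℂ) → ℂ} (hf : AnalyticOnNhd ℂ f U) (h : taylor f = 0) : Set.EqOn f 0 U :=
  hf.eqOn_zero_of_preconnected_of_eventuallyEq_zero hU h0
    (eventually_eq_zero_of_taylor (hf 0 h0) h)

section
variable {f g : Series} {z w : Fin 3 → ℂ}

theorem term_add (f g : Series) (z : Fin 3 → ℂ) (d : Fin 3 →₀ ℕ) :
    term (f + g) z d = term f z d + term g z d := by
  rw [term, map_add, add_mul]; rfl

theorem prod_pow_add_single (z : Fin 3 → ℂ) (d : Fin 3 →₀ ℕ) (b : Fin 3) :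
    ∏ j, z j ^ (d + Finsupp.single b 1 : Fin 3 →₀ ℕ) j = z b * ∏ j, z j ^ d j := by
  rw [Fin.prod_univ_three, Fin.prod_univ_three]
  fin_cases b <;> simp [pow_succ] <;> ring

theorem coeff_add_single_X_mul (f : Series) (d : Fin 3 →₀ ℕ) (b : Fin 3) :
    coeff (d + Finsupp.single b 1) (X b * f) = coeff d f := by
  classical
  rw [X, coeff_monomial_mul, if_pos le_add_self, one_mul, add_tsub_cancel_right]

theorem term_X_mul (b : Fin 3) (f : Series) (z : Fin 3 → ℂ) (d : Fin 3 →₀ ℕ) :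
    term (X b * f) z (d + Finsupp.single b 1) = z b * term f z d := by
  rw [term, term, coeff_add_single_X_mul, prod_pow_add_single]; ring

theorem term_X_mul_eq_zero (b : Fin 3) (f : Series) (z : Fin 3 → ℂ) {d : Fin 3 →₀ ℕ}
    (hd : d b = 0) : term (X b * f) z d = 0 := by
  classical
  rw [term, X, coeff_monomial_mul, if_neg, zero_mul]
  rw [Finsupp.single_le_iff]
  omega

theorem tsum_term_X_mul (b : Fin 3) (f : Series) (z : Fin 3 → ℂ) :
    ∑' d, term (X b * f) z d = z b * ∑' d, term f z d := by
  have hinj : Function.Injective fun d : Fin 3 →₀ ℕ => d + Finsupp.single b 1 :=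
    add_left_injective _
  rw [← hinj.tsum_eq, ← tsum_mul_left]
  · exact tsum_congr fun d => term_X_mul b f z d
  · intro d hd
    refine ⟨d - Finsupp.single b 1, tsub_add_cancel_of_le (Finsupp.single_le_iff.2 ?_)⟩
    by_contra h
    exact hd (term_X_mul_eq_zero b f z (by omega))

theorem tsum_term_C (c : ℂ) (z : Fin 3 → ℂ) : ∑' d, term (C c) z d = c := by
  classical
  rw [tsum_eq_single 0]
  · simp [term]
  · intro d hd
    rw [term, coeff_C, if_neg hd, zero_mul]

/-- The part of `f` which does not contain the variable number `b`. -/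
def restrictVar (b : Fin 3) (f : Series) : Series := fun d => if d b = 0 then coeff d f else 0

/-- The quotient of the rest of `f` by the variable number `b`. -/
def divVar (b : Fin 3) (f : Series) : Series := fun d => coeff (d + Finsupp.single b 1) f

theorem coeff_restrictVar (b : Fin 3) (f : Series) (d : Fin 3 →₀ ℕ) :
    coeff d (restrictVar b f) = if d b = 0 then coeff d f else 0 := rfl

theorem coeff_divVar (b : Fin 3) (f : Series) (d : Fin 3 →₀ ℕ) :
    coeff d (divVar b f) = coeff (d + Finsupp.single b 1) f := rfl

theorem restrictVar_add_X_mul_divVar (b : Fin 3) (f : Series) :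
    restrictVar b f + X b * divVar b f = f := by
  ext d
  rw [map_add, coeff_restrictVar]
  split_ifs with h
  · rw [add_eq_left]
    classical
    rw [X, coeff_monomial_mul, if_neg]
    rw [Finsupp.single_le_iff]
    omega
  · obtain ⟨e, rfl⟩ : ∃ e, d = e + Finsupp.single b 1 := ⟨d - Finsupp.single b 1,
      (tsub_add_cancel_of_le (Finsupp.single_le_iff.2 (Nat.one_le_iff_ne_zero.2 h))).symm⟩
    rw [coeff_add_single_X_mul, coeff_divVar, zero_add]

theorem summable_restrictVar (hw : Summable fun d => ‖term f w d‖) (b : Fin 3) :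
    Summable fun d => ‖term (restrictVar b f) w d‖ := by
  refine Summable.of_nonneg_of_le (fun _ => norm_nonneg _) (fun d => ?_) hw
  rw [term, coeff_restrictVar]
  split_ifs
  · exact le_rfl
  · simp

theorem summable_divVar (hw : Summable fun d => ‖term f w d‖) {b : Fin 3} (hb : w b ≠ 0) :
    Summable fun d => ‖term (divVar b f) w d‖ := by
  have hinj : Function.Injective fun d : Fin 3 →₀ ℕ => d + Finsupp.single b 1 :=
    add_left_injective _
  refine ((hw.comp_injective hinj).mul_left ‖w b‖⁻¹).congr fun d => ?_
  rw [Function.comp, ← norm_inv, ← norm_mul, term, prod_pow_add_single, term, coeff_divVar]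
  congr 1
  field_simp

/-- The Taylor series of the sum of a convergent power series. -/
theorem taylor_tsum_term (hz : z ∈ polydisc w) (hw : Summable fun d => ‖term f w d‖) :
    taylor (fun z => ∑' d, term f z d) = f := by
  have hw0 : ∀ j, w j ≠ 0 := fun j => norm_pos_iff.1 ((norm_nonneg _).trans_lt (hz j))
  have h0 := zero_mem_polydisc hz
  have han : ∀ {g : Series}, (Summable fun d => ‖term g w d‖) →
      AnalyticAt ℂ (fun z => ∑' d, term g z d) 0 := fun hg => analyticOnNhd_tsum_term hg 0 h0
  have hadd : ∀ {q} {g h : Series}, (Summable fun d => ‖term g w d‖) →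
      (Summable fun d => ‖term h w d‖) →
      LowVanish q (taylor (fun z => ∑' d, term g z d) - g) →
      LowVanish q (taylor (fun z => ∑' d, term h z d) - h) →
      LowVanish q (taylor (fun z => ∑' d, term (g + h) z d) - (g + h)) := by
    intro q g h hg hh h1 h2
    have e : (fun z => ∑' d, term (g + h) z d) =ᶠ[𝓝 0]
        (fun z => ∑' d, term g z d) + fun z => ∑' d, term h z d := by
      filter_upwards [(isOpen_polydisc w).mem_nhds h0] with z hz
      have hs : ∀ {k : Series}, (Summable fun d => ‖term k w d‖) → Summable fun d => term k z d :=
        fun hk => (summable_term_of_mem_polydisc hk fun j => (hz j).le).of_norm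
      simp only [term_add, Pi.add_apply]
      exact (hs hg).tsum_add (hs hh)
    rw [taylor_congr e, taylor_add (han hg) (han hh), add_sub_add_comm]
    exact h1.add h2
  have hX : ∀ {q} {g : Series} b, (Summable fun d => ‖term g w d‖) →
      LowVanish q (taylor (fun z => ∑' d, term g z d) - g) →
      LowVanish (q + 1) (taylor (fun z => ∑' d, term (X b * g) z d) - X b * g) := by
    intro q g b hg h
    have e : (fun z => ∑' d, term (X b * g) z d) =
        (fun z => z b) * fun z => ∑' d, term g z d := funext fun z => tsum_term_X_mul b g z
    have ha : AnalyticAt ℂ (fun z : Fin 3 → ℂ => z b) 0 :=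
      (ContinuousLinearMap.proj b : (Fin 3 → ℂ) →L[ℂ] ℂ).analyticAt 0
    rw [e, taylor_mul ha (han hg), taylor_coord, ← mul_sub]
    exact h.X_mul b
  have hC : ∀ q c, LowVanish q (taylor (fun z => ∑' d, term (C c) z d) - C c) := by
    intro q c
    simp only [tsum_term_C]
    rw [taylor_const, sub_self]
    exact fun _ _ => rfl
  have hXs : ∀ {g : Series} b, (Summable fun d => ‖term g w d‖) →
      Summable fun d => ‖term (X b * divVar b g) w d‖ := by
    intro g b hg
    have e : X b * divVar b g = g - restrictVar b g := by
      rw [eq_sub_iff_add_eq, add_comm, restrictVar_add_X_mul_divVar]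
    refine Summable.of_nonneg_of_le (fun _ => norm_nonneg _) (fun d => ?_) hg
    rw [term, e, map_sub, coeff_restrictVar]
    split_ifs
    · simp
    · rw [sub_zero]; rfl
  rw [← sub_eq_zero]
  refine LowVanish.eq_zero fun q => ?_
  induction q generalizing f with
  | zero => exact LowVanish.zero_left _
  | succ q ih =>
    have step : ∀ b {g : Series}, (Summable fun d => ‖term g w d‖) →
        LowVanish (q + 1) (taylor (fun z => ∑' d, term (restrictVar b g) z d) - restrictVar b g) →
        LowVanish (q + 1) (taylor (fun z => ∑' d, term g z d) - g) := by
      intro b g hg h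
      have := hadd (summable_restrictVar hg b) (hXs b hg) h
        (hX b (summable_divVar hg (hw0 b)) (ih (summable_divVar hg (hw0 b))))
      rwa [restrictVar_add_X_mul_divVar] at this
    have h1 := summable_restrictVar hw 0
    have h2 := summable_restrictVar h1 1
    refine step 0 hw (step 1 h1 (step 2 h2 ?_))
    have e : restrictVar 2 (restrictVar 1 (restrictVar 0 f)) = C (coeff 0 f) := by
      classical
      ext d
      rw [coeff_restrictVar, coeff_restrictVar, coeff_restrictVar, coeff_C]
      by_cases hd : d = 0
      · simp [hd]
      · rw [if_neg hd]
        split_ifs with a b c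
        · exact absurd (Finsupp.ext fun j => by fin_cases j <;> assumption) hd
        all_goals rfl
    rw [e]
    exact hC _ _

end

/-! ### Transfer between series and functions -/

/-- A function which vanishes where the coordinates with numbers in `s` are zero has a Taylor series
with the same property. -/
theorem coeff_taylor_eq_zero {s : Set (Fin 3)} {f : (Fin 3 → ℂ) → ℂ} (hf : AnalyticAt ℂ f 0)
    (h : ∀ᶠ z in 𝓝 (0 : Fin 3 → ℂ), (∀ j ∈ s, z j = 0) → f z = 0) {d : Fin 3 →₀ ℕ}
    (hd : ∀ j ∈ s, d j = 0) : coeff d (taylor f) = 0 := by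
  obtain ⟨n, hn⟩ : ∃ n, d 0 + d 1 + d 2 = n := ⟨_, rfl⟩
  induction n generalizing f d with
  | zero =>
    have : d = 0 := Finsupp.ext fun j => by fin_cases j <;> simp <;> omega
    rw [this, coeff_zero_eq_constantCoeff_apply, constantCoeff_taylor]
    exact h.self_of_nhds fun j _ => rfl
  | succ n ih =>
    obtain ⟨b, hb⟩ : ∃ b, d b ≠ 0 := by
      by_contra hc
      push Not at hc
      have := hc 0; have := hc 1; have := hc 2
      omega
    have hbs : b ∉ s := fun hc => hb (hd b hc)
    obtain ⟨e, rfl⟩ : ∃ e, d = e + Finsupp.single b 1 := ⟨d - Finsupp.single b 1,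
      (tsub_add_cancel_of_le (Finsupp.single_le_iff.2 (Nat.one_le_iff_ne_zero.2 hb))).symm⟩
    have hpd : ∀ᶠ z in 𝓝 (0 : Fin 3 → ℂ), (∀ j ∈ s, z j = 0) → pd b f z = 0 := by
      filter_upwards [h.eventually_nhds, hf.eventually_analyticAt] with z hz ha hzs
      have hl : HasDerivAt (fun t : ℂ => z + t • (Pi.single b 1 : Fin 3 → ℂ)) (Pi.single b 1) 0 :=
          by
        simpa using ((hasDerivAt_id (0 : ℂ)).smul_const (Pi.single b 1 : Fin 3 → ℂ)).const_add z
      have hz0 : z + (0 : ℂ) • (Pi.single b 1 : Fin 3 → ℂ) = z := by simp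
      have h1 : HasDerivAt (fun t : ℂ => f (z + t • (Pi.single b 1 : Fin 3 → ℂ))) (pd b f z) 0 := by
        refine HasFDerivAt.comp_hasDerivAt (f := fun t : ℂ => z + t • (Pi.single b 1 : Fin 3 → ℂ))
          (l := f) (l' := fderiv ℂ f z) 0 ?_ hl
        rw [hz0]
        exact ha.differentiableAt.hasFDerivAt
      have hz' : ∀ᶠ y in 𝓝 (z + (0 : ℂ) • (Pi.single b 1 : Fin 3 → ℂ)),
        (∀ j ∈ s, y j = 0) → f y = 0 := by rwa [hz0]
      have h2 : (fun t : ℂ => f (z + t • (Pi.single b 1 : Fin 3 → ℂ))) =ᶠ[𝓝 0] fun _ => 0 := by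
        filter_upwards [hl.continuousAt.eventually hz'] with t ht
        refine ht fun j hj => ?_
        have : j ≠ b := fun h => hbs (h ▸ hj)
        simp [hzs j hj, this]
      exact h1.unique ((hasDerivAt_const (0 : ℂ) (0 : ℂ)).congr_of_eventuallyEq h2)
    have := ih (hf.pd b) hpd (d := e) (fun j hj => by
      have := hd j hj
      simp at this
      exact this.1) (by fin_cases b <;> simp at hn <;> omega)
    rw [taylor_pd hf, coeff_pderiv] at this
    exact (mul_eq_zero.1 this).resolve_right (by exact_mod_cast Nat.succ_ne_zero (e b))

/-- The jet of a family of analytic functions, in the ring of analytic functions. -/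
def analyticJet {U : Set (Fin 3 → ℂ)} {F : HolFields} (hF : ∀ i, AnalyticOnNhd ℂ (F i) U) :
    Jet (analyticRing U) where
  u := ⟨fun z => z 0, (ContinuousLinearMap.proj 0 : (Fin 3 → ℂ) →L[ℂ] ℂ).analyticOnNhd U⟩
  val i := ⟨F i, hF i⟩
  der b i := ⟨pd b (F i), fun z hz => (hF i z hz).pd b⟩

/-- A constant function. -/
def analyticConst (U : Set (Fin 3 → ℂ)) (c : ℂ) : analyticRing U :=
  ⟨fun _ => c, analyticOnNhd_const⟩

section
variable {U : Set (Fin 3 → ℂ)} {F : HolFields}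

theorem map_taylorHom_analyticJet (hF : ∀ i, AnalyticOnNhd ℂ (F i) U) (h0 : 0 ∈ U) :
    (analyticJet hF).map (taylorHom h0) = seriesJet fun i => taylor (F i) := by
  simp only [Jet.map, analyticJet, seriesJet, taylorHom, RingHom.coe_mk, MonoidHom.coe_mk,
    OneHom.coe_mk, taylor_coord]
  congr 1
  funext b i
  exact taylor_pd (hF i 0 h0) b

theorem map_evalHom_analyticJet (hF : ∀ i, AnalyticOnNhd ℂ (F i) U) (z : Fin 3 → ℂ) :
    (analyticJet hF).map (evalHom U z) = holJet F z := rfl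

theorem taylorHom_const (h0 : 0 ∈ U) (c : ℂ) : taylorHom h0 (analyticConst U c) = C c :=
  taylor_const c

theorem evalHom_const (z : Fin 3 → ℂ) (c : ℂ) : evalHom U z (analyticConst U c) = c := rfl

/-- The equations hold for analytic functions if they hold for their Taylor series. -/
theorem complete_of_taylor (hF : ∀ i, AnalyticOnNhd ℂ (F i) U) (hU : IsPreconnected U) (h0 : 0 ∈ U)
    {μ : ℂ}
    (hred : ∀ x ∈ reducedList (C μ) (seriesJet fun i => taylor (F i)), x = 0)
    (hcon : ∀ x ∈ constraintList (C μ) (seriesJet fun i => taylor (F i)), x = 0)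
    {z : Fin 3 → ℂ} (hz : z ∈ U) (hu : z 0 ≠ 0) (hω : 1 - μ * F zeta z ≠ 0) :
    (holJet F z).CompleteEquations μ := by
  have key : ∀ x : analyticRing U, taylorHom h0 x = 0 → evalHom U z x = 0 := fun x hx =>
    eqOn_zero_of_taylor hU h0 x.2 hx hz
  rw [completeEquations_iff hu hω, ← map_evalHom_analyticJet hF z, ← evalHom_const (U := U) z μ,
    ← map_reducedList, ← map_constraintList]
  rw [← map_taylorHom_analyticJet hF h0, ← taylorHom_const h0 μ] at hred hcon
  rw [← map_reducedList] at hred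
  rw [← map_constraintList] at hcon
  simp only [List.forall_mem_map] at hred hcon ⊢
  exact ⟨fun x hx => key x (hred x hx), fun x hx => key x (hcon x hx)⟩

/-- The equations hold for the Taylor series of analytic functions if they hold at all points with
`u ≠ 0`. -/
theorem taylor_of_complete (hF : ∀ i, AnalyticOnNhd ℂ (F i) U) (hU : IsOpen U) (h0 : 0 ∈ U) {μ : ℂ}
    (h : ∀ z ∈ U, z 0 ≠ 0 → 1 - μ * F zeta z ≠ 0 ∧ (holJet F z).CompleteEquations μ) :
    (∀ x ∈ reducedList (C μ) (seriesJet fun i => taylor (F i)), x = 0) ∧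
    (∀ x ∈ constraintList (C μ) (seriesJet fun i => taylor (F i)), x = 0) := by
  have key : ∀ x : analyticRing U, (∀ z ∈ U, z 0 ≠ 0 → evalHom U z x = 0) →
      taylorHom h0 x = 0 := by
    intro x hx
    have e : taylorHom h0 ((analyticJet hF).u * x) = 0 := by
      have h1 : ((analyticJet hF).u * x).1 =ᶠ[𝓝 0] fun _ => 0 := by
        filter_upwards [hU.mem_nhds h0] with z hz
        show z 0 * x.1 z = 0
        by_cases hz0 : z 0 = 0
        · rw [hz0, zero_mul]
        · have : x.1 z = 0 := hx z hz hz0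
          rw [this, mul_zero]
      exact (taylor_congr h1).trans ((taylor_const 0).trans (map_zero C))
    rw [map_mul] at e
    have hu : taylorHom h0 (analyticJet hF).u = X 0 := taylor_coord 0
    rw [hu] at e
    exact (mul_eq_zero.1 e).resolve_left u_ne_zero
  rw [← map_taylorHom_analyticJet hF h0, ← taylorHom_const h0 μ, ← map_reducedList,
    ← map_constraintList]
  simp only [List.forall_mem_map]
  have hz : ∀ z ∈ U, z 0 ≠ 0 → (∀ x ∈ reducedList (analyticConst U μ) (analyticJet hF),
      evalHom U z x = 0) ∧ ∀ x ∈ constraintList (analyticConst U μ) (analyticJet hF),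
      evalHom U z x = 0 := by
    intro z hz hu
    have := (completeEquations_iff hu (h z hz hu).1).1 (h z hz hu).2
    rw [← map_evalHom_analyticJet hF z, ← evalHom_const (U := U) z μ,
      ← map_reducedList, ← map_constraintList] at this
    simpa only [List.forall_mem_map] using this
  exact ⟨fun x hx => key x fun z h1 h2 => (hz z h1 h2).1 x hx,
    fun x hx => key x fun z h1 h2 => (hz z h1 h2).2 x hx⟩

end

/-- The coefficients of `v^n w^p` with `p < q` vanish. -/
def WOrd (q : ℕ) (f : Series) : Prop :=
  ∀ d : Fin 3 →₀ ℕ, d 0 = 0 → d 2 < q → coeff d f = 0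

namespace WOrd
variable {q : ℕ} {f g : Series}

theorem zero_left (f : Series) : WOrd 0 f := fun _ _ h => absurd h (by omega)
theorem add (hf : WOrd q f) (hg : WOrd q g) : WOrd q (f + g) := fun d h0 hd => by
  rw [map_add, hf d h0 hd, hg d h0 hd, add_zero]
theorem mul_left (a : Series) (hf : WOrd q f) : WOrd q (a * f) := fun d h0 hd => by
  classical
  rw [coeff_mul]
  refine Finset.sum_eq_zero fun x hx => ?_
  have h1 : ∀ j, x.1 j + x.2 j = d j := fun j => by
    rw [← Finsupp.add_apply, Finset.HasAntidiagonal.mem_antidiagonal.1 hx]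
  rw [hf x.2 (by have := h1 0; omega) (by have := h1 2; omega), mul_zero]
theorem of_uOrd (hf : UOrd 1 f) : WOrd q f := fun d h0 _ => hf d (by omega)
/-- The value on `I` and the derivative along `∂_w` determine a series on `U_0`. -/
theorem step (hI : VanishesOnI f) (hf : WOrd q (pderiv ℂ 2 f)) : WOrd (q + 1) f := by
  intro d h0 hd
  by_cases h2 : d 2 = 0
  · exact hI d h0 h2
  have h := hf (d - Finsupp.single 2 1) (by simp [h0]) (by simp; omega)
  rw [coeff_pderiv, tsub_add_cancel_of_le
    (Finsupp.single_le_iff.2 (Nat.one_le_iff_ne_zero.2 h2))] at h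
  exact (mul_eq_zero.1 h).resolve_right (Nat.cast_add_one_ne_zero _)
theorem uOrd (h : ∀ q, WOrd q f) : UOrd 1 f := fun d hd =>
  h (d 2 + 1) d (by omega) (Nat.lt_succ_self _)
end WOrd

set_option maxHeartbeats 1000000 in
/-- The conditions on `U_0` which single out the formal expansion follow from the complete set of
equations and the conditions on `I`: on `U_0` the equations along `∂_w` are linear homogeneous
ordinary differential equations for `ζ`, `ζ_{01}`, `ζ_{11}`, whose data on `I` vanish. -/
theorem isFormalExpansion_of_complete {μ : ℂ} {ψ : NullData} {Y : FormalFields}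
    (hred : ∀ x ∈ reducedList (C μ) (seriesJet Y), x = 0)
    (hcon : ∀ x ∈ constraintList (C μ) (seriesJet Y), x = 0)
    (hg : ∀ i : FieldIndex, i.IsGauge → UOrd 1 (Y i)) (hz : VanishesOnI (Y zeta))
    (hdz : ∀ k, VanishesOnI (Y (dzeta k))) (hs : VanishesOnI (Y scal + C 2))
    (hd : ∀ d : Fin 3 →₀ ℕ, d 2 = 0 → coeff d (Y (ricci 0)) = ψ.datumCoeff (d 0) (d 1)) :
    IsFormalExpansion μ ψ Y := by
  have hω : 1 - C μ * Y zeta ≠ 0 := fun h => by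
    have h1 := congrArg (coeff 0) h
    have h2 := hz 0 rfl rfl
    rw [coeff_zero_eq_constantCoeff_apply] at h1 h2
    simp [h2] at h1
  have hred' := (seriesJet_reducedEquations_iff hω).2 hred
  simp only [reducedList, constraintList, List.forall_mem_cons, List.not_mem_nil, false_imp_iff,
    implies_true, and_true, seriesJet, Jet.dir01, Jet.dir11, Jet.grad] at hred hcon
  obtain ⟨-, -, -, -, -, -, -, -, -, -, -, -, -, -, -, r1, r2, r3, r4, -⟩ := hred
  obtain ⟨-, -, -, -, -, -, -, cz, -, -, -, cz0, cz1, cz2, -, cs, -⟩ := hcon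
  have pi : ∀ {f : Series}, UOrd 1 f → Ideal.Quotient.mk (uIdeal 1) f = 0 :=
    fun h => mk_uIdeal_eq_zero.2 h
  have e0 := pi (hg (frame01 0) trivial)
  have e1 := pi (hg (frame01 1) trivial)
  have f0 := pi (hg (frame11 0) trivial)
  have f1 := pi (hg (frame11 1) trivial)
  have a0 := pi (hg (conn01 0) trivial)
  have a1 := pi (hg (conn01 1) trivial)
  have a2 := pi (hg (conn01 2) trivial)
  have b0 := pi (hg (conn11 0) trivial)
  have b1 := pi (hg (conn11 1) trivial)
  have b2 := pi (hg (conn11 2) trivial)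
  have u0 := pi UOrd.X_one
  -- the consequences of the equations on `U_0`
  have d1 : UOrd 1 (pderiv ℂ 2 (Y zeta) - Y (dzeta 2)) := by
    have h := congrArg (Ideal.Quotient.mk (uIdeal 1)) cz
    rw [← mk_uIdeal_eq_zero]
    simpa only [map_add, map_sub, map_mul, f0, f1, zero_mul, zero_add, map_zero] using h
  have d2 : UOrd 1 (pderiv ℂ 2 (Y (dzeta 2)) + Y (ricci 4) * (1 - C μ * Y zeta) * Y zeta) := by
    have h := congrArg (Ideal.Quotient.mk (uIdeal 1)) cz2
    rw [← mk_uIdeal_eq_zero]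
    simp only [map_add, map_sub, map_mul, f0, f1, b1, b2, zero_mul, mul_zero, zero_add, add_zero,
      sub_zero, map_zero, map_one] at h ⊢
    linear_combination h
  have hw : ∀ q, WOrd q (Y zeta) ∧ WOrd q (Y (dzeta 2)) := by
    intro q
    induction q with
    | zero => exact ⟨WOrd.zero_left _, WOrd.zero_left _⟩
    | succ q ih =>
      refine ⟨WOrd.step hz ?_, WOrd.step (hdz 2) ?_⟩
      · simpa using (WOrd.of_uOrd d1).add ih.2
      · have h1 := (WOrd.of_uOrd (q := q) d2).add (ih.1.mul_left
          (-(Y (ricci 4) * (1 - C μ * Y zeta))))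
        rwa [neg_mul, add_neg_cancel_right] at h1
  have gz : UOrd 1 (Y zeta) := WOrd.uOrd fun q => (hw q).1
  have gz2 : UOrd 1 (Y (dzeta 2)) := WOrd.uOrd fun q => (hw q).2
  have z0 := pi gz
  have z2 := pi gz2
  have gz1 : UOrd 1 (Y (dzeta 1)) := by
    have d3 : UOrd 1 (pderiv ℂ 2 (Y (dzeta 1))) := by
      have h := congrArg (Ideal.Quotient.mk (uIdeal 1)) cz1
      rw [← mk_uIdeal_eq_zero]
      simpa only [map_add, map_sub, map_mul, f0, f1, b0, b2, z0, zero_mul, mul_zero, zero_add,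
        add_zero, sub_zero, map_zero] using h
    refine WOrd.uOrd fun q => ?_
    cases q with
    | zero => exact WOrd.zero_left _
    | succ q => exact WOrd.step (hdz 1) (WOrd.of_uOrd d3)
  have z1 := pi gz1
  refine ⟨hred', fun i hi => vanishesOnU_iff.2 (hg i hi), vanishesOnU_iff.2 gz,
    vanishesOnU_iff.2 gz1, vanishesOnU_iff.2 gz2, vanishesOnU_iff.2 ?_, vanishesOnU_iff.2 ?_,
    hdz 0, hs, fun k => vanishesOnU_iff.2 ?_, hd⟩
  · have h := congrArg (Ideal.Quotient.mk (uIdeal 1)) cz0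
    rw [← mk_uIdeal_eq_zero]
    simpa only [map_add, map_sub, map_mul, f0, f1, b0, b1, z0, zero_mul, mul_zero, zero_add,
      add_zero, sub_zero, map_zero] using h
  · have h := congrArg (Ideal.Quotient.mk (uIdeal 1)) cs
    rw [← mk_uIdeal_eq_zero]
    simp only [map_add, map_sub, map_mul, map_one, f0, f1, z0, z1, z2, zero_mul, mul_zero, zero_add,
      add_zero, sub_zero, map_zero, one_mul] at h ⊢
    linear_combination h
  · have hc : (C (4 - ((k.val : ℕ) : ℂ)) : Series) = 4 - (k.val : Series) := by
      rw [map_sub, map_natCast, map_ofNat]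
    rw [hc, ← mk_uIdeal_eq_zero]
    fin_cases k
    · have h := congrArg (Ideal.Quotient.mk (uIdeal 1)) r1
      simp [u0, z0, map_ofNat (Ideal.Quotient.mk (uIdeal 1))] at h ⊢
      linear_combination -h
    · have h := congrArg (Ideal.Quotient.mk (uIdeal 1)) r2
      simp [u0, z0, map_ofNat (Ideal.Quotient.mk (uIdeal 1))] at h ⊢
      linear_combination -h
    · have h := congrArg (Ideal.Quotient.mk (uIdeal 1)) r3
      simp [u0, z0, map_ofNat (Ideal.Quotient.mk (uIdeal 1))] at h ⊢
      linear_combination -h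
    · have h := congrArg (Ideal.Quotient.mk (uIdeal 1)) r4
      simp [u0, z0, map_ofNat (Ideal.Quotient.mk (uIdeal 1))] at h ⊢
      linear_combination -h

/-! ### The sums of the formal expansion -/

theorem vDeg_le_four (i : FieldIndex) : vDeg (some i) ≤ 4 := by
  rcases i with k | k | k | k | _ | k | _ | k <;> try fin_cases k
  all_goals simp [vDeg]

section
variable {F : FormalFields} {μ : ℂ}

/-- The degree in `v` of the coefficient of `u^m w^p` is at most `2 m + 4`, so that the larger range
`|v| < 1 / (α ρ)` is paid for by the factor `α ^ 2` in the range of `u` and `w`. For `s` the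
estimates refer to `s + 2`. -/
theorem absConvergesAt_of_estimates (hv : ∀ i, VDegLE (vDeg (some i)) (F i))
    {c : FieldIndex → ℝ} {r ρ : ℝ} (hc : ∀ i, 0 < c i) (hr : 0 < r) (hρ : 0 < ρ)
    (h : Estimates c r ρ F) {α : ℝ} (hα : 0 < α) (hα1 : α ≤ 1) {z : Fin 3 → ℂ}
    (hz : z ∈ convDomain r ρ α) : AbsConvergesAt F z := by
  intro i
  have hi := h i
  have key : ∀ {f : Series} {q : ℤ}, VDegLE 4 f →
      (∀ d, ‖derivAtO f d‖ ≤ c i * majorant r ρ q d) → Summable fun d => ‖term f z d‖ :=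
    fun hk hf => summable_term_of_bound (hc i) hr hρ hf hk hα hα1 hz
  have h4 : VDegLE 4 (F i) := (hv i).mono (vDeg_le_four i)
  rcases i with k | k | k | k | _ | k | _ | k
  case scal =>
    have h1 := key (h4.add ((VDegLE.const 2).mono (by norm_num))) hi
    have h2 : Summable fun d => term (C 2 : Series) z d := by
      classical
      refine summable_of_ne_finset_zero (s := {0}) fun d hd => ?_
      rw [term, coeff_C, if_neg (by simpa using hd), zero_mul]
    refine (h1.of_norm.sub h2).norm.congr fun d => ?_
    rw [term_add, add_sub_cancel_right]
  all_goals exact key h4 hi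

theorem analyticOnNhd_sumFields {P : Set (Fin 3 → ℂ)} (hP : IsOpen P)
    (h : ∀ z ∈ P, AbsConvergesAt F z) (i : FieldIndex) : AnalyticOnNhd ℂ (sumFields F i) P := by
  intro z hz
  obtain ⟨w, hw, hzw⟩ := exists_mem_polydisc hP hz
  exact analyticOnNhd_tsum_term (h w hw i) z hzw

/-- The coefficients are recovered from the sums, which are holomorphic near the origin. -/
theorem taylor_sumFields {P : Set (Fin 3 → ℂ)} (hP : IsOpen P) (h0 : 0 ∈ P)
    (h : ∀ z ∈ P, AbsConvergesAt F z) (i : FieldIndex) : taylor (sumFields F i) = F i := by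
  obtain ⟨w, hw, hzw⟩ := exists_mem_polydisc hP h0
  exact taylor_tsum_term hzw (h w hw i)

/-- Where the series converge, their sums satisfy the complete set of equations. -/
theorem complete_sumFields (hred : ∀ x ∈ reducedList (C μ) (seriesJet F), x = 0)
    (hcon : ∀ x ∈ constraintList (C μ) (seriesJet F), x = 0) {P : Set (Fin 3 → ℂ)} (hP : IsOpen P)
    (h : ∀ z ∈ P, AbsConvergesAt F z) {z : Fin 3 → ℂ} (hz : z ∈ P)
    (hreg : IsRegularPoint μ (sumFields F) z) : (holJet (sumFields F) z).CompleteEquations μ := by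
  obtain ⟨w, hw, hzw⟩ := exists_mem_polydisc hP hz
  have ht : (fun i => taylor (sumFields F i)) = F := funext fun i => taylor_tsum_term hzw (h w hw i)
  exact complete_of_taylor (F := sumFields F) (fun i => analyticOnNhd_tsum_term (h w hw i))
    (convex_polydisc w).isPreconnected (zero_mem_polydisc hzw) (by rw [ht]; exact hred)
    (by rw [ht]; exact hcon) hzw
    hreg.2.1 hreg.1

theorem mem_sHat {r ρ : ℝ} {z : Fin 3 → ℂ} :
    z ∈ sHat r ρ ↔ ∃ α : ℝ, 0 < α ∧ α ≤ 1 ∧ z ∈ convDomain r ρ α := by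
  simp [sHat, and_assoc]

theorem isOpen_sHat (r ρ : ℝ) : IsOpen (sHat r ρ) := by
  refine isOpen_biUnion fun α _ => ?_
  exact (isOpen_lt (continuous_apply 1).norm continuous_const).inter
    (isOpen_lt ((continuous_apply 0).norm.add (continuous_apply 2).norm) continuous_const)

/-- The sum of a series without monomials whose exponents vanish on `s` is zero where the
coordinates with numbers in `s` vanish. -/
theorem tsum_term_eq_zero {s : Set (Fin 3)} {f : Series}
    (hf : ∀ d : Fin 3 →₀ ℕ, (∀ j ∈ s, d j = 0) → coeff d f = 0) {z : Fin 3 → ℂ}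
    (hz : ∀ j ∈ s, z j = 0) : ∑' d, term f z d = 0 := by
  refine (tsum_congr fun d => ?_).trans tsum_zero
  by_cases h : ∀ j ∈ s, d j = 0
  · rw [term, hf d h, zero_mul]
  · push Not at h
    obtain ⟨j, hj, hdj⟩ := h
    rw [term, Finset.prod_eq_zero (Finset.mem_univ j), mul_zero]
    rw [hz j hj, zero_pow hdj]

/-- On `W_0` only the monomials without `w` contribute to the sum for `s_0`, and these are the
datum. -/
theorem inducesDatum_sumFields {ψ : NullData} (hF : IsFormalExpansion μ ψ F)
    {P : Set (Fin 3 → ℂ)} (h : ∀ z ∈ P, AbsConvergesAt F z) : InducesDatum ψ P (sumFields F) := by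
  intro z hz hz2
  have hinj : Function.Injective fun k : ℕ × ℕ => expEquiv (k.1, k.2, 0) := fun a b hab => by
    have := expEquiv.injective hab
    simp only [Prod.mk.injEq, and_true] at this
    exact Prod.ext this.1 this.2
  have hs : HasSum (term (F (ricci 0)) z) (sumFields F (ricci 0) z) :=
    (h z hz (ricci 0)).of_norm.hasSum
  rw [← hinj.hasSum_iff] at hs
  · convert hs using 1
    funext k
    rw [Function.comp_apply, term, hF.datum _ (by simp), Fin.prod_univ_three]
    simp [mul_assoc]
  · intro d hd
    rw [term, Finset.prod_eq_zero (Finset.mem_univ 2), mul_zero]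
    rw [hz2, zero_pow]
    intro h2
    refine hd ⟨(d 0, d 1), ?_⟩
    ext j
    fin_cases j
    · rfl
    · rfl
    · exact h2.symm

/-- A holomorphic solution coincides with the sums of a formal expansion with the same datum. -/
theorem eqOn_sumFields {ψ : NullData} (hF : IsFormalExpansion μ ψ F)
    (huniq : ∀ Y, IsFormalExpansion μ ψ Y → Y = F) {Q : Set (Fin 3 → ℂ)} (hQ : IsOpen Q)
    (hQc : IsPreconnected Q) (h0 : 0 ∈ Q) (h : ∀ z ∈ Q, AbsConvergesAt F z) {G : HolFields}
    (hG : IsHolomorphicSolution μ Q G) (hd : InducesDatum ψ Q G) (i : FieldIndex) :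
    Set.EqOn (G i) (sumFields F i) Q := by
  have hev : ∀ᶠ z in 𝓝 (0 : Fin 3 → ℂ), z ∈ Q := hQ.mem_nhds h0
  have ha : ∀ i, AnalyticAt ℂ (G i) 0 := fun i => hG.holomorphic i 0 h0
  have hI : ∀ {f : (Fin 3 → ℂ) → ℂ}, AnalyticAt ℂ f 0 →
      (∀ z ∈ Q, z 0 = 0 → z 2 = 0 → f z = 0) → VanishesOnI (taylor f) := fun hf hz d hd0 hd2 =>
    coeff_taylor_eq_zero (s := {0, 2}) hf (hev.mono fun z hzQ hzs =>
      hz z hzQ (hzs 0 (by simp)) (hzs 2 (by simp))) (by simp [hd0, hd2])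
  obtain ⟨hred, hcon⟩ := taylor_of_complete hG.holomorphic hQ h0 (μ := μ)
    fun z hz hz0 => ⟨hG.denom z hz, hG.equations z hz hz0⟩
  have hs := analyticOnNhd_sumFields hQ h
  have hsd := inducesDatum_sumFields hF h
  have hY : IsFormalExpansion μ ψ fun i => taylor (G i) := by
    refine isFormalExpansion_of_complete hred hcon (fun i hi d hd0 => ?_)
      (hI (ha _) fun z hz h1 h2 => (hG.vertex z hz h1 h2).1)
      (fun k => hI (ha _) fun z hz h1 h2 => (hG.vertex z hz h1 h2).2.1 k) ?_ ?_
    · exact coeff_taylor_eq_zero (s := {0}) (ha i) (hev.mono fun z hzQ hzs =>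
        hG.gauge z hzQ (hzs 0 rfl) i hi) (by simpa using hd0)
    · rw [← taylor_const, ← taylor_add (ha _) analyticAt_const]
      exact hI ((ha _).add analyticAt_const) fun z hz h1 h2 => by
        simp [(hG.vertex z hz h1 h2).2.2]
    · intro d hd2
      have h1 := coeff_taylor_eq_zero (s := {2}) (d := d) ((ha (ricci 0)).sub (hs (ricci 0) 0 h0))
        (hev.mono fun z hzQ hzs => by
          rw [Pi.sub_apply, (hd z hzQ (hzs 2 rfl)).unique (hsd z hzQ (hzs 2 rfl)), sub_self])
        (by simpa using hd2)
      have e : taylor (G (ricci 0)) =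
          taylor (G (ricci 0) - sumFields F (ricci 0)) + taylor (sumFields F (ricci 0)) := by
        rw [← taylor_add ((ha _).sub (hs _ 0 h0)) (hs _ 0 h0), sub_add_cancel]
      rw [e, map_add, h1, zero_add, taylor_sumFields hQ h0 h]
      exact hF.datum d hd2
  have ht : taylor (G i - sumFields F i) = 0 := by
    have h1 : taylor (G i) = taylor (sumFields F i) := by
      rw [taylor_sumFields hQ h0 h]; exact congrFun (huniq _ hY) i
    have e : taylor (G i) =
        taylor (G i - sumFields F i) + taylor (sumFields F i) := by
      rw [← taylor_add ((ha _).sub (hs _ 0 h0)) (hs _ 0 h0), sub_add_cancel]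
    rw [h1] at e
    exact left_eq_add.1 (e.trans (add_comm _ _))
  exact fun z hz => sub_eq_zero.1 (eqOn_zero_of_taylor hQc h0
    ((hG.holomorphic i).sub (hs i)) ht hz)

end

/-! ### The holomorphic solution -/

section
variable {F : FormalFields} {K R : ℝ≥0}

theorem nnnorm_coeff_C_two_le (R : ℝ≥0) (d : Fin 3 →₀ ℕ) :
    ‖coeff d (C 2 : Series)‖₊ ≤ 2 * ((d 0 + d 2).choose (d 0) : ℝ≥0) * R ^ (d 0 + d 2) := by
  classical
  rw [coeff_C]
  split_ifs with h
  · simp [h]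
  · simp

/-- Bounds of Cauchy type for the coefficients imply the estimates for the derivatives at `O`. -/
theorem exists_estimates_of_bound
    (hb : ∀ i d, ‖coeff d (F i)‖₊ ≤ K * ((d 0 + d 2).choose (d 0) : ℝ≥0) * R ^ (d 0 + d 2))
    {r : ℝ} (hr : 0 < r) (hRr : 4 * R ≤ r) :
    ∃ c : FieldIndex → ℝ, (∀ i, 0 < c i) ∧ Estimates c r 4 F := by
  have hb' : ∀ i d, ‖coeff d (F i)‖₊ ≤
      (K + 2) * ((d 0 + d 2).choose (d 0) : ℝ≥0) * R ^ (d 0 + d 2) := fun i d =>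
    (hb i d).trans (by gcongr; exact le_self_add)
  have hs : ∀ d, ‖coeff d (F scal + C 2)‖₊ ≤
      (K + 2) * ((d 0 + d 2).choose (d 0) : ℝ≥0) * R ^ (d 0 + d 2) := fun d => by
    rw [map_add, add_mul, add_mul]
    exact (nnnorm_add_le _ _).trans (add_le_add (hb scal d) (nnnorm_coeff_C_two_le R d))
  refine ⟨fun i => ((K + 2 : ℝ≥0) : ℝ) * r ^ (-(match i with | ricci _ => 0 | _ => -1 : ℤ)),
    fun i => by positivity, fun i => ?_⟩
  rcases i with k | k | k | k | _ | k | _ | k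
  case scal => exact derivAtO_bound hr hRr hs (-1)
  case ricci => exact derivAtO_bound hr hRr (hb' _) 0
  all_goals exact derivAtO_bound hr hRr (hb' _) (-1)

variable {μ : ℂ} {ψ : NullData}

/-- If `r` is large compared with the bounds for the coefficients, then `ζ` and `u ê²_{01}` are so
small on the domains of convergence that neither `1 - μ ζ` nor `e²_{01}` has a zero. -/
theorem isHolomorphicSolution_sumFields (hF : IsFormalExpansion μ ψ F)
    (hred : ∀ x ∈ reducedList (C μ) (seriesJet F), x = 0)
    (hcon : ∀ x ∈ constraintList (C μ) (seriesJet F), x = 0)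
    (hv : ∀ i, VDegLE (vDeg (some i)) (F i))
    (hb : ∀ i d, ‖coeff d (F i)‖₊ ≤ K * ((d 0 + d 2).choose (d 0) : ℝ≥0) * R ^ (d 0 + d 2))
    {r : ℝ≥0} (hr : 0 < r) (hRr : 4 * R ≤ r) (hμr : 4 * K * R * ‖μ‖₊ < r) (hKr : 8 * K < r)
    (h : ∀ z ∈ sHat r 4, AbsConvergesAt F z) :
    IsHolomorphicSolution μ (sHat r 4) (sumFields F) := by
  have hden : ∀ z ∈ sHat r 4, 1 - μ * sumFields F zeta z ≠ 0 := fun z hz h0 => by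
    obtain ⟨α, hα, hα1, hz⟩ := mem_sHat.1 hz
    lift α to ℝ≥0 using hα.le
    have hα : 0 < α := by exact_mod_cast hα
    have hα1 : α ≤ 1 := by exact_mod_cast hα1
    have hn := norm_tsum_term_le_of_bound hr hRr (hb zeta) (vanishesOnU_iff.1 hF.zeta) (hv zeta)
      hα hα1 hz
    have hk : -vDeg (some zeta) = ((2 : ℕ) : ℤ) := by simp [vDeg]
    rw [hk, zpow_natCast, pow_one] at hn
    have hn' : ‖sumFields F zeta z‖₊ ≤ K * 1 * 4 * (R / r) :=
      hn.trans (by gcongr; exact pow_le_one₀ zero_le hα1)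
    have h1 : ‖μ * sumFields F zeta z‖₊ = 1 := by
      rw [← sub_eq_zero.1 h0, nnnorm_one]
    rw [nnnorm_mul] at h1
    have : (1 : ℝ≥0) < 1 := calc
      1 = ‖μ‖₊ * ‖sumFields F zeta z‖₊ := h1.symm
      _ ≤ ‖μ‖₊ * (K * 1 * 4 * (R / r)) := by gcongr
      _ = (4 * K * R * ‖μ‖₊) / r := by ring
      _ < 1 := by rwa [div_lt_one hr]
    exact this.false
  have hframe : ∀ z ∈ sHat r 4, z 0 ≠ 0 → (holJet (sumFields F) z).e 1 0 1 ≠ 0 :=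
      fun z hz hz0 h0 => by
    obtain ⟨α, hα, hα1, hz⟩ := mem_sHat.1 hz
    lift α to ℝ≥0 using hα.le
    have hα : 0 < α := by exact_mod_cast hα
    have hα1 : α ≤ 1 := by exact_mod_cast hα1
    have hn := norm_tsum_term_le_of_bound hr hRr (hb (frame01 1)) (UOrd.zero _) (hv (frame01 1))
      hα hα1 hz
    have hk : -vDeg (some (frame01 1)) = -((2 : ℕ) : ℤ) := by simp [vDeg]
    rw [hk, zpow_neg, zpow_natCast, pow_zero, mul_one] at hn
    have hu : ‖z 0‖₊ ≤ α ^ 2 / r := by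
      have h2 : ‖z 0‖₊ + ‖z 2‖₊ < α ^ 2 / r := by exact_mod_cast hz.2
      exact le_self_add.trans h2.le
    have h1 : 2 * z 0 * sumFields F (frame01 1) z = -1 := by
      have e : (holJet (sumFields F) z).e 1 0 1 = 1 / (2 * z 0) + sumFields F (frame01 1) z := by
        simp [Jet.e, frameSing, frameReg, sum2, holJet]
      rw [e] at h0
      field_simp at h0
      linear_combination h0
    have h1 : 2 * ‖z 0‖₊ * ‖sumFields F (frame01 1) z‖₊ = 1 := by
      have := congrArg nnnorm h1
      simpa using this
    have : (1 : ℝ≥0) < 1 := calc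
      1 = 2 * ‖z 0‖₊ * ‖sumFields F (frame01 1) z‖₊ := h1.symm
      _ ≤ 2 * (α ^ 2 / r) * (K * (α ^ 2)⁻¹ * 4) := by gcongr; exact hn
      _ = 8 * K / r := by field_simp; ring
      _ < 1 := by rwa [div_lt_one hr]
    exact this.false
  have hU : ∀ {i : FieldIndex}, VanishesOnU (F i) → ∀ {z : Fin 3 → ℂ}, z 0 = 0 →
      sumFields F i z = 0 := fun hi z hz =>
    tsum_term_eq_zero (s := {0}) (fun d hd => hi d (hd 0 rfl)) (by simpa using hz)
  refine ⟨analyticOnNhd_sumFields (isOpen_sHat _ _) h, hden, hframe,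
    fun z _ hz0 i hi => hU (hF.gauge i hi) hz0, fun z hz hz0 hz2 =>
        ⟨hU hF.zeta hz0, fun k => ?_, ?_⟩,
    fun z hz hz0 => complete_sumFields hred hcon (isOpen_sHat _ _) h hz
      ⟨hden z hz, hz0, hframe z hz hz0⟩⟩
  · fin_cases k
    · exact tsum_term_eq_zero (s := {0, 2}) (fun d hd => hF.zeta00I d (hd 0 (by simp))
        (hd 2 (by simp))) (by simp [hz0, hz2])
    · exact hU hF.zeta01 hz0
    · exact hU hF.zeta11 hz0
  · have h0 : ∑' d, term (F scal + C 2) z d = 0 :=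
      tsum_term_eq_zero (s := {0, 2}) (fun d hd => hF.scalI d (hd 0 (by simp)) (hd 2 (by simp)))
        (by simp [hz0, hz2])
    have h2 : HasSum (term (C 2 : Series) z) 2 := by
      classical
      convert hasSum_single (0 : Fin 3 →₀ ℕ) fun d hd => ?_ using 1
      · simp [term]
      · rw [term, coeff_C, if_neg hd, zero_mul]
    have h1 := (h z hz scal).of_norm.hasSum.add h2
    simp only [← term_add] at h1
    exact eq_neg_of_add_eq_zero_left (h1.tsum_eq.symm.trans h0)

/-- The fixed point satisfies all the equations formally, its monomials `u^m v^n w^p` have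
`n ≤ 2 m + k`, and its coefficients have bounds of Cauchy type. -/
theorem exists_formal_expansion (μ : ℂ) (hest : ∃ M r : ℝ, 0 < M ∧ 0 < r ∧
    ∀ p I, ‖ψ p I‖ ≤ (p ! : ℝ) * M / r ^ p) :
    ∃ F : FormalFields, IsFormalExpansion μ ψ F ∧ (∀ Z, IsFormalExpansion μ ψ Z → Z = F) ∧
      (∀ x ∈ reducedList (C μ) (seriesJet F), x = 0) ∧
      (∀ x ∈ constraintList (C μ) (seriesJet F), x = 0) ∧
      (∀ i, VDegLE (vDeg (some i)) (F i)) ∧ ∃ K R : ℝ≥0, ∀ i d,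
        ‖coeff d (F i)‖₊ ≤ K * ((d 0 + d 2).choose (d 0) : ℝ≥0) * R ^ (d 0 + d 2) := by
  obtain ⟨Y, hY, -⟩ := exists_fixedPoint μ ψ.datumCoeff
  obtain ⟨hX, hη, hred, hcone⟩ := formal_of_isStep hY
  obtain ⟨hv, K, R, hb⟩ := exists_coeff_bound hest hY
  have h1 : VDegLE 0 (Y (some (dzeta 0))) := by simpa [vDeg] using hv (some (dzeta 0))
  have h2 : VDegLE 0 (Y (some scal)) := by simpa [vDeg] using hv (some scal)
  have h3 : VDegLE 0 (Y (some (ricci 4))) := by simpa [vDeg] using hv (some (ricci 4))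
  refine ⟨fun i => Y (some i), hX, fun Z hZ => ?_, hred,
    constraints_of_reduced hη hred (hcone h1 h2 h3), fun i => hv (some i), K, R,
    fun i => hb (some i)⟩
  obtain ⟨Z', hZ', hs⟩ := exists_isStep_of_formal hZ
  funext i
  rw [← hZ', hs.fixedPoint_unique hY]

/-- The conditions on `r` under which the sums are a holomorphic solution. -/
theorem exists_radius (K R M : ℝ≥0) :
    ∃ r : ℝ≥0, 0 < r ∧ 4 * R ≤ r ∧ 4 * K * R * M < r ∧ 8 * K < r := by
  refine ⟨4 * R + 4 * K * R * M + 8 * K + 1, by positivity, ?_, ?_, ?_⟩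
  · rw [add_assoc, add_assoc]; exact le_self_add
  · refine lt_of_le_of_lt ?_ (lt_add_one _)
    rw [add_assoc]; exact le_self_add.trans le_add_self
  · exact lt_of_le_of_lt le_add_self (lt_add_one _)

end

end StaticVacuum

end

theorem mainTheorem6 (m : ℝ) (hm : m ≠ 0) (μ : ℝ) (hμ : μ = m ^ 2 / 4)
    (ψ : NullData) (hsymm : ψ.IsSymmetric)
    (hest : ∃ M r : ℝ, 0 < M ∧ 0 < r ∧ ∀ p I, ‖ψ p I‖ ≤ (p ! : ℝ) * M / r ^ p) :
    ∃ X : FormalFields,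
      -- the formal expansion exists and is unique
      IsFormalExpansion μ ψ X ∧
      (∀ Y : FormalFields, IsFormalExpansion μ ψ Y → Y = X) ∧
      -- the estimates for its coefficients imply absolute convergence
      (∀ (c : FieldIndex → ℝ) (r ρ : ℝ), (∀ i, 0 < c i) → 0 < r → 0 < ρ → Estimates c r ρ X →
        ∀ α : ℝ, 0 < α → α ≤ 1 → ∀ z ∈ convDomain r ρ α, AbsConvergesAt X z) ∧
      -- wherever the series converge they satisfy the complete set of field equations
      (∀ P : Set (Fin 3 → ℂ), IsOpen P → 0 ∈ P → (∀ z ∈ P, AbsConvergesAt X z) →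
        (∀ i, AnalyticOnNhd ℂ (sumFields X i) P) ∧
        ∀ z ∈ P, IsRegularPoint μ (sumFields X) z →
          (holJet (sumFields X) z).CompleteEquations (μ : ℂ)) ∧
      -- the estimates hold, and the expansion defines a unique holomorphic solution
      -- which induces the datum
      ∃ (c : FieldIndex → ℝ) (r ρ : ℝ), (∀ i, 0 < c i) ∧ 0 < r ∧ 0 < ρ ∧ Estimates c r ρ X ∧
        IsHolomorphicSolution μ (sHat r ρ) (sumFields X) ∧
        InducesDatum ψ (sHat r ρ) (sumFields X) ∧
        ∀ (Q : Set (Fin 3 → ℂ)) (F : HolFields), IsOpen Q → IsPreconnected Q → 0 ∈ Q →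
          Q ⊆ sHat r ρ → IsHolomorphicSolution μ Q F → InducesDatum ψ Q F →
          ∀ i, Set.EqOn (F i) (sumFields X i) Q := by
  obtain ⟨X, hX, huniq, hred, hcon, hv, K, R, hb⟩ := exists_formal_expansion (μ : ℂ) hest
  have habs : ∀ (c : FieldIndex → ℝ) (r ρ : ℝ), (∀ i, 0 < c i) → 0 < r → 0 < ρ →
      Estimates c r ρ X → ∀ α : ℝ, 0 < α → α ≤ 1 → ∀ z ∈ convDomain r ρ α, AbsConvergesAt X z :=
    fun c r ρ hc hr hρ he α hα hα1 z hz => absConvergesAt_of_estimates hv hc hr hρ he hα hα1 hz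
  refine ⟨X, hX, huniq, habs, fun P hP _ h =>
    ⟨analyticOnNhd_sumFields hP h, fun z hz hreg => complete_sumFields hred hcon hP h hz hreg⟩, ?_⟩
  obtain ⟨r, hr, hRr, hμr, hKr⟩ := exists_radius K R ‖(μ : ℂ)‖₊
  have hr' : (0 : ℝ) < r := by exact_mod_cast hr
  obtain ⟨c, hc, he⟩ := exists_estimates_of_bound hb hr' (by exact_mod_cast hRr)
  have habs' : ∀ z ∈ sHat (r : ℝ) 4, AbsConvergesAt X z := fun z hz => by
    obtain ⟨α, hα, hα1, hz⟩ := mem_sHat.1 hz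
    exact habs c r 4 hc hr' four_pos he α hα hα1 z hz
  refine ⟨c, r, 4, hc, hr', four_pos, he,
    isHolomorphicSolution_sumFields hX hred hcon hv hb hr hRr hμr hKr habs',
    inducesDatum_sumFields hX habs', ?_⟩
  intro Q F hQ hQc h0 hQs hF hFd i
  exact eqOn_sumFields hX huniq hQ hQc h0 (fun z hz => habs' z (hQs hz)) hF hFd i
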